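/- **Setting.** Let $Y$ be a closed oriented three-manifold and $K\subset Y$ a null-homologous knot, presented by a doubly pointed Heegaard diagram $(\Sigma,\boldsymbol\alpha,\boldsymbol\beta,w,z)$ of genus $g$. That is: * $Y=U_0\cup_\Sigma U_1$ is a splitting into handlebodies along a closed surface $\Sigma$ of genus $g$. * $\boldsymbol\alpha=\{\alpha_1,\dots,\alpha_g\}$ and $\boldsymbol\beta=\{\beta_1,\dots,\beta_g\}$ are sets of attaching circles of $U_0$ and $U_1$. They are smoothly embedded closed curves in $\Sigma-\{w,z\}$. The curves of each set are pairwise disjoint and span a $g$-dimensional subspace of $H_1(\Sigma;\mathbb Q)$. The $\alpha_i$ are transverse to the $\beta_j$. * $K$ is the union of two arcs. One is obtained by pushing an arc in $\Sigma$ from $z$ to $w$, disjoint from $\boldsymbol\alpha$, into $U_0$. The other is obtained by pushing an arc from $w$ to $z$, disjoint from $\boldsymbol\beta$, into $U_1$. (The pushed arcs avoid the chosen attaching discs.) Let $p:\tilde Y\to Y$ be the double cover branched along $K$ obtained from a Seifert surface of $K$, by gluing two copies of $Y$ cut open along the surface crosswise. Let $\tilde\Sigma=p^{-1}(\Sigma)$,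 let $\iota$ be the deck transformation, and let $\tilde w,\tilde z$ be the points of $\tilde\Sigma$ over $w,z$. Fix a complex structure on $\Sigma$ and the one on $\tilde\Sigma$ for which $p:\tilde\Sigma\to\Sigma$ is holomorphic. Put $$M=\mathrm{Sym}^g(\Sigma-\{w,z\}),\qquad \tilde M=\mathrm{Sym}^{2g}(\tilde\Sigma-\{\tilde w,\tilde z\}),$$ with the induced complex structures. Embed $M\subset\tilde M$ by $\{x_1,\dots,x_g\}\mapsto\{\tilde x_1,\iota\tilde x_1,\dots,\tilde x_g,\iota\tilde x_g\}$, where $\tilde x_i,\iota\tilde x_i$ are the preimages of $x_i$. This is the fixed point set of the involution $\iota$ of $\tilde M$. Let $\mathbb T_\alpha=\alpha_1\times\cdots\times\alpha_g\subset M$, and let $\mathbb T_{\tilde\alpha}=\tilde\alpha_1\times\cdots\times\tilde\alpha_{2g}\subset\tilde M$, where $\tilde\alpha_i,\tilde\alpha_{g+i}$ are the two components of the preimage of $\alpha_i$. Define $\mathbb T_\beta$ and $\mathbb T_{\tilde\beta}$ likewise. Let $\omega$ be a symplectic form on $\tilde M$ that is $\iota$-invariant, tames the complex structure, and makes $\mathbb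 T_{\tilde\alpha},\mathbb T_{\tilde\beta}$ Lagrangian. (Only continuity and these properties of the two-form $\omega$ are used; neither smoothness nor closedness nor exactness is needed.) **Polarization data.** Polarization data on $(M;\mathbb T_\alpha,\mathbb T_\beta)$ is a triple $(E,F_0,F_1)$ as follows: $E$ is a symplectic vector bundle over $M$; $F_0$ and $F_1$ are Lagrangian subbundles of $E|_{\mathbb T_\alpha}$ and $E|_{\mathbb T_\beta}$; and $F_0,F_1$ are transverse over $\mathbb T_\alpha\cap\mathbb T_\beta$. An isomorphism $(E,F_0,F_1)\cong(E',F_0',F_1')$ is an isomorphism $a:E\to E'$ of symplectic vector bundles for which there are homotopies, through Lagrangian subbundles of the restriction of $E'$ to $\mathbb T_\alpha$ (for $i=0$) and to $\mathbb T_\beta$ (for $i=1$), from $a(F_i)$ to $F_i'$. Bundles, isomorphisms and homotopies are continuous. **Proposition.** Let $\mathfrak p=(E,F_0,F_1)$ be the normal polarization: $E$ is the normal bundle of $M\subset\tilde M$, that is, the bundle of $(-1)$-eigenspaces of $d\iota$ on $T\tilde M|_M$, and $F_0,F_1$ are the normal bundles of $\mathbb T_\alpha\subset\mathbb T_{\tilde\alpha}$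 and $\mathbb T_\beta\subset\mathbb T_{\tilde\beta}$, that is, the $(-1)$-eigenspaces of $d\iota$ in the tangent spaces of $\mathbb T_{\tilde\alpha},\mathbb T_{\tilde\beta}$. Let $\mathfrak t=(TM,T\mathbb T_\alpha,T\mathbb T_\beta)$ be the tangential polarization. The symplectic forms on $E$ and $TM$ are the restrictions of $\omega$. Then $\mathfrak p$ and $\mathfrak t$ are polarization data of rank $2g$, and they are isomorphic. -/

import Mathlib

open Set Topology
open scoped Manifold ContDiff

noncomputable section

namespace HFK

universe u v a b c

/-! ### Symmetric products of a Riemann surface as complex spaces -/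

section SymmetricProduct

variable {X : Type u} [TopologicalSpace X] [ChartedSpace ℂ X]
variable {X' : Type v} [TopologicalSpace X'] [ChartedSpace ℂ X']

/-- The unordered tuple underlying an ordered `n`-tuple: the quotient map `Xⁿ → Symⁿ(X)`. -/
def symMk {X : Type u} {n : ℕ} (x : Fin n → X) : Sym X n :=
  ⟨Finset.univ.val.map x, by simp⟩

/-- `Symⁿ(X)` carries the quotient topology of `Xⁿ`. -/
instance symTopology (X : Type u) [TopologicalSpace X] (n : ℕ) : TopologicalSpace (Sym X n) :=
  TopologicalSpace.coinduced symMk inferInstance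

/-- The coordinates of an ordered tuple in the preferred charts at its entries. -/
def coord {n : ℕ} (x : Fin n → X) : Fin n → ℂ := fun i => chartAt ℂ (x i) (x i)

/-- A function on `Symⁿ(X)`, pulled back to `Xⁿ` and read in the product of the preferred charts
at the entries of the ordered tuple `x`. -/
def localRep {n : ℕ} (f : Sym X n → ℂ) (x : Fin n → X) : (Fin n → ℂ) → ℂ :=
  fun z => f (symMk fun i => (chartAt ℂ (x i)).symm (z i))

/-- The complex structure of `Symⁿ(X)`, the quotient of the complex manifold `Xⁿ` by the symmetric
group: a function is holomorphic near `D` if its pull-back to `Xⁿ` is holomorphic near the ordered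
tuples over `D`. -/
def HolAt {n : ℕ} (f : Sym X n → ℂ) (D : Sym X n) : Prop :=
  ∀ x : Fin n → X, symMk x = D → AnalyticAt ℂ (localRep f x) (coord x)

/-- The algebra of functions on `Symⁿ(X)` that are holomorphic near `D`. -/
def holFun {n : ℕ} (D : Sym X n) : Subalgebra ℂ (Sym X n → ℂ) where
  carrier := {f | HolAt f D}
  mul_mem' hf hg x hx := (hf x hx).mul (hg x hx)
  add_mem' hf hg x hx := (hf x hx).add (hg x hx)
  algebraMap_mem' r := fun _ _ => (analyticAt_const (v := r))

/-- The (holomorphic) tangent space of `Symⁿ(X)` at `D`: the point derivations at `D` of the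
functions that are holomorphic near `D`. As a real vector space it is the tangent space of the
underlying real manifold; the almost complex structure is multiplication by `I`. -/
def SymTangent {n : ℕ} (D : Sym X n) : Submodule ℂ (Module.Dual ℂ (holFun D)) where
  carrier := {ξ | ∀ f h : holFun D, ξ (f * h) = f.1 D * ξ h + h.1 D * ξ f}
  add_mem' := by
    intro ξ η hξ hη f h
    simp only [LinearMap.add_apply, hξ f h, hη f h]
    ring
  zero_mem' := by intro f h; simp
  smul_mem' := by
    intro r ξ hξ f h
    simp only [LinearMap.smul_apply, hξ f h, smul_eq_mul]
    ring

/-- The total space of the tangent bundle of `Symⁿ(X)`. -/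
abbrev SymTangentBundle (X : Type u) [TopologicalSpace X] [ChartedSpace ℂ X] (n : ℕ) :=
  Bundle.TotalSpace (Fin n → ℂ) (fun D : Sym X n => SymTangent D)

/-- The topology of the tangent bundle: the coarsest one for which the projection and the
differentials `df : TO → ℂ` of all holomorphic functions `f` on open sets `O` are continuous
(with `TO` open). -/
instance symTangentTopology (n : ℕ) : TopologicalSpace (SymTangentBundle X n) :=
  TopologicalSpace.generateFrom
    ({W | ∃ O : Set (Sym X n), IsOpen O ∧ W = {q | q.proj ∈ O}} ∪
     {W | ∃ (O : Set (Sym X n)) (f : Sym X n → ℂ) (hf : ∀ D ∈ O, HolAt f D) (V : Set ℂ),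
        IsOpen O ∧ IsOpen V ∧
          W = {q | ∃ h : q.proj ∈ O, q.snd.1 ⟨f, hf q.proj h⟩ ∈ V}})

/-- `ξ` is the image under the differential of `Xⁿ → Symⁿ(X)` of the tangent vector at the
ordered tuple `x` with components `v i ∈ T_{x i} X`. -/
def IsImageVector {n : ℕ} {D : Sym X n} (ξ : SymTangent D) (x : Fin n → X)
    (v : ∀ i, TangentSpace 𝓘(ℂ) (x i)) : Prop :=
  symMk x = D ∧
    ∀ f : holFun D, ξ.1 f = fderiv ℂ (localRep f.1 x) (coord x) (fun i => (v i : ℂ))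

/-- The differential at `D` of a map of symmetric products that is holomorphic near `D`. -/
def symDifferential {n m : ℕ} (φ : Sym X n → Sym X' m) (D : Sym X n)
    (hφ : ∀ f : Sym X' m → ℂ, HolAt f (φ D) → HolAt (f ∘ φ) D) :
    SymTangent D →ₗ[ℂ] SymTangent (φ D) where
  toFun ξ := ⟨{ toFun := fun f => ξ.1 ⟨f.1 ∘ φ, hφ f.1 f.2⟩
                map_add' := fun f h =>
                  ξ.1.map_add ⟨f.1 ∘ φ, hφ f.1 f.2⟩ ⟨h.1 ∘ φ, hφ h.1 h.2⟩
                map_smul' := fun r f => ξ.1.map_smul r ⟨f.1 ∘ φ, hφ f.1 f.2⟩ },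
              fun f h => ξ.2 ⟨f.1 ∘ φ, hφ f.1 f.2⟩ ⟨h.1 ∘ φ, hφ h.1 h.2⟩⟩
  map_add' _ _ := rfl
  map_smul' _ _ := rfl

theorem analyticAt_chart_of_contMDiffAt {h : X → X'} {x : X}
    (hh : ContMDiffAt 𝓘(ℂ) 𝓘(ℂ) ω h x) :
    AnalyticAt ℂ (fun z => chartAt ℂ (h x) (h ((chartAt ℂ x).symm z))) (chartAt ℂ x x) := by
  have := (contMDiffAt_iff.1 hh).2
  simp only [mfld_simps] at this
  have h2 := contDiffWithinAt_omega_iff_analyticWithinAt.1 this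
  rw [analyticWithinAt_univ] at h2
  exact h2

/-- A map of symmetric products that is given near `D` by local holomorphic maps between the
surfaces pulls functions holomorphic near `φ D` back to functions holomorphic near `D`. -/
theorem holAt_comp {n m : ℕ} (φ : Sym X n → Sym X' m) (D : Sym X n)
    (H : ∀ x : Fin n → X, symMk x = D → ∃ (r : Fin m → Fin n) (h : Fin m → X → X'),
      (∀ k, ContMDiffAt 𝓘(ℂ) 𝓘(ℂ) ω (h k) (x (r k))) ∧
      ∀ᶠ y in 𝓝 x, φ (symMk y) = symMk fun k => h k (y (r k)))
    (f : Sym X' m → ℂ) (hf : HolAt f (φ D)) : HolAt (f ∘ φ) D := by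
  intro x hx
  obtain ⟨r, h, hh, hφ⟩ := H x hx
  set x' : Fin m → X' := fun k => h k (x (r k)) with hx'
  have hD : symMk x' = φ D := by rw [← hx]; exact (hφ.self_of_nhds).symm
  have h1 := hf x' hD
  set T : (Fin n → ℂ) → (Fin m → ℂ) := fun z k =>
    chartAt ℂ (x' k) (h k ((chartAt ℂ (x (r k))).symm (z (r k)))) with hT
  have hTx : T (coord x) = coord x' := by
    funext k
    simp only [hT, coord]
    rw [(chartAt ℂ (x (r k))).left_inv (mem_chart_source ℂ _)]
  have hTan : AnalyticAt ℂ T (coord x) := by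
    apply AnalyticAt.pi
    intro k
    have e := analyticAt_chart_of_contMDiffAt (hh k)
    have p : AnalyticAt ℂ (fun z : Fin n → ℂ => z (r k)) (coord x) :=
      (ContinuousLinearMap.proj (R := ℂ) (φ := fun _ : Fin n => ℂ) (r k)).analyticAt _
    exact e.comp_of_eq p rfl
  have hcomp := h1.comp_of_eq hTan hTx
  refine hcomp.congr ?_
  set χ : (Fin n → ℂ) → (Fin n → X) := fun z i => (chartAt ℂ (x i)).symm (z i) with hχ
  have hχx : χ (coord x) = x := by
    funext i
    exact (chartAt ℂ (x i)).left_inv (mem_chart_source ℂ _)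
  have hχc : ContinuousAt χ (coord x) := by
    refine continuousAt_pi.2 fun i => ?_
    exact ContinuousAt.comp (f := fun z : Fin n → ℂ => z i)
      ((chartAt ℂ (x i)).continuousAt_symm (mem_chart_target ℂ (x i)))
      (continuous_apply i).continuousAt
  have hφ' : ∀ᶠ z in 𝓝 (coord x), φ (symMk (χ z)) = symMk fun k => h k (χ z (r k)) := by
    refine Filter.Tendsto.eventually (p := fun y => φ (symMk y) = symMk fun k => h k (y (r k)))
      hχc ?_
    rw [hχx]
    exact hφ
  have hsrc : ∀ᶠ z in 𝓝 (coord x), ∀ k, h k (χ z (r k)) ∈ (chartAt ℂ (x' k)).source := by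
    rw [Filter.eventually_all]
    intro k
    have c1 : ContinuousAt (fun z => χ z (r k)) (coord x) := (continuousAt_pi.1 hχc) (r k)
    have e1 : χ (coord x) (r k) = x (r k) := congrFun hχx _
    have c2 : ContinuousAt (fun z => h k (χ z (r k))) (coord x) :=
      ContinuousAt.comp_of_eq (hh k).continuousAt c1 e1
    apply c2.eventually_mem
    rw [e1]
    exact chart_source_mem_nhds ℂ (x' k)
  filter_upwards [hφ', hsrc] with z hz hs
  simp only [Function.comp, localRep]
  change _ = f (φ (symMk (χ z)))
  rw [hz]
  congr 2
  funext k
  exact (chartAt ℂ (x' k)).left_inv (hs k)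

end SymmetricProduct

/-! ### Branched double covers of surfaces and the induced maps of symmetric products -/

section Cover

variable {S : Type u} [TopologicalSpace S] [ChartedSpace ℂ S]
variable {S' : Type v} [TopologicalSpace S'] [ChartedSpace ℂ S']

/-- A holomorphic double cover `π : S' → S` of Riemann surfaces with deck transformation `ι`,
branched exactly at the two points `w'`, `z'` of `S'`, which lie over `w`, `z`. -/
structure SurfaceDoubleCover (S : Type u) [TopologicalSpace S] [ChartedSpace ℂ S]
    (S' : Type v) [TopologicalSpace S'] [ChartedSpace ℂ S'] (w z : S) where
  π : S' → S
  ι : S' → S'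
  w' : S'
  z' : S'
  holomorphic : MDifferentiable 𝓘(ℂ) 𝓘(ℂ) π
  surjective : Function.Surjective π
  continuous_deck : Continuous ι
  fibre : ∀ a b, π a = π b ↔ b = a ∨ b = ι a
  fixed : ∀ a, ι a = a ↔ a = w' ∨ a = z'
  map_w : π w' = w
  map_z : π z' = z
  unbranched : ∀ a, a ≠ w' → a ≠ z' → IsLocalDiffeomorphAt 𝓘(ℂ) 𝓘(ℂ) ω π a

/-- `Symⁿ(X - {p, q})`, as an open subset of `Symⁿ(X)`. -/
def puncturedSym (X : Type u) (n : ℕ) (p q : X) : Set (Sym X n) := {D | p ∉ D ∧ q ∉ D}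

namespace SurfaceDoubleCover

variable {w z : S} (P : SurfaceDoubleCover S S' w z)

theorem map_deck (a : S') : P.π (P.ι a) = P.π a := ((P.fibre a (P.ι a)).2 (Or.inr rfl)).symm

theorem deck_deck (a : S') : P.ι (P.ι a) = a := by
  rcases (P.fibre (P.ι a) a).1 (P.map_deck a) with h | h
  · rw [← h]; exact h.symm
  · exact h.symm

theorem deck_w : P.ι P.w' = P.w' := (P.fixed _).2 (Or.inl rfl)

theorem deck_z : P.ι P.z' = P.z' := (P.fixed _).2 (Or.inr rfl)

theorem eq_w {a : S'} (h : P.π a = w) : a = P.w' := by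
  rcases (P.fibre P.w' a).1 (P.map_w.trans h.symm) with h | h
  · exact h
  · rw [h, P.deck_w]

theorem eq_z {a : S'} (h : P.π a = z) : a = P.z' := by
  rcases (P.fibre P.z' a).1 (P.map_z.trans h.symm) with h | h
  · exact h
  · rw [h, P.deck_z]

theorem deck_contMDiffAt {a : S'} (hw : a ≠ P.w') (hz : a ≠ P.z') :
    ContMDiffAt 𝓘(ℂ) 𝓘(ℂ) ω P.ι a := by
  have hw' : P.ι a ≠ P.w' := fun h => hw (by rw [← P.deck_deck a, h, P.deck_w])
  have hz' : P.ι a ≠ P.z' := fun h => hz (by rw [← P.deck_deck a, h, P.deck_z])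
  have L := P.unbranched (P.ι a) hw' hz'
  have h1 : ContMDiffAt 𝓘(ℂ) 𝓘(ℂ) ω L.localInverse (P.π a) := by
    rw [← P.map_deck a]; exact L.localInverse_contMDiffAt
  have h2 := h1.comp a (P.unbranched a hw hz).contMDiffAt
  refine h2.congr_of_eventuallyEq ?_
  have h3 : ∀ᶠ b in 𝓝 a, P.ι b ∈ L.localInverse.target :=
    P.continuous_deck.continuousAt.eventually_mem
      (L.localInverse.open_target.mem_nhds L.localInverse_mem_target)
  filter_upwards [h3] with b hb
  have := L.localInverse_left_inv hb
  rw [P.map_deck] at this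
  exact this.symm

/-- The involution of `Symⁿ(S')` induced by the deck transformation. -/
def symDeck (n : ℕ) : Sym S' n → Sym S' n := Sym.map P.ι

/-- A choice of a preimage of each point. -/
def lift : S → S' := Function.surjInv P.surjective

theorem map_lift (x : S) : P.π (P.lift x) = x := Function.surjInv_eq P.surjective x

/-- The embedding `Sym^g(S) → Sym^{2g}(S')`,
`{x₁, …, x_g} ↦ {x̃₁, ι x̃₁, …, x̃_g, ι x̃_g}`, where `x̃ᵢ`, `ι x̃ᵢ` are the preimages of `xᵢ`. -/
def symLift (g : ℕ) (D : Sym S g) : Sym S' (2 * g) :=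
  ⟨D.1.bind fun x => {P.lift x, P.ι (P.lift x)}, by
    rw [Multiset.card_bind]
    simp [mul_comm]⟩

theorem holAt_symDeck {n : ℕ} (D : Sym S' n) (hD : D ∈ puncturedSym S' n P.w' P.z')
    (f : Sym S' n → ℂ) (hf : HolAt f (P.symDeck n D)) : HolAt (f ∘ P.symDeck n) D := by
  refine holAt_comp _ D ?_ f hf
  intro x hx
  have hm : ∀ i, x i ∈ D := by
    intro i
    rw [← hx]
    exact Multiset.mem_map.2 ⟨i, Finset.mem_univ _, rfl⟩
  refine ⟨id, fun _ => P.ι, fun k => ?_, Filter.Eventually.of_forall fun y => ?_⟩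
  · exact P.deck_contMDiffAt (fun h => hD.1 (h ▸ hm k)) (fun h => hD.2 (h ▸ hm k))
  · apply Subtype.ext
    simp [symDeck, symMk, Function.comp_def]

theorem pair_eq {a b : S'} (h : P.π a = P.π b) :
    ({a, P.ι a} : Multiset S') = {b, P.ι b} := by
  rcases (P.fibre a b).1 h with rfl | rfl
  · rfl
  · rw [P.deck_deck, Multiset.pair_comm]

theorem symLift_symMk {g : ℕ} (y : Fin g → S) (s : Fin g → S') (hs : ∀ i, P.π (s i) = y i) :
    P.symLift g (symMk y) = symMk fun k : Fin (2 * g) =>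
      if (finProdFinEquiv.symm k).1 = 0 then s (finProdFinEquiv.symm k).2
      else P.ι (s (finProdFinEquiv.symm k).2) := by
  apply Subtype.ext
  change Multiset.bind (Multiset.map y (Finset.univ : Finset (Fin g)).val) _ =
    Multiset.map _ (Finset.univ : Finset (Fin (2 * g))).val
  rw [Multiset.bind_map]
  have h1 : ∀ i, ({P.lift (y i), P.ι (P.lift (y i))} : Multiset S') = {s i, P.ι (s i)} :=
    fun i => P.pair_eq (by rw [P.map_lift, hs])
  simp only [h1]
  have h2 : (Finset.univ : Finset (Fin (2 * g))).val =
      Multiset.map finProdFinEquiv (Finset.univ : Finset (Fin 2 × Fin g)).val := by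
    rw [← Finset.map_univ_equiv (finProdFinEquiv (m := 2) (n := g))]
    rfl
  have h3 : (Finset.univ : Finset (Fin 2 × Fin g)).val =
      Multiset.map (Prod.mk 0) (Finset.univ : Finset (Fin g)).val +
      Multiset.map (Prod.mk 1) (Finset.univ : Finset (Fin g)).val := by
    change Multiset.bind (Finset.univ : Finset (Fin 2)).val _ = _
    have : (Finset.univ : Finset (Fin 2)).val = {0, 1} := rfl
    rw [this]
    simp
  have h4 : ∀ i, ({s i, P.ι (s i)} : Multiset S') = {s i} + {P.ι (s i)} := fun i => rfl
  simp only [h4]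
  rw [Multiset.bind_add, Multiset.bind_singleton, Multiset.bind_singleton, h2, h3]
  simp only [Multiset.map_add, Multiset.map_map, Function.comp_def, Equiv.symm_apply_apply]
  rfl

theorem holAt_symLift {g : ℕ} (D : Sym S g) (hD : D ∈ puncturedSym S g w z)
    (f : Sym S' (2 * g) → ℂ) (hf : HolAt f (P.symLift g D)) : HolAt (f ∘ P.symLift g) D := by
  refine holAt_comp _ D ?_ f hf
  intro x hx
  have hm : ∀ i, x i ∈ D := by
    intro i
    rw [← hx]
    exact Multiset.mem_map.2 ⟨i, Finset.mem_univ _, rfl⟩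
  have hw : ∀ i, P.lift (x i) ≠ P.w' := fun i h =>
    hD.1 (by rw [← P.map_w, ← h, P.map_lift]; exact hm i)
  have hz : ∀ i, P.lift (x i) ≠ P.z' := fun i h =>
    hD.2 (by rw [← P.map_z, ← h, P.map_lift]; exact hm i)
  have L := fun i => P.unbranched _ (hw i) (hz i)
  have hmem : ∀ i, x i ∈ (L i).localInverse.source := fun i => by
    have := (L i).localInverse_mem_source
    rwa [P.map_lift] at this
  have hval : ∀ i, (L i).localInverse (x i) = P.lift (x i) := fun i => by
    have := (L i).localInverse_left_inv (L i).localInverse_mem_target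
    rwa [P.map_lift] at this
  have hsm : ∀ i, ContMDiffAt 𝓘(ℂ) 𝓘(ℂ) ω (L i).localInverse (x i) := fun i => by
    have := (L i).localInverse_contMDiffAt
    rwa [P.map_lift] at this
  refine ⟨fun k => (finProdFinEquiv.symm k).2, fun k a =>
    if (finProdFinEquiv.symm k).1 = 0 then (L (finProdFinEquiv.symm k).2).localInverse a
      else P.ι ((L (finProdFinEquiv.symm k).2).localInverse a), fun k => ?_, ?_⟩
  · by_cases h0 : (finProdFinEquiv.symm k).1 = 0
    · simp only [h0, if_true]
      exact hsm _
    · simp only [h0, if_false]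
      refine ContMDiffAt.comp (x _) ?_ (hsm _)
      rw [hval]
      exact P.deck_contMDiffAt (hw _) (hz _)
  · have hev : ∀ᶠ y in 𝓝 x, ∀ i, y i ∈ (L i).localInverse.source := by
      rw [Filter.eventually_all]
      intro i
      exact (continuous_apply i).continuousAt.eventually_mem
        ((L i).localInverse.open_source.mem_nhds (hmem i))
    filter_upwards [hev] with y hy
    exact P.symLift_symMk y (fun i => (L i).localInverse (y i))
      (fun i => (L i).localInverse_right_inv (hy i))

end SurfaceDoubleCover

end Cover

/-! ### Polarization data -/

section Polarization

/-- A family of subspaces `G b ⊆ E (r b)`, `b ∈ K`, of the pull-back of a family of vector spaces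
is a (continuous) subbundle over `K`: near each point of `K` it has a continuous frame. -/
def IsSubbundleOn {M : Type u} {B : Type v} [TopologicalSpace B] {Fib : Type a} (E : M → Type b)
    [∀ x, AddCommGroup (E x)] [∀ x, Module ℝ (E x)] [TopologicalSpace (Bundle.TotalSpace Fib E)]
    (r : B → M) (K : Set B) (G : ∀ b, Submodule ℝ (E (r b))) : Prop :=
  ∀ b₀ ∈ K, ∃ (U : Set B) (m : ℕ) (s : Fin m → ∀ b, E (r b)), IsOpen U ∧ b₀ ∈ U ∧
    (∀ i, ContinuousOn (fun b => (⟨r b, s i b⟩ : Bundle.TotalSpace Fib E)) (U ∩ K)) ∧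
    ∀ b ∈ U ∩ K, LinearIndependent ℝ (fun i => s i b) ∧
      Submodule.span ℝ (Set.range fun i => s i b) = G b

/-- Continuity over `K` of a family of bilinear forms on the fibres of `E`. -/
def FormContinuousOn {M : Type u} {Fib : Type a} (E : M → Type b)
    [∀ x, AddCommGroup (E x)] [∀ x, Module ℝ (E x)] [TopologicalSpace (Bundle.TotalSpace Fib E)]
    (K : Set M) (form : ∀ x, E x →ₗ[ℝ] E x →ₗ[ℝ] ℝ) : Prop :=
  @Continuous (Σ x : K, E x × E x) ℝ
    (TopologicalSpace.induced
      (fun q => ((⟨q.1, q.2.1⟩, ⟨q.1, q.2.2⟩) :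
        Bundle.TotalSpace Fib E × Bundle.TotalSpace Fib E)) inferInstance)
    inferInstance (fun q => form q.1 q.2.1 q.2.2)

/-- A subspace of a symplectic vector space is Lagrangian if it is its own symplectic
orthogonal. -/
def IsLagrangian {V : Type u} [AddCommGroup V] [Module ℝ V] (form : V →ₗ[ℝ] V →ₗ[ℝ] ℝ)
    (W : Submodule ℝ V) : Prop :=
  ∀ x, x ∈ W ↔ ∀ y ∈ W, form x y = 0

/-- The data `(E, F₀, F₁)` of a family `E` of real vector spaces over `M` with bilinear forms and
a topology on the total space, and subspaces `F i` of its fibres, of interest over `L i`. -/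
structure PolarizationData (M : Type u) (L : Fin 2 → Set M) (k : ℕ) where
  E : M → Type a
  addCommGroup : ∀ x, AddCommGroup (E x)
  module : ∀ x, Module ℝ (E x)
  topology : TopologicalSpace (Bundle.TotalSpace (Fin (2 * k) → ℝ) E)
  form : ∀ x, E x →ₗ[ℝ] E x →ₗ[ℝ] ℝ
  F : Fin 2 → ∀ x, Submodule ℝ (E x)

attribute [instance] PolarizationData.addCommGroup PolarizationData.module
  PolarizationData.topology

namespace PolarizationData

variable {M : Type u} [TopologicalSpace M] {L : Fin 2 → Set M} {k : ℕ}

/-- The total space of the bundle. -/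
abbrev Total (p : PolarizationData.{u, a} M L k) := Bundle.TotalSpace (Fin (2 * k) → ℝ) p.E

/-- `(E, F₀, F₁)` is polarization data: `E` is a symplectic vector bundle of rank `2k`, `F i` is
a Lagrangian subbundle of `E` over `L i`, and `F 0`, `F 1` are transverse over `L 0 ∩ L 1`. -/
structure IsPolarization (p : PolarizationData.{u, a} M L k) : Prop where
  locally_trivial : ∀ x₀ : M, ∃ (U : Set M) (e : ∀ x, (Fin (2 * k) → ℝ) ≃ₗ[ℝ] p.E x),
    IsOpen U ∧ x₀ ∈ U ∧
      IsOpenEmbedding (fun q : U × (Fin (2 * k) → ℝ) => (⟨q.1, e q.1 q.2⟩ : p.Total))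
  continuous_proj : Continuous (fun q : p.Total => q.proj)
  continuous_form : FormContinuousOn (Fib := Fin (2 * k) → ℝ) p.E univ p.form
  alternating : ∀ x v, p.form x v v = 0
  nondegenerate : ∀ x v, (∀ v', p.form x v v' = 0) → v = 0
  subbundle : ∀ i, IsSubbundleOn (Fib := Fin (2 * k) → ℝ) p.E id (L i) (p.F i)
  lagrangian : ∀ i, ∀ x ∈ L i, IsLagrangian (p.form x) (p.F i x)
  transverse : ∀ x ∈ L 0 ∩ L 1, IsCompl (p.F 0 x) (p.F 1 x)

/-- An isomorphism `(E, F₀, F₁) ≅ (E', F₀', F₁')`: an isomorphism `α : E → E'` of symplectic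
vector bundles together with homotopies through Lagrangian subbundles of `E'` over `L i` from
`α (F i)` to `F' i`. -/
def Isomorphic (p : PolarizationData.{u, a} M L k) (q : PolarizationData.{u, b} M L k) : Prop :=
  ∃ α : ∀ x, p.E x ≃ₗ[ℝ] q.E x,
    Continuous (fun y : p.Total => (⟨y.proj, α y.proj y.snd⟩ : q.Total)) ∧
    Continuous (fun y : q.Total => (⟨y.proj, (α y.proj).symm y.snd⟩ : p.Total)) ∧
    (∀ x u v, q.form x (α x u) (α x v) = p.form x u v) ∧
    ∀ i : Fin 2, ∃ G : ℝ → ∀ x, Submodule ℝ (q.E x),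
      (∀ x ∈ L i, G 0 x = (p.F i x).map (α x).toLinearMap) ∧
      (∀ x ∈ L i, G 1 x = q.F i x) ∧
      (∀ t ∈ Icc (0 : ℝ) 1, ∀ x ∈ L i, IsLagrangian (q.form x) (G t x)) ∧
      IsSubbundleOn (Fib := Fin (2 * k) → ℝ) q.E (fun y : ℝ × M => y.2)
        (Icc (0 : ℝ) 1 ×ˢ L i) (fun y => G y.1 y.2)

end PolarizationData

end Polarization

/-! ### Heegaard diagrams -/

section Diagrams

variable {S : Type u} [TopologicalSpace S] [ChartedSpace ℂ S]

/-- A smoothly embedded closed curve, parametrized with period `1`. -/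
structure IsClosedCurve (γ : ℝ → S) : Prop where
  smooth : ContMDiff 𝓘(ℝ, ℝ) 𝓘(ℝ, ℂ) ∞ γ
  immersed : ∀ t, mfderiv 𝓘(ℝ, ℝ) 𝓘(ℝ, ℂ) γ t ≠ 0
  embedded : ∀ s t, γ s = γ t ↔ ∃ n : ℤ, s = t + n

/-- The tangent line at `x` of a closed curve through `x`, as a set of real tangent vectors. -/
def tangentLine (γ : ℝ → S) (x : S) : Set ℂ :=
  {v | ∃ t c : ℝ, γ t = x ∧ v = c • (mfderiv 𝓘(ℝ, ℝ) 𝓘(ℝ, ℂ) γ t (1 : ℝ) : ℂ)}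

/-- First singular homology with rational coefficients. -/
def H1 (X : Type u) [TopologicalSpace X] : ModuleCat.{u} ℚ :=
  ((AlgebraicTopology.singularHomologyFunctor (ModuleCat.{u} ℚ) 1).obj
    (ModuleCat.of ℚ (ULift.{u} ℚ))).obj (TopCat.of X)

/-- The image in `H₁(X; ℚ)` of the homology of a subspace. -/
def homologyImage {X : Type u} [TopologicalSpace X] (A : Set X) : Submodule ℚ (H1 X) :=
  LinearMap.range (((AlgebraicTopology.singularHomologyFunctor (ModuleCat.{u} ℚ) 1).obj
    (ModuleCat.of ℚ (ULift.{u} ℚ))).map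
      (TopCat.ofHom ⟨(Subtype.val : A → X), continuous_subtype_val⟩)).hom

/-- A doubly pointed Heegaard diagram `(Σ, α, β, w, z)` of genus `g`. The attaching curves are
indexed as `curve 0 i = αᵢ`, `curve 1 i = βᵢ`. -/
structure HeegaardDiagram (S : Type u) [TopologicalSpace S] [ChartedSpace ℂ S] (g : ℕ) where
  curve : Fin 2 → Fin g → ℝ → S
  w : S
  z : S
  w_ne_z : w ≠ z
  genus : Module.finrank ℚ (H1 S) = 2 * g
  isClosedCurve : ∀ c i, IsClosedCurve (curve c i)
  disjoint : ∀ c i j, i ≠ j → Disjoint (range (curve c i)) (range (curve c j))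
  span : ∀ c, Module.finrank ℚ (homologyImage (⋃ i, range (curve c i))) = g
  avoids : ∀ c i t, curve c i t ≠ w ∧ curve c i t ≠ z
  transverse : ∀ i j s t, curve 0 i s = curve 1 j t →
    LinearIndependent ℝ ![(mfderiv 𝓘(ℝ, ℝ) 𝓘(ℝ, ℂ) (curve 0 i) s (1 : ℝ) : ℂ),
      (mfderiv 𝓘(ℝ, ℝ) 𝓘(ℝ, ℂ) (curve 1 j) t (1 : ℝ) : ℂ)]

/-- One side of a Heegaard splitting adapted to a knot. The closed set `U` is a handlebody with
boundary `emb S`: the closed curves `γ i` bound disjoint properly embedded discs `disc i` in `U`,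
which cut its interior into an open ball. The knot meets `U` in an arc `s ↦ push (s, 1)`, obtained
by pushing an embedded arc of `emb S` from `p` to `q` that is disjoint from the curves into `U`,
in the complement of the discs. -/
structure HandlebodySide {Y : Type v} [TopologicalSpace Y] {g : ℕ} (emb : S → Y) (U : Set Y)
    (γ : Fin g → ℝ → S) (p q : S) where
  disc : Fin g → ℂ → Y
  disc_continuousOn : ∀ i, ContinuousOn (disc i) (Metric.closedBall 0 1)
  disc_injOn : ∀ i, InjOn (disc i) (Metric.closedBall 0 1)
  disc_boundary : ∀ i (t : ℝ), disc i (Complex.exp (2 * Real.pi * t * Complex.I)) = emb (γ i t)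
  disc_interior : ∀ i, ∀ u ∈ Metric.ball (0 : ℂ) 1, disc i u ∈ U \ range emb
  disc_disjoint : ∀ i j, i ≠ j →
    Disjoint (disc i '' Metric.closedBall 0 1) (disc j '' Metric.closedBall 0 1)
  complement_ball : Nonempty
    (↥(U \ (range emb ∪ ⋃ i, disc i '' Metric.closedBall 0 1)) ≃ₜ EuclideanSpace ℝ (Fin 3))
  push : unitInterval × unitInterval → Y
  push_continuous : Continuous push
  push_injOn : InjOn push {r | 0 < r.1 ∧ r.1 < 1}
  push_slice : ∀ t, Function.Injective fun s => push (s, t)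
  push_start : ∀ t, push (0, t) = emb p
  push_end : ∀ t, push (1, t) = emb q
  push_surface : ∀ s, push (s, 0) ∈ range emb
  push_interior : ∀ s t, 0 < s → s < 1 → 0 < t → push (s, t) ∈ U \ range emb
  push_disc : ∀ r i, push r ∉ disc i '' Metric.closedBall 0 1

/-- The arc in which the knot meets a side of the splitting. -/
def HandlebodySide.arc {Y : Type v} [TopologicalSpace Y] {g : ℕ} {emb : S → Y} {U : Set Y}
    {γ : Fin g → ℝ → S} {p q : S} (h : HandlebodySide emb U γ p q) : Set Y :=
  range fun s => h.push (s, 1)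

/-- A realization of a doubly pointed Heegaard diagram by a knot `K` in the three-manifold `Y`:
a splitting of `Y` along the bicollared surface `emb S` into two handlebodies, in which the `α`
and the `β` curves are attaching circles, and in which `K` is the union of a pushed-off arc from
`z` to `w` in the complement of the `α` curves and one from `w` to `z` in the complement of the
`β` curves. -/
structure HeegaardSplitting {g : ℕ} (𝓗 : HeegaardDiagram S g) (Y : Type v) [TopologicalSpace Y]
    (K : Set Y) where
  emb : S → Y
  U : Fin 2 → Set Y
  isClosedEmbedding : IsClosedEmbedding emb
  isClosed : ∀ c, IsClosed (U c)
  union : U 0 ∪ U 1 = univ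
  inter : U 0 ∩ U 1 = range emb
  bicollar : S × Ioo (-1 : ℝ) 1 → Y
  bicollar_isOpenEmbedding : IsOpenEmbedding bicollar
  bicollar_zero : ∀ x, bicollar (x, ⟨0, by norm_num⟩) = emb x
  bicollar_side : ∀ x (t : Ioo (-1 : ℝ) 1),
    ((t : ℝ) ≤ 0 → bicollar (x, t) ∈ U 0) ∧ (0 ≤ (t : ℝ) → bicollar (x, t) ∈ U 1)
  side₀ : HandlebodySide emb (U 0) (𝓗.curve 0) 𝓗.z 𝓗.w
  side₁ : HandlebodySide emb (U 1) (𝓗.curve 1) 𝓗.w 𝓗.z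
  knot : K = side₀.arc ∪ side₁.arc

end Diagrams

/-! ### Seifert surfaces and branched double covers of three-manifolds -/

section Seifert

variable {Y : Type u} [TopologicalSpace Y]

/-- A Seifert surface for `K`: a compact surface `F` (with boundary) embedded in `Y` with
boundary `K`, cooriented by a bicollar of its interior in `Y - K`. -/
structure SeifertSurface (K : Set Y) (F : Type v) [TopologicalSpace F]
    [ChartedSpace (EuclideanHalfSpace 2) F] where
  emb : F → Y
  isClosedEmbedding : IsClosedEmbedding emb
  boundary : emb '' (𝓡∂ 2).boundary F = K
  bicollar : (𝓡∂ 2).interior F × Icc (-1 : ℝ) 1 → ↥(Kᶜ)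
  bicollar_isClosedEmbedding : IsClosedEmbedding bicollar
  bicollar_isOpen : IsOpen (bicollar '' {q | -1 < (q.2 : ℝ) ∧ (q.2 : ℝ) < 1})
  bicollar_zero : ∀ x, (bicollar (x, ⟨0, by norm_num⟩) : Y) = emb x

/-- The double cover `p : Y' → Y` with deck transformation `τ`, branched along `K`, that is
obtained from the Seifert surface `Q`: two copies of `Y`, cut open along the surface, are glued so
that one passes from one copy (`sheet`) to the other (`τ '' sheet`) on crossing the surface. -/
structure BranchedDoubleCover {K : Set Y} {F : Type v} [TopologicalSpace F]
    [ChartedSpace (EuclideanHalfSpace 2) F] (Q : SeifertSurface K F)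
    (Y' : Type a) [TopologicalSpace Y'] where
  p : Y' → Y
  τ : Y' → Y'
  continuous_p : Continuous p
  continuous_τ : Continuous τ
  surjective : Function.Surjective p
  fibre : ∀ a b, p a = p b ↔ b = a ∨ b = τ a
  fixed : ∀ a, τ a = a ↔ p a ∈ K
  covering : IsCoveringMapOn p Kᶜ
  local_model : ∀ a, p a ∈ K → ∃ (e' : OpenPartialHomeomorph Y' (ℂ × ℝ))
    (e : OpenPartialHomeomorph Y (ℂ × ℝ)), a ∈ e'.source ∧
      (∀ x ∈ e'.source, p x ∈ e.source ∧ e (p x) = ((e' x).1 ^ 2, (e' x).2)) ∧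
      ∀ y ∈ e.source, y ∈ K ↔ (e y).1 = 0
  sheet : Set Y'
  sheet_isOpen : IsOpen sheet
  sheet_subset : ∀ a ∈ sheet, p a ∉ range Q.emb
  sheet_compl : ∀ a, p a ∉ range Q.emb → (a ∈ sheet ↔ τ a ∉ sheet)
  sheet_crossing : ∀ (x : (𝓡∂ 2).interior F) (γ : Icc (-1 : ℝ) 1 → Y'), Continuous γ →
    (∀ t, p (γ t) = Q.bicollar (x, t)) →
      (γ ⟨-1, by norm_num⟩ ∈ sheet ↔ γ ⟨1, by norm_num⟩ ∉ sheet)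

end Seifert

/-! ### The normal and tangential polarizations -/

section Main

variable {S : Type u} [TopologicalSpace S] [ChartedSpace ℂ S]
variable {S' : Type v} [TopologicalSpace S'] [ChartedSpace ℂ S']

/-- The tangent space at `D ∈ Symⁿ` of the torus which is the image of a set `T` of ordered
tuples whose `i`-th factor is a curve with tangent lines `l i`. -/
def torusTangent {n : ℕ} (T : Set (Fin n → S)) (l : Fin n → S → Set ℂ) (D : Sym S n) :
    Submodule ℝ (SymTangent D) :=
  Submodule.span ℝ {ξ | ∃ x ∈ T, ∃ v : Fin n → ℂ, (∀ i, v i ∈ l i (x i)) ∧ IsImageVector ξ x v}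

/-- The ordered points of the torus `γ₁ × ⋯ × γ_g`. -/
def orderedTorus {g : ℕ} (γ : Fin g → ℝ → S) : Set (Fin g → S) := {x | ∀ i, x i ∈ range (γ i)}

/-- The torus `𝕋 = γ₁ × ⋯ × γ_g` in `Sym^g(S)`. -/
def torus {g : ℕ} (γ : Fin g → ℝ → S) : Set (Sym S g) := symMk '' orderedTorus γ

/-- The ordered points of the torus `γ̃₁ × ⋯ × γ̃_{2g}`, where `γ̃ᵢ`, `γ̃_{g+i}` are the two
components of the preimage of `γᵢ` in `S'`: the entries `i` and `g + i` lie in different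
components of that preimage. -/
def orderedLiftTorus {w z : S} (P : SurfaceDoubleCover S S' w z) {g : ℕ} (γ : Fin g → ℝ → S) :
    Set (Fin (2 * g) → S') :=
  {x | ∀ i : Fin g, (∀ c : Fin 2, P.π (x (finProdFinEquiv (c, i))) ∈ range (γ i)) ∧
    connectedComponentIn (P.π ⁻¹' range (γ i)) (x (finProdFinEquiv (0, i))) ≠
      connectedComponentIn (P.π ⁻¹' range (γ i)) (x (finProdFinEquiv (1, i)))}

/-- The torus `γ̃₁ × ⋯ × γ̃_{2g}` in `Sym^{2g}(S')`. -/
def liftTorus {w z : S} (P : SurfaceDoubleCover S S' w z) {g : ℕ} (γ : Fin g → ℝ → S) :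
    Set (Sym S' (2 * g)) := symMk '' orderedLiftTorus P γ

/-- The tangent space at `D` of the torus `γ₁ × ⋯ × γ_g`. -/
def tangentTorus {g : ℕ} (γ : Fin g → ℝ → S) (D : Sym S g) : Submodule ℝ (SymTangent D) :=
  torusTangent (orderedTorus γ) (fun i => tangentLine (γ i)) D

/-- The tangent space at `D` of the torus `γ̃₁ × ⋯ × γ̃_{2g}`. The tangent line of the preimage of
a curve is the preimage of its tangent line under the differential of the covering. -/
def tangentLiftTorus {w z : S} (P : SurfaceDoubleCover S S' w z) {g : ℕ} (γ : Fin g → ℝ → S)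
    (D : Sym S' (2 * g)) : Submodule ℝ (SymTangent D) :=
  torusTangent (orderedLiftTorus P γ)
    (fun k a => {v | (mfderiv 𝓘(ℂ) 𝓘(ℂ) P.π a v : ℂ) ∈
      tangentLine (γ (finProdFinEquiv.symm k).2) (P.π a)}) D

variable {g : ℕ} {𝓗 : HeegaardDiagram S g}

/-- A nondegenerate two-form on `M̃ = Sym^{2g}(S' - {w', z'})` that is invariant under the
involution, tames the complex structure, and for which the two tori are Lagrangian. (Closedness
is not required.) -/
structure TamedForm (P : SurfaceDoubleCover S S' 𝓗.w 𝓗.z) where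
  form : ∀ D : Sym S' (2 * g), SymTangent D →ₗ[ℝ] SymTangent D →ₗ[ℝ] ℝ
  continuous : FormContinuousOn (Fib := Fin (2 * g) → ℂ) (fun D : Sym S' (2 * g) => SymTangent D)
    (puncturedSym S' (2 * g) P.w' P.z') form
  alternating : ∀ D ∈ puncturedSym S' (2 * g) P.w' P.z', ∀ u, form D u u = 0
  tame : ∀ D ∈ puncturedSym S' (2 * g) P.w' P.z', ∀ u, u ≠ 0 → 0 < form D u (Complex.I • u)
  invariant : ∀ (D : Sym S' (2 * g)) (hD : D ∈ puncturedSym S' (2 * g) P.w' P.z') (u v),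
    form (P.symDeck _ D) (symDifferential (P.symDeck _) D (P.holAt_symDeck D hD) u)
      (symDifferential (P.symDeck _) D (P.holAt_symDeck D hD) v) = form D u v
  lagrangian : ∀ c, ∀ D ∈ liftTorus P (𝓗.curve c),
    IsLagrangian (form D) (tangentLiftTorus P (𝓗.curve c) D)

/-- `M = Sym^g(S - {w, z})`. -/
abbrev Base (𝓗 : HeegaardDiagram S g) : Type u := ↥(puncturedSym S g 𝓗.w 𝓗.z)

/-- The Lagrangian tori `L 0 = 𝕋_α`, `L 1 = 𝕋_β` in `M`. -/
def tori (𝓗 : HeegaardDiagram S g) (c : Fin 2) : Set (Base 𝓗) := {D | D.1 ∈ torus (𝓗.curve c)}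

/-- The tangential polarization `(TM, T𝕋_α, T𝕋_β)`, where `M` carries the restriction of the
symplectic form of `M̃`. -/
def tangentialPolarization (P : SurfaceDoubleCover S S' 𝓗.w 𝓗.z) (Ω : TamedForm P) :
    PolarizationData.{u, u} (Base 𝓗) (tori 𝓗) g where
  E D := SymTangent D.1
  addCommGroup _ := inferInstance
  module _ := inferInstance
  topology := TopologicalSpace.induced
    (fun q => ((q.proj, ⟨q.proj.1, q.snd⟩) : Base 𝓗 × SymTangentBundle S g)) inferInstance
  form D :=
    let d := (symDifferential (P.symLift g) D.1 (P.holAt_symLift D.1 D.2)).restrictScalars ℝ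
    (Ω.form (P.symLift g D.1)).compl₁₂ d d
  F c D := tangentTorus (𝓗.curve c) D.1

/-- The fibre at `D ∈ M` of the normal bundle of `M ⊂ M̃`: the `-1`-eigenspace of the differential
of the involution on the tangent space of `M̃` at the image of `D`, a fixed point. -/
def normalFibre (P : SurfaceDoubleCover S S' 𝓗.w 𝓗.z) (D : Sym S g) :
    Submodule ℂ (SymTangent (P.symLift g D)) where
  carrier := {ξ | ∀ (f : Sym S' (2 * g) → ℂ) (hf : HolAt f (P.symLift g D))
    (hf' : HolAt (f ∘ P.symDeck (2 * g)) (P.symLift g D)),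
      ξ.1 ⟨f ∘ P.symDeck (2 * g), hf'⟩ = -ξ.1 ⟨f, hf⟩}
  add_mem' := by
    intro ξ η hξ hη f hf hf'
    have h1 := hξ f hf hf'
    have h2 := hη f hf hf'
    simp only [Submodule.coe_add, LinearMap.add_apply, h1, h2]
    ring
  zero_mem' := by intro f hf hf'; simp
  smul_mem' := by
    intro r ξ hξ f hf hf'
    have h1 := hξ f hf hf'
    simp only [Submodule.coe_smul, LinearMap.smul_apply, h1, smul_eq_mul]
    ring

/-- The normal polarization `(E, F₀, F₁)`: the normal bundle `E` of `M ⊂ M̃`, and the normal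
bundles of `𝕋_α ⊂ 𝕋_α̃` and `𝕋_β ⊂ 𝕋_β̃`, i.e. the `-1`-eigenspaces on the tangent spaces of the
tori in `M̃`. -/
def normalPolarization (P : SurfaceDoubleCover S S' 𝓗.w 𝓗.z) (Ω : TamedForm P) :
    PolarizationData.{u, v} (Base 𝓗) (tori 𝓗) g where
  E D := normalFibre P D.1
  addCommGroup _ := inferInstance
  module _ := inferInstance
  topology := TopologicalSpace.induced
    (fun q => ((q.proj, ⟨P.symLift g q.proj.1, q.snd.1⟩) :
      Base 𝓗 × SymTangentBundle S' (2 * g))) inferInstance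
  form D :=
    let i := (normalFibre P D.1).subtype.restrictScalars ℝ
    (Ω.form (P.symLift g D.1)).compl₁₂ i i
  F c D := (tangentLiftTorus P (𝓗.curve c) (P.symLift g D.1)).comap
    ((normalFibre P D.1).subtype.restrictScalars ℝ)

end Main

end HFK

end

/-! Over a tuple D with distinct entries x₁, …, x_g, a (-1)-eigenvector of dι has components vᵢ at
x̃ᵢ and -vᵢ at ιx̃ᵢ. So the normal fibre is the tangent space of M, up to deciding for each i which
preimage carries the plus sign. This choice has monodromy, but on complex vector spaces signs can be
replaced by phases. Because the cover comes from a Seifert surface, there is a continuous function s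
on it away from the branch set, with |s| = 1 and s(ιa) = -s(a): the sheet sign, made to turn by a
half circle across a bicollar of the surface (`BranchedDoubleCover.oddFun`). The map (vᵢ) ↦
(s(x̃ᵢ)vᵢ, s(ιx̃ᵢ)vᵢ) then identifies TM with the normal bundle, complex linearly.

On the diagonal of the symmetric product this formula has no meaning as it stands. There a tangent
vector is a functional on germs of holomorphic functions h at the points of D, namely the derivative
of the trace of h, and multiplication by s does not preserve holomorphic germs. So s is replaced by
a function σ(D, a) that is locally constant in a near the points over D, continuous in D, odd, and
within a right angle of s; a partition of unity on M provides it (`exists_varying`). Multiplication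
by locally constant functions does act on germs (`SurfaceDoubleCover.twist`). To dualize this
action, the tangent space is computed: the power sums of a coordinate are holomorphic coordinates on
the symmetric product (`exists_analytic_of_symmetric`, `eventually_eq_zero_of_comp_psum`).
Derivatives of traces vanish on functions that are constant at each point of D to an order above its
multiplicity, and every functional with this property is a tangent vector (`tr_flat`,
`exists_tangent_of_functional`).

The twist is complex linear but not symplectic. Let θ be the form on TM and η the normal form
transported to TM. Both tame the complex structure, so the segment between them is nondegenerate,
and the principal square root R of θ⁻¹η exists. It satisfies θ(Ru, Rv) = η(u, v), is independent of
bases and varies continuously (`SegInv.sqrtForm_congr`, `rootMap_indep`, `exists_root`). Undoing the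
twist and then applying R is the symplectic isomorphism.

It remains to compare the Lagrangians. The attaching curves bound discs in the complement of K.
Hence they have closed lifts along which s has a single-valued argument, and σ has a single-valued
logarithm ℓ (`exists_phase`, `logLift`). In the frame of velocities along a torus, its tangent space
is ℝ^g, and the normal Lagrangian corresponds to exp(-ℓ)ℝ^g. The obvious path exp(-(1-r)ℓ)ℝ^g need
not be Lagrangian. But ℝ^g is isotropic for θ and for the pull-back of η by exp(-ℓ), so also for
their convex combinations, and a further square root carries these combinations back to θ
(`pathMap`). Naturality of the root gives the correct ends of the path. -/

namespace HFK

noncomputable section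

/-! ### Analytic functions with values in spaces of continuous functions -/

section Analysis

variable {E : Type*} [NormedAddCommGroup E] [NormedSpace ℂ E]

/-- Hadamard's lemma for analytic functions. -/
theorem exists_analytic_hadamard {F : E → ℂ} {c : E} (hF : AnalyticAt ℂ F c) :
    ∃ G : E → (E →L[ℂ] ℂ), AnalyticAt ℂ G c ∧ G c = fderiv ℂ F c ∧
      ∀ᶠ x in 𝓝 c, F x = F c + G x (x - c) := by
  obtain ⟨p, r, hp⟩ := hF
  -- The shifted series leaves one argument of each term of positive degree free, so its sum takes
  -- values in linear maps; it has the same radius of convergence.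
  set q := p.shift with hq
  have hqr : q.radius = p.radius := p.radius_shift
  have hpos : 0 < q.radius := by rw [hqr]; exact hp.r_pos.trans_le hp.r_le
  have h0 := q.hasFPowerSeriesOnBall hpos
  have h1 : HasFPowerSeriesOnBall (fun x => q.sum (x - c)) q (0 + c) q.radius := h0.comp_sub c
  rw [zero_add] at h1
  have hev : ∀ᶠ x in 𝓝 c, F x = F c + q.sum (x - c) (x - c) := by
    filter_upwards [Metric.eball_mem_nhds c hp.r_pos, Metric.eball_mem_nhds c hpos] with x hx hx'
    have e1 := hp.hasSum_sub hx
    have e2 := (h1.unshift (z := F c)).hasSum_sub hx'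
    refine e1.unique (e2.congr_fun ?_)
    intro n
    cases n with
    | zero => simpa [FormalMultilinearSeries.unshift] using (hp.coeff_zero _)
    | succ n =>
      simp [FormalMultilinearSeries.unshift, hq, FormalMultilinearSeries.shift]
  refine ⟨fun x => q.sum (x - c), h1.analyticAt, ?_, hev⟩
  have h2 : HasFDerivAt (fun x => F c + q.sum (x - c) (x - c)) (q.sum (c - c)) c := by
    have d1 := h1.analyticAt.differentiableAt.hasFDerivAt
    have d2 := (d1.clm_apply ((hasFDerivAt_id c).sub_const c)).const_add (F c)
    have e : q.sum (c - c) = q.sum (c - c) ∘SL ContinuousLinearMap.id ℂ E +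
        (fderiv ℂ (fun x => q.sum (x - c)) c).flip (id c - c) := by
      ext v
      simp
    rw [e]
    exact d2
  exact (h2.congr_of_eventuallyEq hev).fderiv.symm

variable {K : Type*} [TopologicalSpace K] [CompactSpace K]

/-- Post-composition with an analytic function is analytic on spaces of continuous functions. -/
theorem exists_analytic_postcomp {H : E → ℂ} {x₀ : E} (hH : AnalyticAt ℂ H x₀) :
    ∃ δ > 0, ∃ Φ : C(K, E) → C(K, ℂ), ∀ y : C(K, E), ‖y - ContinuousMap.const K x₀‖ < δ →
      AnalyticAt ℂ Φ y ∧ ∀ θ, Φ y θ = H (y θ) := by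
  obtain ⟨p, r, hp⟩ := hH
  -- The Taylor coefficients of `H` act pointwise. Their norms do not grow, so the series over the
  -- space of continuous functions converges at least as far as the original one.
  let P : ∀ n, (C(K, E)) [×n]→L[ℂ] C(K, ℂ) := fun n =>
    MultilinearMap.mkContinuous
      { toFun := fun v => ⟨fun θ => p n fun i => v i θ, by
          exact (p n).cont.comp (continuous_pi fun i => (v i).continuous)⟩
        map_update_add' := by
          intro _ m i x y
          ext θ
          have h : ∀ u, (fun j => (Function.update m i u j) θ) =
              Function.update (fun j => m j θ) i (u θ) := by
            intro u; funext j; by_cases hj : j = i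
            · subst hj; simp
            · simp [hj]
          simp [h]
        map_update_smul' := by
          intro _ m i c x
          ext θ
          have h : ∀ u, (fun j => (Function.update m i u j) θ) =
              Function.update (fun j => m j θ) i (u θ) := by
            intro u; funext j; by_cases hj : j = i
            · subst hj; simp
            · simp [hj]
          simp [h] } ‖p n‖ (by
        intro v
        rw [ContinuousMap.norm_le _ (by positivity)]
        intro θ
        refine ((p n).le_opNorm _).trans ?_
        gcongr
        exact ContinuousMap.norm_coe_le_norm _ _)
  let Q : FormalMultilinearSeries ℂ C(K, E) C(K, ℂ) := P
  have hn : ∀ n, ‖Q n‖ ≤ ‖p n‖ := fun n => MultilinearMap.mkContinuous_norm_le _ (norm_nonneg _) _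
  have hrad : p.radius ≤ Q.radius := by
    refine ENNReal.le_of_forall_nnreal_lt fun ρ hρ => ?_
    refine Q.le_radius_of_summable_norm ?_
    exact (p.summable_norm_mul_pow hρ).of_nonneg_of_le (fun n => by positivity)
      fun n => by gcongr; exact hn n
  have hpos : 0 < Q.radius := hp.r_pos.trans_le (hp.r_le.trans hrad)
  have h0 := Q.hasFPowerSeriesOnBall hpos
  have h1 := h0.comp_sub (ContinuousMap.const K x₀)
  rw [zero_add] at h1
  obtain ⟨δ, hδ, hδr⟩ := ENNReal.lt_iff_exists_nnreal_btwn.1 hp.r_pos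
  have hδ' : (0 : ℝ) < δ := by exact_mod_cast hδ
  refine ⟨δ, hδ', fun y => Q.sum (y - ContinuousMap.const K x₀), fun y hy => ?_⟩
  have hyQ : y ∈ Metric.eball (ContinuousMap.const K x₀) Q.radius := by
    rw [Metric.mem_eball, edist_dist, dist_eq_norm]
    refine lt_of_lt_of_le ?_ ((hδr.le.trans hp.r_le).trans hrad)
    rw [ENNReal.ofReal_lt_coe_iff (by positivity)]; exact_mod_cast hy
  refine ⟨h1.analyticAt_of_mem hyQ, fun θ => ?_⟩
  have e1 := h1.hasSum_sub hyQ
  have e2 := (ContinuousMap.evalCLM ℂ θ).hasSum e1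
  have hyθ : y θ ∈ Metric.eball x₀ r := by
    rw [Metric.mem_eball, edist_dist, dist_eq_norm]
    refine lt_of_le_of_lt ?_ hδr
    refine ENNReal.ofReal_le_of_le_toReal ?_
    exact (ContinuousMap.norm_coe_le_norm (y - ContinuousMap.const K x₀) θ).trans hy.le
  exact e2.unique (hp.hasSum_sub hyθ)

/-- An analytic function of `(ζ, e)` restricted to a small curve `γ` in the first variable depends
analytically on the second variable, as a continuous function on the curve. -/
theorem exists_analytic_curve_restrict {H : ℂ × E → ℂ} {a : ℂ} {e₀ : E}
    (hH : AnalyticAt ℂ H (a, e₀)) :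
    ∃ δ > 0, ∀ γ : C(K, ℂ), (∀ θ, ‖γ θ - a‖ < δ) → ∃ Φ : E → C(K, ℂ), AnalyticAt ℂ Φ e₀ ∧
      ∀ᶠ e in 𝓝 e₀, ∀ θ, Φ e θ = H (γ θ, e) := by
  obtain ⟨δ, hδ, Ψ, hΨ⟩ := exists_analytic_postcomp (K := K) hH
  -- The supremum norm is only bounded non-strictly by pointwise bounds; halving `δ` restores the
  -- strict inequality.
  refine ⟨δ / 2, by positivity, fun γ hγ => ?_⟩
  let L : E →L[ℂ] C(K, ℂ × E) := LinearMap.mkContinuous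
    { toFun := fun e => ContinuousMap.const K (0, e)
      map_add' := by intro x y; ext θ <;> simp
      map_smul' := by intro x y; ext θ <;> simp } 1 (by
        intro e
        rw [ContinuousMap.norm_le _ (by positivity)]
        intro θ; simp)
  let y : E → C(K, ℂ × E) := fun e => γ.prodMk (ContinuousMap.const K 0) + L e
  have hy : ∀ e θ, y e θ = (γ θ, e) := by intro e θ; simp [y, L]
  have hyan : ∀ e, AnalyticAt ℂ y e := fun e => analyticAt_const.add (L.analyticAt e)
  have hnorm : ∀ e, ‖e - e₀‖ < δ / 2 → ‖y e - ContinuousMap.const K (a, e₀)‖ < δ := by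
    intro e he
    refine lt_of_le_of_lt ?_ (half_lt_self hδ)
    rw [ContinuousMap.norm_le _ (by positivity)]
    intro θ
    simp only [ContinuousMap.sub_apply, hy, ContinuousMap.const_apply]
    exact max_le (hγ θ).le he.le
  refine ⟨Ψ ∘ y, (hΨ (y e₀) (hnorm e₀ (by simpa using hδ))).1.comp (hyan e₀), ?_⟩
  filter_upwards [Metric.ball_mem_nhds e₀ (half_pos hδ)] with e he θ
  rw [mem_ball_iff_norm] at he
  simp only [Function.comp, (hΨ (y e) (hnorm e he)).2, hy]

end Analysis

/-! ### Power sums and elementary symmetric polynomials -/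

section PowerSums

/-- The power sums `∑ zᵢ^(k+1)`, `k < n`. -/
def psum {n : ℕ} (z : Fin n → ℂ) : Fin n → ℂ := fun k => ∑ i, z i ^ (k.val + 1)

theorem psum_perm {n : ℕ} (z : Fin n → ℂ) (σ : Equiv.Perm (Fin n)) : psum (z ∘ σ) = psum z := by
  funext k
  exact Equiv.sum_comp σ fun i => z i ^ (k.val + 1)

theorem analyticAt_psum {n : ℕ} (z : Fin n → ℂ) : AnalyticAt ℂ (psum (n := n)) z := by
  refine AnalyticAt.pi fun k => ?_
  refine Finset.analyticAt_fun_sum _ fun i _ => ?_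
  exact ((ContinuousLinearMap.proj (R := ℂ) (φ := fun _ : Fin n => ℂ) i).analyticAt z).pow _

/-- Newton's identities express k·eₖ through the eᵢ with i < k and the power sums of degree k - i;
over ℂ one may divide by k. -/
theorem esymm_mem_adjoin_psum (n k : ℕ) (hk : k ≤ n) :
    MvPolynomial.esymm (Fin n) ℂ k ∈
      Algebra.adjoin ℂ (Set.range fun j : Fin n => MvPolynomial.psum (Fin n) ℂ (j.val + 1)) := by
  induction k using Nat.strong_induction_on with
  | _ k ih =>
    rcases Nat.eq_zero_or_pos k with rfl | hpos
    · simp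
    · have h := MvPolynomial.mul_esymm_eq_sum (Fin n) ℂ k
      have hk0 : (k : ℂ) ≠ 0 := by exact_mod_cast hpos.ne'
      have h2 : MvPolynomial.esymm (Fin n) ℂ k = (k : ℂ)⁻¹ •
          ((k : MvPolynomial (Fin n) ℂ) * MvPolynomial.esymm (Fin n) ℂ k) := by
        rw [← nsmul_eq_mul, ← Nat.cast_smul_eq_nsmul ℂ, smul_smul, inv_mul_cancel₀ hk0, one_smul]
      rw [h2, h]
      refine Subalgebra.smul_mem _ (mul_mem (pow_mem (neg_mem (one_mem _)) _) ?_) _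
      refine sum_mem fun a ha => ?_
      rw [Finset.mem_filter, Finset.HasAntidiagonal.mem_antidiagonal] at ha
      refine mul_mem (mul_mem (pow_mem (neg_mem (one_mem _)) _) (ih _ ha.2 (by omega))) ?_
      -- The generator with index j has degree j + 1, and `a.2` is positive because `a.1 < k`.
      refine Algebra.subset_adjoin ⟨⟨a.2 - 1, by omega⟩, ?_⟩
      simp only
      congr 1; omega

/-- The monic polynomial with roots `zᵢ` depends polynomially on the power sums of the roots. -/
theorem exists_rootPoly (n : ℕ) : ∃ c : Fin (n + 1) → MvPolynomial (Fin n) ℂ,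
    ∀ z : Fin n → ℂ, ∏ i, (Polynomial.X - Polynomial.C (z i)) =
      ∑ j : Fin (n + 1), Polynomial.C (MvPolynomial.eval (psum z) (c j)) * Polynomial.X ^ (n - j.val) := by
  have h : ∀ j : Fin (n + 1), ∃ c : MvPolynomial (Fin n) ℂ, ∀ z : Fin n → ℂ,
      MvPolynomial.eval (psum z) c = (-1) ^ j.val * MvPolynomial.eval z (MvPolynomial.esymm (Fin n) ℂ j) := by
    intro j
    have := esymm_mem_adjoin_psum n j (by omega)
    rw [Algebra.adjoin_range_eq_range_aeval] at this
    obtain ⟨q, hq⟩ := this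
    refine ⟨MvPolynomial.C ((-1) ^ j.val) * q, fun z => ?_⟩
    rw [← hq, map_mul, MvPolynomial.eval_C]
    congr 1
    have e : (MvPolynomial.aeval (psum z) : MvPolynomial (Fin n) ℂ →ₐ[ℂ] ℂ) =
        (MvPolynomial.aeval z).comp
          (MvPolynomial.aeval fun j : Fin n => MvPolynomial.psum (Fin n) ℂ (j.val + 1)) := by
      ext k
      simp [psum, MvPolynomial.psum]
    have := DFunLike.congr_fun e q
    simpa [MvPolynomial.aeval_eq_eval] using this
  choose c hc using h
  refine ⟨c, fun z => ?_⟩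
  have e := Multiset.prod_X_sub_X_eq_sum_esymm (Finset.univ.val.map z)
  simp only [Multiset.map_map, Multiset.card_map, Finset.card_val, Finset.card_univ,
    Fintype.card_fin] at e
  change ∏ i, (Polynomial.X - Polynomial.C (z i)) = _ at e
  rw [e, Finset.sum_range]
  refine Finset.sum_congr rfl fun j _ => ?_
  rw [hc]
  have := MvPolynomial.aeval_esymm_eq_multiset_esymm (Fin n) ℂ (f := z) (n := j)
  rw [← this]
  simp [MvPolynomial.aeval_eq_eval, mul_assoc]

end PowerSums

end

end HFK

namespace HFK

noncomputable section

/-! ### Symmetric analytic functions as analytic functions of the power sums -/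

section SymmetricAnalytic

/-- The integral over the circle as a continuous linear functional on continuous functions of the
angle. -/
def circleFunctional (a : ℂ) (ε : ℝ) : C(Icc (0 : ℝ) (2 * Real.pi), ℂ) →L[ℂ] ℂ :=
  LinearMap.mkContinuous
    { toFun := fun g => ∫ θ in (0 : ℝ)..2 * Real.pi, deriv (circleMap a ε) θ *
        g (projIcc 0 (2 * Real.pi) Real.two_pi_pos.le θ)
      map_add' := by
        intro f g
        rw [← intervalIntegral.integral_add]
        · simp [mul_add]
        all_goals
          refine Continuous.intervalIntegrable ?_ _ _
          simp only [deriv_circleMap]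
          fun_prop
      map_smul' := by
        intro c f
        simp only [RingHom.id_apply, smul_eq_mul]
        rw [← intervalIntegral.integral_const_mul]
        congr 1
        ext θ
        simp
        ring } (|ε| * |2 * Real.pi - 0|) (by
      intro g
      have : ∀ θ ∈ Set.uIoc (0 : ℝ) (2 * Real.pi), ‖deriv (circleMap a ε) θ *
        g (projIcc 0 (2 * Real.pi) Real.two_pi_pos.le θ)‖ ≤ |ε| * ‖g‖ := by
        intro θ _
        rw [norm_mul]
        gcongr
        · simp [deriv_circleMap]
        · exact ContinuousMap.norm_coe_le_norm _ _
      refine (intervalIntegral.norm_integral_le_of_norm_le_const this).trans (le_of_eq ?_)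
      ring)

theorem circleFunctional_eq (a : ℂ) (ε : ℝ) (g : C(Icc (0 : ℝ) (2 * Real.pi), ℂ)) (f : ℂ → ℂ)
    (h : ∀ θ, g θ = f (circleMap a ε θ)) : circleFunctional a ε g = ∮ ζ in C(a, ε), f ζ := by
  change (∫ θ in (0 : ℝ)..2 * Real.pi, deriv (circleMap a ε) θ *
        g (projIcc 0 (2 * Real.pi) Real.two_pi_pos.le θ)) = _
  rw [circleIntegral]
  refine intervalIntegral.integral_congr fun θ hθ => ?_
  rw [Set.uIcc_of_le Real.two_pi_pos.le] at hθ
  simp only [smul_eq_mul]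
  rw [h, Set.projIcc_of_mem _ hθ]

/-- The monic polynomial whose roots have the given power sums. -/
def rootCoeff {n : ℕ} (p : Fin n → ℂ) (j : Fin (n + 1)) : ℂ :=
  MvPolynomial.eval p ((exists_rootPoly n).choose j)

theorem prod_X_sub_C_eq {n : ℕ} (z : Fin n → ℂ) : ∏ i, (Polynomial.X - Polynomial.C (z i)) =
    ∑ j : Fin (n + 1), Polynomial.C (rootCoeff (psum z) j) * Polynomial.X ^ (n - j.val) :=
  (exists_rootPoly n).choose_spec z

theorem analyticAt_rootCoeff {n : ℕ} (p : Fin n → ℂ) (j : Fin (n + 1)) :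
    AnalyticAt ℂ (fun p => rootCoeff (n := n) p j) p :=
  AnalyticOnNhd.eval_mvPolynomial _ p (Set.mem_univ _)

theorem prod_sub_eq {n : ℕ} (z : Fin n → ℂ) (ζ : ℂ) : ∏ i, (ζ - z i) =
    ∑ j : Fin (n + 1), rootCoeff (psum z) j * ζ ^ (n - j.val) := by
  have := congrArg (Polynomial.eval ζ) (prod_X_sub_C_eq z)
  simpa [Polynomial.eval_prod, Polynomial.eval_finsetSum] using this

/-- Both sides are the logarithmic derivative of ∏ (ζ - zᵢ). By `prod_sub_eq` this product also
depends on the power sums alone, so the whole right side does. -/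
theorem sum_inv_sub_eq {n : ℕ} (z : Fin n → ℂ) (ζ : ℂ) (hζ : ∀ i, ζ ≠ z i) :
    ∑ i, (ζ - z i)⁻¹ =
      (∑ j : Fin (n + 1), rootCoeff (psum z) j * ((n - j.val : ℕ) * ζ ^ (n - j.val - 1))) *
        (∏ i, (ζ - z i))⁻¹ := by
  have h0 : ∏ i, (ζ - z i) ≠ 0 := Finset.prod_ne_zero_iff.2 fun i _ => sub_ne_zero.2 (hζ i)
  have h := logDeriv_prod (𝕜 := ℂ) (s := Finset.univ) (f := fun i ζ => ζ - z i) (x := ζ)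
    (fun i _ => sub_ne_zero.2 (hζ i)) (fun i _ => by fun_prop)
  have h1 : ∀ i, logDeriv (fun ζ => ζ - z i) ζ = (ζ - z i)⁻¹ := by
    intro i
    simp [logDeriv_apply]
  simp only [h1] at h
  rw [← h, logDeriv_apply, div_eq_mul_inv]
  congr 1
  have h2 : (fun ζ => ∏ i, (ζ - z i)) =
      fun ζ => ∑ j : Fin (n + 1), rootCoeff (psum z) j * ζ ^ (n - j.val) := by
    funext ζ; exact prod_sub_eq z ζ
  rw [h2, deriv_fun_sum (fun j _ => by fun_prop)]
  refine Finset.sum_congr rfl fun j _ => ?_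
  simp

variable {W : Type} [NormedAddCommGroup W] [NormedSpace ℂ W]

/-- The sum of the values of an analytic function at the roots near `a₀` depends analytically on
the power sums of all the roots. -/
theorem exists_analytic_trace {n : ℕ} {H : ℂ × (W × (Fin n → ℂ)) → ℂ} {a₀ : ℂ} {w₀ : W}
    {a : Fin n → ℂ} (hH : AnalyticAt ℂ H (a₀, (w₀, psum a))) :
    ∃ F : W × (Fin n → ℂ) → ℂ, AnalyticAt ℂ F (w₀, psum a) ∧
      ∀ᶠ q in 𝓝 (w₀, a), F (q.1, psum q.2) =
        ∑ i with a i = a₀, H (q.2 i, (q.1, psum q.2)) := by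
  obtain ⟨δ, hδ, hcurve⟩ :=
    exists_analytic_curve_restrict (K := Icc (0 : ℝ) (2 * Real.pi)) hH
  obtain ⟨ρ, hρ, hball⟩ := Metric.eventually_nhds_iff_ball.1 (hH.eventually_analyticAt)
  -- a radius that isolates `a₀` among the entries of `a`
  obtain ⟨τ, hτ, hsep⟩ : ∃ τ > 0, ∀ i, a i ≠ a₀ → τ < ‖a i - a₀‖ := by
    have : ∀ i, ∃ τ > 0, a i ≠ a₀ → τ < ‖a i - a₀‖ := by
      intro i
      by_cases h : a i = a₀
      · exact ⟨1, one_pos, fun h' => absurd h h'⟩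
      · have : 0 < ‖a i - a₀‖ := norm_pos_iff.2 (sub_ne_zero.2 h)
        exact ⟨‖a i - a₀‖ / 2, by positivity, fun _ => by linarith⟩
    choose τ hτ hτ' using this
    obtain ⟨t, ht⟩ := Filter.Eventually.exists (f := 𝓝[>] (0 : ℝ))
      ((Filter.eventually_all.2 fun i => (Ioo_mem_nhdsGT (hτ i) : ∀ᶠ t in 𝓝[>] (0 : ℝ), t ∈ Ioo 0 (τ i))).and
        self_mem_nhdsWithin)
    exact ⟨t, ht.2, fun i hi => (ht.1 i).2.trans (hτ' i hi)⟩
  obtain ⟨ε, hε, hεδ, hερ, hετ⟩ : ∃ ε > 0, ε < δ ∧ ε < ρ ∧ ε < τ := by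
    refine ⟨min δ (min ρ τ) / 2, by positivity, ?_, ?_, ?_⟩
    · have := min_le_left δ (min ρ τ); linarith [half_lt_self (show 0 < min δ (min ρ τ) by positivity)]
    · have := (min_le_right δ (min ρ τ)).trans (min_le_left _ _)
      linarith [half_lt_self (show 0 < min δ (min ρ τ) by positivity)]
    · have := (min_le_right δ (min ρ τ)).trans (min_le_right _ _)
      linarith [half_lt_self (show 0 < min δ (min ρ τ) by positivity)]
  let γ : C(Icc (0 : ℝ) (2 * Real.pi), ℂ) := ⟨fun θ => circleMap a₀ ε θ, by fun_prop⟩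
  have hγ : ∀ θ, γ θ = circleMap a₀ ε θ := fun _ => rfl
  have hγε : ∀ θ, ‖γ θ - a₀‖ = ε := by
    intro θ; rw [hγ]; simp [circleMap, abs_of_pos hε]
  obtain ⟨Φ, hΦ, hΦH⟩ := hcurve γ (fun θ => by rw [hγε]; exact hεδ)
  -- The polynomial P(ζ) = ∏ (ζ - zᵢ) and its derivative along the circle, as elements of the Banach
  -- algebra of continuous functions. They are analytic in the power sums, inversion is analytic at
  -- units, and integration is bounded and linear; so an integral of H P'/P is analytic in the power
  -- sums.
  let Dn : (Fin n → ℂ) → C(Icc (0 : ℝ) (2 * Real.pi), ℂ) := fun p =>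
    ∑ j : Fin (n + 1), rootCoeff p j • γ ^ (n - j.val)
  let Nm : (Fin n → ℂ) → C(Icc (0 : ℝ) (2 * Real.pi), ℂ) := fun p =>
    ∑ j : Fin (n + 1), rootCoeff p j • (((n - j.val : ℕ) : ℂ) • γ ^ (n - j.val - 1))
  have hDan : AnalyticAt ℂ Dn (psum a) := Finset.analyticAt_fun_sum _ fun j _ =>
    (analyticAt_rootCoeff _ j).smul analyticAt_const
  have hNan : AnalyticAt ℂ Nm (psum a) := Finset.analyticAt_fun_sum _ fun j _ =>
    (analyticAt_rootCoeff _ j).smul analyticAt_const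
  have hD : ∀ z θ, Dn (psum z) θ = ∏ i, (γ θ - z i) := by
    intro z θ
    rw [prod_sub_eq]
    simp [Dn, ContinuousMap.sum_apply]
  have hunit : IsUnit (Dn (psum a)) := by
    rw [ContinuousMap.isUnit_iff_forall_ne_zero]
    intro θ
    rw [hD]
    refine Finset.prod_ne_zero_iff.2 fun i _ h => ?_
    rw [sub_eq_zero] at h
    by_cases hi : a i = a₀
    · have := hγε θ
      rw [h, hi] at this
      simp at this
      exact hε.ne' this.symm
    · have := hsep i hi
      rw [← h, hγε] at this
      linarith
  obtain ⟨un, hun⟩ := hunit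
  have hIan : AnalyticAt ℂ (fun p => Ring.inverse (Dn p)) (psum a) := by
    have h1 := analyticAt_inverse (𝕜 := ℂ) un
    rw [hun] at h1
    exact h1.comp hDan
  have hsnd : AnalyticAt ℂ (fun q : W × (Fin n → ℂ) => q.2) (w₀, psum a) := analyticAt_snd
  -- The residue formula (2πi)⁻¹ ∮ H P'/P, over a circle around `a₀` that separates the roots near
  -- `a₀` from the others.
  refine ⟨fun q => (2 * Real.pi * Complex.I : ℂ)⁻¹ *
    circleFunctional a₀ ε (Φ q * (Nm q.2 * Ring.inverse (Dn q.2))), ?_, ?_⟩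
  · refine analyticAt_const.mul (((circleFunctional a₀ ε).analyticAt _).comp ?_)
    refine hΦ.mul (AnalyticAt.mul ?_ ?_)
    · exact AnalyticAt.comp (f := fun q : W × (Fin n → ℂ) => q.2) (g := Nm) hNan hsnd
    · exact AnalyticAt.comp (f := fun q : W × (Fin n → ℂ) => q.2)
        (g := fun p => Ring.inverse (Dn p)) hIan hsnd
  · have hps : Filter.Tendsto (fun q : W × (Fin n → ℂ) => (q.1, psum q.2)) (𝓝 (w₀, a))
        (𝓝 (w₀, psum a)) := by
      have : ContinuousAt (fun q : W × (Fin n → ℂ) => (q.1, psum q.2)) (w₀, a) := by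
        refine continuousAt_fst.prodMk ?_
        exact ContinuousAt.comp (f := fun q : W × (Fin n → ℂ) => q.2) (g := psum)
          (analyticAt_psum a).continuousAt continuousAt_snd
      exact this
    have ev1 := hps.eventually hΦH
    have ev2 : ∀ᶠ q in 𝓝 (w₀, a), ((q.1, psum q.2) : W × (Fin n → ℂ)) ∈
        Metric.ball (w₀, psum a) ρ := hps (Metric.ball_mem_nhds _ hρ)
    have hentry : ∀ i, Filter.Tendsto (fun q : W × (Fin n → ℂ) => ‖q.2 i - a₀‖) (𝓝 (w₀, a))
        (𝓝 ‖a i - a₀‖) := by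
      intro i
      have : Continuous fun q : W × (Fin n → ℂ) => ‖q.2 i - a₀‖ := by fun_prop
      exact this.tendsto (w₀, a)
    have ev3 : ∀ᶠ q in 𝓝 (w₀, a), ∀ i, a i = a₀ → ‖q.2 i - a₀‖ < ε := by
      rw [Filter.eventually_all]
      intro i
      by_cases hi : a i = a₀
      · have := (hentry i).eventually_lt_const (show ‖a i - a₀‖ < ε by simpa [hi] using hε)
        filter_upwards [this] with q hq _ using hq
      · exact Filter.Eventually.of_forall fun _ h => absurd h hi
    have ev4 : ∀ᶠ q in 𝓝 (w₀, a), ∀ i, a i ≠ a₀ → ε < ‖q.2 i - a₀‖ := by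
      rw [Filter.eventually_all]
      intro i
      by_cases hi : a i = a₀
      · exact Filter.Eventually.of_forall fun _ h => absurd hi h
      · have := (hentry i).eventually_const_lt (hετ.trans (hsep i hi))
        filter_upwards [this] with q hq _ using hq
    filter_upwards [ev1, ev2, ev3, ev4] with q h1 h2 h3 h4
    obtain ⟨w, z⟩ := q
    simp only at h1 h2 h3 h4 ⊢
    have hne : ∀ ζ, ‖ζ - a₀‖ = ε → ∀ i, ζ ≠ z i := by
      rintro ζ hζ i rfl
      by_cases hi : a i = a₀
      · exact (h3 i hi).ne hζ
      · exact (h4 i hi).ne' hζ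
    have hunz : IsUnit (Dn (psum z)) := by
      rw [ContinuousMap.isUnit_iff_forall_ne_zero]
      intro θ
      rw [hD]
      exact Finset.prod_ne_zero_iff.2 fun i _ => sub_ne_zero.2 (hne _ (hγε θ) i)
    have hinv : ∀ θ, Ring.inverse (Dn (psum z)) θ = (∏ i, (γ θ - z i))⁻¹ := by
      intro θ
      have := congrArg (fun f => f θ) (Ring.mul_inverse_cancel _ hunz)
      simp only [ContinuousMap.mul_apply, ContinuousMap.one_apply, hD] at this
      exact eq_inv_of_mul_eq_one_right this
    set f : ℂ → ℂ := fun ζ => H (ζ, (w, psum z)) with hf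
    have hfd : ∀ ζ ∈ Metric.closedBall a₀ ε, DifferentiableAt ℂ f ζ := by
      intro ζ hζ
      have hm : (ζ, (w, psum z)) ∈ Metric.ball (a₀, (w₀, psum a)) ρ := by
        rw [Metric.mem_ball, Prod.dist_eq]
        exact max_lt ((Metric.mem_closedBall.1 hζ).trans_lt hερ) h2
      have h5 := (hball _ hm).differentiableAt
      have h6 : DifferentiableAt ℂ (fun ζ : ℂ => (ζ, ((w, psum z) : W × (Fin n → ℂ)))) ζ :=
        differentiableAt_id.prodMk (differentiableAt_const _)
      exact DifferentiableAt.comp (f := fun ζ : ℂ => (ζ, ((w, psum z) : W × (Fin n → ℂ)))) ζ h5 h6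
    have hfc : ContinuousOn f (Metric.closedBall a₀ ε) := fun ζ hζ =>
      (hfd ζ hζ).continuousAt.continuousWithinAt
    rw [circleFunctional_eq a₀ ε _ (fun ζ => ∑ i, (ζ - z i)⁻¹ • f ζ)]
    · rw [circleIntegral.integral_fun_sum]
      -- P'/P is the sum of the 1/(ζ - zᵢ). For a root inside the circle Cauchy's formula gives the
      -- value of `H` there; for a root outside the integrand is holomorphic on the disc.
      · rw [Finset.mul_sum, Finset.sum_filter]
        refine Finset.sum_congr rfl fun i _ => ?_
        split_ifs with hi
        · rw [Complex.circleIntegral_sub_inv_smul_of_differentiable_on_off_countable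
            countable_empty (mem_ball_iff_norm.2 (h3 i hi)) hfc
            (fun x hx => hfd x (Metric.ball_subset_closedBall hx.1)), smul_eq_mul, ← mul_assoc,
            inv_mul_cancel₀ Complex.two_pi_I_ne_zero, one_mul]
        · have hnz : ∀ ζ ∈ Metric.closedBall a₀ ε, ζ - z i ≠ 0 := by
            intro ζ hζ h0
            rw [sub_eq_zero] at h0
            rw [mem_closedBall_iff_norm, h0] at hζ
            exact absurd hζ (not_le.2 (h4 i hi))
          have hd : ∀ ζ ∈ Metric.closedBall a₀ ε,
              DifferentiableAt ℂ (fun ζ => (ζ - z i)⁻¹ • f ζ) ζ := fun ζ hζ =>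
            DifferentiableAt.smul (𝕜 := ℂ) (c := fun ζ => (ζ - z i)⁻¹) (x := ζ)
              (DifferentiableAt.inv (h := fun ζ => ζ - z i) (z := ζ) (by fun_prop) (hnz ζ hζ)) (hfd ζ hζ)
          rw [Complex.circleIntegral_eq_zero_of_differentiable_on_off_countable hε.le
            countable_empty (fun ζ hζ => (hd ζ hζ).continuousAt.continuousWithinAt)
            (fun x hx => hd x (Metric.ball_subset_closedBall hx.1)), mul_zero]
      · intro i _
        refine ContinuousOn.circleIntegrable hε.le ?_
        refine ContinuousOn.smul (ContinuousOn.inv₀ (f := fun ζ => ζ - z i) (by fun_prop) fun ζ hζ => ?_)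
          (hfc.mono Metric.sphere_subset_closedBall)
        exact sub_ne_zero.2 (hne ζ (mem_sphere_iff_norm.1 hζ) i)
    · intro θ
      have hs := sum_inv_sub_eq z (γ θ) (hne _ (hγε θ))
      simp only [ContinuousMap.mul_apply, h1, hinv]
      rw [← hγ, ← Finset.sum_smul, hs, smul_eq_mul, mul_comm (H _)]
      simp [Nm, ContinuousMap.sum_apply, hf]

/-- Freezing one variable leaves a symmetric function of the others, to which the induction
hypothesis applies; `W` is there to hold frozen variables. The result expresses `f` through one root
and all the power sums. By symmetry every root of the cluster around `a 0` can play this role, so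
`f` is the average over the cluster, which is analytic in the power sums by `exists_analytic_trace`.
-/
theorem exists_analytic_of_symmetric_aux (n : ℕ) : ∀ {W : Type} [NormedAddCommGroup W]
    [NormedSpace ℂ W] (f : W → (Fin n → ℂ) → ℂ) (w₀ : W) (a : Fin n → ℂ),
    (∀ w z (σ : Equiv.Perm (Fin n)), f w (z ∘ σ) = f w z) →
    AnalyticAt ℂ (fun q : W × (Fin n → ℂ) => f q.1 q.2) (w₀, a) →
    ∃ F : W × (Fin n → ℂ) → ℂ, AnalyticAt ℂ F (w₀, psum a) ∧
      ∀ᶠ q in 𝓝 (w₀, a), f q.1 q.2 = F (q.1, psum q.2) := by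
  induction n with
  | zero =>
    intro W _ _ f w₀ a _ hf
    refine ⟨fun q => f q.1 q.2, ?_, Filter.Eventually.of_forall fun q => ?_⟩
    · rwa [Subsingleton.elim (psum a) a]
    · simp only [Subsingleton.elim (psum q.2) q.2]
  | succ n ih =>
    intro W _ _ f w₀ a hsym hf
    -- treat the first variable as a parameter
    let f₁ : W × ℂ → (Fin n → ℂ) → ℂ := fun w z => f w.1 (Fin.cons w.2 z)
    have hcons : AnalyticAt ℂ (fun q : (W × ℂ) × (Fin n → ℂ) =>
        ((q.1.1, Fin.cons q.1.2 q.2) : W × (Fin (n + 1) → ℂ))) ((w₀, a 0), Fin.tail a) := by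
      refine AnalyticAt.prod ?_ (AnalyticAt.pi fun i => ?_)
      · exact ((ContinuousLinearMap.fst ℂ W ℂ).comp
          (ContinuousLinearMap.fst ℂ (W × ℂ) (Fin n → ℂ))).analyticAt _
      · refine Fin.cases ?_ (fun i => ?_) i
        · exact ((ContinuousLinearMap.snd ℂ W ℂ).comp
            (ContinuousLinearMap.fst ℂ (W × ℂ) (Fin n → ℂ))).analyticAt _
        · exact ((ContinuousLinearMap.proj (R := ℂ) (φ := fun _ : Fin n => ℂ) i).comp
            (ContinuousLinearMap.snd ℂ (W × ℂ) (Fin n → ℂ))).analyticAt _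
    obtain ⟨F₁, hF₁, hev₁⟩ := ih f₁ (w₀, a 0) (Fin.tail a)
      (by
        intro w z σ
        have := hsym w.1 (Fin.cons w.2 z) (Equiv.Perm.decomposeFin.symm (0, σ))
        simp only [f₁]
        rw [← this]
        congr 1
        funext i
        refine Fin.cases ?_ (fun i => ?_) i <;> simp)
      (AnalyticAt.comp_of_eq (g := fun q : W × (Fin (n + 1) → ℂ) => f q.1 q.2) hf hcons (by
        simp [Fin.cons_self_tail]))
    -- express the power sums of the other variables through all of them
    let low : ℂ × (W × (Fin (n + 1) → ℂ)) → (W × ℂ) × (Fin n → ℂ) := fun q =>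
      ((q.2.1, q.1), fun k => q.2.2 k.castSucc - q.1 ^ (k.val + 1))
    have hlow : ∀ w (z : Fin (n + 1) → ℂ),
        low (z 0, (w, psum z)) = ((w, z 0), psum (Fin.tail z)) := by
      intro w z
      simp only [low, Prod.mk.injEq, true_and]
      funext k
      simp [psum, Fin.sum_univ_succ, Fin.tail]
    have hlowan : ∀ q, AnalyticAt ℂ low q := by
      intro q
      have e1 : AnalyticAt ℂ (fun q : ℂ × (W × (Fin (n + 1) → ℂ)) => q.1) q := analyticAt_fst
      refine AnalyticAt.prod (AnalyticAt.prod ?_ e1) (AnalyticAt.pi fun k => ?_)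
      · exact ((ContinuousLinearMap.fst ℂ W (Fin (n + 1) → ℂ)).comp
          (ContinuousLinearMap.snd ℂ ℂ (W × (Fin (n + 1) → ℂ)))).analyticAt _
      · refine AnalyticAt.sub ?_ (e1.pow _)
        exact ((ContinuousLinearMap.proj (R := ℂ) (φ := fun _ : Fin (n + 1) => ℂ) k.castSucc).comp
          ((ContinuousLinearMap.snd ℂ W (Fin (n + 1) → ℂ)).comp
          (ContinuousLinearMap.snd ℂ ℂ (W × (Fin (n + 1) → ℂ))))).analyticAt _
    obtain ⟨F, hF, hevF⟩ := exists_analytic_trace (H := F₁ ∘ low) (a₀ := a 0) (w₀ := w₀) (a := a)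
      (AnalyticAt.comp_of_eq hF₁ (hlowan _) (hlow _ _))
    -- the function is the same function of each of the roots near `a 0`
    have hev₂ : ∀ᶠ q in 𝓝 (w₀, a), f q.1 q.2 = F₁ (low (q.2 0, (q.1, psum q.2))) := by
      have hc : Filter.Tendsto (fun q : W × (Fin (n + 1) → ℂ) => ((q.1, q.2 0), Fin.tail q.2))
          (𝓝 (w₀, a)) (𝓝 ((w₀, a 0), Fin.tail a)) := by
        have : Continuous fun q : W × (Fin (n + 1) → ℂ) => ((q.1, q.2 0), Fin.tail q.2) := by
          unfold Fin.tail
          fun_prop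
        exact this.tendsto (w₀, a)
      filter_upwards [hc.eventually hev₁] with q hq
      simp only [f₁, Fin.cons_self_tail] at hq
      rw [hq, hlow]
    have hev₃ : ∀ᶠ q in 𝓝 (w₀, a), ∀ i, a i = a 0 →
        f q.1 q.2 = F₁ (low (q.2 i, (q.1, psum q.2))) := by
      rw [Filter.eventually_all]
      intro i
      by_cases hi : a i = a 0
      · have hsw : a ∘ Equiv.swap 0 i = a := by
          funext j
          simp only [Function.comp]
          rcases eq_or_ne j 0 with rfl | h0
          · rw [Equiv.swap_apply_left, hi]
          · rcases eq_or_ne j i with rfl | h1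
            · rw [Equiv.swap_apply_right, hi]
            · rw [Equiv.swap_apply_of_ne_of_ne h0 h1]
        have hc : Filter.Tendsto (fun q : W × (Fin (n + 1) → ℂ) =>
            ((q.1, q.2 ∘ Equiv.swap 0 i) : W × (Fin (n + 1) → ℂ))) (𝓝 (w₀, a)) (𝓝 (w₀, a)) := by
          have : Continuous fun q : W × (Fin (n + 1) → ℂ) =>
              ((q.1, q.2 ∘ Equiv.swap 0 i) : W × (Fin (n + 1) → ℂ)) := by
            refine continuous_fst.prodMk (continuous_pi fun j => ?_)
            exact (continuous_apply _).comp continuous_snd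
          have := this.tendsto (w₀, a)
          simpa only [hsw] using this
        filter_upwards [hc.eventually hev₂] with q hq _
        simp only [psum_perm, hsym, Function.comp, Equiv.swap_apply_left] at hq
        exact hq
      · exact Filter.Eventually.of_forall fun _ h => absurd h hi
    set m : ℕ := (Finset.univ.filter fun i => a i = a 0).card with hm
    have hm0 : (m : ℂ) ≠ 0 := by
      have : 0 < m := Finset.card_pos.2 ⟨0, by simp⟩
      exact_mod_cast this.ne'
    refine ⟨fun q => (m : ℂ)⁻¹ * F q, analyticAt_const.mul hF, ?_⟩
    filter_upwards [hevF, hev₃] with q h1 h2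
    rw [h1]
    have : ∑ i with a i = a 0, (F₁ ∘ low) (q.2 i, (q.1, psum q.2)) =
        ∑ i with a i = a 0, f q.1 q.2 :=
      Finset.sum_congr rfl fun i hi => (h2 i (Finset.mem_filter.1 hi).2).symm
    rw [this, Finset.sum_const, nsmul_eq_mul, ← mul_assoc, ← hm, inv_mul_cancel₀ hm0, one_mul]

/-- A symmetric analytic function is locally an analytic function of the power sums. -/
theorem exists_analytic_of_symmetric {n : ℕ} {f : (Fin n → ℂ) → ℂ} {a : Fin n → ℂ}
    (hsym : ∀ z (σ : Equiv.Perm (Fin n)), f (z ∘ σ) = f z) (hf : AnalyticAt ℂ f a) :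
    ∃ F : (Fin n → ℂ) → ℂ, AnalyticAt ℂ F (psum a) ∧ ∀ᶠ z in 𝓝 a, f z = F (psum z) := by
  obtain ⟨F, hF, hev⟩ := exists_analytic_of_symmetric_aux n (fun (_ : ℂ) => f) 0 a
    (fun _ => hsym) (AnalyticAt.comp (f := fun q : ℂ × (Fin n → ℂ) => q.2) (g := f) hf analyticAt_snd)
  refine ⟨fun p => F (0, p), hF.comp_of_eq (analyticAt_const.prod analyticAt_id) rfl, ?_⟩
  have hc : Filter.Tendsto (fun z : Fin n → ℂ => ((0 : ℂ), z)) (𝓝 a) (𝓝 (0, a)) :=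
    (Continuous.prodMk_right (0 : ℂ)).tendsto a
  exact hc.eventually hev

/-- An analytic function of the power sums that vanishes on all tuples near `a` vanishes. -/
theorem eventually_eq_zero_of_comp_psum {n : ℕ} {F : (Fin n → ℂ) → ℂ} {a : Fin n → ℂ}
    (hF : AnalyticAt ℂ F (psum a)) (h0 : ∀ᶠ z in 𝓝 a, F (psum z) = 0) :
    ∀ᶠ p in 𝓝 (psum a), F p = 0 := by
  obtain ⟨ρ, hρ, hball⟩ := Metric.eventually_nhds_iff_ball.1 hF.eventually_analyticAt
  have hcont : ContinuousAt (psum (n := n)) a := (analyticAt_psum a).continuousAt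
  have h1 : ∀ᶠ z in 𝓝 a, (∀ᶠ z' in 𝓝 z, F (psum z') = 0) ∧ psum z ∈ Metric.ball (psum a) ρ :=
    h0.eventually_nhds.and (hcont (Metric.ball_mem_nhds _ hρ))
  -- a nearby tuple with distinct entries
  obtain ⟨b, hbinj, hb0, hbρ⟩ : ∃ b : Fin n → ℂ, Function.Injective b ∧
      (∀ᶠ z' in 𝓝 b, F (psum z') = 0) ∧ psum b ∈ Metric.ball (psum a) ρ := by
    have hl : Filter.Tendsto (fun ε : ℂ => fun i : Fin n => a i + ε * (i.val : ℂ)) (𝓝[≠] 0)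
        (𝓝 a) := by
      have : Continuous fun ε : ℂ => fun i : Fin n => a i + ε * (i.val : ℂ) := by fun_prop
      have := this.tendsto 0
      simp only [zero_mul, add_zero] at this
      exact this.mono_left nhdsWithin_le_nhds
    have h2 : ∀ᶠ ε : ℂ in 𝓝[≠] 0, ∀ i j : Fin n, i ≠ j →
        a i + ε * (i.val : ℂ) ≠ a j + ε * (j.val : ℂ) := by
      rw [Filter.eventually_all]; intro i
      rw [Filter.eventually_all]; intro j
      by_cases hij : i = j
      · exact Filter.Eventually.of_forall fun _ h => absurd hij h
      have hne : ((i.val : ℂ) - j.val) ≠ 0 := by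
        rw [sub_ne_zero]; exact_mod_cast fun h => hij (Fin.ext h)
      by_cases ha : a i = a j
      · filter_upwards [self_mem_nhdsWithin] with ε hε _ h
        rw [ha, add_right_inj] at h
        have := mul_left_cancel₀ hε h
        exact hne (sub_eq_zero.2 this)
      · have hc : Continuous fun ε : ℂ => (a i + ε * (i.val : ℂ)) - (a j + ε * (j.val : ℂ)) := by
          fun_prop
        have := hc.tendsto 0
        simp only [zero_mul, add_zero] at this
        have h3 := (this.eventually_ne (sub_ne_zero.2 ha)).filter_mono
          (nhdsWithin_le_nhds (s := {0}ᶜ))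
        filter_upwards [h3] with ε hε _ h
        exact hε (sub_eq_zero.2 h)
    obtain ⟨ε, hε1, hε2⟩ := ((hl.eventually h1).and h2).exists
    refine ⟨_, fun i j hij => ?_, hε1.1, hε1.2⟩
    by_contra hne
    exact hε2 i j hne hij
  -- the power sums are local coordinates there
  let J : (Fin n → ℂ) →L[ℂ] (Fin n → ℂ) := ContinuousLinearMap.pi fun k =>
    ∑ i, (((k.val + 1 : ℕ) : ℂ) * b i ^ k.val) • ContinuousLinearMap.proj (R := ℂ) (φ := fun _ : Fin n => ℂ) i
  have hJ : HasFDerivAt psum J b := by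
    rw [hasFDerivAt_pi']
    intro k
    have : HasFDerivAt (fun z : Fin n → ℂ => ∑ i, z i ^ (k.val + 1))
        (∑ i, (((k.val + 1 : ℕ) : ℂ) * b i ^ k.val) •
          ContinuousLinearMap.proj (R := ℂ) (φ := fun _ : Fin n => ℂ) i) b := by
      refine HasFDerivAt.fun_sum fun i _ => ?_
      have := ((ContinuousLinearMap.proj (R := ℂ) (φ := fun _ : Fin n => ℂ) i).hasFDerivAt
        (x := b)).pow (k.val + 1)
      simpa [smul_eq_mul] using this
    have e : (ContinuousLinearMap.proj (R := ℂ) (φ := fun _ : Fin n => ℂ) k).comp J =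
        ∑ i, (((k.val + 1 : ℕ) : ℂ) * b i ^ k.val) •
          ContinuousLinearMap.proj (R := ℂ) (φ := fun _ : Fin n => ℂ) i := by
      ext v; simp [J]
    rw [e]
    exact this
  have hJs : HasStrictFDerivAt psum J b := by
    have := (analyticAt_psum b).hasStrictFDerivAt
    rwa [hJ.fderiv] at this
  -- A kernel vector is annihilated by all the power vectors (bᵢ^k), k < n, so it vanishes by the
  -- Vandermonde determinant of the distinct entries.
  have hJinj : Function.Injective J := by
    rw [injective_iff_map_eq_zero]
    intro v hv
    refine Matrix.eq_zero_of_forall_pow_sum_mul_pow_eq_zero hbinj fun k => ?_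
    have := congrFun hv k
    simp only [J, ContinuousLinearMap.coe_pi', FunLike.coe_sum, Finset.sum_apply,
      smul_apply, ContinuousLinearMap.proj_apply, smul_eq_mul, Pi.zero_apply,
      mul_assoc, ← Finset.mul_sum] at this
    have hk : ((k.val + 1 : ℕ) : ℂ) ≠ 0 := Nat.cast_ne_zero.2 (Nat.succ_ne_zero k.val)
    rw [← (mul_eq_zero.1 this).resolve_left hk]
    exact Finset.sum_congr rfl fun i _ => mul_comm _ _
  have hJsurj : Function.Surjective J := LinearMap.injective_iff_surjective.1 hJinj
  have hmap := hJs.map_nhds_eq_of_surj (LinearMap.range_eq_top.2 hJsurj)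
  have hz : ∀ᶠ p in 𝓝 (psum b), F p = 0 := by
    rw [← hmap]; exact hb0
  have := AnalyticOnNhd.eqOn_zero_of_preconnected_of_eventuallyEq_zero
    (f := F) (U := Metric.ball (psum a) ρ) (fun p hp => hball p hp)
    (convex_ball _ _).isPreconnected hbρ hz
  filter_upwards [Metric.ball_mem_nhds _ hρ] with p hp using this hp

end SymmetricAnalytic

end

end HFK

namespace HFK

noncomputable section

/-! ### Symmetric products as quotient spaces -/

section SymTopology

universe u v

variable {X : Type u} {n : ℕ}

theorem symMk_comp_perm (x : Fin n → X) (σ : Equiv.Perm (Fin n)) : symMk (x ∘ σ) = symMk x := by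
  apply Subtype.ext
  change Multiset.map (x ∘ σ) Finset.univ.val = Multiset.map x Finset.univ.val
  rw [← Multiset.map_map]
  congr 1
  have := Finset.map_univ_equiv σ
  exact congrArg Finset.val this

/-- If the multisets agree, the fibres of the two tuples over each point have the same size, and
bijections of fibres assemble into a permutation. -/
theorem symMk_eq_iff {x y : Fin n → X} :
    symMk x = symMk y ↔ ∃ σ : Equiv.Perm (Fin n), y = x ∘ σ := by
  classical
  refine ⟨fun h => ?_, ?_⟩
  · have hc : ∀ a, Nonempty ({i // y i = a} ≃ {i // x i = a}) := by
      intro a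
      refine ⟨Fintype.equivOfCardEq ?_⟩
      have h1 := congrArg (fun D : Sym X n => Multiset.count a D.1) h
      change Multiset.count a (Multiset.map x Finset.univ.val) =
        Multiset.count a (Multiset.map y Finset.univ.val) at h1
      rw [Multiset.count_map, Multiset.count_map] at h1
      rw [Fintype.card_subtype, Fintype.card_subtype]
      simp only [eq_comm (a := a)] at h1
      exact h1.symm
    refine ⟨(Equiv.sigmaFiberEquiv y).symm.trans
      ((Equiv.sigmaCongrRight fun a => (hc a).some).trans (Equiv.sigmaFiberEquiv x)), ?_⟩
    funext i
    simp only [Function.comp, Equiv.trans_apply]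
    exact (((hc (y i)).some ⟨i, rfl⟩).2).symm
  · rintro ⟨σ, rfl⟩
    exact (symMk_comp_perm x σ).symm

theorem symMk_surjective : Function.Surjective (symMk : (Fin n → X) → Sym X n) := by
  rintro ⟨s, hs⟩
  obtain ⟨l, rfl⟩ := Quot.exists_rep s
  have hl : l.length = n := hs
  subst hl
  refine ⟨l.get, Subtype.ext ?_⟩
  change Multiset.map l.get (Finset.univ : Finset (Fin l.length)).val = (l : Multiset X)
  rw [Fin.univ_val_map, List.ofFn_get]

theorem mem_symMk {x : Fin n → X} {a : X} : a ∈ symMk x ↔ ∃ i, x i = a := by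
  change a ∈ Multiset.map x Finset.univ.val ↔ _
  simp

variable [TopologicalSpace X]

theorem continuous_symMk : Continuous (symMk : (Fin n → X) → Sym X n) := continuous_coinduced_rng

/-- The saturation of an open set is the union of its permuted copies. -/
theorem isOpenQuotientMap_symMk : IsOpenQuotientMap (symMk : (Fin n → X) → Sym X n) := by
  refine ⟨symMk_surjective, continuous_symMk, fun U hU => ?_⟩
  rw [isOpen_coinduced]
  have : symMk ⁻¹' (symMk '' U) = ⋃ σ : Equiv.Perm (Fin n), (fun x : Fin n → X => x ∘ σ) ⁻¹' U := by
    ext x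
    simp only [mem_preimage, mem_image, mem_iUnion]
    constructor
    · rintro ⟨y, hy, h⟩
      obtain ⟨σ, rfl⟩ := symMk_eq_iff.1 h.symm
      exact ⟨σ, hy⟩
    · rintro ⟨σ, h⟩
      exact ⟨_, h, symMk_comp_perm x σ⟩
  rw [this]
  refine isOpen_iUnion fun σ => hU.preimage ?_
  exact continuous_pi fun i => continuous_apply _

theorem map_symMk_nhds (x : Fin n → X) : Filter.map symMk (𝓝 x) = 𝓝 (symMk x) :=
  isOpenQuotientMap_symMk.map_nhds_eq x

instance [T2Space X] : T2Space (Sym X n) := by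
  rw [t2Space_iff_of_isOpenQuotientMap (isOpenQuotientMap_symMk (X := X) (n := n))]
  have : {q : (Fin n → X) × (Fin n → X) | symMk q.1 = symMk q.2} =
      ⋃ σ : Equiv.Perm (Fin n), {q | q.2 = q.1 ∘ σ} := by
    ext q
    simp [symMk_eq_iff]
  rw [this]
  refine isClosed_iUnion_of_finite fun σ => isClosed_eq continuous_snd ?_
  exact continuous_pi fun i => (continuous_apply _).comp continuous_fst

instance [SecondCountableTopology X] : SecondCountableTopology (Sym X n) :=
  isOpenQuotientMap_symMk.isQuotientMap.secondCountableTopology isOpenQuotientMap_symMk.isOpenMap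

instance [CompactSpace X] : CompactSpace (Sym X n) :=
  isOpenQuotientMap_symMk.surjective.compactSpace continuous_symMk

theorem isOpen_forall_mem {U : Set X} (hU : IsOpen U) : IsOpen {D : Sym X n | ∀ x ∈ D, x ∈ U} := by
  rw [isOpen_coinduced]
  have : symMk ⁻¹' {D : Sym X n | ∀ x ∈ D, x ∈ U} = ⋂ i, (fun x : Fin n → X => x i) ⁻¹' U := by
    ext x
    simp [mem_symMk]
  rw [this]
  exact isOpen_iInter_of_finite fun i => hU.preimage (continuous_apply i)

theorem eventually_forall_mem {p : X → Prop} {D : Sym X n} (h : ∀ x ∈ D, ∀ᶠ y in 𝓝 x, p y) :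
    ∀ᶠ D' in 𝓝 D, ∀ x ∈ D', p x := by
  have h1 : {D' : Sym X n | ∀ x ∈ D', x ∈ interior {y | p y}} ∈ 𝓝 D :=
    (isOpen_forall_mem isOpen_interior).mem_nhds fun x hx => mem_interior_iff_mem_nhds.2 (h x hx)
  filter_upwards [h1] with D' hD' x hx using interior_subset (hD' x hx)

theorem isOpen_puncturedSym [T1Space X] (p q : X) : IsOpen (puncturedSym X n p q) := by
  have : puncturedSym X n p q = {D : Sym X n | ∀ x ∈ D, x ∈ ({p, q}ᶜ : Set X)} := by
    ext D
    constructor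
    · rintro ⟨h1, h2⟩ x hx (rfl | rfl)
      · exact h1 hx
      · exact h2 hx
    · intro h
      exact ⟨fun hp => h p hp (Or.inl rfl), fun hq => h q hq (Or.inr rfl)⟩
  rw [this]
  exact isOpen_forall_mem (Set.Finite.isClosed (by simp)).isOpen_compl

/-- The sum of the values of a function over the entries of an unordered tuple. -/
def trace (h : X → ℂ) (D : Sym X n) : ℂ := (D.1.map h).sum

omit [TopologicalSpace X] in
theorem trace_symMk (h : X → ℂ) (x : Fin n → X) : trace h (symMk x) = ∑ i, h (x i) := by
  simp only [trace, symMk, Multiset.map_map]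
  rfl

omit [TopologicalSpace X] in
theorem trace_congr {h k : X → ℂ} {D : Sym X n} (hk : ∀ x ∈ D, h x = k x) :
    trace h D = trace k D := by
  simp only [trace]
  rw [Multiset.map_congr rfl hk]

end SymTopology

/-! ### Power sums of a coordinate as coordinates on the symmetric product -/

section HolCharts

universe u v

variable {X : Type u} [TopologicalSpace X] [ChartedSpace ℂ X]

/-- A holomorphic coordinate on an open subset of a Riemann surface. -/
structure IsHolChart (e : OpenPartialHomeomorph X ℂ) : Prop where
  contMDiffAt : ∀ x ∈ e.source, ContMDiffAt 𝓘(ℂ) 𝓘(ℂ) ω e x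
  contMDiffAt_symm : ∀ z ∈ e.target, ContMDiffAt 𝓘(ℂ) 𝓘(ℂ) ω e.symm z

theorem isHolChart_chartAt [IsManifold 𝓘(ℂ) ω X] (x : X) : IsHolChart (chartAt ℂ x) :=
  ⟨fun _ hy => contMDiffAt_of_mem_maximalAtlas (IsManifold.chart_mem_maximalAtlas x) hy,
    fun _ hy => contMDiffAt_symm_of_mem_maximalAtlas (IsManifold.chart_mem_maximalAtlas x) hy⟩

theorem IsHolChart.restrOpen {e : OpenPartialHomeomorph X ℂ} (he : IsHolChart e) {s : Set X}
    (hs : IsOpen s) : IsHolChart (e.restrOpen s hs) := by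
  refine ⟨fun x hx => he.contMDiffAt x ?_, fun z hz => he.contMDiffAt_symm z ?_⟩
  · rw [e.restrOpen_source] at hx; exact hx.1
  · have := (e.restrOpen s hs).map_target hz
    have h2 : z = e (e.symm z) := ((e.restrOpen s hs).right_inv hz).symm
    rw [h2]
    refine e.map_source ?_
    rw [e.restrOpen_source] at this
    exact this.1

theorem IsHolChart.translate {e : OpenPartialHomeomorph X ℂ} (he : IsHolChart e) (c : ℂ) :
    IsHolChart (e.transHomeomorph (Homeomorph.addRight c)) := by
  refine ⟨fun x hx => ?_, fun z hz => ?_⟩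
  · have h1 : ContMDiffAt 𝓘(ℂ) 𝓘(ℂ) ω (fun z : ℂ => z + c) (e x) :=
      contMDiffAt_iff_contDiffAt.2 (by fun_prop)
    exact h1.comp x (he.contMDiffAt x hx)
  · have h1 : ContMDiffAt 𝓘(ℂ) 𝓘(ℂ) ω (fun z : ℂ => z + -c) z :=
      contMDiffAt_iff_contDiffAt.2 (by fun_prop)
    exact (he.contMDiffAt_symm _ hz).comp z h1

open scoped Classical in
theorem IsHolChart.disjointUnion {e e' : OpenPartialHomeomorph X ℂ} (he : IsHolChart e)
    (he' : IsHolChart e') (hs : Disjoint e.source e'.source) (ht : Disjoint e.target e'.target) :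
    IsHolChart (e.disjointUnion e' hs ht) := by
  refine ⟨fun x hx => ?_, fun z hz => ?_⟩
  · rcases hx with hx | hx
    · refine (he.contMDiffAt x hx).congr_of_eventuallyEq ?_
      filter_upwards [e.open_source.mem_nhds hx] with y hy
      exact Set.piecewise_eq_of_mem _ _ _ hy
    · refine (he'.contMDiffAt x hx).congr_of_eventuallyEq ?_
      filter_upwards [e'.open_source.mem_nhds hx] with y hy
      exact Set.piecewise_eq_of_notMem _ _ _ (disjoint_right.1 hs hy)
  · rcases hz with hz | hz
    · refine (he.contMDiffAt_symm z hz).congr_of_eventuallyEq ?_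
      filter_upwards [e.open_target.mem_nhds hz] with y hy
      exact Set.piecewise_eq_of_mem _ _ _ hy
    · refine (he'.contMDiffAt_symm z hz).congr_of_eventuallyEq ?_
      filter_upwards [e'.open_target.mem_nhds hz] with y hy
      exact Set.piecewise_eq_of_notMem _ _ _ (disjoint_right.1 ht hy)

/-- The target can be put into a unit ball about any prescribed point. Charts around different
points can thus be given disjoint targets and be united into one coordinate with a disconnected
domain. -/
theorem exists_small_chart [IsManifold 𝓘(ℂ) ω X] (x : X) {V : Set X} (hV : IsOpen V) (hx : x ∈ V)
    (c : ℂ) : ∃ e : OpenPartialHomeomorph X ℂ, IsHolChart e ∧ x ∈ e.source ∧ e.source ⊆ V ∧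
      e.target ⊆ Metric.ball c 1 := by
  let e₀ := chartAt ℂ x
  have h0 : x ∈ e₀.source := mem_chart_source ℂ x
  have hO : IsOpen (e₀.source ∩ e₀ ⁻¹' Metric.ball (e₀ x) 1) :=
    e₀.isOpen_inter_preimage Metric.isOpen_ball
  let e₁ := e₀.restrOpen _ (hO.inter hV)
  have h1 : IsHolChart e₁ := (isHolChart_chartAt x).restrOpen _
  refine ⟨e₁.transHomeomorph (Homeomorph.addRight (c - e₀ x)), h1.translate _, ?_, ?_, ?_⟩
  · change x ∈ e₁.source
    rw [e₀.restrOpen_source]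
    exact ⟨h0, ⟨h0, Metric.mem_ball_self one_pos⟩, hx⟩
  · change e₁.source ⊆ V
    rw [e₀.restrOpen_source]
    exact fun y hy => hy.2.2
  · intro z hz
    have h2 : z - (c - e₀ x) ∈ e₁.target := by
      have h6 : z - (c - e₀ x) = (Homeomorph.addRight (c - e₀ x)).symm z := sub_eq_add_neg _ _
      rw [h6]
      exact hz
    have h3 := e₁.map_target h2
    rw [e₀.restrOpen_source] at h3
    have h4 : e₀ (e₁.symm (z - (c - e₀ x))) = z - (c - e₀ x) := e₁.right_inv h2
    have h5 := h3.2.1.2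
    simp only [mem_preimage, h4, mem_ball_iff_norm] at h5 ⊢
    convert h5 using 2
    ring

/-- Any finite set of points of a Riemann surface is contained in the domain of a coordinate. -/
theorem exists_isHolChart [IsManifold 𝓘(ℂ) ω X] [T2Space X] [Nonempty X] (A : Finset X) :
    ∃ e : OpenPartialHomeomorph X ℂ, IsHolChart e ∧ ↑A ⊆ e.source := by
  classical
  suffices ∃ e : OpenPartialHomeomorph X ℂ, IsHolChart e ∧ ↑A ⊆ e.source ∧
      ∃ R : ℝ, e.target ⊆ Metric.ball 0 R by
    obtain ⟨e, h1, h2, _⟩ := this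
    exact ⟨e, h1, h2⟩
  induction A using Finset.induction_on with
  | empty =>
    obtain ⟨e, h1, _, _, h4⟩ :=
      exists_small_chart (Classical.arbitrary X) isOpen_univ (mem_univ _) 0
    exact ⟨e, h1, by simp, 1, h4⟩
  | insert x A hxA ih =>
    obtain ⟨e, h1, h2, R, h3⟩ := ih
    obtain ⟨U, V, hU, hV, hAU, hxV, hUV⟩ : SeparatedNhds (A : Set X) ({x} : Set X) :=
      SeparatedNhds.of_isCompact_isCompact A.finite_toSet.isCompact isCompact_singleton
        (by simpa using hxA)
    -- The unit ball about |R| + 1 does not meet the ball of radius R about 0, and both lie in the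
    -- ball of radius |R| + 2.
    obtain ⟨e', h1', h2', h3', h4'⟩ := exists_small_chart x hV (hxV rfl) ((|R| + 1 : ℝ) : ℂ)
    have hsub : (e.restrOpen U hU).target ⊆ Metric.ball 0 R := by
      refine Subset.trans ?_ h3
      intro z hz
      have h5 : z = e (e.symm z) := ((e.restrOpen U hU).right_inv hz).symm
      rw [h5]
      refine e.map_source ?_
      have := (e.restrOpen U hU).map_target hz
      rw [e.restrOpen_source] at this
      exact this.1
    have hs : Disjoint (e.restrOpen U hU).source e'.source := by
      rw [e.restrOpen_source]
      exact hUV.mono inter_subset_right h3'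
    have ht : Disjoint (e.restrOpen U hU).target e'.target := by
      refine Disjoint.mono hsub h4' (Metric.ball_disjoint_ball ?_)
      rw [dist_comm, dist_zero_right, Complex.norm_real, Real.norm_eq_abs,
        abs_of_pos (by positivity)]
      linarith [le_abs_self R]
    refine ⟨(e.restrOpen U hU).disjointUnion e' hs ht, (h1.restrOpen hU).disjointUnion h1' hs ht,
      ?_, |R| + 2, ?_⟩
    · intro y hy
      simp only [Finset.coe_insert, Set.mem_insert_iff] at hy
      rcases hy with rfl | hy
      · exact Or.inr h2'
      · refine Or.inl ?_
        rw [e.restrOpen_source]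
        exact ⟨h2 hy, hAU hy⟩
    · rintro z (hz | hz)
      · exact Metric.ball_subset_ball (by linarith [le_abs_self R]) (hsub hz)
      · refine Metric.ball_subset_ball' ?_ (h4' hz)
        rw [dist_zero_right, Complex.norm_real, Real.norm_eq_abs, abs_of_pos (by positivity)]
        linarith

theorem exists_isHolChart_sym [IsManifold 𝓘(ℂ) ω X] [T2Space X] [Nonempty X] {n : ℕ}
    (D : Sym X n) : ∃ e : OpenPartialHomeomorph X ℂ, IsHolChart e ∧ ∀ x ∈ D, x ∈ e.source := by
  classical
  obtain ⟨e, h1, h2⟩ := exists_isHolChart D.1.toFinset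
  exact ⟨e, h1, fun x hx => h2 (by simpa using hx)⟩

theorem analyticAt_comp_chart_symm {h : X → ℂ} {x : X} (hh : ContMDiffAt 𝓘(ℂ) 𝓘(ℂ) ω h x) :
    AnalyticAt ℂ (fun z => h ((chartAt ℂ x).symm z)) (chartAt ℂ x x) := by
  exact analyticAt_chart_of_contMDiffAt hh

theorem IsHolChart.analyticAt_comp_symm {e : OpenPartialHomeomorph X ℂ} (he : IsHolChart e)
    {h : X → ℂ} {x : X} (hx : x ∈ e.source) (hh : ContMDiffAt 𝓘(ℂ) 𝓘(ℂ) ω h x) :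
    AnalyticAt ℂ (fun z => h (e.symm z)) (e x) := by
  have h1 : ContMDiffAt 𝓘(ℂ) 𝓘(ℂ) ω (fun z => h (e.symm z)) (e x) :=
    ContMDiffAt.comp_of_eq hh (he.contMDiffAt_symm _ (e.map_source hx)) (e.left_inv hx)
  exact (contMDiffAt_iff_contDiffAt.1 h1).analyticAt

theorem IsHolChart.contMDiffAt_comp {e : OpenPartialHomeomorph X ℂ} (he : IsHolChart e)
    {h : ℂ → ℂ} {x : X} (hx : x ∈ e.source) (hh : AnalyticAt ℂ h (e x)) :
    ContMDiffAt 𝓘(ℂ) 𝓘(ℂ) ω (fun y => h (e y)) x :=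
  ContMDiffAt.comp x (contMDiffAt_iff_contDiffAt.2 hh.contDiffAt) (he.contMDiffAt x hx)

variable {n : ℕ}

theorem holAt_trace {h : X → ℂ} {D : Sym X n}
    (hh : ∀ x ∈ D, ContMDiffAt 𝓘(ℂ) 𝓘(ℂ) ω h x) : HolAt (trace h) D := by
  intro x hx
  have : localRep (trace h) x = fun z => ∑ i, h ((chartAt ℂ (x i)).symm (z i)) := by
    funext z
    simp [localRep, trace_symMk]
  rw [this]
  refine Finset.analyticAt_fun_sum _ fun i _ => ?_
  have h1 := analyticAt_comp_chart_symm (hh (x i) (hx ▸ mem_symMk.2 ⟨i, rfl⟩))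
  exact h1.comp_of_eq
    ((ContinuousLinearMap.proj (R := ℂ) (φ := fun _ : Fin n => ℂ) i).analyticAt _) rfl

/-- Holomorphy is defined with a separate chart for each entry. With a single coordinate for all
entries the pull-back becomes a symmetric function, as the theorem on power sums requires. -/
theorem HolAt.analyticAt_of_chart {e : OpenPartialHomeomorph X ℂ} (he : IsHolChart e)
    {f : Sym X n → ℂ} {x : Fin n → X} (hf : HolAt f (symMk x)) (hx : ∀ i, x i ∈ e.source) :
    AnalyticAt ℂ (fun z => f (symMk fun i => e.symm (z i))) (fun i => e (x i)) := by
  have h1 := hf x rfl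
  let T : (Fin n → ℂ) → (Fin n → ℂ) := fun z i => chartAt ℂ (x i) (e.symm (z i))
  have hT0 : T (fun i => e (x i)) = coord x := by
    funext i
    simp only [T, coord, e.left_inv (hx i)]
  have hT : AnalyticAt ℂ T (fun i => e (x i)) := by
    refine AnalyticAt.pi fun i => ?_
    have h2 := analyticAt_chart_of_contMDiffAt (he.contMDiffAt_symm _ (e.map_source (hx i)))
    simp only [chartAt_self_eq, OpenPartialHomeomorph.refl_apply, OpenPartialHomeomorph.refl_symm,
      e.left_inv (hx i)] at h2
    exact h2.comp_of_eq
      ((ContinuousLinearMap.proj (R := ℂ) (φ := fun _ : Fin n => ℂ) i).analyticAt _) rfl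
  refine (h1.comp_of_eq hT hT0).congr ?_
  have hs : ∀ᶠ z : Fin n → ℂ in 𝓝 (fun i => e (x i)), ∀ i,
      e.symm (z i) ∈ (chartAt ℂ (x i)).source := by
    rw [Filter.eventually_all]
    intro i
    have c : ContinuousAt (fun z : Fin n → ℂ => e.symm (z i)) (fun i => e (x i)) :=
      ContinuousAt.comp (f := fun z : Fin n → ℂ => z i)
        (e.continuousAt_symm (e.map_source (hx i))) (continuous_apply i).continuousAt
    refine c.eventually_mem ?_
    simp only [e.left_inv (hx i)]
    exact chart_source_mem_nhds ℂ (x i)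
  filter_upwards [hs] with z hz
  simp only [Function.comp, localRep, T]
  congr 2
  funext i
  exact (chartAt ℂ (x i)).left_inv (hz i)

/-- The power sums of a coordinate, as functions on the symmetric product. -/
def powerSums (e : X → ℂ) (D : Sym X n) : Fin n → ℂ :=
  fun k => trace (fun x => e x ^ (k.val + 1)) D

omit [ChartedSpace ℂ X] [TopologicalSpace X] in
theorem powerSums_symMk (e : X → ℂ) (x : Fin n → X) :
    powerSums e (symMk x) = psum fun i => e (x i) := by
  funext k
  simp [powerSums, trace_symMk, psum]

theorem IsHolChart.holAt_pow {e : OpenPartialHomeomorph X ℂ} (he : IsHolChart e) {D : Sym X n}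
    (hD : ∀ x ∈ D, x ∈ e.source) (k : ℕ) : HolAt (trace fun x => e x ^ k) D :=
  holAt_trace fun x hx => he.contMDiffAt_comp (h := fun z => z ^ k) (hD x hx)
    (analyticAt_id.pow k)

/-- Functions of the power sums of a coordinate are holomorphic. -/
theorem IsHolChart.holAt_comp_powerSums {e : OpenPartialHomeomorph X ℂ} (he : IsHolChart e)
    {D : Sym X n} (hD : ∀ x ∈ D, x ∈ e.source) {F : (Fin n → ℂ) → ℂ}
    (hF : AnalyticAt ℂ F (powerSums e D)) : HolAt (fun D' => F (powerSums e D')) D := by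
  intro x hx
  have h1 : AnalyticAt ℂ (fun z k => localRep (trace fun x => e x ^ ((k : Fin n).val + 1)) x z)
      (coord x) := AnalyticAt.pi fun k => he.holAt_pow hD (k.val + 1) x hx
  refine hF.comp_of_eq h1 ?_
  subst hx
  funext k
  simp only [powerSums, coord]
  congr 1
  congr 1
  funext i
  exact (chartAt ℂ (x i)).left_inv (mem_chart_source ℂ _)

/-- Functions holomorphic near `D` are analytic functions of the power sums of a coordinate. -/
theorem HolAt.exists_powerSums {e : OpenPartialHomeomorph X ℂ} (he : IsHolChart e)
    {D : Sym X n} (hD : ∀ x ∈ D, x ∈ e.source) {f : Sym X n → ℂ} (hf : HolAt f D) :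
    ∃ F : (Fin n → ℂ) → ℂ, AnalyticAt ℂ F (powerSums e D) ∧
      ∀ᶠ D' in 𝓝 D, f D' = F (powerSums e D') := by
  obtain ⟨x, rfl⟩ := symMk_surjective D
  have hx : ∀ i, x i ∈ e.source := fun i => hD _ (mem_symMk.2 ⟨i, rfl⟩)
  obtain ⟨F, hF, hev⟩ := exists_analytic_of_symmetric
    (f := fun z => f (symMk fun i => e.symm (z i)))
    (fun z σ => congrArg f (symMk_comp_perm (fun i => e.symm (z i)) σ))
    (hf.analyticAt_of_chart he hx)
  refine ⟨F, by rwa [powerSums_symMk], ?_⟩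
  rw [← map_symMk_nhds, Filter.eventually_map]
  have hc : Filter.Tendsto (fun y : Fin n → X => fun i => e (y i)) (𝓝 x)
      (𝓝 fun i => e (x i)) := by
    have : ContinuousAt (fun y : Fin n → X => fun i => e (y i)) x :=
      continuousAt_pi.2 fun i => ContinuousAt.comp (f := fun y : Fin n → X => y i)
        (e.continuousAt (hx i)) (continuous_apply i).continuousAt
    exact this
  have hs : ∀ᶠ y : Fin n → X in 𝓝 x, ∀ i, y i ∈ e.source := by
    rw [Filter.eventually_all]
    exact fun i => (continuous_apply i).continuousAt.eventually_mem (e.open_source.mem_nhds (hx i))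
  filter_upwards [hc.eventually hev, hs] with y h1 h2
  rw [powerSums_symMk, ← h1]
  congr 2
  funext i
  exact (e.left_inv (h2 i)).symm

omit [ChartedSpace ℂ X] in
theorem continuousAt_powerSums {e : OpenPartialHomeomorph X ℂ}
    {D : Sym X n} (hD : ∀ x ∈ D, x ∈ e.source) : ContinuousAt (powerSums e) D := by
  obtain ⟨x, rfl⟩ := symMk_surjective D
  rw [← isOpenQuotientMap_symMk.continuousAt_comp_iff]
  have : (powerSums e ∘ symMk : (Fin n → X) → _) = fun y => psum fun i => e (y i) := by
    funext y; exact powerSums_symMk _ _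
  rw [this]
  refine ContinuousAt.comp (g := psum) (f := fun y : Fin n → X => fun i => e (y i))
    (analyticAt_psum _).continuousAt (continuousAt_pi.2 fun i => ?_)
  exact ContinuousAt.comp (f := fun y : Fin n → X => y i)
    (e.continuousAt (hD _ (mem_symMk.2 ⟨i, rfl⟩))) (continuous_apply i).continuousAt

omit [ChartedSpace ℂ X] in
/-- A function on the symmetric product determines the germ of the function of the power sums. -/
theorem eventuallyEq_of_powerSums {e : OpenPartialHomeomorph X ℂ}
    {D : Sym X n} (hD : ∀ x ∈ D, x ∈ e.source) {F G : (Fin n → ℂ) → ℂ}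
    (hF : AnalyticAt ℂ F (powerSums e D)) (hG : AnalyticAt ℂ G (powerSums e D))
    (h : ∀ᶠ D' in 𝓝 D, F (powerSums e D') = G (powerSums e D')) :
    F =ᶠ[𝓝 (powerSums e D)] G := by
  obtain ⟨x, rfl⟩ := symMk_surjective D
  have hx : ∀ i, x i ∈ e.source := fun i => hD _ (mem_symMk.2 ⟨i, rfl⟩)
  rw [powerSums_symMk] at *
  have h0 := eventually_eq_zero_of_comp_psum (hF.sub hG) ?_
  · filter_upwards [h0] with p hp
    exact sub_eq_zero.1 hp
  · rw [← map_symMk_nhds, Filter.eventually_map] at h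
    have hc : Filter.Tendsto (fun z : Fin n → ℂ => fun i => e.symm (z i)) (𝓝 fun i => e (x i))
        (𝓝 x) := by
      have : ContinuousAt (fun z : Fin n → ℂ => fun i => e.symm (z i)) fun i => e (x i) :=
        continuousAt_pi.2 fun i => ContinuousAt.comp (f := fun z : Fin n → ℂ => z i)
          (e.continuousAt_symm (e.map_source (hx i))) (continuous_apply i).continuousAt
      have h2 := this.tendsto
      simpa only [e.left_inv (hx _)] using h2
    have ht : ∀ᶠ z : Fin n → ℂ in 𝓝 fun i => e (x i), ∀ i, z i ∈ e.target := by
      rw [Filter.eventually_all]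
      exact fun i => (continuous_apply i).continuousAt.eventually_mem
        (e.open_target.mem_nhds (e.map_source (hx i)))
    filter_upwards [hc.eventually h, ht] with z hz hzt
    rw [powerSums_symMk] at hz
    simp only [e.right_inv (hzt _)] at hz
    exact sub_eq_zero.2 hz

end HolCharts

end

end HFK

namespace HFK

noncomputable section

/-! ### Tangent spaces and the tangent bundle in terms of power sums -/

section Tangent

universe u v

variable {X : Type u} [TopologicalSpace X] [ChartedSpace ℂ X] {n : ℕ}

theorem HolAt.congr {f g : Sym X n → ℂ} {D : Sym X n} (hf : HolAt f D) (h : f =ᶠ[𝓝 D] g) :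
    HolAt g D := by
  intro x hx
  refine (hf x hx).congr ?_
  have hc : Filter.Tendsto (fun z : Fin n → ℂ => symMk fun i => (chartAt ℂ (x i)).symm (z i))
      (𝓝 (coord x)) (𝓝 D) := by
    have : ContinuousAt (fun z : Fin n → ℂ => fun i => (chartAt ℂ (x i)).symm (z i)) (coord x) :=
      continuousAt_pi.2 fun i => ContinuousAt.comp (f := fun z : Fin n → ℂ => z i)
        ((chartAt ℂ (x i)).continuousAt_symm (mem_chart_target ℂ (x i)))
        (continuous_apply i).continuousAt
    have h2 := (continuous_symMk.continuousAt (x := fun i => (chartAt ℂ (x i)).symm (coord x i))).tendsto.comp this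
    have h3 : (fun i => (chartAt ℂ (x i)).symm (coord x i)) = x := by
      funext i
      exact (chartAt ℂ (x i)).left_inv (mem_chart_source ℂ _)
    rw [h3, hx] at h2
    exact h2
  exact hc.eventually h

theorem HolAt.const (c : ℂ) (D : Sym X n) : HolAt (fun _ => c) D := fun _ _ => analyticAt_const

theorem HolAt.mul {f g : Sym X n → ℂ} {D : Sym X n} (hf : HolAt f D) (hg : HolAt g D) :
    HolAt (f * g) D := fun x hx => (hf x hx).mul (hg x hx)

theorem HolAt.add {f g : Sym X n → ℂ} {D : Sym X n} (hf : HolAt f D) (hg : HolAt g D) :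
    HolAt (f + g) D := fun x hx => (hf x hx).add (hg x hx)

theorem HolAt.smul {f : Sym X n → ℂ} {D : Sym X n} (c : ℂ) (hf : HolAt f D) :
    HolAt (c • f) D := fun x hx => analyticAt_const.mul (hf x hx)

open scoped Classical in
/-- The derivative of a function in the direction of a tangent vector (zero if the function is not
holomorphic). -/
def ev {D : Sym X n} (ξ : SymTangent D) (f : Sym X n → ℂ) : ℂ :=
  if hf : HolAt f D then ξ.1 ⟨f, hf⟩ else 0

variable {D : Sym X n} (ξ η : SymTangent D) {f g : Sym X n → ℂ}

theorem ev_eq (hf : HolAt f D) : ev ξ f = ξ.1 ⟨f, hf⟩ := dif_pos hf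

theorem ev_mul (hf : HolAt f D) (hg : HolAt g D) : ev ξ (f * g) = f D * ev ξ g + g D * ev ξ f := by
  rw [ev_eq ξ hf, ev_eq ξ hg, ev_eq ξ (hf.mul hg)]
  exact ξ.2 ⟨f, hf⟩ ⟨g, hg⟩

theorem ev_add (hf : HolAt f D) (hg : HolAt g D) : ev ξ (f + g) = ev ξ f + ev ξ g := by
  rw [ev_eq ξ hf, ev_eq ξ hg, ev_eq ξ (hf.add hg)]
  exact ξ.1.map_add ⟨f, hf⟩ ⟨g, hg⟩

theorem ev_smul (c : ℂ) (hf : HolAt f D) : ev ξ (c • f) = c * ev ξ f := by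
  rw [ev_eq ξ hf, ev_eq ξ (hf.smul c)]
  exact ξ.1.map_smul c ⟨f, hf⟩

theorem ev_const (c : ℂ) : ev ξ (fun _ => c) = 0 := by
  have h1 := ev_mul ξ (HolAt.const 1 D) (HolAt.const 1 D)
  have h2 : ((fun _ => 1 : Sym X n → ℂ) * fun _ => 1) = fun _ => 1 := by funext; simp
  rw [h2] at h1
  have h3 : ev ξ (fun _ => 1) = 0 := by linear_combination -h1
  have h4 := ev_smul ξ c (HolAt.const 1 D)
  have h5 : (c • (fun _ => 1 : Sym X n → ℂ)) = fun _ => c := by funext; simp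
  rw [h5, h3, mul_zero] at h4
  exact h4

-- Derivations act on globally defined functions, so their locality needs a proof. The difference k
-- of the two functions satisfies k = kχ, with χ the indicator function of the set where they
-- differ. Both factors vanish near `D`, so both terms of the product rule are zero.
open scoped Classical in
theorem ev_congr (h : f =ᶠ[𝓝 D] g) : ev ξ f = ev ξ g := by
  by_cases hf : HolAt f D
  · have hg := hf.congr h
    -- `f - g` is the product of itself and of the indicator function of its support
    set k : Sym X n → ℂ := f + (-1 : ℂ) • g with hk
    set χ : Sym X n → ℂ := fun D' => if f D' = g D' then 0 else 1 with hχ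
    have hkD : HolAt k D := hf.add (hg.smul _)
    have hχ0 : χ =ᶠ[𝓝 D] fun _ => 0 := by
      filter_upwards [h] with D' hD'
      simp [hχ, hD']
    have hχD : HolAt χ D := (HolAt.const 0 D).congr hχ0.symm
    have hmul : k * χ = k := by
      funext D'
      by_cases hD' : f D' = g D' <;> simp [hk, hχ, hD']
    have h1 := ev_mul ξ hkD hχD
    rw [hmul, hχ0.self_of_nhds] at h1
    have hk0 : k D = 0 := by simp [hk, h.self_of_nhds]
    rw [hk0, zero_mul, zero_mul, add_zero] at h1
    have h2 := ev_add ξ hf (hg.smul (-1))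
    rw [ev_smul ξ _ hg] at h2
    rw [← hk, h1] at h2
    linear_combination -h2
  · have hg : ¬ HolAt g D := fun hg => hf (hg.congr h.symm)
    rw [ev, ev, dif_neg hf, dif_neg hg]

theorem ev_add_left : ev (ξ + η) f = ev ξ f + ev η f := by
  by_cases hf : HolAt f D
  · simp [ev_eq _ hf]
  · simp [ev, hf]

theorem ev_smul_left (c : ℂ) : ev (c • ξ) f = c * ev ξ f := by
  by_cases hf : HolAt f D
  · simp [ev_eq _ hf]
  · simp [ev, hf]

theorem ev_zero_left : ev (0 : SymTangent D) f = 0 := by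
  by_cases hf : HolAt f D
  · simp [ev_eq _ hf]
  · simp [ev, hf]

theorem HolAt.sum {ι : Type*} {s : Finset ι} {F : ι → Sym X n → ℂ}
    (hF : ∀ i ∈ s, HolAt (F i) D) : HolAt (∑ i ∈ s, F i) D := by
  classical
  induction s using Finset.induction_on with
  | empty => exact HolAt.const 0 D
  | insert a s ha ih =>
    rw [Finset.sum_insert ha]
    exact (hF a (Finset.mem_insert_self _ _)).add
      (ih fun i hi => hF i (Finset.mem_insert_of_mem hi))

theorem ev_sum {ι : Type*} {s : Finset ι} {F : ι → Sym X n → ℂ}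
    (hF : ∀ i ∈ s, HolAt (F i) D) : ev ξ (∑ i ∈ s, F i) = ∑ i ∈ s, ev ξ (F i) := by
  classical
  induction s using Finset.induction_on with
  | empty => exact ev_const ξ 0
  | insert a s ha ih =>
    rw [Finset.sum_insert ha, Finset.sum_insert ha, ev_add ξ (hF a (Finset.mem_insert_self _ _))
      (HolAt.sum fun i hi => hF i (Finset.mem_insert_of_mem hi)),
      ih fun i hi => hF i (Finset.mem_insert_of_mem hi)]

variable {ξ η}
variable {e : OpenPartialHomeomorph X ℂ} (he : IsHolChart e) (hD : ∀ x ∈ D, x ∈ e.source)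

/-- The derivatives of the power sums of a coordinate. -/
def powerDeriv (e : X → ℂ) {D : Sym X n} (ξ : SymTangent D) : Fin n → ℂ :=
  fun k => ev ξ (trace fun x => e x ^ (k.val + 1))

include he hD in
/-- The chain rule. -/
theorem ev_comp_powerSums {F : (Fin n → ℂ) → ℂ} (hF : AnalyticAt ℂ F (powerSums e D)) :
    ev ξ (fun D' => F (powerSums e D')) = fderiv ℂ F (powerSums e D) (powerDeriv e ξ) := by
  obtain ⟨G, hG, hG0, hev⟩ := exists_analytic_hadamard hF
  set c := powerSums e D with hc
  let Gk : Fin n → Sym X n → ℂ := fun k D' => G (powerSums e D') (Pi.single k 1)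
  let pk : Fin n → Sym X n → ℂ := fun k D' => powerSums e D' k + -c k
  have hGk : ∀ k, HolAt (Gk k) D := fun k => by
    refine he.holAt_comp_powerSums hD (F := fun p => G p (Pi.single k 1)) ?_
    exact ((ContinuousLinearMap.apply ℂ ℂ (Pi.single k (1 : ℂ) : Fin n → ℂ)).analyticAt _).comp hG
  have hp : ∀ k : Fin n, HolAt (fun D' => powerSums e D' k) D := fun k => he.holAt_pow hD _
  have hpk : ∀ k, HolAt (pk k) D := fun k => (hp k).add (HolAt.const _ D)
  have hpk0 : ∀ k, pk k D = 0 := fun k => by simp [pk, hc]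
  have hpkev : ∀ k, ev ξ (pk k) = powerDeriv e ξ k := fun k => by
    have := ev_add ξ (hp k) (HolAt.const (-c k) D)
    rw [ev_const, add_zero] at this
    exact this
  -- By Hadamard's lemma F - F(c) is a sum of products (pₖ - cₖ)Gₖ. Since pₖ - cₖ vanishes at `D`,
  -- only its derivative survives in the product rule.
  have h1 : (fun D' => F (powerSums e D')) =ᶠ[𝓝 D]
      ((fun _ => F c) + ∑ k, pk k * Gk k : Sym X n → ℂ) := by
    filter_upwards [(continuousAt_powerSums hD).eventually hev] with D' hD'
    rw [hD']
    simp only [Pi.add_apply, Finset.sum_apply, Pi.mul_apply, add_right_inj, Gk, pk]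
    have h2 : powerSums e D' - c = ∑ k, (powerSums e D' k + -c k) • (Pi.single k (1 : ℂ)) := by
      funext j
      simp [Finset.sum_apply, Pi.single_apply, sub_eq_add_neg]
    conv_lhs => rw [h2]
    simp [map_sum]
  rw [ev_congr ξ h1, ev_add ξ (HolAt.const _ D) (HolAt.sum fun k _ => (hpk k).mul (hGk k)),
    ev_const, zero_add, ev_sum ξ fun k _ => (hpk k).mul (hGk k)]
  have h3 : powerDeriv e ξ = ∑ k, powerDeriv e ξ k • (Pi.single k (1 : ℂ)) := by
    funext j
    simp [Finset.sum_apply, Pi.single_apply]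
  conv_rhs => rw [h3, map_sum]
  refine Finset.sum_congr rfl fun k _ => ?_
  rw [ev_mul ξ (hpk k) (hGk k), hpk0, zero_mul, zero_add, hpkev, map_smul, smul_eq_mul, ← hG0,
    mul_comm]

include he hD in
theorem tangent_ext (h : powerDeriv e ξ = powerDeriv e η) : ξ = η := by
  apply Subtype.ext
  ext ⟨f, hf⟩
  obtain ⟨F, hF, hev⟩ := HolAt.exists_powerSums he hD hf
  rw [← ev_eq ξ hf, ← ev_eq η hf, ev_congr ξ hev, ev_congr η hev, ev_comp_powerSums he hD hF,
    ev_comp_powerSums he hD hF, h]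

include he hD in
theorem exists_tangent (v : Fin n → ℂ) : ∃ ξ : SymTangent D, powerDeriv e ξ = v := by
  choose F hF hev using fun f : holFun D => HolAt.exists_powerSums he hD f.2
  -- A function determines the germ of its expression through the power sums, so any such expression
  -- may be used to compute the derivative. Linearity and the product rule are inherited from
  -- `fderiv`.
  have huniq : ∀ (f : holFun D) (G : (Fin n → ℂ) → ℂ), AnalyticAt ℂ G (powerSums e D) →
      (∀ᶠ D' in 𝓝 D, f.1 D' = G (powerSums e D')) →
      fderiv ℂ (F f) (powerSums e D) = fderiv ℂ G (powerSums e D) := by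
    intro f G hG h
    refine Filter.EventuallyEq.fderiv_eq (eventuallyEq_of_powerSums hD (hF f) hG ?_)
    filter_upwards [hev f, h] with D' h1 h2
    rw [← h1, h2]
  refine ⟨⟨{ toFun := fun f => fderiv ℂ (F f) (powerSums e D) v
             map_add' := ?_
             map_smul' := ?_ }, ?_⟩, ?_⟩
  · intro f g
    rw [huniq (f + g) (fun p => F f p + F g p) ((hF f).add (hF g)) (by
      filter_upwards [hev f, hev g] with D' h1 h2
      rw [← h1, ← h2]; rfl),
      fderiv_fun_add (hF f).differentiableAt (hF g).differentiableAt]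
    rfl
  · intro c f
    rw [huniq (c • f) (fun p => c • F f p) (AnalyticAt.smul (f := fun _ => c) analyticAt_const (hF f)) (by
      filter_upwards [hev f] with D' h1
      rw [← h1]; rfl),
      fderiv_fun_const_smul (hF f).differentiableAt]
    rfl
  · intro f g
    change fderiv ℂ (F (f * g)) (powerSums e D) v = f.1 D * fderiv ℂ (F g) (powerSums e D) v +
      g.1 D * fderiv ℂ (F f) (powerSums e D) v
    rw [huniq (f * g) (fun p => F f p * F g p) ((hF f).mul (hF g)) (by
      filter_upwards [hev f, hev g] with D' h1 h2
      rw [← h1, ← h2]; rfl),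
      fderiv_fun_mul (hF f).differentiableAt (hF g).differentiableAt, (hev f).self_of_nhds,
      (hev g).self_of_nhds]
    simp
  · funext k
    have hk : HolAt (trace fun x => e x ^ (k.val + 1)) D := he.holAt_pow hD _
    rw [powerDeriv, ev_eq _ hk]
    change fderiv ℂ (F ⟨_, hk⟩) (powerSums e D) v = v k
    rw [huniq ⟨_, hk⟩ (fun p => p k)
      ((ContinuousLinearMap.proj (R := ℂ) (φ := fun _ : Fin n => ℂ) k).analyticAt _)
      (Filter.Eventually.of_forall fun D' => rfl)]
    have := (ContinuousLinearMap.proj (R := ℂ) (φ := fun _ : Fin n => ℂ) k).hasFDerivAt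
      (x := powerSums e D)
    rw [show (fun p : Fin n → ℂ => p k) =
      (ContinuousLinearMap.proj (R := ℂ) (φ := fun _ : Fin n => ℂ) k) from rfl, this.fderiv]
    rfl

/-- The derivatives of the power sums of a coordinate are linear coordinates on the tangent
space. -/
def tangentEquiv : SymTangent D ≃ₗ[ℂ] (Fin n → ℂ) :=
  LinearEquiv.ofBijective
    { toFun := powerDeriv e
      map_add' := fun ξ η => by funext k; exact ev_add_left ξ η
      map_smul' := fun c ξ => by funext k; exact ev_smul_left ξ c }
    ⟨fun _ _ h => tangent_ext he hD h, exists_tangent he hD⟩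

theorem powerDeriv_tangentEquiv_symm (v : Fin n → ℂ) :
    powerDeriv e ((tangentEquiv he hD).symm v) = v := (tangentEquiv he hD).apply_symm_apply v

theorem continuousAt_ev {q₀ : SymTangentBundle X n} {f : Sym X n → ℂ}
    (hf : ∀ᶠ D in 𝓝 q₀.proj, HolAt f D) :
    ContinuousAt (fun q : SymTangentBundle X n => ev q.snd f) q₀ := by
  obtain ⟨O, hOf, hO, hq⟩ := eventually_nhds_iff.1 hf
  intro V hV
  obtain ⟨V', hV'V, hV', hqV⟩ := mem_nhds_iff.1 hV
  rw [Filter.mem_map]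
  refine Filter.mem_of_superset (IsOpen.mem_nhds
    (s := {q : SymTangentBundle X n | ∃ h : q.proj ∈ O, q.snd.1 ⟨f, hOf q.proj h⟩ ∈ V'})
    (TopologicalSpace.isOpen_generateFrom_of_mem (Or.inr ⟨O, f, hOf, V', hO, hV', rfl⟩)) ?_) ?_
  · refine ⟨hq, ?_⟩
    rw [← ev_eq q₀.snd (hOf _ hq)]
    exact hqV
  · rintro q ⟨h, hqv⟩
    rw [← ev_eq q.snd (hOf _ h)] at hqv
    exact hV'V hqv

theorem tendsto_ev {B : Type*} {l : Filter B} {q : B → SymTangentBundle X n}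
    {q₀ : SymTangentBundle X n} (hq : Filter.Tendsto q l (𝓝 q₀)) {f : Sym X n → ℂ}
    (hf : ∀ᶠ D in 𝓝 q₀.proj, HolAt f D) :
    Filter.Tendsto (fun b => ev (q b).snd f) l (𝓝 (ev q₀.snd f)) :=
  Filter.Tendsto.comp (continuousAt_ev hf) hq

include he in
theorem eventually_holAt_trace {h : X → ℂ} (hh : ∀ x ∈ D, ContMDiffAt 𝓘(ℂ) 𝓘(ℂ) ω h x)
    (hD : ∀ x ∈ D, x ∈ e.source) : ∀ᶠ D' in 𝓝 D, HolAt (trace h) D' := by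
  have h1 : ∀ x ∈ D, ∀ᶠ y in 𝓝 x, ContMDiffAt 𝓘(ℂ) 𝓘(ℂ) ω h y := by
    intro x hx
    have ha := (he.analyticAt_comp_symm (hD x hx) (hh x hx)).eventually_analyticAt
    have hc := (e.continuousAt (hD x hx)).eventually ha
    filter_upwards [hc, hc.eventually_nhds, e.open_source.mem_nhds (hD x hx)] with y hy _ hys
    refine (he.contMDiffAt_comp hys hy).congr_of_eventuallyEq ?_
    filter_upwards [e.open_source.mem_nhds hys] with y' hy'
    simp only [e.left_inv hy']
  filter_upwards [eventually_forall_mem h1] with D' hD'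
  exact holAt_trace hD'

include he in
/-- Convergence in the tangent bundle, in terms of a coordinate. -/
theorem tendsto_bundle {B : Type*} {l : Filter B} {q : B → SymTangentBundle X n}
    {q₀ : SymTangentBundle X n} (hD : ∀ x ∈ q₀.proj, x ∈ e.source)
    (h1 : Filter.Tendsto (fun b => (q b).proj) l (𝓝 q₀.proj))
    (h2 : Filter.Tendsto (fun b => powerDeriv e (q b).snd) l (𝓝 (powerDeriv e q₀.snd))) :
    Filter.Tendsto q l (𝓝 q₀) := by
  rw [TopologicalSpace.tendsto_nhds_generateFrom_iff]
  rintro W (⟨O, hO, rfl⟩ | ⟨O, f, hf, V, hO, hV, rfl⟩) hqW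
  · exact h1 (hO.mem_nhds hqW)
  · obtain ⟨hq0, hqV⟩ := hqW
    obtain ⟨F, hF, hev⟩ := HolAt.exists_powerSums he hD (hf _ hq0)
    have hps := (continuousAt_powerSums hD).tendsto
    have hsrc : ∀ᶠ D' in 𝓝 q₀.proj, ∀ x ∈ D', x ∈ e.source :=
      (isOpen_forall_mem e.open_source).mem_nhds hD
    have hchain : ∀ᶠ D' in 𝓝 q₀.proj, ∀ ζ : SymTangent D', ev ζ f =
        fderiv ℂ F (powerSums e D') (powerDeriv e ζ) := by
      filter_upwards [hps.eventually hF.eventually_analyticAt, hev.eventually_nhds, hsrc]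
        with D' hFD' hev' hs ζ
      rw [ev_congr ζ hev', ev_comp_powerSums he hs hFD']
    have hlim : Filter.Tendsto (fun b => fderiv ℂ F (powerSums e (q b).proj)
        (powerDeriv e (q b).snd)) l
        (𝓝 (fderiv ℂ F (powerSums e q₀.proj) (powerDeriv e q₀.snd))) :=
      (isBoundedBilinearMap_apply.continuous.tendsto
        (fderiv ℂ F (powerSums e q₀.proj), powerDeriv e q₀.snd)).comp
        (((hF.fderiv.continuousAt.tendsto.comp hps).comp h1).prodMk_nhds h2)
    have h3 : fderiv ℂ F (powerSums e q₀.proj) (powerDeriv e q₀.snd) ∈ V := by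
      rw [← hchain.self_of_nhds q₀.snd, ev_eq _ (hf _ hq0)]
      exact hqV
    filter_upwards [h1.eventually hchain, h1.eventually (hO.mem_nhds hq0),
      hlim (hV.mem_nhds h3)] with b hb1 hb2 hb3
    refine ⟨hb2, ?_⟩
    rw [← ev_eq _ (hf _ hb2), hb1]
    exact hb3

end Tangent

end

end HFK

namespace HFK

noncomputable section

/-! ### Interpolation with multiplicities -/

section Hermite

/-- Division with remainder of a function that is analytic at the points of `B` by a polynomial
with roots in `B`. -/
theorem exists_hermite {B : Set ℂ} (L : List ℂ) (hL : ∀ b ∈ L, b ∈ B) {H : ℂ → ℂ}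
    (hH : ∀ b ∈ B, AnalyticAt ℂ H b) :
    ∃ (c : Fin L.length → ℂ) (k : ℂ → ℂ), (∀ b ∈ B, AnalyticAt ℂ k b) ∧
      ∀ z, H z = ∑ j, c j * z ^ j.val + (L.map fun b => z - b).prod * k z := by
  suffices ∃ (q : Polynomial ℂ) (k : ℂ → ℂ), q.degree < L.length ∧ (∀ b ∈ B, AnalyticAt ℂ k b) ∧
      ∀ z, H z = q.eval z + (L.map fun b => z - b).prod * k z by
    obtain ⟨q, k, hq, hk, h⟩ := this
    refine ⟨fun j => q.coeff j, k, hk, fun z => ?_⟩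
    rw [h z, Polynomial.eval_eq_sum_degreeLTEquiv (Polynomial.mem_degreeLT.2 hq)]
    rfl
  induction L with
  | nil => exact ⟨0, H, by simp, hH, by simp⟩
  | cons a L ih =>
    obtain ⟨q, k, hq, hk, h⟩ := ih fun b hb => hL b (List.mem_cons_of_mem _ hb)
    have ha := hL a List.mem_cons_self
    -- Newton interpolation: the quotient `k` found so far is its value at the new node plus z - a
    -- times its divided difference.
    refine ⟨q + Polynomial.C (k a) * (L.map fun b => Polynomial.X - Polynomial.C b).prod,
      dslope k a, ?_, fun b hb => ?_, fun z => ?_⟩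
    · refine (Polynomial.degree_add_le _ _).trans_lt (max_lt (hq.trans ?_) ?_)
      · simp only [List.length_cons]; exact_mod_cast Nat.lt_succ_self _
      · refine ((Polynomial.degree_mul_le _ _).trans (add_le_add Polynomial.degree_C_le le_rfl)).trans_lt ?_
        have h1 : (L.map fun b => Polynomial.X - Polynomial.C b).prod.degree =
            (L.length : WithBot ℕ) := by
          clear * -
          induction L with
          | nil => simp
          | cons b L ih =>
            rw [List.map_cons, List.prod_cons, Polynomial.degree_mul, ih, Polynomial.degree_X_sub_C,
              List.length_cons, Nat.cast_add, Nat.cast_one, add_comm]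
        rw [h1, zero_add]
        simp only [List.length_cons]; exact_mod_cast Nat.lt_succ_self _
    · rcases eq_or_ne b a with rfl | hne
      · obtain ⟨p, hp⟩ := hk b hb
        exact ⟨_, hp.has_fpower_series_dslope_fslope⟩
      · have h1 : AnalyticAt ℂ (fun z => (z - a)⁻¹ • (k z - k a)) b :=
          ((analyticAt_id.sub analyticAt_const).inv (sub_ne_zero.2 hne)).smul
            ((hk b hb).sub analyticAt_const)
        refine h1.congr ?_
        filter_upwards [isOpen_ne.mem_nhds hne] with z hz
        rw [dslope_of_ne _ hz, slope_def_module]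
    · have h1 := sub_smul_dslope k a z
      rw [smul_eq_mul] at h1
      have h2 : (L.map fun b => Polynomial.X - Polynomial.C b).prod.eval z =
          (L.map fun b => z - b).prod := by
        rw [Polynomial.eval_list_prod, List.map_map]
        congr 2
        funext b
        simp
      rw [h z]
      simp only [Polynomial.eval_add, Polynomial.eval_mul, Polynomial.eval_C, h2, List.map_cons,
        List.prod_cons]
      linear_combination -(L.map fun b => z - b).prod * h1

end Hermite

/-! ### Tangent vectors as functionals on germs of functions on the surface -/

section Traces

universe u v

variable {X : Type u} [TopologicalSpace X] [ChartedSpace ℂ X] {n : ℕ} {D : Sym X n}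

/-- Functions holomorphic near the entries of `D`. -/
def HolNear (h : X → ℂ) (D : Sym X n) : Prop := ∀ x ∈ D, ContMDiffAt 𝓘(ℂ) 𝓘(ℂ) ω h x

theorem HolNear.add {h k : X → ℂ} (hh : HolNear h D) (hk : HolNear k D) :
    HolNear (fun x => h x + k x) D := fun x hx => (hh x hx).add (hk x hx)

theorem HolNear.mul {h k : X → ℂ} (hh : HolNear h D) (hk : HolNear k D) :
    HolNear (fun x => h x * k x) D := fun x hx =>
  (ContMDiffAt.smul (hh x hx) (hk x hx) : ContMDiffAt 𝓘(ℂ) 𝓘(ℂ) ω (fun x => h x • k x) x)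

theorem HolNear.const (c : ℂ) : HolNear (fun _ : X => c) D := fun _ _ => contMDiffAt_const

theorem HolNear.sum {ι : Type*} {s : Finset ι} {F : ι → X → ℂ}
    (hF : ∀ i ∈ s, HolNear (F i) D) : HolNear (fun x => ∑ i ∈ s, F i x) D := by
  classical
  induction s using Finset.induction_on with
  | empty => simpa using HolNear.const 0
  | insert a s ha ih =>
    simp only [Finset.sum_insert ha]
    exact (hF a (Finset.mem_insert_self _ _)).add
      (ih fun i hi => hF i (Finset.mem_insert_of_mem hi))

/-- The derivative of the trace of a function. -/
def tr (ξ : SymTangent D) (h : X → ℂ) : ℂ := ev ξ (trace h)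

variable (ξ : SymTangent D) {h k : X → ℂ}

theorem tr_add (hh : HolNear h D) (hk : HolNear k D) :
    tr ξ (fun x => h x + k x) = tr ξ h + tr ξ k := by
  rw [tr, tr, tr, ← ev_add ξ (holAt_trace hh) (holAt_trace hk)]
  congr 1
  funext D'
  simp [trace]

theorem tr_smul (c : ℂ) (hh : HolNear h D) : tr ξ (fun x => c * h x) = c * tr ξ h := by
  rw [tr, tr, ← ev_smul ξ c (holAt_trace hh)]
  congr 1
  funext D'
  simp [trace, Multiset.sum_map_mul_left]

theorem tr_sum {ι : Type*} {s : Finset ι} {F : ι → X → ℂ}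
    (hF : ∀ i ∈ s, HolNear (F i) D) : tr ξ (fun x => ∑ i ∈ s, F i x) = ∑ i ∈ s, tr ξ (F i) := by
  simp only [tr]
  rw [← ev_sum ξ fun i hi => holAt_trace (hF i hi)]
  congr 1
  funext D'
  simp only [trace, Finset.sum_apply]
  exact Multiset.sum_map_sum_map _ _

omit [ChartedSpace ℂ X] in
theorem eventually_trace_congr {h k : X → ℂ} (hk : ∀ x ∈ D, h =ᶠ[𝓝 x] k) :
    trace h =ᶠ[𝓝 D] trace k := by
  filter_upwards [eventually_forall_mem hk] with D' hD' using trace_congr hD'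

theorem tr_congr (hk : ∀ x ∈ D, h =ᶠ[𝓝 x] k) : tr ξ h = tr ξ k :=
  ev_congr ξ (eventually_trace_congr hk)

/-- The entries of a nearby tuple stay near those of `D`, so the trace itself is constant near `D`.
-/
theorem tr_locallyConst {l c : X → ℂ} (hl : ∀ x ∈ D, ∀ᶠ y in 𝓝 x, l y = c x) : tr ξ l = 0 := by
  obtain ⟨x, rfl⟩ := symMk_surjective D
  have h1 : trace l =ᶠ[𝓝 (symMk x)] fun _ => ∑ i, c (x i) := by
    change ∀ᶠ D' in 𝓝 (symMk x), _
    rw [← map_symMk_nhds, Filter.eventually_map]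
    have : ∀ᶠ y in 𝓝 x, ∀ i, l (y i) = c (x i) := by
      rw [Filter.eventually_all]
      exact fun i => (continuous_apply i).continuousAt.eventually (hl _ (mem_symMk.2 ⟨i, rfl⟩))
    filter_upwards [this] with y hy
    rw [trace_symMk]
    exact Finset.sum_congr rfl fun i _ => hy i
  rw [tr, ev_congr ξ h1, ev_const]

omit [ChartedSpace ℂ X] in
theorem exists_locallyConst [T2Space X] (D : Sym X n) (c : X → ℂ) :
    ∃ l : X → ℂ, ∀ x ∈ D, ∀ᶠ y in 𝓝 x, l y = c x := by
  classical
  obtain ⟨U, hU, hd⟩ := (Multiset.toFinset D.1).finite_toSet.t2_separation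
  refine ⟨fun y => if h : ∃ x ∈ D, y ∈ U x then c h.choose else 0, fun x hx => ?_⟩
  filter_upwards [(hU x).2.mem_nhds (hU x).1] with y hy
  have h : ∃ x ∈ D, y ∈ U x := ⟨x, hx, hy⟩
  rw [dif_pos h]
  congr 1
  by_contra hne
  exact disjoint_left.1 (hd (by simpa using h.choose_spec.1) (by simpa using hx) hne)
    h.choose_spec.2 hy

variable {e : OpenPartialHomeomorph X ℂ} (he : IsHolChart e) (hD : ∀ x ∈ D, x ∈ e.source)

include he hD in
theorem HolNear.comp_chart {H : ℂ → ℂ} (hH : ∀ x ∈ D, AnalyticAt ℂ H (e x)) :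
    HolNear (fun y => H (e y)) D := fun x hx => he.contMDiffAt_comp (hD x hx) (hH x hx)

include he hD in
/-- The derivative of the trace vanishes on functions divisible by the polynomial of `D`. -/
theorem tr_mul_prod {x : Fin n → X} (hx : symMk x = D) (hh : HolNear h D)
    (h0 : ∀ x ∈ D, h x = 0) : tr ξ (fun y => (∏ i, (e y - e (x i))) * h y) = 0 := by
  have hroot : ∀ D' : Sym X n, ∀ x' : Fin n → X, symMk x' = D' → ∀ ζ, ∏ i, (ζ - e (x' i)) =
      ∑ j : Fin (n + 1), rootCoeff (powerSums e D') j * ζ ^ (n - j.val) := by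
    rintro D' x' rfl ζ
    rw [prod_sub_eq, powerSums_symMk]
  let a : Fin (n + 1) → Sym X n → ℂ := fun j D' => rootCoeff (powerSums e D') j
  let t : Fin (n + 1) → X → ℂ := fun j y => e y ^ (n - j.val) * h y
  have ht : ∀ j, HolNear (t j) D := fun j =>
    (HolNear.comp_chart he hD (H := fun z => z ^ (n - j.val))
      fun _ _ => analyticAt_id.pow _).mul hh
  have ha : ∀ j, HolAt (a j) D := fun j =>
    he.holAt_comp_powerSums hD (F := fun p => rootCoeff p j) (analyticAt_rootCoeff _ j)
  -- At D' this is the sum of P_{D'}(e y) h(y) over the entries y of D', where P_{D'} has the roots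
  -- e y. It vanishes for every D', not only at `D`, so it may be differentiated.
  have hzero : (∑ j, a j * trace (t j) : Sym X n → ℂ) = fun _ => 0 := by
    funext D'
    obtain ⟨x', rfl⟩ := symMk_surjective D'
    simp only [Finset.sum_apply, Pi.mul_apply, trace_symMk, Finset.mul_sum]
    rw [Finset.sum_comm]
    refine Finset.sum_eq_zero fun i _ => ?_
    have h1 := hroot _ x' rfl (e (x' i))
    rw [Finset.prod_eq_zero (Finset.mem_univ i) (sub_self _)] at h1
    have h2 : ∑ j, a j (symMk x') * t j (x' i) =
        (∑ j : Fin (n + 1), rootCoeff (powerSums e (symMk x')) j * e (x' i) ^ (n - j.val)) *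
          h (x' i) := by
      rw [Finset.sum_mul]
      exact Finset.sum_congr rfl fun j _ => by simp only [a, t]; ring
    rw [h2, ← h1, zero_mul]
  have h3 := ev_sum ξ (s := Finset.univ) (F := fun j => a j * trace (t j))
    fun j _ => (ha j).mul (holAt_trace (ht j))
  rw [hzero, ev_const] at h3
  -- The term with the derivative of the coefficient drops out because `h` vanishes on the entries
  -- of `D`.
  have h4 : ∀ j, ev ξ (a j * trace (t j)) = a j D * tr ξ (t j) := by
    intro j
    rw [ev_mul ξ (ha j) (holAt_trace (ht j))]
    have : trace (t j) D = 0 := by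
      rw [trace_congr (k := fun _ => 0) fun y hy => by simp [t, h0 y hy]]
      simp [trace]
    rw [this, zero_mul, add_zero]
    rfl
  simp only [h4] at h3
  have h5 : (fun y => (∏ i, (e y - e (x i))) * h y) = fun y => ∑ j, a j D * t j y := by
    funext y
    rw [hroot D x hx, Finset.sum_mul]
    exact Finset.sum_congr rfl fun j _ => by simp only [a, t]; ring
  rw [h5, tr_sum ξ fun j _ => (HolNear.const (a j D)).mul (ht j), h3]
  exact Finset.sum_congr rfl fun j _ => tr_smul ξ _ (ht j)

/-- `h - h(x)` vanishes at `x` to order larger than `m`. -/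
def FlatAt (h : X → ℂ) (x : X) (m : ℕ) : Prop :=
  ∃ t k : X → ℂ, ContMDiffAt 𝓘(ℂ) 𝓘(ℂ) ω t x ∧ ContMDiffAt 𝓘(ℂ) 𝓘(ℂ) ω k x ∧ t x = 0 ∧
    ∀ᶠ y in 𝓝 x, h y = h x + t y ^ (m + 1) * k y

open scoped Classical in
/-- The multiplicity of a point in an unordered tuple. -/
def mult (D : Sym X n) (x : X) : ℕ := Multiset.count x D.1

theorem IsHolChart.exists_factor {e : OpenPartialHomeomorph X ℂ} (he : IsHolChart e) {x : X}
    (hx : x ∈ e.source) {t : X → ℂ} (ht : ContMDiffAt 𝓘(ℂ) 𝓘(ℂ) ω t x) (h0 : t x = 0) :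
    ∃ t' : X → ℂ, ContMDiffAt 𝓘(ℂ) 𝓘(ℂ) ω t' x ∧ ∀ᶠ y in 𝓝 x, t y = (e y - e x) * t' y := by
  have ha := he.analyticAt_comp_symm hx ht
  refine ⟨fun y => dslope (fun z => t (e.symm z)) (e x) (e y),
    he.contMDiffAt_comp hx ?_, ?_⟩
  · obtain ⟨p, hp⟩ := ha
    exact ⟨_, hp.has_fpower_series_dslope_fslope⟩
  · filter_upwards [e.open_source.mem_nhds hx] with y hy
    have := sub_smul_dslope (fun z => t (e.symm z)) (e x) (e y)
    rw [smul_eq_mul, e.left_inv hy, e.left_inv hx, h0, sub_zero] at this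
    exact this.symm

include he hD in
open scoped Classical in
/-- The derivative of the trace vanishes on functions that are flat to high order. -/
theorem tr_flat [T2Space X] (hf : ∀ x ∈ D, FlatAt h x (mult D x)) :
    tr ξ h = 0 := by
  obtain ⟨x, hx⟩ := symMk_surjective D
  have hxD : ∀ i, x i ∈ D := fun i => hx ▸ mem_symMk.2 ⟨i, rfl⟩
  obtain ⟨l, hl⟩ := exists_locallyConst D h
  let P : X → ℂ := fun y => ∏ i, (e y - e (x i))
  -- Division by zero gives 0 at the points of `D`. This is the right value: the numerator vanishes
  -- there to one order more than `P`.
  let K : X → ℂ := fun y => (h y - l y) / P y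
  have hP0 : ∀ y ∈ D, P y = 0 := by
    intro y hy
    rw [← hx] at hy
    obtain ⟨i, rfl⟩ := mem_symMk.1 hy
    exact Finset.prod_eq_zero (Finset.mem_univ i) (sub_self _)
  have key : ∀ y ∈ D, ContMDiffAt 𝓘(ℂ) 𝓘(ℂ) ω K y ∧ ∀ᶠ y' in 𝓝 y, h y' = l y' + P y' * K y' := by
    intro y hy
    obtain ⟨t, k, ht, hk, ht0, hev⟩ := hf y hy
    obtain ⟨t', ht', hev'⟩ := he.exists_factor (hD y hy) ht ht0
    let R : X → ℂ := fun y' => ∏ i with x i ≠ y, (e y' - e (x i))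
    have hPR : ∀ y', P y' = (e y' - e y) ^ mult D y * R y' := by
      intro y'
      have h1 := Finset.prod_filter_mul_prod_filter_not Finset.univ (fun i => x i = y)
        fun i => e y' - e (x i)
      have h2 : ∏ i with x i = y, (e y' - e (x i)) = (e y' - e y) ^ mult D y := by
        rw [Finset.prod_congr rfl (g := fun _ => e y' - e y) fun i hi => by
          rw [(Finset.mem_filter.1 hi).2], Finset.prod_const]
        congr 1
        rw [mult, ← hx, symMk, Multiset.count_map]
        simp only [eq_comm]
        rfl
      simp only [P, R]
      rw [← h1, h2]
    have hm : mult D y ≠ 0 := (Multiset.count_pos.2 hy).ne'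
    have hRy : R y ≠ 0 := by
      refine Finset.prod_ne_zero_iff.2 fun i hi => sub_ne_zero.2 fun h => ?_
      exact (Finset.mem_filter.1 hi).2 (e.injOn (hD _ hy) (hD _ (hxD i)) h).symm
    have hRan : AnalyticAt ℂ (fun z => ∏ i with x i ≠ y, (z - e (x i))) (e y) :=
      Finset.analyticAt_fun_prod _ fun i _ => analyticAt_id.sub analyticAt_const
    have hRinv : ContMDiffAt 𝓘(ℂ) 𝓘(ℂ) ω (fun y' => (R y')⁻¹) y :=
      he.contMDiffAt_comp (hD y hy) (hRan.inv hRy)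
    have hRev : ∀ᶠ y' in 𝓝 y, R y' ≠ 0 :=
      (he.contMDiffAt_comp (hD y hy) hRan).continuousAt.eventually_ne hRy
    have hform : ∀ᶠ y' in 𝓝 y, h y' - l y' =
        (e y' - e y) * (P y' * ((t' y' ^ (mult D y + 1) * k y') * (R y')⁻¹)) := by
      filter_upwards [hev, hev', hl y hy, hRev] with y' h1 h2 h3 h4
      rw [h1, h3, h2, hPR, mul_pow]
      linear_combination (e y' - e y) ^ (mult D y + 1) * t' y' ^ (mult D y + 1) * k y' *
        (-mul_inv_cancel₀ h4)
    have hmulsmooth : ∀ {f g : X → ℂ}, ContMDiffAt 𝓘(ℂ) 𝓘(ℂ) ω f y →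
        ContMDiffAt 𝓘(ℂ) 𝓘(ℂ) ω g y → ContMDiffAt 𝓘(ℂ) 𝓘(ℂ) ω (fun y' => f y' * g y') y :=
      fun hf hg => hf.smul hg
    have hpowsmooth : ContMDiffAt 𝓘(ℂ) 𝓘(ℂ) ω (fun y' => t' y' ^ (mult D y + 1)) y := by
      have h1 : ContMDiffAt 𝓘(ℂ) 𝓘(ℂ) ω (fun z : ℂ => z ^ (mult D y + 1)) (t' y) :=
        contMDiffAt_iff_contDiffAt.2 (by fun_prop)
      exact h1.comp y ht'
    have hcoord : ContMDiffAt 𝓘(ℂ) 𝓘(ℂ) ω (fun y' => e y' - e y) y :=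
      he.contMDiffAt_comp (hD y hy) (h := fun z => z - e y) (analyticAt_id.sub analyticAt_const)
    refine ⟨?_, ?_⟩
    · refine (hmulsmooth hcoord (hmulsmooth (hmulsmooth hpowsmooth hk)
        hRinv)).congr_of_eventuallyEq ?_
      filter_upwards [hform, hRev, e.open_source.mem_nhds (hD y hy)] with y' h1 h2 h3
      simp only [K]
      by_cases h4 : e y' - e y = 0
      · rw [h1, h4]; simp
      · have h5 : P y' ≠ 0 := by rw [hPR]; exact mul_ne_zero (pow_ne_zero _ h4) h2
        rw [h1, div_eq_iff h5]; ring
    · filter_upwards [hform, hRev] with y' h1 h2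
      simp only [K]
      by_cases h4 : e y' - e y = 0
      · have h5 : P y' = 0 := by rw [hPR, h4, zero_pow hm, zero_mul]
        rw [h4, zero_mul] at h1
        rw [h5, zero_mul, add_zero]
        exact sub_eq_zero.1 h1
      · have h5 : P y' ≠ 0 := by rw [hPR]; exact mul_ne_zero (pow_ne_zero _ h4) h2
        field_simp
        ring
  have hK : HolNear K D := fun y hy => (key y hy).1
  have hlh : HolNear l D := fun y hy =>
    (contMDiffAt_const (c := h y)).congr_of_eventuallyEq (hl y hy)
  have hPh : HolNear P D := HolNear.comp_chart he hD (H := fun z => ∏ i, (z - e (x i)))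
    fun _ _ => Finset.analyticAt_fun_prod _ fun i _ => analyticAt_id.sub analyticAt_const
  rw [tr_congr ξ (k := fun y => l y + P y * K y) fun y hy => (key y hy).2,
    tr_add ξ hlh (hPh.mul hK), tr_locallyConst ξ hl, zero_add]
  exact tr_mul_prod ξ he hD hx hK fun y hy => by simp only [K, hP0 y hy, div_zero]

include he hD in
theorem tangent_ext_tr {ξ η : SymTangent D} (h : ∀ h : X → ℂ, HolNear h D → tr ξ h = tr η h) :
    ξ = η := by
  refine tangent_ext he hD ?_
  funext k
  exact h _ (HolNear.comp_chart he hD (H := fun z => z ^ (k.val + 1)) fun _ _ => analyticAt_id.pow _)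

include he hD in
/-- A linear functional on functions holomorphic near `D` that vanishes on flat functions is the
derivative of the trace in the direction of a tangent vector. -/
theorem exists_tangent_of_functional [T2Space X] (lam : (X → ℂ) → ℂ)
    (hadd : ∀ h k, HolNear h D → HolNear k D → lam (fun x => h x + k x) = lam h + lam k)
    (hsmul : ∀ (c : ℂ) h, HolNear h D → lam (fun x => c * h x) = c * lam h)
    (hflat : ∀ h, HolNear h D → (∀ x ∈ D, FlatAt h x (mult D x)) → lam h = 0) :
    ∃ ξ : SymTangent D, ∀ h, HolNear h D → tr ξ h = lam h := by
  classical
  obtain ⟨ξ, hξ⟩ := exists_tangent he hD fun k : Fin n => lam fun x => e x ^ (k.val + 1)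
  refine ⟨ξ, fun h hh => ?_⟩
  obtain ⟨x, hx⟩ := symMk_surjective D
  have hxD : ∀ i, x i ∈ D := fun i => hx ▸ mem_symMk.2 ⟨i, rfl⟩
  let H : ℂ → ℂ := fun z => h (e.symm z)
  have hH : ∀ y ∈ D, AnalyticAt ℂ H (e y) := fun y hy => he.analyticAt_comp_symm (hD y hy) (hh y hy)
  -- It is the derivative of `H` that is divided by the polynomial of `D`. The remainder integrates
  -- to a combination Q of the powers 1, …, n, the ones whose traces are the coordinates. Moreover H
  -- - Q has a derivative divisible by the polynomial, and this is flatness.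
  obtain ⟨c, k, hk, hdiv⟩ := exists_hermite (B := {b | ∃ y ∈ D, b = e y})
    (List.ofFn fun i => e (x i)) (by
      intro b hb
      rw [List.mem_ofFn] at hb
      obtain ⟨i, rfl⟩ := hb
      exact ⟨x i, hxD i, rfl⟩) (H := deriv H) (by rintro b ⟨y, hy, rfl⟩; exact (hH y hy).deriv)
  have hlen : (List.ofFn fun i => e (x i)).length = n := List.length_ofFn
  let c' : Fin n → ℂ := fun j => c (j.cast hlen.symm) / (j.val + 1)
  let Q : ℂ → ℂ := fun z => ∑ j : Fin n, c' j * z ^ (j.val + 1)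
  have hQ : ∀ z, HasDerivAt Q (∑ j, c j * z ^ j.val) z := by
    intro z
    have h1 : ∑ j, c j * z ^ j.val = ∑ j : Fin n, c (j.cast hlen.symm) * z ^ j.val :=
      (Equiv.sum_comp (finCongr hlen.symm) fun j => c j * z ^ j.val).symm
    rw [h1]
    refine HasDerivAt.fun_sum fun j _ => ?_
    have h2 := ((hasDerivAt_id z).pow (j.val + 1)).const_mul (c' j)
    have hj : ((j.val : ℂ) + 1) ≠ 0 := Nat.cast_add_one_ne_zero j.val
    refine h2.congr_deriv ?_
    simp only [c', id, Nat.add_sub_cancel]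
    push_cast
    field_simp
  have hQan : ∀ z, AnalyticAt ℂ Q z := fun z =>
    Finset.analyticAt_fun_sum _ fun j _ => analyticAt_const.mul (analyticAt_id.pow _)
  have hpow : ∀ j : ℕ, HolNear (fun y => e y ^ j) D := fun j =>
    HolNear.comp_chart he hD (H := fun z => z ^ j) fun _ _ => analyticAt_id.pow _
  have hQe : HolNear (fun y => Q (e y)) D := HolNear.comp_chart he hD fun _ _ => hQan _
  let r : X → ℂ := fun y => h y + (-1) * Q (e y)
  have hr : HolNear r D := hh.add ((HolNear.const (-1)).mul hQe)
  have hrflat : ∀ y ∈ D, FlatAt r y (mult D y) := by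
    intro y hy
    let G : ℂ → ℂ := fun z => H z - Q z
    have hG : AnalyticAt ℂ G (e y) := (hH y hy).sub (hQan _)
    have hGd : deriv G =ᶠ[𝓝 (e y)] fun z => (List.map (fun b => z - b)
        (List.ofFn fun i => e (x i))).prod * k z := by
      filter_upwards [(hH y hy).eventually_analyticAt] with z hz
      rw [show G = fun z => H z - Q z from rfl,
        deriv_fun_sub hz.differentiableAt (hQ z).differentiableAt, (hQ z).deriv, hdiv z]
      ring
    have hprod : ∀ z, (List.map (fun b => z - b) (List.ofFn fun i => e (x i))).prod =
        (z - e y) ^ mult D y * ∏ i with x i ≠ y, (z - e (x i)) := by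
      intro z
      rw [List.map_ofFn, List.prod_ofFn]
      simp only [Function.comp]
      rw [← Finset.prod_filter_mul_prod_filter_not Finset.univ (fun i => x i = y)]
      congr 1
      rw [Finset.prod_congr rfl (g := fun _ => z - e y) fun i hi => by
        rw [(Finset.mem_filter.1 hi).2], Finset.prod_const]
      congr 1
      rw [mult, ← hx, symMk, Multiset.count_map]
      simp only [eq_comm]
      rfl
    have hord : (mult D y : ℕ∞) ≤ analyticOrderAt (deriv G) (e y) := by
      rw [natCast_le_analyticOrderAt hG.deriv]
      refine ⟨fun z => (∏ i with x i ≠ y, (z - e (x i))) * k z, ?_, ?_⟩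
      · exact (Finset.analyticAt_fun_prod _ fun i _ => analyticAt_id.sub analyticAt_const).mul
          (hk _ ⟨y, hy, rfl⟩)
      · filter_upwards [hGd] with z hz
        rw [hz, hprod, smul_eq_mul, mul_assoc]
    have hord2 : ((mult D y + 1 : ℕ) : ℕ∞) ≤ analyticOrderAt (fun z => G z - G (e y)) (e y) := by
      rw [← hG.analyticOrderAt_deriv_add_one]
      push_cast
      gcongr
    obtain ⟨g, hg, hev⟩ := (natCast_le_analyticOrderAt (hG.sub analyticAt_const)).1 hord2
    refine ⟨fun y' => e y' - e y, fun y' => g (e y'),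
      he.contMDiffAt_comp (hD y hy) (h := fun z => z - e y) (analyticAt_id.sub analyticAt_const),
      he.contMDiffAt_comp (hD y hy) hg, sub_self _, ?_⟩
    have h1 := (e.continuousAt (hD y hy)).eventually hev
    filter_upwards [h1, e.open_source.mem_nhds (hD y hy)] with y' h2 h3
    simp only [Pi.sub_apply, G, H, e.left_inv h3, e.left_inv (hD y hy), smul_eq_mul] at h2
    simp only [r]
    linear_combination h2
  have hdec : h = fun y => r y + Q (e y) := by funext y; simp only [r]; ring
  have hlamQ : lam (fun y => Q (e y)) = tr ξ fun y => Q (e y) := by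
    have hgen : ∀ s : Finset (Fin n), lam (fun y => ∑ j ∈ s, c' j * e y ^ (j.val + 1)) =
        ∑ j ∈ s, c' j * lam fun y => e y ^ (j.val + 1) := by
      intro s
      induction s using Finset.induction_on with
      | empty =>
        simp only [Finset.sum_empty]
        have := hsmul 0 (fun _ => 0) (HolNear.const 0)
        simpa using this
      | insert a s ha ih =>
        simp only [Finset.sum_insert ha]
        rw [hadd _ _ ((HolNear.const (c' a)).mul (hpow _))
          (HolNear.sum fun j _ => (HolNear.const (c' j)).mul (hpow _)), ih, hsmul _ _ (hpow _)]
    rw [show (fun y => Q (e y)) = fun y => ∑ j : Fin n, c' j * e y ^ (j.val + 1) from rfl,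
      hgen Finset.univ, tr_sum ξ fun j _ => (HolNear.const (c' j)).mul (hpow _)]
    refine Finset.sum_congr rfl fun j _ => ?_
    rw [tr_smul ξ _ (hpow _)]
    congr 1
    exact (congrFun hξ j).symm
  rw [hdec, tr_add ξ hr hQe, hadd _ _ hr hQe, tr_flat ξ he hD hrflat, hflat r hr hrflat, hlamQ]

end Traces

end

end HFK

namespace HFK

noncomputable section

/-! ### Maps of tangent spaces induced by operators on germs -/

section Transport

universe u v

variable {X : Type u} [TopologicalSpace X] [ChartedSpace ℂ X] {n : ℕ} {D : Sym X n}

theorem mulSmooth {f g : X → ℂ} {x : X} (hf : ContMDiffAt 𝓘(ℂ) 𝓘(ℂ) ω f x)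
    (hg : ContMDiffAt 𝓘(ℂ) 𝓘(ℂ) ω g x) : ContMDiffAt 𝓘(ℂ) 𝓘(ℂ) ω (fun y => f y * g y) x :=
  hf.smul hg

theorem powSmooth {f : X → ℂ} {x : X} (hf : ContMDiffAt 𝓘(ℂ) 𝓘(ℂ) ω f x) (m : ℕ) :
    ContMDiffAt 𝓘(ℂ) 𝓘(ℂ) ω (fun y => f y ^ m) x := by
  have h1 : ContMDiffAt 𝓘(ℂ) 𝓘(ℂ) ω (fun z : ℂ => z ^ m) (f x) :=
    contMDiffAt_iff_contDiffAt.2 (by fun_prop)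
  exact h1.comp x hf

section

variable {h k : X → ℂ} {x : X} {m : ℕ}

/-- Each remainder comes with its own function vanishing at `x`. Both are rewritten through the
centred preferred chart, so that they have a common factor. -/
theorem FlatAt.add [IsManifold 𝓘(ℂ) ω X] (hh : FlatAt h x m) (hk : FlatAt k x m) :
    FlatAt (fun y => h y + k y) x m := by
  obtain ⟨t, a, ht, ha, ht0, hev⟩ := hh
  obtain ⟨s, b, hs, hb, hs0, hev'⟩ := hk
  have he := isHolChart_chartAt x
  have hx := mem_chart_source ℂ x
  obtain ⟨t', ht', h1⟩ := he.exists_factor hx ht ht0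
  obtain ⟨s', hs', h2⟩ := he.exists_factor hx hs hs0
  refine ⟨fun y => chartAt ℂ x y - chartAt ℂ x x,
    fun y => t' y ^ (m + 1) * a y + s' y ^ (m + 1) * b y,
    he.contMDiffAt_comp hx (h := fun z => z - chartAt ℂ x x) (analyticAt_id.sub analyticAt_const),
    (mulSmooth (powSmooth ht' _) ha).add (mulSmooth (powSmooth hs' _) hb), sub_self _, ?_⟩
  filter_upwards [hev, hev', h1, h2] with y e1 e2 e3 e4
  rw [e1, e2, e3, e4, mul_pow, mul_pow]
  ring

theorem FlatAt.const_mul (c : ℂ) (hh : FlatAt h x m) : FlatAt (fun y => c * h y) x m := by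
  obtain ⟨t, a, ht, ha, ht0, hev⟩ := hh
  refine ⟨t, fun y => c * a y, ht, mulSmooth contMDiffAt_const ha, ht0, ?_⟩
  filter_upwards [hev] with y e1
  rw [e1]
  ring

theorem FlatAt.congr (hh : FlatAt h x m) (hk : h =ᶠ[𝓝 x] k) : FlatAt k x m := by
  obtain ⟨t, a, ht, ha, ht0, hev⟩ := hh
  refine ⟨t, a, ht, ha, ht0, ?_⟩
  filter_upwards [hev, hk] with y e1 e2
  rw [← e2, e1, hk.self_of_nhds]

theorem FlatAt.comp {X' : Type v} [TopologicalSpace X'] [ChartedSpace ℂ X'] {φ : X' → X} {x' : X'}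
    (hh : FlatAt h x m) (hφ : ContMDiffAt 𝓘(ℂ) 𝓘(ℂ) ω φ x') (hx : φ x' = x) :
    FlatAt (fun y => h (φ y)) x' m := by
  subst hx
  obtain ⟨t, a, ht, ha, ht0, hev⟩ := hh
  exact ⟨fun y => t (φ y), fun y => a (φ y), ht.comp x' hφ, ha.comp x' hφ, ht0,
    hφ.continuousAt.eventually hev⟩

end

variable [IsManifold 𝓘(ℂ) ω X] [T2Space X] [Nonempty X]

theorem tr_ext {ξ η : SymTangent D} (h : ∀ h : X → ℂ, HolNear h D → tr ξ h = tr η h) : ξ = η := by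
  obtain ⟨e, he, hD⟩ := exists_isHolChart_sym D
  exact tangent_ext_tr he hD h

theorem tendsto_tr {B : Type*} {l : Filter B} {q : B → SymTangentBundle X n}
    {q₀ : SymTangentBundle X n} (hq : Filter.Tendsto q l (𝓝 q₀)) {h : X → ℂ}
    (hh : HolNear h q₀.proj) :
    Filter.Tendsto (fun b => tr (q b).snd h) l (𝓝 (tr q₀.snd h)) := by
  obtain ⟨e, he, hD⟩ := exists_isHolChart_sym q₀.proj
  exact tendsto_ev hq (eventually_holAt_trace he hh hD)

/-- With `tendsto_tr`, this reduces continuity in the tangent bundle to continuity of the numbers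
`tr ξ h` for fixed functions `h`. -/
theorem tendsto_of_tr {B : Type*} {l : Filter B} {q : B → SymTangentBundle X n}
    {q₀ : SymTangentBundle X n}
    (h1 : Filter.Tendsto (fun b => (q b).proj) l (𝓝 q₀.proj))
    (h2 : ∀ h : X → ℂ, HolNear h q₀.proj →
      Filter.Tendsto (fun b => tr (q b).snd h) l (𝓝 (tr q₀.snd h))) :
    Filter.Tendsto q l (𝓝 q₀) := by
  obtain ⟨e, he, hD⟩ := exists_isHolChart_sym q₀.proj
  refine tendsto_bundle he hD h1 (tendsto_pi_nhds.2 fun k => h2 _ ?_)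
  exact HolNear.comp_chart he hD (H := fun z => z ^ (k.val + 1)) fun _ _ => analyticAt_id.pow _

variable {X' : Type v} [TopologicalSpace X'] [ChartedSpace ℂ X'] [IsManifold 𝓘(ℂ) ω X']
  [T2Space X'] [Nonempty X'] {m : ℕ} {D' : Sym X' m}

omit [T2Space X] [Nonempty X] [IsManifold 𝓘(ℂ) ω X] [IsManifold 𝓘(ℂ) ω X'] [T2Space X']
  [Nonempty X'] in
theorem tr_add_left (ξ η : SymTangent D) (h : X → ℂ) : tr (ξ + η) h = tr ξ h + tr η h :=
  ev_add_left ξ η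

omit [T2Space X] [Nonempty X] [IsManifold 𝓘(ℂ) ω X] [IsManifold 𝓘(ℂ) ω X'] [T2Space X']
  [Nonempty X'] in
theorem tr_smul_left (c : ℂ) (ξ : SymTangent D) (h : X → ℂ) : tr (c • ξ) h = c * tr ξ h :=
  ev_smul_left ξ c

/-- A linear operator on germs of functions that preserves flatness induces a linear map of
tangent spaces. -/
theorem exists_transport (T : (X' → ℂ) → X → ℂ)
    (hT : ∀ h, HolNear h D' → HolNear (T h) D)
    (hadd : ∀ h k, HolNear h D' → HolNear k D' → T (fun x => h x + k x) = fun x => T h x + T k x)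
    (hsmul : ∀ (c : ℂ) h, HolNear h D' → T (fun x => c * h x) = fun x => c * T h x)
    (hflat : ∀ h, HolNear h D' → (∀ x ∈ D', FlatAt h x (mult D' x)) →
      ∀ x ∈ D, FlatAt (T h) x (mult D x)) :
    ∃ A : SymTangent D →ₗ[ℂ] SymTangent D', ∀ ξ h, HolNear h D' → tr (A ξ) h = tr ξ (T h) := by
  obtain ⟨e, he, hD⟩ := exists_isHolChart_sym D
  obtain ⟨e', he', hD'⟩ := exists_isHolChart_sym D'
  choose A hA using fun ξ : SymTangent D => exists_tangent_of_functional he' hD'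
    (fun h => tr ξ (T h))
    (fun h k hh hk => by rw [hadd h k hh hk, tr_add ξ (hT h hh) (hT k hk)])
    (fun c h hh => by rw [hsmul c h hh, tr_smul ξ c (hT h hh)])
    (fun h hh hf => tr_flat ξ he hD (hflat h hh hf))
  refine ⟨{ toFun := A, map_add' := fun ξ η => tr_ext fun h hh => ?_,
            map_smul' := fun c ξ => tr_ext fun h hh => ?_ }, hA⟩
  · rw [tr_add_left, hA _ h hh, hA _ h hh, hA _ h hh, tr_add_left]
  · rw [RingHom.id_apply, tr_smul_left, hA _ h hh, hA _ h hh, tr_smul_left]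

end Transport

/-! ### Functions and tuples on the double cover of the surface -/

section CoverMaps

universe u v

variable {S : Type u} [TopologicalSpace S] [ChartedSpace ℂ S]
variable {S' : Type v} [TopologicalSpace S'] [ChartedSpace ℂ S']

namespace SurfaceDoubleCover

variable {w z : S} (P : SurfaceDoubleCover S S' w z)

theorem deck_ne_w {a : S'} (h : a ≠ P.w') : P.ι a ≠ P.w' :=
  fun h' => h (by rw [← P.deck_deck a, h', P.deck_w])

theorem deck_ne_z {a : S'} (h : a ≠ P.z') : P.ι a ≠ P.z' :=
  fun h' => h (by rw [← P.deck_deck a, h', P.deck_z])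

/-- A local section of the covering through a given point. -/
theorem exists_section {a : S'} (hw : a ≠ P.w') (hz : a ≠ P.z') :
    ∃ σ : S → S', ContMDiffAt 𝓘(ℂ) 𝓘(ℂ) ω σ (P.π a) ∧ σ (P.π a) = a ∧
      (∀ᶠ y in 𝓝 (P.π a), P.π (σ y) = y) ∧ ∀ᶠ b in 𝓝 a, σ (P.π b) = b := by
  have L := P.unbranched a hw hz
  refine ⟨L.localInverse, L.localInverse_contMDiffAt,
    L.localInverse_left_inv L.localInverse_mem_target, ?_, ?_⟩
  · filter_upwards [L.localInverse.open_source.mem_nhds L.localInverse_mem_source] with y hy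
    exact L.localInverse_right_inv hy
  · filter_upwards [L.localInverse.open_target.mem_nhds L.localInverse_mem_target] with b hb
    exact L.localInverse_left_inv hb

theorem contMDiffAt_π {a : S'} (hw : a ≠ P.w') (hz : a ≠ P.z') :
    ContMDiffAt 𝓘(ℂ) 𝓘(ℂ) ω P.π a := (P.unbranched a hw hz).contMDiffAt

/-- The sum over the fibres of `l * h`. -/
def push (l h : S' → ℂ) (x : S) : ℂ :=
  l (P.lift x) * h (P.lift x) + l (P.ι (P.lift x)) * h (P.ι (P.lift x))

theorem push_apply (l h : S' → ℂ) {a : S'} {x : S} (hx : P.π a = x) :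
    P.push l h x = l a * h a + l (P.ι a) * h (P.ι a) := by
  rcases (P.fibre (P.lift x) a).1 (by rw [P.map_lift, hx]) with h1 | h1
  · rw [push, h1]
  · rw [push, h1, P.deck_deck, add_comm]

variable {g : ℕ} {D : Sym S g}

theorem mem_symLift {a : S'} : a ∈ P.symLift g D ↔ P.π a ∈ D := by
  change a ∈ D.1.bind (fun x => {P.lift x, P.ι (P.lift x)}) ↔ P.π a ∈ D.1
  rw [Multiset.mem_bind]
  constructor
  · rintro ⟨x, hx, ha⟩
    rcases Multiset.mem_cons.1 ha with rfl | ha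
    · rwa [P.map_lift]
    · rw [Multiset.mem_singleton.1 ha, P.map_deck, P.map_lift]; exact hx
  · intro ha
    refine ⟨_, ha, ?_⟩
    rcases (P.fibre (P.lift (P.π a)) a).1 (P.map_lift _) with h | h
    · exact Multiset.mem_cons.2 (Or.inl h)
    · exact Multiset.mem_cons.2 (Or.inr (Multiset.mem_singleton.2 h))

theorem deck_mem_symLift {a : S'} : P.ι a ∈ P.symLift g D ↔ a ∈ P.symLift g D := by
  rw [mem_symLift, mem_symLift, P.map_deck]

theorem symLift_mem (hD : D ∈ puncturedSym S g w z) :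
    P.symLift g D ∈ puncturedSym S' (2 * g) P.w' P.z' := by
  refine ⟨fun h => hD.1 ?_, fun h => hD.2 ?_⟩
  · rw [P.mem_symLift, P.map_w] at h; exact h
  · rw [P.mem_symLift, P.map_z] at h; exact h

theorem ne_w (hD : D ∈ puncturedSym S g w z) {a : S'} (ha : P.π a ∈ D) : a ≠ P.w' := by
  rintro rfl; rw [P.map_w] at ha; exact hD.1 ha

theorem ne_z (hD : D ∈ puncturedSym S g w z) {a : S'} (ha : P.π a ∈ D) : a ≠ P.z' := by
  rintro rfl; rw [P.map_z] at ha; exact hD.2 ha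

theorem symDeck_symLift : P.symDeck (2 * g) (P.symLift g D) = P.symLift g D := by
  apply Subtype.ext
  change Multiset.map P.ι (D.1.bind _) = D.1.bind _
  rw [Multiset.map_bind]
  refine Multiset.bind_congr fun x _ => ?_
  simp only [Multiset.insert_eq_cons, Multiset.map_cons, Multiset.map_singleton, P.deck_deck]
  exact Multiset.pair_comm _ _

theorem trace_symLift (h : S' → ℂ) (D : Sym S g) :
    trace h (P.symLift g D) = trace (P.push (fun _ => 1) h) D := by
  change (Multiset.map h (D.1.bind _)).sum = (Multiset.map _ D.1).sum
  rw [Multiset.map_bind, Multiset.sum_bind]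
  congr 1
  refine Multiset.map_congr rfl fun x _ => ?_
  simp [push]

/-- Off the branch points a fibre consists of two different points, each contributing once. Equal
multiplicities upstairs and downstairs allow flatness to be transferred. -/
theorem mult_symLift (hD : D ∈ puncturedSym S g w z) {a : S'} (ha : P.π a ∈ D) :
    mult (P.symLift g D) a = mult D (P.π a) := by
  classical
  have hne : P.ι a ≠ a := fun h => ((P.fixed a).1 h).elim (P.ne_w hD ha) (P.ne_z hD ha)
  simp only [mult]
  change Multiset.count a (D.1.bind _) = _
  rw [Multiset.count_bind]
  have h1 : ∀ x ∈ D.1, Multiset.count a {P.lift x, P.ι (P.lift x)} = if P.π a = x then 1 else 0 := by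
    intro x _
    split_ifs with h
    · rw [P.pair_eq (b := a) (by rw [P.map_lift, h]), Multiset.insert_eq_cons,
        Multiset.count_cons_self, Multiset.count_singleton, if_neg hne.symm]
    · rw [Multiset.count_eq_zero]
      intro ha
      apply h
      rcases Multiset.mem_cons.1 ha with h2 | h2
      · rw [h2, P.map_lift]
      · rw [Multiset.mem_singleton.1 h2, P.map_deck, P.map_lift]
  rw [Multiset.map_congr rfl h1, Multiset.count]
  clear * -
  induction D.1 using Multiset.induction_on with
  | empty => simp
  | cons b s ih =>
    rw [Multiset.map_cons, Multiset.sum_cons, ih, Multiset.countP_cons, add_comm]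

theorem continuousAt_symLift (hD : D ∈ puncturedSym S g w z) :
    ContinuousAt (P.symLift g) D := by
  obtain ⟨x, rfl⟩ := symMk_surjective D
  have hm : ∀ i, P.π (P.lift (x i)) ∈ symMk x := fun i => by
    rw [P.map_lift]; exact mem_symMk.2 ⟨i, rfl⟩
  choose σ hσ hσx hσr _ using fun i => P.exists_section (P.ne_w hD (hm i)) (P.ne_z hD (hm i))
  simp only [P.map_lift] at hσ hσx hσr
  have hev : ∀ᶠ y in 𝓝 x, ∀ i, P.π (σ i (y i)) = y i := by
    rw [Filter.eventually_all]
    exact fun i => (continuous_apply i).continuousAt.eventually (hσr i)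
  have hev' : ∀ᶠ y in 𝓝 x, symMk (fun k : Fin (2 * g) =>
      if (finProdFinEquiv.symm k).1 = 0 then σ (finProdFinEquiv.symm k).2 (y (finProdFinEquiv.symm k).2)
      else P.ι (σ (finProdFinEquiv.symm k).2 (y (finProdFinEquiv.symm k).2))) =
      P.symLift g (symMk y) := by
    filter_upwards [hev] with y hy
    exact (P.symLift_symMk y (fun i => σ i (y i)) hy).symm
  have hc : ∀ i, ContinuousAt (fun y : Fin g → S => σ i (y i)) x := fun i =>
    ContinuousAt.comp (g := σ i) (hσ i).continuousAt (continuous_apply i).continuousAt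
  rw [ContinuousAt, ← map_symMk_nhds, Filter.tendsto_map'_iff]
  refine Filter.Tendsto.congr' hev' ?_
  rw [← hev'.self_of_nhds]
  refine continuous_symMk.continuousAt.comp (continuousAt_pi.2 fun k => ?_)
  split_ifs
  · exact hc _
  · exact P.continuous_deck.continuousAt.comp (hc _)

/-- A function that is locally constant near the points over `D`, with prescribed values. -/
def LocConst (D : Sym S g) (l c : S' → ℂ) : Prop := ∀ a, P.π a ∈ D → ∀ᶠ b in 𝓝 a, l b = c a

variable {P}

theorem LocConst.holNear {l c : S' → ℂ} (hl : P.LocConst D l c) :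
    HolNear l (P.symLift g D) := fun a ha =>
  (contMDiffAt_const (c := c a)).congr_of_eventuallyEq (hl a (P.mem_symLift.1 ha))

/-- Through a holomorphic local section, the sum over the fibres is a combination of pull-backs of
`h` with constant coefficients. Holomorphy and flatness of the push-forward are read off from this
form. -/
theorem LocConst.push_eventually {l c : S' → ℂ} (hl : P.LocConst D l c)
    (hD : D ∈ puncturedSym S g w z) {a : S'} (ha : P.π a ∈ D) {h : S' → ℂ} :
    ∃ σ : S → S', ContMDiffAt 𝓘(ℂ) 𝓘(ℂ) ω σ (P.π a) ∧ σ (P.π a) = a ∧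
      (∀ᶠ y in 𝓝 (P.π a), P.π (σ y) = y) ∧
      ∀ᶠ y in 𝓝 (P.π a), P.push l h y = c a * h (σ y) + c (P.ι a) * h (P.ι (σ y)) := by
  obtain ⟨σ, hσ, hσa, hr, -⟩ := P.exists_section (P.ne_w hD ha) (P.ne_z hD ha)
  refine ⟨σ, hσ, hσa, hr, ?_⟩
  have h1 : ∀ᶠ y in 𝓝 (P.π a), l (σ y) = c a :=
    hσ.continuousAt.eventually (by rw [hσa]; exact hl a ha)
  have h2 : ∀ᶠ y in 𝓝 (P.π a), l (P.ι (σ y)) = c (P.ι a) :=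
    (P.continuous_deck.continuousAt.comp hσ.continuousAt).eventually
      (by simp only [Function.comp, hσa]; exact hl _ (by rwa [P.map_deck]))
  filter_upwards [hr, h1, h2] with y e1 e2 e3
  rw [P.push_apply l h e1, e2, e3]

theorem LocConst.holNear_push {l c : S' → ℂ} (hl : P.LocConst D l c)
    (hD : D ∈ puncturedSym S g w z) {h : S' → ℂ} (hh : HolNear h (P.symLift g D)) :
    HolNear (P.push l h) D := by
  intro x hx
  rw [← P.map_lift x] at hx ⊢
  obtain ⟨σ, hσ, hσa, -, hev⟩ := hl.push_eventually hD hx (h := h)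
  refine ContMDiffAt.congr_of_eventuallyEq ?_ hev
  have hι : ContMDiffAt 𝓘(ℂ) 𝓘(ℂ) ω (fun y => P.ι (σ y)) (P.π (P.lift x)) :=
    ContMDiffAt.comp_of_eq (P.deck_contMDiffAt (P.ne_w hD hx) (P.ne_z hD hx)) hσ hσa
  have ha := P.mem_symLift.2 hx
  exact (mulSmooth contMDiffAt_const (ContMDiffAt.comp_of_eq (hh _ ha) hσ hσa)).add
    (mulSmooth contMDiffAt_const
      (ContMDiffAt.comp_of_eq (hh _ (P.deck_mem_symLift.2 ha)) hι (by rw [hσa])))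

/-! ### Twisting tangent vectors by locally constant functions -/

section Twist

variable [IsManifold 𝓘(ℂ) ω S] [T2Space S] [Nonempty S] [IsManifold 𝓘(ℂ) ω S'] [T2Space S']
  [Nonempty S']

variable (P) (hD : D ∈ puncturedSym S g w z) (c : S' → ℂ)

-- Multiplying by a locally constant function and summing over fibres preserves holomorphy and
-- flatness of germs, so it dualizes to tangent spaces. Only the germs of `l` enter, so the map
-- depends on the values `c` alone.
include hD in
theorem exists_twist : ∃ A : SymTangent D →ₗ[ℂ] SymTangent (P.symLift g D),
    ∀ ξ h, HolNear h (P.symLift g D) → ∀ l, P.LocConst D l c → tr (A ξ) h = tr ξ (P.push l h) := by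
  obtain ⟨l, hl'⟩ := exists_locallyConst (P.symLift g D) c
  have hl : P.LocConst D l c := fun a ha => hl' a (P.mem_symLift.2 ha)
  obtain ⟨A, hA⟩ := exists_transport (D := D) (D' := P.symLift g D) (P.push l)
    (fun h hh => hl.holNear_push hD hh)
    (fun h k _ _ => by funext x; simp only [push]; ring)
    (fun c h _ => by funext x; simp only [push]; ring) (by
      intro h hh hf x hx
      rw [← P.map_lift x] at hx ⊢
      obtain ⟨σ, hσ, hσa, -, hev⟩ := hl.push_eventually hD hx (h := h)
      refine FlatAt.congr ?_ (Filter.EventuallyEq.symm hev)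
      have hι : ContMDiffAt 𝓘(ℂ) 𝓘(ℂ) ω (fun y => P.ι (σ y)) (P.π (P.lift x)) :=
        ContMDiffAt.comp_of_eq (P.deck_contMDiffAt (P.ne_w hD hx) (P.ne_z hD hx)) hσ hσa
      have ha := P.mem_symLift.2 hx
      have h1 := hf _ ha
      have h2 := hf _ (P.deck_mem_symLift.2 ha)
      rw [P.mult_symLift hD hx] at h1
      rw [P.mult_symLift hD (by rwa [P.map_deck]), P.map_deck] at h2
      exact ((h1.comp hσ hσa).const_mul _).add ((h2.comp hι (by rw [hσa])).const_mul _))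
  refine ⟨A, fun ξ h hh l' hl'' => ?_⟩
  rw [hA ξ h hh]
  refine tr_congr ξ fun x hx => ?_
  rw [← P.map_lift x] at hx ⊢
  have hι : P.π (P.ι (P.lift x)) ∈ D := by rwa [P.map_deck]
  obtain ⟨σ, hσ, hσa, hr, hev⟩ := hl.push_eventually hD hx (h := h)
  have h1 : ∀ᶠ y in 𝓝 (P.π (P.lift x)), l' (σ y) = c (P.lift x) :=
    hσ.continuousAt.eventually (by rw [hσa]; exact hl'' _ hx)
  have h2 : ∀ᶠ y in 𝓝 (P.π (P.lift x)), l' (P.ι (σ y)) = c (P.ι (P.lift x)) :=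
    (P.continuous_deck.continuousAt.comp hσ.continuousAt).eventually
      (by simp only [Function.comp, hσa]; exact hl'' _ hι)
  filter_upwards [hev, hr, h1, h2] with y e0 e1 e2 e3
  rw [e0, P.push_apply l' h e1, e2, e3]

/-- The map of tangent spaces `(vᵢ)ᵢ ↦ (c(x̃ᵢ) vᵢ, c(ι x̃ᵢ) vᵢ)ᵢ`. -/
def twist : SymTangent D →ₗ[ℂ] SymTangent (P.symLift g D) := (P.exists_twist hD c).choose

variable {c}

theorem tr_twist (ξ : SymTangent D) {h : S' → ℂ} (hh : HolNear h (P.symLift g D)) {l : S' → ℂ}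
    (hl : P.LocConst D l c) : tr (P.twist hD c ξ) h = tr ξ (P.push l h) :=
  (P.exists_twist hD c).choose_spec ξ h hh l hl

omit [IsManifold 𝓘(ℂ) ω S] [T2Space S] [Nonempty S] [IsManifold 𝓘(ℂ) ω S'] [Nonempty S'] in
variable (D c) in
theorem exists_locConst : ∃ l, P.LocConst D l c := by
  obtain ⟨l, hl'⟩ := exists_locallyConst (P.symLift g D) c
  exact ⟨l, fun a ha => hl' a (P.mem_symLift.2 ha)⟩

variable (c) in
include hD in
theorem exists_untwist : ∃ A : SymTangent (P.symLift g D) →ₗ[ℂ] SymTangent D,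
    ∀ η h, HolNear h D → ∀ l, P.LocConst D l c →
      tr (A η) h = 2⁻¹ * tr η (fun a => l a * h (P.π a)) := by
  obtain ⟨l, hl⟩ := P.exists_locConst D c
  have hcomp : ∀ h : S → ℂ, HolNear h D → HolNear (fun a => h (P.π a)) (P.symLift g D) := by
    intro h hh a ha
    have ha' := P.mem_symLift.1 ha
    exact (hh _ ha').comp a (P.contMDiffAt_π (P.ne_w hD ha') (P.ne_z hD ha'))
  obtain ⟨A, hA⟩ := exists_transport (D := P.symLift g D) (D' := D)
    (fun h a => l a * h (P.π a)) (fun h hh => hl.holNear.mul (hcomp h hh))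
    (fun h k _ _ => by funext x; ring) (fun c h _ => by funext x; ring) (by
      intro h hh hf a ha
      have ha' := P.mem_symLift.1 ha
      rw [P.mult_symLift hD ha']
      refine FlatAt.congr (((hf _ ha').comp (P.contMDiffAt_π (P.ne_w hD ha') (P.ne_z hD ha'))
        rfl).const_mul (c a)) ?_
      filter_upwards [hl a ha'] with b hb
      rw [hb])
  refine ⟨(2⁻¹ : ℂ) • A, fun η h hh l' hl' => ?_⟩
  rw [LinearMap.smul_apply, tr_smul_left, hA η h hh]
  congr 1
  refine tr_congr η fun a ha => ?_
  filter_upwards [hl a (P.mem_symLift.1 ha), hl' a (P.mem_symLift.1 ha)] with b h1 h2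
  rw [h1, h2]

variable (c) in
/-- The map of tangent spaces `(ṽᵢ, ṽᵢ')ᵢ ↦ ((c(x̃ᵢ) ṽᵢ + c(ι x̃ᵢ) ṽᵢ') / 2)ᵢ`. -/
def untwist : SymTangent (P.symLift g D) →ₗ[ℂ] SymTangent D := (P.exists_untwist hD c).choose

theorem tr_untwist (η : SymTangent (P.symLift g D)) {h : S → ℂ} (hh : HolNear h D) {l : S' → ℂ}
    (hl : P.LocConst D l c) : tr (P.untwist hD c η) h = 2⁻¹ * tr η (fun a => l a * h (P.π a)) :=
  (P.exists_untwist hD c).choose_spec η h hh l hl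

/-- Each of the two points over an entry contributes c'c = 1; the factor one half in `untwist`
cancels the resulting 2. -/
theorem untwist_twist {c' : S' → ℂ} (hc : ∀ a, P.π a ∈ D → c' a * c a = 1) (ξ : SymTangent D) :
    P.untwist hD c' (P.twist hD c ξ) = ξ := by
  obtain ⟨l, hl⟩ := P.exists_locConst D c
  obtain ⟨l', hl'⟩ := P.exists_locConst D c'
  have hcomp : ∀ h : S → ℂ, HolNear h D → HolNear (fun a => h (P.π a)) (P.symLift g D) := by
    intro h hh a ha
    have ha' := P.mem_symLift.1 ha
    exact (hh _ ha').comp a (P.contMDiffAt_π (P.ne_w hD ha') (P.ne_z hD ha'))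
  refine tr_ext fun h hh => ?_
  rw [P.tr_untwist hD _ hh hl', P.tr_twist hD _ (hl'.holNear.mul (hcomp h hh)) hl]
  have h1 : tr ξ (P.push l fun a => l' a * h (P.π a)) = tr ξ (fun x => 2 * h x) := by
    refine tr_congr ξ fun x hx => ?_
    rw [← P.map_lift x] at hx ⊢
    have hι : P.π (P.ι (P.lift x)) ∈ D := by rwa [P.map_deck]
    obtain ⟨σ, hσ, hσa, hr, hev⟩ := hl.push_eventually hD hx (h := fun a => l' a * h (P.π a))
    have h1 : ∀ᶠ y in 𝓝 (P.π (P.lift x)), l' (σ y) = c' (P.lift x) :=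
      hσ.continuousAt.eventually (by rw [hσa]; exact hl' _ hx)
    have h2 : ∀ᶠ y in 𝓝 (P.π (P.lift x)), l' (P.ι (σ y)) = c' (P.ι (P.lift x)) :=
      (P.continuous_deck.continuousAt.comp hσ.continuousAt).eventually
        (by simp only [Function.comp, hσa]; exact hl' _ hι)
    filter_upwards [hev, hr, h1, h2] with y e0 e1 e2 e3
    rw [e0, e2, e3, P.map_deck, e1]
    linear_combination h y * hc _ hx + h y * hc _ hι
  rw [h1, tr_smul ξ 2 hh]
  ring

variable (c) in
/-- The differential of the embedding `symLift`. -/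
theorem symDifferential_symLift (ξ : SymTangent D) :
    symDifferential (P.symLift g) D (P.holAt_symLift D hD) ξ = P.twist hD (fun _ => 1) ξ := by
  refine tr_ext fun h hh => ?_
  rw [P.tr_twist hD ξ hh (l := fun _ => 1) fun a _ => Filter.Eventually.of_forall fun _ => rfl]
  rw [tr, ev_eq _ (holAt_trace hh)]
  change ξ.1 ⟨trace h ∘ P.symLift g, _⟩ = _
  rw [← ev_eq ξ]
  congr 1
  funext D'
  exact P.trace_symLift h D'

end Twist

/-! ### The deck transformation on tangent spaces at fixed points -/

section Deck

variable (P)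

/-- The image tuple is a free variable, so that at a fixed point of the involution the differential
becomes an endomorphism of one tangent space without a cast. -/
theorem exists_deckMap {n : ℕ} {D₁ D₂ : Sym S' n} (h₁ : D₁ ∈ puncturedSym S' n P.w' P.z')
    (h : P.symDeck n D₁ = D₂) : ∃ A : SymTangent D₁ →ₗ[ℂ] SymTangent D₂,
      ∀ ξ f, HolAt f D₂ → HolAt (f ∘ P.symDeck n) D₁ ∧ ev (A ξ) f = ev ξ (f ∘ P.symDeck n) := by
  subst h
  refine ⟨symDifferential (P.symDeck n) D₁ (P.holAt_symDeck D₁ h₁), fun ξ f hf => ?_⟩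
  refine ⟨P.holAt_symDeck D₁ h₁ f hf, ?_⟩
  rw [ev_eq _ hf, ev_eq _ (P.holAt_symDeck D₁ h₁ f hf)]
  rfl

variable (hD : D ∈ puncturedSym S g w z)

/-- The action of the deck transformation on the tangent spaces at the fixed points. -/
def deckT : SymTangent (P.symLift g D) →ₗ[ℂ] SymTangent (P.symLift g D) :=
  (P.exists_deckMap (P.symLift_mem hD) P.symDeck_symLift).choose

theorem ev_deckT (η : SymTangent (P.symLift g D)) {f : Sym S' (2 * g) → ℂ}
    (hf : HolAt f (P.symLift g D)) : ev (P.deckT hD η) f = ev η (f ∘ P.symDeck _) :=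
  ((P.exists_deckMap (P.symLift_mem hD) P.symDeck_symLift).choose_spec η f hf).2

include hD in
theorem holAt_comp_symDeck {f : Sym S' (2 * g) → ℂ}
    (hf : HolAt f (P.symLift g D)) : HolAt (f ∘ P.symDeck _) (P.symLift g D) :=
  ((P.exists_deckMap (P.symLift_mem hD) P.symDeck_symLift).choose_spec 0 f hf).1

theorem tr_deckT (η : SymTangent (P.symLift g D)) {h : S' → ℂ}
    (hh : HolNear h (P.symLift g D)) : tr (P.deckT hD η) h = tr η (h ∘ P.ι) := by
  rw [tr, P.ev_deckT hD η (holAt_trace hh)]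
  congr 1
  funext D'
  simp [trace, symDeck]

variable [IsManifold 𝓘(ℂ) ω S'] [T2Space S'] [Nonempty S']

include hD in
omit [IsManifold 𝓘(ℂ) ω S'] [T2Space S'] [Nonempty S'] in
theorem holNear_comp_deck {h : S' → ℂ} (hh : HolNear h (P.symLift g D)) :
    HolNear (h ∘ P.ι) (P.symLift g D) := fun a ha =>
  ContMDiffAt.comp a (hh _ (P.deck_mem_symLift.2 ha))
    (P.deck_contMDiffAt (P.ne_w hD (P.mem_symLift.1 ha)) (P.ne_z hD (P.mem_symLift.1 ha)))

variable [IsManifold 𝓘(ℂ) ω S] [T2Space S] [Nonempty S]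

theorem deckT_twist {c : S' → ℂ} {ε : ℂ} (hc : ∀ a, P.π a ∈ D → c (P.ι a) = ε * c a)
    (ξ : SymTangent D) : P.deckT hD (P.twist hD c ξ) = ε • P.twist hD c ξ := by
  obtain ⟨l, hl⟩ := P.exists_locConst D c
  refine tr_ext fun h hh => ?_
  rw [P.tr_deckT hD _ hh, P.tr_twist hD ξ (P.holNear_comp_deck hD hh) hl, tr_smul_left,
    P.tr_twist hD ξ hh hl, ← tr_smul ξ ε (hl.holNear_push hD hh)]
  refine tr_congr ξ fun x hx => ?_
  rw [← P.map_lift x] at hx ⊢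
  obtain ⟨σ, hσ, hσa, hr, hev⟩ := hl.push_eventually hD hx (h := h)
  have hι : P.π (P.ι (P.lift x)) ∈ D := by rwa [P.map_deck]
  have h1 : ∀ᶠ y in 𝓝 (P.π (P.lift x)), l (σ y) = c (P.lift x) :=
    hσ.continuousAt.eventually (by rw [hσa]; exact hl _ hx)
  have h2 : ∀ᶠ y in 𝓝 (P.π (P.lift x)), l (P.ι (σ y)) = c (P.ι (P.lift x)) :=
    (P.continuous_deck.continuousAt.comp hσ.continuousAt).eventually
      (by simp only [Function.comp, hσa]; exact hl _ hι)
  filter_upwards [hr, h1, h2] with y e1 e2 e3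
  have h4 := hc _ hι
  rw [P.deck_deck] at h4
  rw [P.push_apply l h e1, P.push_apply l _ e1, e2, e3]
  simp only [Function.comp, P.deck_deck]
  linear_combination h (P.ι (σ y)) * h4 + h (σ y) * hc _ hx

/-- On germs the composite is the average of h and ε(h ∘ ι). For ε = -1 it is the projection to the
normal fibre. -/
theorem twist_untwist {c c' : S' → ℂ} {ε : ℂ} (hc' : ∀ a, P.π a ∈ D → c' a * c a = 1)
    (hc : ∀ a, P.π a ∈ D → c (P.ι a) = ε * c a) (η : SymTangent (P.symLift g D)) :
    P.twist hD c (P.untwist hD c' η) = (2⁻¹ : ℂ) • (η + ε • P.deckT hD η) := by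
  obtain ⟨l, hl⟩ := P.exists_locConst D c
  obtain ⟨l', hl'⟩ := P.exists_locConst D c'
  refine tr_ext fun h hh => ?_
  rw [P.tr_twist hD _ hh hl, P.tr_untwist hD η (hl.holNear_push hD hh) hl', tr_smul_left,
    tr_add_left, tr_smul_left, P.tr_deckT hD η hh,
    ← tr_smul η ε (P.holNear_comp_deck hD hh),
    ← tr_add η hh ((HolNear.const ε).mul (P.holNear_comp_deck hD hh))]
  congr 1
  refine tr_congr η fun a ha => ?_
  have ha' := P.mem_symLift.1 ha
  have hι : P.π (P.ι a) ∈ D := by rwa [P.map_deck]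
  filter_upwards [hl a ha', hl' a ha', P.continuous_deck.continuousAt.eventually (hl _ hι)]
    with b e1 e2 e3
  rw [P.push_apply l h rfl, e1, e2, e3]
  simp only [Function.comp]
  linear_combination (h b + ε * h (P.ι b)) * hc' a ha' + c' a * h (P.ι b) * hc a ha'

end Deck

section NormalFibre

variable {𝓗 : HeegaardDiagram S g} (P : SurfaceDoubleCover S S' 𝓗.w 𝓗.z)
  (hD : D ∈ puncturedSym S g 𝓗.w 𝓗.z)
variable [IsManifold 𝓘(ℂ) ω S'] [T2Space S'] [Nonempty S']

theorem mem_normalFibre_iff (η : SymTangent (P.symLift g D)) :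
    η ∈ normalFibre P D ↔ P.deckT hD η = -η := by
  constructor
  · intro h
    refine tr_ext fun f hf => ?_
    have hf' := P.holAt_comp_symDeck hD (holAt_trace hf)
    rw [← neg_one_smul ℂ η, tr_smul_left, tr, tr, P.ev_deckT hD η (holAt_trace hf), ev_eq _ hf',
      ev_eq _ (holAt_trace hf), h _ (holAt_trace hf) hf']
    ring
  · intro h f hf hf'
    rw [← ev_eq η hf', ← P.ev_deckT hD η hf, h, ← neg_one_smul ℂ η, ev_smul_left, ev_eq η hf]
    ring

variable [IsManifold 𝓘(ℂ) ω S] [T2Space S] [Nonempty S]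

theorem twist_mem_normalFibre {c : S' → ℂ} (hc : ∀ a, P.π a ∈ D → c (P.ι a) = -c a)
    (ξ : SymTangent D) : P.twist hD c ξ ∈ normalFibre P D := by
  rw [P.mem_normalFibre_iff hD, P.deckT_twist hD (ε := -1) (fun a ha => by rw [hc a ha]; ring)]
  exact neg_one_smul ℂ (P.twist hD c ξ)

theorem twist_untwist_of_mem {c c' : S' → ℂ} (hc' : ∀ a, P.π a ∈ D → c' a * c a = 1)
    (hc : ∀ a, P.π a ∈ D → c (P.ι a) = -c a) {η : SymTangent (P.symLift g D)}
    (hη : η ∈ normalFibre P D) : P.twist hD c (P.untwist hD c' η) = η := by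
  rw [P.twist_untwist hD (ε := -1) hc' (fun a ha => by rw [hc a ha]; ring),
    (P.mem_normalFibre_iff hD η).1 hη]
  have h1 : (-1 : ℂ) • -η = η := by rw [smul_neg, ← neg_smul, neg_neg]; exact one_smul ℂ η
  rw [h1, ← two_smul ℂ η]
  exact inv_smul_smul₀ two_ne_zero η

/-- An odd nonvanishing function on the points over `D` identifies the tangent space with the
normal space. -/
def twistEquiv {c : S' → ℂ} (h0 : ∀ a, P.π a ∈ D → c a ≠ 0)
    (hc : ∀ a, P.π a ∈ D → c (P.ι a) = -c a) : SymTangent D ≃ₗ[ℂ] normalFibre P D :=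
  LinearEquiv.ofLinearMap ((P.twist hD c).codRestrict _ (P.twist_mem_normalFibre hD hc))
    ((P.untwist hD c⁻¹).comp (normalFibre P D).subtype)
    (LinearMap.ext fun η => Subtype.ext
      (P.twist_untwist_of_mem hD (fun a ha => inv_mul_cancel₀ (h0 a ha)) hc η.2))
    (LinearMap.ext fun ξ => P.untwist_twist hD (fun a ha => inv_mul_cancel₀ (h0 a ha)) ξ)

end NormalFibre

end SurfaceDoubleCover

end CoverMaps

end

end HFK

namespace HFK

noncomputable section

/-! ### Principal square roots in Banach algebras -/

section SquareRoot

open NormedSpace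

variable {𝔸 : Type*} [NormedRing 𝔸] [NormedAlgebra ℝ 𝔸] [CompleteSpace 𝔸]

/-- The clamp of a real number to the unit interval. -/
def clamp (t : ℝ) : ℝ := max 0 (min 1 t)

theorem clamp_mem (t : ℝ) : clamp t ∈ Icc (0 : ℝ) 1 :=
  ⟨le_max_left _ _, max_le zero_le_one (min_le_left _ _)⟩

theorem clamp_of_mem {t : ℝ} (ht : t ∈ Icc (0 : ℝ) 1) : clamp t = t := by
  rw [clamp, min_eq_right ht.2, max_eq_right ht.1]

theorem continuous_clamp : Continuous clamp := by unfold clamp; fun_prop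

/-- The segment from `1` to `b`. -/
def seg (b : 𝔸) (t : ℝ) : 𝔸 := (1 - clamp t) • (1 : 𝔸) + clamp t • b

/-- The segment from `1` to `b` consists of units. -/
def SegUnit (b : 𝔸) : Prop := ∀ t ∈ Icc (0 : ℝ) 1, IsUnit ((1 - t) • (1 : 𝔸) + t • b)

/-- The principal logarithm, integrated along the segment from `1` to `b`. -/
def segLog (b : 𝔸) (τ : ℝ) : 𝔸 := ∫ t in (0 : ℝ)..τ, (b - 1) * Ring.inverse (seg b t)

/-- The principal square root. -/
def segSqrt (b : 𝔸) : 𝔸 := exp ((2⁻¹ : ℝ) • segLog b 1)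

omit [CompleteSpace 𝔸] in
theorem SegUnit.isUnit {b : 𝔸} (hb : SegUnit b) (t : ℝ) : IsUnit (seg b t) := hb _ (clamp_mem t)

theorem continuous_segLog_integrand :
    Continuous fun q : {b : 𝔸 // SegUnit b} × ℝ =>
      (q.1.1 - 1) * Ring.inverse (seg q.1.1 q.2) := by
  refine ((continuous_subtype_val.comp continuous_fst).sub continuous_const).mul ?_
  rw [continuous_iff_continuousAt]
  intro q
  have h1 : Continuous fun q : {b : 𝔸 // SegUnit b} × ℝ => seg q.1.1 q.2 := by
    unfold seg
    have := continuous_clamp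
    fun_prop
  obtain ⟨u, hu⟩ := q.1.2.isUnit q.2
  have h2 := NormedRing.inverse_continuousAt u
  rw [hu] at h2
  exact ContinuousAt.comp (f := fun q : {b : 𝔸 // SegUnit b} × ℝ => seg q.1.1 q.2) h2 h1.continuousAt

theorem SegUnit.continuous_integrand {b : 𝔸} (hb : SegUnit b) :
    Continuous fun t : ℝ => (b - 1) * Ring.inverse (seg b t) :=
  continuous_segLog_integrand.comp (Continuous.prodMk_right (⟨b, hb⟩ : {b : 𝔸 // SegUnit b}))

theorem continuous_segSqrt : Continuous fun b : {b : 𝔸 // SegUnit b} => segSqrt b.1 := by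
  have h1 : Continuous fun b : {b : 𝔸 // SegUnit b} => segLog b.1 1 :=
    intervalIntegral.continuous_parametric_intervalIntegral_of_continuous'
      (f := fun (b : {b : 𝔸 // SegUnit b}) (t : ℝ) => (b.1 - 1) * Ring.inverse (seg b.1 t))
      continuous_segLog_integrand 0 1
  let _ := NormedAlgebra.restrictScalars ℚ ℝ 𝔸
  exact (NormedSpace.exp_continuous).comp (h1.const_smul (2⁻¹ : ℝ))

omit [NormedAlgebra ℝ 𝔸] [CompleteSpace 𝔸] in
theorem commute_ringInverse {x y : 𝔸} (h : Commute x y) : Commute x (Ring.inverse y) := by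
  by_cases hy : IsUnit y
  · obtain ⟨u, rfl⟩ := hy
    rw [Ring.inverse_unit]
    exact h.units_inv_right
  · rw [Ring.inverse_non_unit _ hy]
    exact Commute.zero_right x

theorem commute_intervalIntegral {f : ℝ → 𝔸} (hf : Continuous f) {x : 𝔸}
    (h : ∀ s, Commute (f s) x) (c d : ℝ) : Commute (∫ s in c..d, f s) x := by
  have h1 := ((ContinuousLinearMap.mul ℝ 𝔸).flip x -
    ContinuousLinearMap.mul ℝ 𝔸 x).intervalIntegral_comp_comm
      (hf.intervalIntegrable (μ := MeasureTheory.volume) c d)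
  have h2 : ∀ s, ((ContinuousLinearMap.mul ℝ 𝔸).flip x - ContinuousLinearMap.mul ℝ 𝔸 x) (f s) =
      0 := fun s => sub_eq_zero.2 (h s)
  simp only [h2, intervalIntegral.integral_zero] at h1
  exact sub_eq_zero.1 h1.symm

omit [CompleteSpace 𝔸] in
theorem commute_seg (b : 𝔸) (s t : ℝ) : Commute (seg b s) (seg b t) := by
  have h1 : ∀ s, Commute b (seg b s) := fun s =>
    ((Commute.one_right b).smul_right _).add_right ((Commute.refl b).smul_right _)
  unfold seg
  exact Commute.add_left ((Commute.one_left _).smul_left _) ((h1 t).smul_left _)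

omit [CompleteSpace 𝔸] in
theorem commute_sub_seg (b : 𝔸) (t : ℝ) : Commute (b - 1) (seg b t) := by
  unfold seg
  refine (((Commute.one_right _).smul_right _).add_right (Commute.smul_right ?_ _))
  exact (Commute.refl b).sub_left (Commute.one_left b)

omit [CompleteSpace 𝔸] in
theorem commute_integrand (b : 𝔸) (s t : ℝ) :
    Commute ((b - 1) * Ring.inverse (seg b s)) ((b - 1) * Ring.inverse (seg b t)) := by
  have h1 := (commute_ringInverse (commute_sub_seg b t))
  have h2 := (commute_ringInverse (commute_sub_seg b s))
  have h3 := ((commute_seg b s t).ringInverse_ringInverse)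
  exact ((Commute.refl _).mul_right h1).mul_left (h2.symm.mul_right h3)

theorem SegUnit.commute_segLog {b : 𝔸} (hb : SegUnit b) (s t : ℝ) :
    Commute (segLog b s) (segLog b t) :=
  commute_intervalIntegral hb.continuous_integrand (fun s => (commute_intervalIntegral
    hb.continuous_integrand (fun t => commute_integrand b t s) 0 t).symm) 0 s

/-- The values L(s) of the logarithm commute, so exp(-L(s)) = exp(-L(τ)) exp(L(τ) - L(s)), and only
the derivative of the exponential at 0 is needed. -/
theorem SegUnit.hasDerivAt_exp {b : 𝔸} (hb : SegUnit b) (τ : ℝ) :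
    HasDerivAt (fun s => exp (-segLog b s))
      (exp (-segLog b τ) * -((b - 1) * Ring.inverse (seg b τ))) τ := by
  have hc := hb.continuous_integrand
  have h1 : HasDerivAt (segLog b) ((b - 1) * Ring.inverse (seg b τ)) τ :=
    intervalIntegral.integral_hasDerivAt_right (hc.intervalIntegrable _ _)
      (hc.stronglyMeasurableAtFilter _ _) hc.continuousAt
  have h2 : HasDerivAt (fun s => segLog b τ - segLog b s)
      (-((b - 1) * Ring.inverse (seg b τ))) τ := h1.const_sub _
  have h3 : HasFDerivAt (exp : 𝔸 → 𝔸) (1 : 𝔸 →L[ℝ] 𝔸) ((fun s => segLog b τ - segLog b s) τ) := by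
    simp only [sub_self]
    exact hasFDerivAt_exp_zero
  have h4 := (h3.comp_hasDerivAt τ h2).const_mul (exp (-segLog b τ))
  refine h4.congr_of_eventuallyEq (Filter.Eventually.of_forall fun s => ?_)
  change exp (-segLog b s) = exp (-segLog b τ) * exp (segLog b τ - segLog b s)
  let _ := NormedAlgebra.restrictScalars ℚ ℝ 𝔸
  rw [← NormedSpace.exp_add_of_commute
    (((Commute.refl _).sub_right (hb.commute_segLog τ s)).neg_left)]
  congr 1
  abel

/-- The product of exp(-L(τ)) with the point of the segment at time τ has zero derivative and starts
at 1. -/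
theorem SegUnit.exp_segLog {b : 𝔸} (hb : SegUnit b) : exp (segLog b 1) = b := by
  have h1 : ∀ τ ∈ Icc (0 : ℝ) 1, exp (-segLog b τ) * ((1 - τ) • (1 : 𝔸) + τ • b) =
      exp (-segLog b 0) * ((1 - (0 : ℝ)) • (1 : 𝔸) + (0 : ℝ) • b) := by
    have hd : ∀ τ ∈ Icc (0 : ℝ) 1, HasDerivAt
        (fun τ : ℝ => exp (-segLog b τ) * ((1 - τ) • (1 : 𝔸) + τ • b)) 0 τ := by
      intro τ hτ
      have h2 : HasDerivAt (fun τ : ℝ => (1 - τ) • (1 : 𝔸) + τ • b) (b - 1) τ := by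
        have := (((hasDerivAt_id τ).const_sub 1).smul_const (1 : 𝔸)).add
          ((hasDerivAt_id τ).smul_const b)
        refine this.congr_deriv ?_
        rw [neg_smul, one_smul, one_smul]; abel
      refine ((hb.hasDerivAt_exp τ).mul h2).congr_deriv ?_
      have h3 : (1 - τ) • (1 : 𝔸) + τ • b = seg b τ := by rw [seg, clamp_of_mem hτ]
      rw [h3, mul_assoc, neg_mul, mul_assoc, Ring.inverse_mul_cancel _ (hb.isUnit τ), mul_one,
        ← mul_add]
      simp
    exact constant_of_has_deriv_right_zero
      (fun τ hτ => (hd τ hτ).continuousAt.continuousWithinAt)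
      (fun τ hτ => (hd τ (Ico_subset_Icc_self hτ)).hasDerivWithinAt)
  have h2 := h1 1 ⟨zero_le_one, le_rfl⟩
  simp only [segLog, intervalIntegral.integral_same, neg_zero, exp_zero, sub_self, zero_smul,
    one_smul, zero_add, sub_zero, add_zero, mul_one] at h2
  let _ := NormedAlgebra.restrictScalars ℚ ℝ 𝔸
  have h3 : exp (segLog b 1) * exp (-segLog b 1) = 1 := by
    rw [← NormedSpace.exp_add_of_commute (Commute.neg_right (Commute.refl _))]
    simp
  calc exp (segLog b 1) = exp (segLog b 1) * (exp (-segLog b 1) * b) := by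
        rw [show exp (-segLog b 1) * b = 1 from h2, mul_one]
    _ = b := by rw [← mul_assoc, h3, one_mul]

theorem SegUnit.segSqrt_mul_self {b : 𝔸} (hb : SegUnit b) : segSqrt b * segSqrt b = b := by
  let _ := NormedAlgebra.restrictScalars ℚ ℝ 𝔸
  rw [segSqrt, ← NormedSpace.exp_add_of_commute (Commute.refl _), ← add_smul]
  norm_num
  exact hb.exp_segLog

omit [CompleteSpace 𝔸] in
theorem segSqrt_one : segSqrt (1 : 𝔸) = 1 := by simp [segSqrt, segLog]

/-- Continuous linear maps that are multiplicative on commuting elements respect principal square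
roots. -/
theorem SegUnit.map_segSqrt {𝔹 : Type*} [NormedRing 𝔹] [NormedAlgebra ℝ 𝔹] [CompleteSpace 𝔹]
    {b : 𝔸} (hb : SegUnit b) (φ : 𝔸 →L[ℝ] 𝔹) (h1 : φ 1 = 1)
    (hmul : ∀ x y, Commute x y → φ (x * y) = φ x * φ y) : φ (segSqrt b) = segSqrt (φ b) := by
  have hinv : ∀ x, IsUnit x → φ (Ring.inverse x) = Ring.inverse (φ x) := by
    intro x hx
    have e1 : φ x * φ (Ring.inverse x) = 1 := by
      rw [← hmul _ _ (commute_ringInverse (Commute.refl x)), Ring.mul_inverse_cancel _ hx, h1]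
    have e2 : φ (Ring.inverse x) * φ x = 1 := by
      rw [← hmul _ _ (commute_ringInverse (Commute.refl x)).symm, Ring.inverse_mul_cancel _ hx, h1]
    have := Ring.inverse_unit (⟨φ x, φ (Ring.inverse x), e1, e2⟩ : 𝔹ˣ)
    exact this.symm
  have hpow : ∀ (x : 𝔸) (n : ℕ), φ (x ^ n) = φ x ^ n := by
    intro x n
    induction n with
    | zero => simp [h1]
    | succ n ih => rw [pow_succ, pow_succ, hmul _ _ ((Commute.refl x).pow_left n), ih]
  have hexp : ∀ x, φ (exp x) = exp (φ x) := by
    intro x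
    rw [exp_eq_tsum ℝ, exp_eq_tsum ℝ, φ.map_tsum (expSeries_summable' (𝕂 := ℝ) x)]
    simp only [map_smul, hpow]
  have hseg : ∀ t, φ (seg b t) = seg (φ b) t := fun t => by simp [seg, h1]
  rw [segSqrt, hexp, map_smul, segSqrt, segLog, segLog,
    ← ContinuousLinearMap.intervalIntegral_comp_comm φ (hb.continuous_integrand.intervalIntegrable _ _)]
  congr 3
  funext t
  rw [hmul _ _ (commute_ringInverse (commute_sub_seg b t)), hinv _ (hb.isUnit t), hseg, map_sub, h1]

/-- Multiplicativity is asked on commuting pairs only, so that anti-automorphisms such as x ↦ a⁻¹xᵀa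
are covered as well as conjugations. -/
theorem SegUnit.map_segSqrt' {𝔹 : Type*} [NormedRing 𝔹] [NormedAlgebra ℝ 𝔹] [CompleteSpace 𝔹]
    {b : 𝔸} (hb : SegUnit b) (φ : 𝔸 → 𝔹) (hadd : ∀ x y, φ (x + y) = φ x + φ y)
    (hsmul : ∀ (c : ℝ) x, φ (c • x) = c • φ x) (hc : Continuous φ) (h1 : φ 1 = 1)
    (hmul : ∀ x y, Commute x y → φ (x * y) = φ x * φ y) : φ (segSqrt b) = segSqrt (φ b) :=
  hb.map_segSqrt ⟨⟨⟨φ, hadd⟩, hsmul⟩, hc⟩ h1 hmul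

end SquareRoot

/-! ### Square roots relating two skew matrices -/

section Forms

open Matrix

variable {ι : Type*} [Fintype ι] [DecidableEq ι]

attribute [local instance] Matrix.linftyOpNormedRing Matrix.linftyOpNormedAlgebra

/-- The matrix `R` with `Rᵀ a R = b`, for skew matrices `a` and `b` that are joined by a segment of
invertible matrices. -/
def sqrtForm (a b : Matrix ι ι ℝ) : Matrix ι ι ℝ := segSqrt (a⁻¹ * b)

/-- The segment from `a` to `b` consists of invertible matrices. -/
def SegInv (a b : Matrix ι ι ℝ) : Prop :=
  ∀ t ∈ Icc (0 : ℝ) 1, IsUnit ((1 - t) • a + t • b).det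

variable {a b : Matrix ι ι ℝ}

theorem SegInv.isUnit (h : SegInv a b) : IsUnit a.det := by
  simpa using h 0 ⟨le_rfl, zero_le_one⟩

theorem SegInv.segUnit (h : SegInv a b) : SegUnit (a⁻¹ * b) := by
  intro t ht
  have h1 : (1 - t) • (1 : Matrix ι ι ℝ) + t • (a⁻¹ * b) = a⁻¹ * ((1 - t) • a + t • b) := by
    rw [mul_add, Matrix.mul_smul, Matrix.mul_smul, nonsing_inv_mul _ h.isUnit]
  rw [h1]
  refine IsUnit.mul ?_ ((isUnit_iff_isUnit_det _).2 (h t ht))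
  exact (isUnit_iff_isUnit_det _).2 (isUnit_nonsing_inv_det _ h.isUnit)

theorem sqrtForm_self (h : IsUnit a.det) : sqrtForm a a = 1 := by
  rw [sqrtForm, nonsing_inv_mul _ h, segSqrt_one]

/-- For skew `a` and `b` the matrix a⁻¹b is fixed by the anti-automorphism x ↦ a⁻¹xᵀa. By naturality
its principal root R is fixed too, which says Rᵀa = aR, and so RᵀaR = aR² = b. -/
theorem SegInv.sqrtForm_congr (h : SegInv a b) (ha : aᵀ = -a) (hb : bᵀ = -b) :
    (sqrtForm a b)ᵀ * a * sqrtForm a b = b := by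
  have hu := h.isUnit
  have hmul : ∀ x y : Matrix ι ι ℝ, Commute x y →
      a⁻¹ * (x * y)ᵀ * a = a⁻¹ * xᵀ * a * (a⁻¹ * yᵀ * a) := by
    intro x y hxy
    rw [hxy.eq, transpose_mul]
    calc a⁻¹ * (xᵀ * yᵀ) * a = a⁻¹ * xᵀ * (1 * (yᵀ * a)) := by
          simp only [one_mul, Matrix.mul_assoc]
      _ = a⁻¹ * xᵀ * a * (a⁻¹ * yᵀ * a) := by
        rw [← mul_nonsing_inv _ hu]; simp only [Matrix.mul_assoc]
  have hone : a⁻¹ * (1 : Matrix ι ι ℝ)ᵀ * a = 1 := by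
    rw [transpose_one, mul_one, nonsing_inv_mul _ hu]
  have hadd : ∀ x y : Matrix ι ι ℝ, a⁻¹ * (x + y)ᵀ * a = a⁻¹ * xᵀ * a + a⁻¹ * yᵀ * a :=
    fun x y => by rw [transpose_add, mul_add, add_mul]
  have hsmul : ∀ (c : ℝ) (x : Matrix ι ι ℝ), a⁻¹ * (c • x)ᵀ * a = c • (a⁻¹ * xᵀ * a) :=
    fun c x => by simp
  have hcont : Continuous fun x : Matrix ι ι ℝ => a⁻¹ * xᵀ * a := by fun_prop
  have h1 : a⁻¹ * (segSqrt (a⁻¹ * b))ᵀ * a = segSqrt (a⁻¹ * (a⁻¹ * b)ᵀ * a) :=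
    h.segUnit.map_segSqrt' (fun x => a⁻¹ * xᵀ * a) hadd hsmul hcont hone hmul
  have h2 : a⁻¹ * (a⁻¹ * b)ᵀ * a = a⁻¹ * b := by
    rw [transpose_mul, transpose_nonsing_inv, ha, hb, Matrix.mul_assoc, Matrix.mul_assoc]
    congr 1
    have : (-a)⁻¹ = -a⁻¹ := by
      refine inv_eq_right_inv ?_
      rw [neg_mul_neg, mul_nonsing_inv _ hu]
    rw [this, neg_mul, neg_mul, mul_neg, neg_neg, nonsing_inv_mul _ hu, mul_one]
  rw [h2] at h1
  have h3 : (sqrtForm a b)ᵀ * a = a * sqrtForm a b := by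
    conv_rhs => rw [sqrtForm, ← h1, Matrix.mul_assoc a⁻¹, mul_nonsing_inv_cancel_left _ _ hu]
    rfl
  rw [h3, Matrix.mul_assoc, sqrtForm, h.segUnit.segSqrt_mul_self,
    mul_nonsing_inv_cancel_left _ _ hu]

/-- A change of basis conjugates a⁻¹b, and principal roots commute with conjugation. -/
theorem SegInv.sqrtForm_conj (h : SegInv a b) {G : Matrix ι ι ℝ} (hG : IsUnit G.det) :
    G * sqrtForm (Gᵀ * a * G) (Gᵀ * b * G) = sqrtForm a b * G := by
  have hGt : IsUnit Gᵀ.det := by rwa [det_transpose]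
  have hmul : ∀ x y : Matrix ι ι ℝ, Commute x y →
      G⁻¹ * (x * y) * G = G⁻¹ * x * G * (G⁻¹ * y * G) := by
    intro x y _
    calc G⁻¹ * (x * y) * G = G⁻¹ * x * (1 * (y * G)) := by simp only [one_mul, Matrix.mul_assoc]
      _ = G⁻¹ * x * G * (G⁻¹ * y * G) := by
        rw [← mul_nonsing_inv _ hG]; simp only [Matrix.mul_assoc]
  have hone : G⁻¹ * (1 : Matrix ι ι ℝ) * G = 1 := by rw [mul_one, nonsing_inv_mul _ hG]
  have hadd : ∀ x y : Matrix ι ι ℝ, G⁻¹ * (x + y) * G = G⁻¹ * x * G + G⁻¹ * y * G :=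
    fun x y => by rw [mul_add, add_mul]
  have hsmul : ∀ (c : ℝ) (x : Matrix ι ι ℝ), G⁻¹ * (c • x) * G = c • (G⁻¹ * x * G) :=
    fun c x => by simp
  have hcont : Continuous fun x : Matrix ι ι ℝ => G⁻¹ * x * G := by fun_prop
  have h1 : G⁻¹ * segSqrt (a⁻¹ * b) * G = segSqrt (G⁻¹ * (a⁻¹ * b) * G) :=
    h.segUnit.map_segSqrt' (fun x => G⁻¹ * x * G) hadd hsmul hcont hone hmul
  have h2 : (Gᵀ * a * G)⁻¹ * (Gᵀ * b * G) = G⁻¹ * (a⁻¹ * b) * G := by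
    rw [Matrix.mul_inv_rev, Matrix.mul_inv_rev]
    calc G⁻¹ * (a⁻¹ * Gᵀ⁻¹) * (Gᵀ * b * G) = G⁻¹ * a⁻¹ * (Gᵀ⁻¹ * Gᵀ) * b * G := by
          simp only [Matrix.mul_assoc]
      _ = _ := by rw [nonsing_inv_mul _ hGt, mul_one]; simp only [Matrix.mul_assoc]
  rw [sqrtForm, h2, ← h1, Matrix.mul_assoc G⁻¹, mul_nonsing_inv_cancel_left _ _ hG, sqrtForm]

theorem continuousOn_sqrtForm {B : Type*} [TopologicalSpace B] {s : Set B}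
    {a b : B → Matrix ι ι ℝ} (ha : ContinuousOn a s) (hb : ContinuousOn b s)
    (h : ∀ x ∈ s, SegInv (a x) (b x)) : ContinuousOn (fun x => sqrtForm (a x) (b x)) s := by
  rw [continuousOn_iff_continuous_domRestrict] at ha hb ⊢
  have h1 : Continuous fun x : s => (a x)⁻¹ * b x := by
    refine Continuous.mul ?_ hb
    rw [continuous_iff_continuousAt]
    intro x
    have h2 : ContinuousAt (fun x : s => Ring.inverse (a x).det) x := by
      simp only [Ring.inverse_eq_inv']
      exact (Continuous.matrix_det ha).continuousAt.inv₀ (h x x.2).isUnit.ne_zero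
    simp only [Matrix.inv_def]
    exact h2.smul (Continuous.matrix_adjugate ha).continuousAt
  exact continuous_segSqrt.comp (Continuous.subtype_mk h1 fun x => (h x x.2).segUnit)

end Forms

/-! ### Root maps and Lagrangian subspaces -/

section VectorSpaces

open Matrix

variable {ι : Type*} [Fintype ι] [DecidableEq ι]
variable {V : Type*} [AddCommGroup V] [Module ℝ V] {V' : Type*} [AddCommGroup V'] [Module ℝ V']

/-- The matrix of a form in linear coordinates. -/
def formMatrix (e : (ι → ℝ) →ₗ[ℝ] V) (θ : V →ₗ[ℝ] V →ₗ[ℝ] ℝ) : Matrix ι ι ℝ :=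
  LinearMap.toMatrix₂' ℝ (θ.compl₁₂ e e)

theorem formMatrix_apply (e : (ι → ℝ) →ₗ[ℝ] V) (θ : V →ₗ[ℝ] V →ₗ[ℝ] ℝ) (i j : ι) :
    formMatrix e θ i j = θ (e (Pi.single i 1)) (e (Pi.single j 1)) := by
  simp [formMatrix, LinearMap.toMatrix₂'_apply]

theorem form_eq (e : (ι → ℝ) →ₗ[ℝ] V) (θ : V →ₗ[ℝ] V →ₗ[ℝ] ℝ) (u v : ι → ℝ) :
    θ (e u) (e v) = u ⬝ᵥ formMatrix e θ *ᵥ v := by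
  rw [← Matrix.toLinearMap₂'_apply', formMatrix, Matrix.toLinearMap₂'_toMatrix',
    LinearMap.compl₁₂_apply]

theorem formMatrix_comp (e : (ι → ℝ) →ₗ[ℝ] V) (G : Matrix ι ι ℝ) (θ : V →ₗ[ℝ] V →ₗ[ℝ] ℝ) :
    formMatrix (e.comp (toLin' G)) θ = Gᵀ * formMatrix e θ * G := by
  have h := LinearMap.toMatrix₂'_compl₁₂ (θ.compl₁₂ e e) (toLin' G) (toLin' G)
  rw [LinearMap.toMatrix'_toLin'] at h
  exact h

theorem formMatrix_transpose (e : (ι → ℝ) →ₗ[ℝ] V) {θ : V →ₗ[ℝ] V →ₗ[ℝ] ℝ}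
    (hθ : ∀ u, θ u u = 0) : (formMatrix e θ)ᵀ = -formMatrix e θ := by
  ext i j
  rw [transpose_apply, neg_apply, formMatrix_apply, formMatrix_apply]
  have h := hθ (e (Pi.single i 1) + e (Pi.single j 1))
  simp only [map_add, LinearMap.add_apply, hθ, zero_add, add_zero] at h
  linarith

/-- The forms on the segment from `θ` to `η` are nondegenerate. -/
def SegNondeg (θ η : V →ₗ[ℝ] V →ₗ[ℝ] ℝ) : Prop :=
  ∀ t ∈ Icc (0 : ℝ) 1, ∀ u, (∀ v, (1 - t) * θ u v + t * η u v = 0) → u = 0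

theorem SegNondeg.segInv {θ η : V →ₗ[ℝ] V →ₗ[ℝ] ℝ} (h : SegNondeg θ η) (e : (ι → ℝ) ≃ₗ[ℝ] V) :
    SegInv (formMatrix e.toLinearMap θ) (formMatrix e.toLinearMap η) := by
  intro t ht
  rw [isUnit_iff_ne_zero]
  intro h0
  obtain ⟨v, hv, hv0⟩ := Matrix.exists_vecMul_eq_zero_iff.2 h0
  refine hv (e.map_eq_zero_iff.1 (h t ht _ fun w => ?_))
  obtain ⟨w, rfl⟩ := e.surjective w
  have h1 := form_eq e.toLinearMap θ v w
  have h2 := form_eq e.toLinearMap η v w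
  simp only [LinearEquiv.coe_coe] at h1 h2
  rw [h1, h2, ← smul_eq_mul, ← smul_eq_mul, ← dotProduct_smul, ← dotProduct_smul, ← smul_mulVec,
    ← smul_mulVec, ← dotProduct_add, ← add_mulVec, dotProduct_mulVec, hv0, zero_dotProduct]

/-- The canonical linear map `R` with `θ (R u) (R v) = η u v`. -/
def rootMap (e : (ι → ℝ) ≃ₗ[ℝ] V) (θ η : V →ₗ[ℝ] V →ₗ[ℝ] ℝ) : V →ₗ[ℝ] V :=
  e.toLinearMap ∘ₗ toLin' (sqrtForm (formMatrix e.toLinearMap θ) (formMatrix e.toLinearMap η)) ∘ₗ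
    e.symm.toLinearMap

theorem rootMap_apply (e : (ι → ℝ) ≃ₗ[ℝ] V) (θ η : V →ₗ[ℝ] V →ₗ[ℝ] ℝ) (u : ι → ℝ) :
    rootMap e θ η (e u) =
      e (sqrtForm (formMatrix e.toLinearMap θ) (formMatrix e.toLinearMap η) *ᵥ u) := by
  simp [rootMap]

theorem sqrtForm_form (e : (ι → ℝ) →ₗ[ℝ] V) {θ : V →ₗ[ℝ] V →ₗ[ℝ] ℝ} {b : Matrix ι ι ℝ}
    (h : SegInv (formMatrix e θ) b) (hθ : ∀ u, θ u u = 0) (hb : bᵀ = -b) (u v : ι → ℝ) :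
    θ (e (sqrtForm (formMatrix e θ) b *ᵥ u)) (e (sqrtForm (formMatrix e θ) b *ᵥ v)) =
      u ⬝ᵥ b *ᵥ v := by
  rw [form_eq]
  conv_rhs => rw [← h.sqrtForm_congr (formMatrix_transpose e hθ) hb]
  rw [← mulVec_mulVec, ← mulVec_mulVec, dotProduct_mulVec u, vecMul_transpose]

theorem rootMap_form (e : (ι → ℝ) ≃ₗ[ℝ] V) {θ η : V →ₗ[ℝ] V →ₗ[ℝ] ℝ} (h : SegNondeg θ η)
    (hθ : ∀ u, θ u u = 0) (hη : ∀ u, η u u = 0) (u v : V) :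
    θ (rootMap e θ η u) (rootMap e θ η v) = η u v := by
  obtain ⟨u, rfl⟩ := e.surjective u
  obtain ⟨v, rfl⟩ := e.surjective v
  rw [rootMap_apply, rootMap_apply]
  exact (sqrtForm_form e.toLinearMap (h.segInv e) hθ (formMatrix_transpose _ hη) u v).trans
    (form_eq e.toLinearMap η u v).symm

/-- This is what makes the root map canonical: it can be computed in any local trivialization of a
bundle, and it is natural under isomorphisms. -/
theorem rootMap_indep (e f : (ι → ℝ) ≃ₗ[ℝ] V) {θ η : V →ₗ[ℝ] V →ₗ[ℝ] ℝ} (h : SegNondeg θ η) :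
    rootMap e θ η = rootMap f θ η := by
  let G : Matrix ι ι ℝ := LinearMap.toMatrix' (e.trans f.symm).toLinearMap
  have hG : IsUnit G.det := by
    have := LinearEquiv.isUnit_det (e.trans f.symm) (Pi.basisFun ℝ ι) (Pi.basisFun ℝ ι)
    rwa [LinearMap.toMatrix_eq_toMatrix'] at this
  have he : e.toLinearMap = f.toLinearMap ∘ₗ toLin' G := by
    refine LinearMap.ext fun u => ?_
    simp only [G, toLin'_toMatrix', LinearMap.comp_apply, LinearEquiv.coe_coe,
      LinearEquiv.trans_apply, f.apply_symm_apply]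
  ext x
  obtain ⟨u, rfl⟩ := e.surjective x
  have h1 : e u = f (G *ᵥ u) := LinearMap.congr_fun he u
  have h2 := (h.segInv f).sqrtForm_conj hG
  rw [rootMap_apply]
  have h3 : ∀ u, e u = f (G *ᵥ u) := fun u => LinearMap.congr_fun he u
  rw [h3, h3, rootMap_apply, he, formMatrix_comp, formMatrix_comp, mulVec_mulVec, mulVec_mulVec, h2]

/-- If x = a + Jb is orthogonal to W, then 0 = θ(x, b) = -θ(b, Jb), and tameness forces b = 0. -/
theorem isLagrangian_of_isotropic {θ : V →ₗ[ℝ] V →ₗ[ℝ] ℝ} {W : Submodule ℝ V} {J : V → V}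
    (hθ : ∀ u, θ u u = 0) (hJ : J 0 = 0) (ht : ∀ u, u ≠ 0 → 0 < θ u (J u)) (hi : ∀ u ∈ W, ∀ v ∈ W, θ u v = 0)
    (hs : ∀ u, ∃ a ∈ W, ∃ b ∈ W, u = a + J b) : IsLagrangian θ W := by
  intro x
  refine ⟨fun hx y hy => hi x hx y hy, fun h => ?_⟩
  obtain ⟨a, ha, b, hb, rfl⟩ := hs x
  have hskew : θ (J b) b = -θ b (J b) := by
    have := hθ (J b + b)
    simp only [map_add, LinearMap.add_apply, hθ, zero_add, add_zero] at this
    linarith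
  have h1 := h b hb
  rw [map_add, LinearMap.add_apply, hi a ha b hb, hskew] at h1
  have hb0 : b = 0 := by
    by_contra hb0
    have := ht b hb0
    linarith
  rwa [hb0, hJ, add_zero]

theorem IsLagrangian.map {θ : V →ₗ[ℝ] V →ₗ[ℝ] ℝ} {κ : V' →ₗ[ℝ] V' →ₗ[ℝ] ℝ} {W : Submodule ℝ V'}
    (hW : IsLagrangian κ W) (Φ : V' ≃ₗ[ℝ] V) (h : ∀ u v, θ (Φ u) (Φ v) = κ u v) :
    IsLagrangian θ (W.map Φ.toLinearMap) := by
  intro x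
  obtain ⟨u, rfl⟩ := Φ.surjective x
  have h1 : Φ u ∈ W.map Φ.toLinearMap ↔ u ∈ W := by
    rw [Submodule.mem_map]
    exact ⟨fun ⟨y, hy, he⟩ => Φ.injective he ▸ hy, fun hu => ⟨u, hu, rfl⟩⟩
  rw [h1, hW u]
  constructor
  · rintro h2 _ ⟨v, hv, rfl⟩
    exact (h u v).trans (h2 v hv)
  · intro h2 v hv
    rw [← h]
    exact h2 _ ⟨v, hv, rfl⟩

end VectorSpaces

end

end HFK

namespace HFK

noncomputable section

/-! ### An odd circle-valued function from a Seifert surface -/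

section OddFunction

universe u v a

variable {Y : Type u} [TopologicalSpace Y] {K : Set Y} {F : Type v} [TopologicalSpace F]
  [ChartedSpace (EuclideanHalfSpace 2) F] {Q : SeifertSurface K F} {Y' : Type a}
  [TopologicalSpace Y'] (C : BranchedDoubleCover Q Y')

namespace BranchedDoubleCover

theorem p_τ (b : Y') : C.p (C.τ b) = C.p b := ((C.fibre b (C.τ b)).2 (Or.inr rfl)).symm

/-- The complement of the branch set. -/
abbrev Off : Type a := ↥(C.p ⁻¹' Kᶜ)

/-- The covering of the complement of the knot. -/
def q : C.Off → ↥Kᶜ := Kᶜ.restrictPreimage C.p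

theorem isCoveringMap_q : IsCoveringMap C.q := C.covering.isCoveringMap_restrictPreimage

theorem coe_q (b : C.Off) : (C.q b : Y) = C.p b := rfl

/-- The deck transformation of the unbranched covering. -/
def deck (b : C.Off) : C.Off :=
  ⟨C.τ b, by have := b.2; rwa [mem_preimage, ← C.p_τ] at this⟩

theorem q_deck (b : C.Off) : C.q (C.deck b) = C.q b := Subtype.ext (C.p_τ b)

theorem continuous_deck : Continuous C.deck :=
  (C.continuous_τ.comp continuous_subtype_val).subtype_mk _

open scoped Classical in
/-- The sheet containing a point. -/
def sgn (b : C.Off) : ℂ := if b.1 ∈ C.sheet then 1 else -1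

theorem sgn_deck {b : C.Off} (hb : C.p b ∉ range Q.emb) : C.sgn (C.deck b) = -C.sgn b := by
  have h := C.sheet_compl b hb
  by_cases h1 : b.1 ∈ C.sheet
  · simp [sgn, deck, h1, h.1 h1]
  · have h2 : C.τ b ∈ C.sheet := not_not.1 fun h2 => h1 (h.2 h2)
    simp [sgn, deck, h1, h2]

/-- Off the surface the complement of the sheet is its preimage under the deck transformation, so
the sheet and its complement are both open there. -/
theorem continuousOn_sgn : ContinuousOn C.sgn {b | C.p b ∉ range Q.emb} := by
  intro b hb
  refine ContinuousAt.continuousWithinAt ?_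
  by_cases h1 : b.1 ∈ C.sheet
  · refine (continuousAt_const (y := (1 : ℂ))).congr ?_
    filter_upwards [(C.sheet_isOpen.preimage continuous_subtype_val).mem_nhds h1] with b' hb'
    exact (if_pos hb').symm
  · have h2 : C.τ b ∈ C.sheet := not_not.1 fun h2 => h1 ((C.sheet_compl b hb).2 h2)
    refine (continuousAt_const (y := (-1 : ℂ))).congr ?_
    filter_upwards [(C.sheet_isOpen.preimage
      (C.continuous_τ.comp continuous_subtype_val)).mem_nhds h2] with b' hb'
    have h3 : C.p b' ∉ range Q.emb := by rw [← C.p_τ]; exact C.sheet_subset _ hb'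
    exact (if_neg fun h4 => (C.sheet_compl b' h3).1 h4 hb').symm

/-- The part of the covering over the bicollar. -/
def collar : Set C.Off := C.q ⁻¹' range Q.bicollar

theorem isClosed_collar : IsClosed C.collar :=
  Q.bicollar_isClosedEmbedding.isClosed_range.preimage C.isCoveringMap_q.continuous

/-- The collar coordinates. -/
def coords (b : C.collar) : (𝓡∂ 2).interior F × Icc (-1 : ℝ) 1 :=
  Q.bicollar_isClosedEmbedding.isEmbedding.toHomeomorph.symm ⟨C.q b, b.2⟩

theorem continuous_coords : Continuous C.coords :=
  (Homeomorph.continuous _).comp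
    ((C.isCoveringMap_q.continuous.comp continuous_subtype_val).subtype_mk _)

theorem bicollar_coords (b : C.collar) : Q.bicollar (C.coords b) = C.q b :=
  congrArg Subtype.val
    (Q.bicollar_isClosedEmbedding.isEmbedding.toHomeomorph.apply_symm_apply ⟨C.q b, b.2⟩)

theorem coords_eq {b : C.collar} {r} (h : Q.bicollar r = C.q b) : C.coords b = r :=
  Q.bicollar_isClosedEmbedding.injective ((C.bicollar_coords b).trans h.symm)

/-- Moving to the positive end of the collar. -/
def slide : C(unitInterval × C.collar, ↥Kᶜ) where
  toFun r := Q.bicollar ((C.coords r.2).1,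
    ⟨(1 - r.1) * (C.coords r.2).2 + r.1, by
      have h1 := r.1.2
      have h2 := (C.coords r.2).2.2
      constructor
      · nlinarith [h1.1, h1.2, h2.1, h2.2]
      · nlinarith [h1.1, h1.2, h2.1, h2.2]⟩)
  continuous_toFun := by
    refine Q.bicollar_isClosedEmbedding.continuous.comp ?_
    have := C.continuous_coords
    fun_prop

theorem slide_zero (b : C.collar) : C.slide (0, b) = C.q b := by
  rw [← C.bicollar_coords b]
  simp [slide]

/-- The lift of `slide`. -/
def slideLift : C(unitInterval × C.collar, C.Off) :=
  C.isCoveringMap_q.liftHomotopy C.slide ⟨Subtype.val, continuous_subtype_val⟩ C.slide_zero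

theorem q_slideLift (r) : C.q (C.slideLift r) = C.slide r :=
  congrFun (C.isCoveringMap_q.liftHomotopy_lifts C.slide _ C.slide_zero) r

theorem slideLift_zero (b : C.collar) : C.slideLift (0, b) = b :=
  C.isCoveringMap_q.liftHomotopy_zero C.slide _ C.slide_zero b

open scoped Classical in
/-- An odd circle-valued function on the complement of the branch set. -/
def oddFun (b : C.Off) : ℂ :=
  -- For the collar coordinate t from -1 to 1 the exponential runs through a half circle, from -1 to
  -- 1. The sign is read at the positive end, where it is unaffected by the surface lying in the
  -- middle of the collar.
  if h : b ∈ C.collar then C.sgn (C.slideLift (1, ⟨b, h⟩)) *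
    Complex.exp (((C.coords ⟨b, h⟩).2 - 1 : ℝ) * (Real.pi / 2) * Complex.I)
  else C.sgn b

theorem p_slideLift_one (b : C.collar) : C.p (C.slideLift (1, b)) ∉ range Q.emb := by
  rw [← C.coe_q, C.q_slideLift]
  rintro ⟨x, hx⟩
  have h1 : x ∉ (𝓡∂ 2).boundary F := fun h =>
    (C.slide (1, b)).2 (by rw [← hx]; exact Q.boundary.subset (mem_image_of_mem _ h))
  have h2 : x ∈ (𝓡∂ 2).interior F := by
    rw [← ModelWithCorners.compl_boundary]; exact h1
  rw [← Q.bicollar_zero ⟨x, h2⟩] at hx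
  have h3 := Q.bicollar_isClosedEmbedding.injective (Subtype.ext hx)
  have h4 := congrArg (fun r => (r.2 : ℝ)) h3
  simp at h4

theorem p_not_mem_of_core {b : C.Off}
    (hb : b ∉ C.q ⁻¹' (Q.bicollar '' {q | -1 < (q.2 : ℝ) ∧ (q.2 : ℝ) < 1})) :
    C.p b ∉ range Q.emb := by
  rintro ⟨x, hx⟩
  have h1 : x ∉ (𝓡∂ 2).boundary F := fun h =>
    b.2 (by rw [← hx]; exact Q.boundary.subset (mem_image_of_mem _ h))
  have h2 : x ∈ (𝓡∂ 2).interior F := by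
    rw [← ModelWithCorners.compl_boundary]; exact h1
  rw [← Q.bicollar_zero ⟨x, h2⟩] at hx
  exact hb ⟨_, by simp, Subtype.ext hx⟩

/-- At the positive end of the collar the slide is constant. From the negative end it crosses the
surface and changes the sheet, which the factor e^{-iπ} = -1 compensates. -/
theorem oddFun_eq_sgn {b : C.Off}
    (hb : b ∉ C.q ⁻¹' (Q.bicollar '' {q | -1 < (q.2 : ℝ) ∧ (q.2 : ℝ) < 1})) :
    C.oddFun b = C.sgn b := by
  by_cases h : b ∈ C.collar
  · rw [oddFun, dif_pos h]
    have hc := C.bicollar_coords ⟨b, h⟩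
    have h1 : ¬ (-1 < ((C.coords ⟨b, h⟩).2 : ℝ) ∧ ((C.coords ⟨b, h⟩).2 : ℝ) < 1) :=
      fun h1 => hb ⟨_, h1, hc⟩
    have h2 := (C.coords ⟨b, h⟩).2.2
    rcases eq_or_lt_of_le h2.2 with h3 | h3
    · have h4 : C.slideLift (1, ⟨b, h⟩) = C.slideLift (0, ⟨b, h⟩) := by
        refine C.isCoveringMap_q.const_of_comp (g := fun r => C.slideLift (r, ⟨b, h⟩))
          (C.slideLift.continuous.comp (Continuous.prodMk_left _)) (fun r r' => ?_) 1 0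
        simp only [C.q_slideLift, slide, ContinuousMap.coe_mk, h3]
        congr 3
        ring
      rw [h4, C.slideLift_zero, h3]
      simp
    · have h3' : ((C.coords ⟨b, h⟩).2 : ℝ) = -1 :=
        le_antisymm (not_lt.1 fun h5 => h1 ⟨h5, h3⟩) h2.1
      have h4 := C.sheet_crossing (C.coords ⟨b, h⟩).1
        (fun t => (C.slideLift (⟨(t + 1) / 2, by
          constructor <;> linarith [t.2.1, t.2.2]⟩, ⟨b, h⟩)).1) (by fun_prop) (by
          intro t
          rw [← C.coe_q, C.q_slideLift]
          simp only [slide, ContinuousMap.coe_mk, h3']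
          congr 4
          ring)
      have e0 : (⟨((-1 : ℝ) + 1) / 2, by norm_num⟩ : unitInterval) = 0 := by
        apply Subtype.ext; norm_num
      have e1 : (⟨((1 : ℝ) + 1) / 2, by norm_num⟩ : unitInterval) = 1 := by
        apply Subtype.ext; norm_num
      simp only [e0, e1, C.slideLift_zero] at h4
      have h5 : C.sgn (C.slideLift (1, ⟨b, h⟩)) = -C.sgn b := by
        by_cases h6 : b.1 ∈ C.sheet
        · simp [sgn, h6, h4.1 h6]
        · have h7 := not_not.1 fun h7 => h6 (h4.2 h7)
          simp [sgn, h6, h7]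
      rw [h5, h3', show (((-1 - 1 : ℝ) : ℂ) * (Real.pi / 2) * Complex.I) = -(Real.pi * Complex.I) by
        push_cast; ring, Complex.exp_neg, Complex.exp_pi_mul_I]
      norm_num
  · rw [oddFun, dif_neg h]

/-- The closed collar and the complement of its open core form a closed cover, and each carries one
continuous formula. -/
theorem continuous_oddFun : Continuous C.oddFun := by
  rw [← continuousOn_univ]
  have hu : C.collar ∪ (C.q ⁻¹' (Q.bicollar '' {q | -1 < (q.2 : ℝ) ∧ (q.2 : ℝ) < 1}))ᶜ = univ := by
    refine eq_univ_of_forall fun b => ?_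
    by_cases hb : b ∈ C.q ⁻¹' (Q.bicollar '' {q | -1 < (q.2 : ℝ) ∧ (q.2 : ℝ) < 1})
    · exact Or.inl (image_subset_range _ _ hb)
    · exact Or.inr hb
  rw [← hu]
  refine ContinuousOn.union_of_isClosed ?_ ?_ C.isClosed_collar
    (Q.bicollar_isOpen.preimage C.isCoveringMap_q.continuous).isClosed_compl
  · rw [continuousOn_iff_continuous_domRestrict]
    have h1 : C.collar.domRestrict C.oddFun = fun b => C.sgn (C.slideLift (1, b)) *
        Complex.exp (((C.coords b).2 - 1 : ℝ) * (Real.pi / 2) * Complex.I) := by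
      funext b
      rw [domRestrict_apply, oddFun, dif_pos b.2]
    have h2 : Continuous fun b : C.collar => C.sgn (C.slideLift (1, b)) :=
      C.continuousOn_sgn.comp_continuous (by fun_prop) C.p_slideLift_one
    have h3 := C.continuous_coords
    refine Continuous.congr (f := fun b => C.sgn (C.slideLift (1, b)) *
        Complex.exp (((C.coords b).2 - 1 : ℝ) * (Real.pi / 2) * Complex.I)) ?_
      fun b => (congrFun h1 b).symm
    fun_prop
  · exact (C.continuousOn_sgn.mono fun b hb => C.p_not_mem_of_core hb).congr
      fun b hb => C.oddFun_eq_sgn hb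

theorem norm_oddFun (b : C.Off) : ‖C.oddFun b‖ = 1 := by
  have h1 : ∀ b, ‖C.sgn b‖ = 1 := fun b => by unfold sgn; split_ifs <;> simp
  unfold oddFun
  split_ifs with h
  · rw [norm_mul, h1, one_mul]
    have : ((((C.coords ⟨b, h⟩).2 - 1 : ℝ) : ℂ) * (Real.pi / 2) * Complex.I) =
        (((((C.coords ⟨b, h⟩).2 - 1) * (Real.pi / 2) : ℝ)) : ℂ) * Complex.I := by push_cast; ring
    rw [this, Complex.norm_exp_ofReal_mul_I]
  · exact h1 b

/-- By uniqueness of lifts the slide commutes with the deck transformation, which also preserves the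
collar coordinate; only the sheet sign changes. -/
theorem oddFun_deck (b : C.Off) : C.oddFun (C.deck b) = -C.oddFun b := by
  by_cases h : b ∈ C.collar
  · have h' : C.deck b ∈ C.collar := by
      rw [collar, mem_preimage, C.q_deck]; exact h
    have hc : C.coords ⟨C.deck b, h'⟩ = C.coords ⟨b, h⟩ :=
      C.coords_eq ((C.bicollar_coords _).trans (C.q_deck b).symm)
    have h1 : (fun r => C.slideLift (r, ⟨C.deck b, h'⟩)) =
        fun r => C.deck (C.slideLift (r, ⟨b, h⟩)) := by
      have hcd := C.continuous_deck
      refine C.isCoveringMap_q.eq_of_comp_eq (by fun_prop) (by fun_prop) ?_ 0 ?_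
      · funext r
        simp only [Function.comp, C.q_deck, C.q_slideLift, slide, ContinuousMap.coe_mk, hc]
      · simp only [C.slideLift_zero]
    rw [oddFun, dif_pos h', oddFun, dif_pos h, hc, congrFun h1 1, C.sgn_deck (C.p_slideLift_one _),
      neg_mul]
  · have h' : C.deck b ∉ C.collar := by
      rw [collar, mem_preimage, C.q_deck]; exact h
    rw [oddFun, dif_neg h', oddFun, dif_neg h, C.sgn_deck]
    exact C.p_not_mem_of_core fun h1 => h (image_subset_range _ _ h1)

/-- Simple connectivity is used twice: to lift the disc to the unbranched covering, and to give the
odd function a continuous argument on the lift. -/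
theorem exists_lift_of_disc {d : ℂ → Y} (hd : ContinuousOn d (Metric.closedBall 0 1))
    (hK : ∀ u ∈ Metric.closedBall (0 : ℂ) 1, d u ∉ K) :
    ∃ (lam : ℂ → C.Off) (φ : ℂ → ℝ), Continuous lam ∧ Continuous φ ∧
      (∀ u ∈ Metric.closedBall (0 : ℂ) 1, C.p (lam u) = d u) ∧
      ∀ u, C.oddFun (lam u) = Complex.exp (φ u * Complex.I) := by
  -- The radial retraction to the closed disc extends the map to all of ℂ, to which the lifting
  -- theorems are applied.
  let r : ℂ → ℂ := fun u => ((max 1 ‖u‖)⁻¹ : ℝ) • u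
  have hpos : ∀ u : ℂ, 0 < max 1 ‖u‖ := fun u => lt_max_of_lt_left one_pos
  have hr : Continuous r :=
    ((continuous_const.max continuous_norm).inv₀ fun u => (hpos u).ne').smul continuous_id
  have hrmem : ∀ u, r u ∈ Metric.closedBall (0 : ℂ) 1 := by
    intro u
    rw [mem_closedBall_zero_iff, norm_smul, Real.norm_of_nonneg (inv_nonneg.2 (hpos u).le),
      inv_mul_le_iff₀ (hpos u), mul_one]
    exact le_max_right _ _
  have hrid : ∀ u ∈ Metric.closedBall (0 : ℂ) 1, r u = u := by
    intro u hu
    simp only [r]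
    rw [max_eq_left (by simpa using hu), inv_one, one_smul]
  let f : C(ℂ, ↥Kᶜ) := ⟨fun u => ⟨d (r u), hK _ (hrmem u)⟩,
    (hd.comp_continuous hr hrmem).subtype_mk _⟩
  obtain ⟨b₀, hb₀⟩ := C.surjective (d (r 0))
  have hb₀K : b₀ ∈ C.p ⁻¹' Kᶜ := by
    rw [mem_preimage, hb₀]; exact hK _ (hrmem 0)
  obtain ⟨lam, ⟨-, hlam⟩, -⟩ := C.isCoveringMap_q.existsUnique_continuousMap_lifts f 0 ⟨b₀, hb₀K⟩
    (Subtype.ext hb₀)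
  have hlam' : ∀ u, C.p (lam u) = d (r u) := fun u => congrArg Subtype.val (congrFun hlam u)
  let σ : C(ℂ, Circle) := ⟨fun u => ⟨C.oddFun (lam u),
    mem_sphere_zero_iff_norm.2 (C.norm_oddFun _)⟩,
    (C.continuous_oddFun.comp lam.continuous).subtype_mk _⟩
  obtain ⟨t₀, ht₀⟩ := Circle.exp_surjective (σ 0)
  obtain ⟨φ, ⟨-, hφ⟩, -⟩ := Circle.isCoveringMap_exp.existsUnique_continuousMap_lifts σ 0 t₀ ht₀
  refine ⟨lam, φ, lam.continuous, φ.continuous, fun u hu => by rw [hlam', hrid u hu], fun u => ?_⟩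
  have h1 := congrArg (fun z : Circle => (z : ℂ)) (congrFun hφ u)
  simp only [Function.comp, Circle.coe_exp] at h1
  exact h1.symm

end BranchedDoubleCover

end OddFunction

/-! ### The attaching discs avoid the knot -/

section Discs

universe u v

variable {S : Type u} [TopologicalSpace S] [ChartedSpace ℂ S] {Y : Type v} [TopologicalSpace Y]
  {g : ℕ} {emb : S → Y} {U₀ U₁ : Set Y} {γ₀ γ₁ : Fin g → ℝ → S} {p q p' q' : S}

omit [TopologicalSpace S] [ChartedSpace ℂ S] in
theorem HandlebodySide.disc_not_mem_arc (h₀ : HandlebodySide emb U₀ γ₀ p q) (i : Fin g) (u : ℂ)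
    (hu : u ∈ Metric.closedBall (0 : ℂ) 1) : h₀.disc i u ∉ h₀.arc := by
  rintro ⟨s, hs⟩
  exact h₀.push_disc (s, 1) i ⟨u, hu, hs.symm⟩

-- The interiors of the disc and of the arc lie in different handlebodies, off the surface. The
-- boundary of the disc lies in the surface, which the arc meets only in its endpoints, and the
-- curve avoids these.
omit [TopologicalSpace S] [ChartedSpace ℂ S] in
theorem HandlebodySide.disc_not_mem_arc' (h₀ : HandlebodySide emb U₀ γ₀ p q)
    (h₁ : HandlebodySide emb U₁ γ₁ p' q') (hU : U₀ ∩ U₁ = range emb)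
    (hemb : Function.Injective emb) (hp : ∀ i t, γ₀ i t ≠ p') (hq : ∀ i t, γ₀ i t ≠ q')
    (i : Fin g) (u : ℂ) (hu : u ∈ Metric.closedBall (0 : ℂ) 1) : h₀.disc i u ∉ h₁.arc := by
  rintro ⟨s, hs⟩
  have hs' : (s = 0 ∨ s = 1) ∨ 0 < s ∧ s < 1 := by
    rcases eq_or_lt_of_le (unitInterval.nonneg' (t := s)) with h | h
    · exact Or.inl (Or.inl h.symm)
    · rcases eq_or_lt_of_le (unitInterval.le_one' (t := s)) with h' | h'
      · exact Or.inl (Or.inr h')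
      · exact Or.inr ⟨h, h'⟩
  have hend : (s = 0 ∨ s = 1) → ∃ x, (x = p' ∨ x = q') ∧ h₁.push (s, 1) = emb x := by
    rintro (rfl | rfl)
    · exact ⟨_, Or.inl rfl, h₁.push_start 1⟩
    · exact ⟨_, Or.inr rfl, h₁.push_end 1⟩
  simp only at hs
  rcases (mem_closedBall_zero_iff.1 hu).lt_or_eq with h | h
  · have h1 := h₀.disc_interior i u (mem_ball_zero_iff.2 h)
    rcases hs' with hs' | hs'
    · obtain ⟨x, -, hx⟩ := hend hs'
      exact h1.2 ⟨x, by rw [← hx, hs]⟩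
    · have h2 := h₁.push_interior s 1 hs'.1 hs'.2 one_pos
      rw [hs] at h2
      exact h1.2 (hU ▸ ⟨h1.1, h2.1⟩)
  · have h1 : u = Complex.exp (2 * Real.pi * ((Complex.arg u / (2 * Real.pi) : ℝ) : ℂ) * Complex.I) := by
      conv_lhs => rw [← Complex.norm_mul_exp_arg_mul_I u, h]
      push_cast
      rw [one_mul]
      congr 2
      have : (Real.pi : ℂ) ≠ 0 := by exact_mod_cast Real.pi_ne_zero
      field_simp
    have h2 := h₀.disc_boundary i (Complex.arg u / (2 * Real.pi))
    rw [← h1] at h2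
    rcases hs' with hs' | hs'
    · obtain ⟨x, hx', hx⟩ := hend hs'
      have h3 := hemb (hx.symm.trans (hs.trans h2))
      rcases hx' with rfl | rfl
      · exact hp i _ h3.symm
      · exact hq i _ h3.symm
    · have h3 := h₁.push_interior s 1 hs'.1 hs'.2 one_pos
      rw [hs, h2] at h3
      exact h3.2 ⟨_, rfl⟩

end Discs

/-! ### Closed lifts of the attaching curves with single-valued arguments -/

section CurveLifts

universe u v a b c d

variable {S : Type u} [TopologicalSpace S] [ChartedSpace ℂ S] {S' : Type v} [TopologicalSpace S']
  [ChartedSpace ℂ S'] {Y : Type a} [TopologicalSpace Y] {Y' : Type b} [TopologicalSpace Y']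
  {F : Type c} [TopologicalSpace F] [ChartedSpace (EuclideanHalfSpace 2) F]
  {g : ℕ} {𝓗 : HeegaardDiagram S g} {K : Set Y} (split : HeegaardSplitting 𝓗 Y K)
  {Q : SeifertSurface K F} (C : BranchedDoubleCover Q Y') (P : SurfaceDoubleCover S S' 𝓗.w 𝓗.z)

include split in
theorem HeegaardSplitting.exists_disc (c : Fin 2) (i : Fin g) : ∃ d : ℂ → Y,
    ContinuousOn d (Metric.closedBall 0 1) ∧ (∀ u ∈ Metric.closedBall (0 : ℂ) 1, d u ∉ K) ∧
    ∀ t : ℝ, d (Complex.exp (2 * Real.pi * t * Complex.I)) = split.emb (𝓗.curve c i t) := by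
  have hinj := split.isClosedEmbedding.injective
  have hav := 𝓗.avoids
  fin_cases c
  · refine ⟨split.side₀.disc i, split.side₀.disc_continuousOn i, fun u hu => ?_,
      split.side₀.disc_boundary i⟩
    intro h
    rcases split.knot.subset h with h | h
    · exact split.side₀.disc_not_mem_arc i u hu h
    · exact split.side₀.disc_not_mem_arc' split.side₁ split.inter hinj (fun i t => (hav 0 i t).1)
        (fun i t => (hav 0 i t).2) i u hu h
  · refine ⟨split.side₁.disc i, split.side₁.disc_continuousOn i, fun u hu => ?_,
      split.side₁.disc_boundary i⟩
    intro h
    rcases split.knot.subset h with h | h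
    · exact split.side₁.disc_not_mem_arc' split.side₀ (by rw [inter_comm, split.inter]) hinj
        (fun i t => (hav 1 i t).2) (fun i t => (hav 1 i t).1) i u hu h
    · exact split.side₁.disc_not_mem_arc i u hu h

variable {emb' : S' → Y'} (hemb' : IsClosedEmbedding emb')
    (hrange : range emb' = C.p ⁻¹' range split.emb)
    (hproj : ∀ a, C.p (emb' a) = split.emb (P.π a)) (hdeck : ∀ a, C.τ (emb' a) = emb' (P.ι a))

include hemb' hdeck in
theorem not_mem_knot_iff (a : S') : C.p (emb' a) ∉ K ↔ a ≠ P.w' ∧ a ≠ P.z' := by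
  rw [← C.fixed, hdeck, hemb'.injective.eq_iff, P.fixed, not_or]

/-- An odd phase function on the double cover, with respect to which the curves of the diagram have
closed lifts with a continuous argument. -/
structure Phase where
  s : S' → ℂ
  continuousAt : ∀ a, a ≠ P.w' → a ≠ P.z' → ContinuousAt s a
  norm_eq : ∀ a, a ≠ P.w' → a ≠ P.z' → ‖s a‖ = 1
  odd : ∀ a, a ≠ P.w' → a ≠ P.z' → s (P.ι a) = -s a
  curve : Fin 2 → Fin g → ℝ → S'
  arg : Fin 2 → Fin g → ℝ → ℝ
  continuous_curve : ∀ c i, Continuous (curve c i)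
  continuous_arg : ∀ c i, Continuous (arg c i)
  periodic_curve : ∀ c i t, curve c i (t + 1) = curve c i t
  periodic_arg : ∀ c i t, arg c i (t + 1) = arg c i t
  map_curve : ∀ c i t, P.π (curve c i t) = 𝓗.curve c i t
  s_curve : ∀ c i t, s (curve c i t) = Complex.exp (arg c i t * Complex.I)

-- The phase is the odd function of the Seifert surface restricted to the double cover of the
-- Heegaard surface. Each curve bounds a disc off the knot; the boundary of the lifted disc is a
-- closed lift of the curve, and the argument on the disc restricts to a periodic function.
include split hemb' hrange hproj hdeck in
theorem exists_phase [T1Space S'] : Nonempty (Phase P) := by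
  classical
  have hK := not_mem_knot_iff C P hemb' hdeck
  let s : S' → ℂ := fun a => if h : C.p (emb' a) ∉ K then C.oddFun ⟨emb' a, h⟩ else 0
  have hs : ∀ a (h : C.p (emb' a) ∉ K), s a = C.oddFun ⟨emb' a, h⟩ := fun a h => dif_pos h
  have hcont : ContinuousOn s {a | C.p (emb' a) ∉ K} := by
    rw [continuousOn_iff_continuous_domRestrict]
    refine Continuous.congr (f := fun a : {a | C.p (emb' a) ∉ K} => C.oddFun ⟨emb' a, a.2⟩) ?_
      fun a => (hs a a.2).symm
    exact C.continuous_oddFun.comp ((hemb'.continuous.comp continuous_subtype_val).subtype_mk _)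
  have hset : {a | C.p (emb' a) ∉ K} = {P.w'}ᶜ ∩ {P.z'}ᶜ := by
    ext a; exact hK a
  have hopen : IsOpen {a | C.p (emb' a) ∉ K} := by
    rw [hset]; exact isOpen_compl_singleton.inter isOpen_compl_singleton
  choose d hd hdK hdb using split.exists_disc
  choose lam φ hlam hφ hlamd hs' using fun c i => C.exists_lift_of_disc (hd c i) (hdK c i)
  let e : ℝ → ℂ := fun t => Complex.exp (2 * Real.pi * t * Complex.I)
  have he : Continuous e := by fun_prop
  have he1 : ∀ t, e t ∈ Metric.closedBall (0 : ℂ) 1 := by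
    intro t
    rw [mem_closedBall_zero_iff]
    have : (2 * Real.pi * t * Complex.I : ℂ) = ((2 * Real.pi * t : ℝ) : ℂ) * Complex.I := by
      push_cast; ring
    simp only [e]
    rw [this, Complex.norm_exp_ofReal_mul_I]
  have hper : ∀ t, e (t + 1) = e t := by
    intro t
    simp only [e]
    rw [show (2 * Real.pi * ((t + 1 : ℝ) : ℂ) * Complex.I) =
      2 * Real.pi * t * Complex.I + 2 * Real.pi * Complex.I by push_cast; ring]
    exact Complex.exp_periodic _
  have hmem : ∀ c i t, ((lam c i (e t)).1 : Y') ∈ range emb' := by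
    intro c i t
    rw [hrange, mem_preimage, hlamd c i _ (he1 t), hdb]
    exact mem_range_self _
  choose γ hγ using hmem
  refine ⟨⟨s, fun a hw hz => hcont.continuousAt (hopen.mem_nhds ((hK a).2 ⟨hw, hz⟩)),
    fun a hw hz => ?_, fun a hw hz => ?_, γ, fun c i t => φ c i (e t), fun c i => ?_,
    fun c i => (hφ c i).comp he, fun c i t => ?_, fun c i t => ?_, fun c i t => ?_,
    fun c i t => ?_⟩⟩
  · rw [hs a ((hK a).2 ⟨hw, hz⟩), C.norm_oddFun]
  · have h1 := (hK a).2 ⟨hw, hz⟩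
    have h2 := (hK (P.ι a)).2 ⟨P.deck_ne_w hw, P.deck_ne_z hz⟩
    rw [hs _ h1, hs _ h2, ← C.oddFun_deck]
    congr 1
    exact Subtype.ext (hdeck a).symm
  · rw [hemb'.isEmbedding.continuous_iff]
    refine Continuous.congr (f := fun t => ((lam c i (e t)).1 : Y'))
      (continuous_subtype_val.comp ((hlam c i).comp he)) fun t => (hγ c i t).symm
  · exact hemb'.injective (by rw [hγ, hγ, hper])
  · simp only [hper]
  · refine split.isClosedEmbedding.injective ?_
    rw [← hproj, hγ, hlamd c i _ (he1 t)]
    exact hdb c i t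
  · have h1 : C.p (emb' (γ c i t)) ∉ K := by rw [hγ]; exact (lam c i (e t)).2
    rw [hs _ h1, ← hs' c i]
    congr 1
    exact Subtype.ext (hγ c i t)

end CurveLifts

end

end HFK

namespace HFK

noncomputable section

/-! ### Tangent vectors at tuples with distinct entries -/

section ImageVectors

universe u

variable {X : Type u} [TopologicalSpace X] [ChartedSpace ℂ X] {n : ℕ}

theorem coord_mem (x : Fin n → X) (f : holFun (symMk x)) :
    DifferentiableAt ℂ (localRep f.1 x) (coord x) := (f.2 x rfl).differentiableAt

/-- The differential of `Xⁿ → Symⁿ(X)`. -/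
def imgMap (x : Fin n → X) : (Fin n → ℂ) →ₗ[ℂ] SymTangent (symMk x) where
  toFun v := ⟨{ toFun := fun f => fderiv ℂ (localRep f.1 x) (coord x) v
                map_add' := fun f h => by
                  have : localRep (f + h).1 x = fun z => localRep f.1 x z + localRep h.1 x z := rfl
                  rw [this, fderiv_fun_add (coord_mem x f) (coord_mem x h)]
                  rfl
                map_smul' := fun c f => by
                  have : localRep (c • f).1 x = fun z => c • localRep f.1 x z := rfl
                  rw [this, fderiv_fun_const_smul (coord_mem x f)]
                  rfl },
    fun f h => by
      have h1 : localRep (f * h).1 x = fun z => localRep f.1 x z * localRep h.1 x z := rfl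
      have h2 : ∀ f : holFun (symMk x), localRep f.1 x (coord x) = f.1 (symMk x) := by
        intro f
        simp only [localRep, coord]
        refine congrArg f.1 (congrArg symMk (funext fun i => ?_))
        exact (chartAt ℂ (x i)).left_inv (mem_chart_source ℂ _)
      change fderiv ℂ (localRep (f * h).1 x) (coord x) v = _
      rw [h1, fderiv_fun_mul (coord_mem x f) (coord_mem x h), h2, h2]
      rfl⟩
  map_add' v w := by
    apply Subtype.ext
    ext f
    exact map_add (fderiv ℂ (localRep f.1 x) (coord x)) v w
  map_smul' c v := by
    apply Subtype.ext
    ext f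
    exact map_smul (fderiv ℂ (localRep f.1 x) (coord x)) c v

theorem isImageVector_imgMap (x : Fin n → X) (v : Fin n → ℂ) :
    IsImageVector (imgMap x v) x v := ⟨rfl, fun _ => rfl⟩

theorem IsImageVector.eq_imgMap {x : Fin n → X} {v : Fin n → ℂ} {ξ : SymTangent (symMk x)}
    (h : IsImageVector ξ x v) : ξ = imgMap x v := by
  apply Subtype.ext
  ext f
  exact h.2 f

/-- The derivative of a function in the preferred chart at a point. -/
def chartDeriv (h : X → ℂ) (x : X) : ℂ :=
  deriv (fun z => h ((chartAt ℂ x).symm z)) (chartAt ℂ x x)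

theorem chartDeriv_congr {h k : X → ℂ} {x : X} (hk : h =ᶠ[𝓝 x] k) :
    chartDeriv h x = chartDeriv k x := by
  refine Filter.EventuallyEq.deriv_eq ?_
  have hc := (chartAt ℂ x).continuousAt_symm (mem_chart_target ℂ x)
  rw [ContinuousAt, (chartAt ℂ x).left_inv (mem_chart_source ℂ x)] at hc
  exact hc.eventually hk

theorem tr_imgMap (x : Fin n → X) (v : Fin n → ℂ) {h : X → ℂ} (hh : HolNear h (symMk x)) :
    tr (imgMap x v) h = ∑ i, chartDeriv h (x i) * v i := by
  rw [tr, ev_eq _ (holAt_trace hh)]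
  change fderiv ℂ (localRep (trace h) x) (coord x) v = _
  have h1 : localRep (trace h) x = fun z => ∑ i, h ((chartAt ℂ (x i)).symm (z i)) := by
    funext z
    exact trace_symMk _ _
  have hx : ∀ i, ContMDiffAt 𝓘(ℂ) 𝓘(ℂ) ω h (x i) := fun i => hh _ (mem_symMk.2 ⟨i, rfl⟩)
  have h2 : HasFDerivAt (localRep (trace h) x) (∑ i, chartDeriv h (x i) • ContinuousLinearMap.proj (R := ℂ) (φ := fun _ : Fin n => ℂ) i)
      (coord x) := by
    rw [h1]
    refine HasFDerivAt.fun_sum fun i _ => ?_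
    have h3 := (analyticAt_comp_chart_symm (hx i)).differentiableAt.hasDerivAt
    exact h3.comp_hasFDerivAt (f := fun z : Fin n → ℂ => z i) (coord x)
      (ContinuousLinearMap.proj (R := ℂ) (φ := fun _ : Fin n => ℂ) i).hasFDerivAt
  rw [h2.fderiv]
  simp only [sum_apply, smul_apply, ContinuousLinearMap.proj_apply, smul_eq_mul]

variable [IsManifold 𝓘(ℂ) ω X] [T2Space X] [Nonempty X]

-- The two transition maps between `e` and the preferred chart are inverse to each other, so the
-- product of their derivatives is 1.
omit [T2Space X] [Nonempty X] in
theorem chartDeriv_ne_zero {e : OpenPartialHomeomorph X ℂ} (he : IsHolChart e) {x : X}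
    (hx : x ∈ e.source) :
    chartDeriv e x ≠ 0 := by
  have h1 := (analyticAt_comp_chart_symm (he.contMDiffAt x hx)).differentiableAt.hasDerivAt
  have h2 := (he.analyticAt_comp_symm hx
    ((isHolChart_chartAt x).contMDiffAt x (mem_chart_source ℂ x))).differentiableAt.hasDerivAt
  have h3 : HasDerivAt (fun z => chartAt ℂ x (e.symm (e ((chartAt ℂ x).symm z))))
      (deriv (fun z => chartAt ℂ x (e.symm z)) (e x) *
        deriv (fun z => e ((chartAt ℂ x).symm z)) (chartAt ℂ x x)) (chartAt ℂ x x) := by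
    refine HasDerivAt.comp (h₂ := fun z => chartAt ℂ x (e.symm z)) _ ?_ h1
    rwa [(chartAt ℂ x).left_inv (mem_chart_source ℂ x)]
  have h4 : (fun z => chartAt ℂ x (e.symm (e ((chartAt ℂ x).symm z)))) =ᶠ[𝓝 (chartAt ℂ x x)] id := by
    have hc := (chartAt ℂ x).continuousAt_symm (mem_chart_target ℂ x)
    have h5 := hc.eventually_mem (s := e.source)
      (by rw [(chartAt ℂ x).left_inv (mem_chart_source ℂ x)]; exact e.open_source.mem_nhds hx)
    filter_upwards [h5, (chartAt ℂ x).open_target.mem_nhds (mem_chart_target ℂ x)] with z hz hz'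
    rw [e.left_inv hz, (chartAt ℂ x).right_inv hz']
    rfl
  have h6 := (h3.congr_of_eventuallyEq h4.symm).unique (hasDerivAt_id _)
  intro h0
  rw [chartDeriv] at h0
  rw [h0, mul_zero] at h6
  exact zero_ne_one h6

/-- A function that is a coordinate near one entry and zero near the others isolates one component
of the vector. -/
theorem imgMap_injective {x : Fin n → X} (hx : Function.Injective x) :
    Function.Injective (imgMap x) := by
  classical
  rw [injective_iff_map_eq_zero]
  intro v hv
  funext j
  obtain ⟨e, he, hD⟩ := exists_isHolChart_sym (symMk x)
  obtain ⟨l, hl⟩ := exists_locallyConst (symMk x) (fun y => if y = x j then (1 : ℂ) else 0)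
  have hxm : ∀ i, x i ∈ symMk x := fun i => mem_symMk.2 ⟨i, rfl⟩
  have hlh : HolNear l (symMk x) := fun y hy =>
    (contMDiffAt_const (c := if y = x j then (1 : ℂ) else 0)).congr_of_eventuallyEq (hl y hy)
  have heh : HolNear e (symMk x) := fun y hy => he.contMDiffAt y (hD y hy)
  have h1 := tr_imgMap x v (hlh.mul heh)
  rw [hv, tr, ev_zero_left] at h1
  have h2 : ∀ i, chartDeriv (fun y => l y * e y) (x i) * v i =
      if i = j then chartDeriv e (x j) * v j else 0 := by
    intro i
    have hev : (fun y => l y * e y) =ᶠ[𝓝 (x i)] fun y => (if x i = x j then (1 : ℂ) else 0) * e y := by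
      filter_upwards [hl _ (hxm i)] with y hy
      rw [hy]
    rw [chartDeriv_congr hev]
    by_cases hij : i = j
    · subst hij
      simp
    · rw [if_neg hij]
      simp [if_neg (fun h => hij (hx h)), chartDeriv]
  simp only [h2, Finset.sum_ite_eq', Finset.mem_univ, if_true] at h1
  exact (mul_eq_zero.1 h1.symm).resolve_left (chartDeriv_ne_zero he (hD _ (hxm j)))

theorem finrank_symTangent (D : Sym X n) : Module.finrank ℂ (SymTangent D) = n := by
  obtain ⟨e, he, hD⟩ := exists_isHolChart_sym D
  rw [(tangentEquiv he hD).finrank_eq]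
  simp

instance (D : Sym X n) : FiniteDimensional ℂ (SymTangent D) := by
  obtain ⟨e, he, hD⟩ := exists_isHolChart_sym D
  exact (tangentEquiv he hD).symm.finiteDimensional

theorem imgMap_bijective {x : Fin n → X} (hx : Function.Injective x) :
    Function.Bijective (imgMap x) := by
  refine ⟨imgMap_injective hx, ?_⟩
  exact (LinearMap.injective_iff_surjective_of_finrank_eq_finrank
    (by rw [finrank_symTangent]; simp)).1 (imgMap_injective hx)

end ImageVectors

/-! ### Velocities of closed curves -/

section Curves

universe u

variable {X : Type u} [TopologicalSpace X] [ChartedSpace ℂ X] {γ : ℝ → X}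

/-- The velocity of a curve. -/
def velocity (γ : ℝ → X) (t : ℝ) : ℂ := mfderiv 𝓘(ℝ, ℝ) 𝓘(ℝ, ℂ) γ t (1 : ℝ)

theorem hasDerivAt_chart_comp (hγ : ContMDiff 𝓘(ℝ, ℝ) 𝓘(ℝ, ℂ) ∞ γ) (t : ℝ) :
    HasDerivAt (fun s => chartAt ℂ (γ t) (γ s)) (velocity γ t) t := by
  have h1 : MDifferentiableAt 𝓘(ℝ, ℝ) 𝓘(ℝ, ℂ) γ t := (hγ t).mdifferentiableAt (by simp)
  obtain ⟨L, hL, h2⟩ : ∃ L : ℝ →L[ℝ] ℂ, L 1 = velocity γ t ∧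
      HasFDerivWithinAt (fun s => chartAt ℂ (γ t) (γ s)) L (range id) t :=
    ⟨mfderiv 𝓘(ℝ, ℝ) 𝓘(ℝ, ℂ) γ t, rfl, h1.hasMFDerivAt.2⟩
  rw [range_id, hasFDerivWithinAt_univ] at h2
  rw [← hL]
  exact h2.hasDerivAt

theorem hasDerivAt_comp_curve (hγ : ContMDiff 𝓘(ℝ, ℝ) 𝓘(ℝ, ℂ) ∞ γ) {h : X → ℂ} {t : ℝ}
    (hh : ContMDiffAt 𝓘(ℂ) 𝓘(ℂ) ω h (γ t)) :
    HasDerivAt (fun s => h (γ s)) (chartDeriv h (γ t) * velocity γ t) t := by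
  have h1 := (analyticAt_comp_chart_symm hh).differentiableAt.hasDerivAt
  have h2 := h1.comp t (hasDerivAt_chart_comp hγ t)
  refine h2.congr_of_eventuallyEq ?_
  filter_upwards [hγ.continuous.continuousAt.eventually_mem
    ((chartAt ℂ (γ t)).open_source.mem_nhds (mem_chart_source ℂ (γ t)))] with s hs
  simp only [Function.comp, (chartAt ℂ (γ t)).left_inv hs]

theorem continuousAt_deriv_comp_curve (hγ : ContMDiff 𝓘(ℝ, ℝ) 𝓘(ℝ, ℂ) ∞ γ) {h : X → ℂ} {t : ℝ}
    (hh : ContMDiffAt 𝓘(ℂ) 𝓘(ℂ) ω h (γ t)) :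
    ContinuousAt (deriv fun s => h (γ s)) t := by
  have h0 : ContDiffAt ℝ ∞ (fun s => chartAt ℂ (γ t) (γ s)) t := by
    have h1 := (contMDiffAt_iff.1 (hγ t)).2
    simp only [mfld_simps] at h1
    exact contDiffWithinAt_univ.1 h1
  have h1 : ContDiffAt ℝ ∞ (fun z => h ((chartAt ℂ (γ t)).symm z)) (chartAt ℂ (γ t) (γ t)) :=
    ((analyticAt_comp_chart_symm hh).contDiffAt (n := ∞)).restrict_scalars ℝ
  have h2 : ContDiffAt ℝ 1 (fun s => h (γ s)) t := by
    have h3 := (h1.comp t h0).of_le (m := 1) (by exact_mod_cast le_top)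
    refine h3.congr_of_eventuallyEq ?_
    filter_upwards [hγ.continuous.continuousAt.eventually_mem
      ((chartAt ℂ (γ t)).open_source.mem_nhds (mem_chart_source ℂ (γ t)))] with s hs
    simp only [Function.comp, (chartAt ℂ (γ t)).left_inv hs]
  have h4 := (h2.fderiv_right (m := 0) (by norm_num)).continuousAt
  exact (ContinuousLinearMap.apply ℝ ℂ (1 : ℝ)).continuous.continuousAt.comp h4

theorem IsClosedCurve.add_int (hγ : IsClosedCurve γ) (t : ℝ) (n : ℤ) : γ (t + n) = γ t :=
  (hγ.embedded _ _).2 ⟨n, rfl⟩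

theorem velocity_ne_zero (hγ : IsClosedCurve γ) (t : ℝ) : velocity γ t ≠ 0 := by
  intro h
  refine hγ.immersed t ?_
  ext
  exact h

theorem velocity_add_int (hγ : IsClosedCurve γ) (t : ℝ) (n : ℤ) :
    velocity γ (t + n) = velocity γ t := by
  have h1 := hasDerivAt_chart_comp hγ.smooth (t + n)
  have h2 := hasDerivAt_chart_comp hγ.smooth t
  have h3 := h1.scomp_of_eq t ((hasDerivAt_id t).add_const (n : ℝ)) rfl
  simp only [hγ.add_int, one_smul] at h3
  refine h3.unique ?_
  refine h2.congr_of_eventuallyEq (Filter.Eventually.of_forall fun s => ?_)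
  simp only [Function.comp, id, hγ.add_int]

end Curves

end

end HFK

namespace HFK

noncomputable section

/-! ### The twist in components -/

section TwistImage

universe u v

section

variable {X : Type u} [TopologicalSpace X] [ChartedSpace ℂ X] {n : ℕ}

theorem chartDeriv_add_mul {h k : X → ℂ} {x : X} (hh : ContMDiffAt 𝓘(ℂ) 𝓘(ℂ) ω h x)
    (hk : ContMDiffAt 𝓘(ℂ) 𝓘(ℂ) ω k x) (c d : ℂ) :
    chartDeriv (fun y => c * h y + d * k y) x = c * chartDeriv h x + d * chartDeriv k x := by
  have h1 := (analyticAt_comp_chart_symm hh).differentiableAt.hasDerivAt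
  have h2 := (analyticAt_comp_chart_symm hk).differentiableAt.hasDerivAt
  exact ((h1.const_mul c).add (h2.const_mul d)).deriv

theorem isImageVector_of_tr [IsManifold 𝓘(ℂ) ω X] [T2Space X] [Nonempty X] {D : Sym X n}
    {ξ : SymTangent D} {x : Fin n → X} {v : Fin n → ℂ} (hx : symMk x = D)
    (h : ∀ h, HolNear h D → tr ξ h = ∑ i, chartDeriv h (x i) * v i) : IsImageVector ξ x v := by
  subst hx
  have : ξ = imgMap x v := tr_ext fun k hk => by rw [h k hk, tr_imgMap x v hk]
  rw [this]
  exact isImageVector_imgMap x v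

end

namespace SurfaceDoubleCover

variable {S : Type u} [TopologicalSpace S] [ChartedSpace ℂ S] 
variable {S' : Type v} [TopologicalSpace S'] [ChartedSpace ℂ S'] 
variable {w z : S} (P : SurfaceDoubleCover S S' w z) {g : ℕ}

/-- The derivative of the covering. -/
def coverDeriv (a : S') : ℂ := mfderiv 𝓘(ℂ) 𝓘(ℂ) P.π a (1 : ℂ)

theorem mfderiv_π (a : S') (v : ℂ) :
    (mfderiv 𝓘(ℂ) 𝓘(ℂ) P.π a v : ℂ) = P.coverDeriv a * v := by
  obtain ⟨L, hL⟩ : ∃ L : ℂ →L[ℂ] ℂ, ∀ v : ℂ, L v = (mfderiv 𝓘(ℂ) 𝓘(ℂ) P.π a v : ℂ) :=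
    ⟨mfderiv 𝓘(ℂ) 𝓘(ℂ) P.π a, fun _ => rfl⟩
  rw [coverDeriv, ← hL v]
  refine Eq.trans ?_ (congrArg (· * v) (hL 1))
  have := L.map_smul v 1
  simp only [smul_eq_mul, mul_one] at this
  rw [this, mul_comm]

theorem chartDeriv_comp_π {h : S → ℂ} {a : S'} (hh : ContMDiffAt 𝓘(ℂ) 𝓘(ℂ) ω h (P.π a)) :
    chartDeriv (fun b => h (P.π b)) a = chartDeriv h (P.π a) * P.coverDeriv a := by
  obtain ⟨L, hL, h2⟩ : ∃ L : ℂ →L[ℂ] ℂ, L 1 = P.coverDeriv a ∧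
      HasFDerivWithinAt (fun z => chartAt ℂ (P.π a) (P.π ((chartAt ℂ a).symm z))) L (range id)
        (chartAt ℂ a a) :=
    ⟨mfderiv 𝓘(ℂ) 𝓘(ℂ) P.π a, rfl, (P.holomorphic a).hasMFDerivAt.2⟩
  rw [range_id, hasFDerivWithinAt_univ] at h2
  have h3 := h2.hasDerivAt
  rw [hL] at h3
  have h1 := (analyticAt_comp_chart_symm hh).differentiableAt.hasDerivAt
  have hc := (chartAt ℂ a).continuousAt_symm (mem_chart_target ℂ a)
  have ha : (chartAt ℂ a).symm (chartAt ℂ a a) = a := (chartAt ℂ a).left_inv (mem_chart_source ℂ a)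
  have h4 := HasDerivAt.comp_of_eq (chartAt ℂ a a) h1 h3 (by rw [ha])
  refine (h4.congr_of_eventuallyEq ?_).deriv
  have h5 : ContinuousAt (fun z => P.π ((chartAt ℂ a).symm z)) (chartAt ℂ a a) :=
    ContinuousAt.comp_of_eq (P.holomorphic a).continuousAt hc ha
  filter_upwards [h5.eventually_mem (s := (chartAt ℂ (P.π a)).source)
    (by rw [ha]; exact chart_source_mem_nhds ℂ _)] with z hz
  simp only [Function.comp, (chartAt ℂ (P.π a)).left_inv hz]

theorem chartDeriv_comp_section {σ : S → S'} {a : S'} (hσ : ContMDiffAt 𝓘(ℂ) 𝓘(ℂ) ω σ (P.π a))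
    (hσa : σ (P.π a) = a) (hl : ∀ᶠ b in 𝓝 a, σ (P.π b) = b) {h : S' → ℂ}
    (hh : ContMDiffAt 𝓘(ℂ) 𝓘(ℂ) ω h a) :
    chartDeriv (fun y => h (σ y)) (P.π a) * P.coverDeriv a = chartDeriv h a := by
  rw [← P.chartDeriv_comp_π (h := fun y => h (σ y))
    (ContMDiffAt.comp_of_eq (f := σ) (g := h) hh hσ hσa)]
  refine chartDeriv_congr ?_
  filter_upwards [hl] with b hb
  rw [hb]

theorem coverDeriv_ne_zero [IsManifold 𝓘(ℂ) ω S'] {a : S'} (hw : a ≠ P.w') (hz : a ≠ P.z') :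
    P.coverDeriv a ≠ 0 := by
  obtain ⟨σ, hσ, hσa, -, hl⟩ := P.exists_section hw hz
  intro h0
  have h1 := P.chartDeriv_comp_section hσ hσa hl
    ((isHolChart_chartAt a).contMDiffAt a (mem_chart_source ℂ a))
  rw [h0, mul_zero] at h1
  exact chartDeriv_ne_zero (isHolChart_chartAt a) (mem_chart_source ℂ a) h1.symm

variable {P} {D : Sym S g} [IsManifold 𝓘(ℂ) ω S']

/-- On each of the two sheets the local section inverts the covering, so its derivative is the
reciprocal of `coverDeriv`. -/
theorem LocConst.chartDeriv_push {l c : S' → ℂ} (hl : P.LocConst D l c)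
    (hD : D ∈ puncturedSym S g w z) {a : S'} (ha : P.π a ∈ D) {h : S' → ℂ}
    (hh : HolNear h (P.symLift g D)) :
    chartDeriv (P.push l h) (P.π a) = c a * (chartDeriv h a / P.coverDeriv a) +
      c (P.ι a) * (chartDeriv h (P.ι a) / P.coverDeriv (P.ι a)) := by
  have hw := P.ne_w hD ha
  have hz := P.ne_z hD ha
  have hι : P.π (P.ι a) ∈ D := by rwa [P.map_deck]
  have hwι := P.ne_w hD hι
  have hzι := P.ne_z hD hι
  obtain ⟨σ, hσ, hσa, hr, hlσ⟩ := P.exists_section hw hz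
  have hσ' : ContMDiffAt 𝓘(ℂ) 𝓘(ℂ) ω (fun y => P.ι (σ y)) (P.π a) :=
    ContMDiffAt.comp_of_eq (P.deck_contMDiffAt hw hz) hσ hσa
  have hl' : ∀ᶠ b in 𝓝 (P.ι a), P.ι (σ (P.π b)) = b := by
    have h1 : ∀ᶠ b in 𝓝 (P.ι a), σ (P.π (P.ι b)) = P.ι b := by
      have h0 : Filter.Tendsto P.ι (𝓝 (P.ι a)) (𝓝 a) := by
        have := P.continuous_deck.tendsto (P.ι a)
        rwa [P.deck_deck] at this
      exact h0.eventually hlσ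
    filter_upwards [h1] with b hb
    rw [P.map_deck] at hb
    rw [hb, P.deck_deck]
  have ha' := P.mem_symLift.2 ha
  have hhι := hh _ (P.mem_symLift.2 hι)
  have e1 := P.chartDeriv_comp_section hσ hσa hlσ (hh _ ha')
  have e2 := P.chartDeriv_comp_section (a := P.ι a) (σ := fun y => P.ι (σ y))
    (by rw [P.map_deck]; exact hσ') (by rw [P.map_deck, hσa]) hl' hhι
  rw [P.map_deck] at e2
  have h1 : ∀ᶠ y in 𝓝 (P.π a), l (σ y) = c a :=
    hσ.continuousAt.eventually (by rw [hσa]; exact hl a ha)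
  have h2 : ∀ᶠ y in 𝓝 (P.π a), l (P.ι (σ y)) = c (P.ι a) :=
    (P.continuous_deck.continuousAt.comp hσ.continuousAt).eventually
      (by simp only [Function.comp, hσa]; exact hl _ hι)
  have hev : P.push l h =ᶠ[𝓝 (P.π a)] fun y => c a * h (σ y) + c (P.ι a) * h (P.ι (σ y)) := by
    filter_upwards [hr, h1, h2] with y e1 e2 e3
    rw [P.push_apply l h e1, e2, e3]
  rw [chartDeriv_congr hev, chartDeriv_add_mul (h := fun y => h (σ y))
    (k := fun y => h (P.ι (σ y)))
    (ContMDiffAt.comp_of_eq (f := σ) (g := h) (hh _ ha') hσ hσa)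
    (ContMDiffAt.comp_of_eq (f := fun y => P.ι (σ y)) (g := h) hhι hσ' (by simp only [hσa])),
    ← e1, ← e2, mul_div_cancel_right₀ _ (P.coverDeriv_ne_zero hw hz),
    mul_div_cancel_right₀ _ (P.coverDeriv_ne_zero hwι hzι)]

variable (P) [IsManifold 𝓘(ℂ) ω S] [T2Space S] [Nonempty S] [T2Space S'] [Nonempty S']
  {x : Fin g → S} (hD : symMk x ∈ puncturedSym S g w z) {s : Fin g → S'}
  (hs : ∀ i, P.π (s i) = x i)

include hs in
theorem tr_twist_imgMap (c : S' → ℂ) (v : Fin g → ℂ) {h : S' → ℂ}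
    (hh : HolNear h (P.symLift g (symMk x))) :
    tr (P.twist hD c (imgMap x v)) h = ∑ i, (c (s i) * (chartDeriv h (s i) / P.coverDeriv (s i)) +
      c (P.ι (s i)) * (chartDeriv h (P.ι (s i)) / P.coverDeriv (P.ι (s i)))) * v i := by
  obtain ⟨l, hl⟩ := P.exists_locConst (symMk x) c
  rw [P.tr_twist hD _ hh hl, tr_imgMap x v (hl.holNear_push hD hh)]
  refine Finset.sum_congr rfl fun i _ => ?_
  rw [← hs i, hl.chartDeriv_push hD (by rw [hs i]; exact mem_symMk.2 ⟨i, rfl⟩) hh]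

-- For odd functions both contributions of the entry xᵢ contain the product c(sᵢ)vᵢ and depend on
-- nothing else. So one odd twisting function can be traded for another by rescaling the components
-- of the vector.
include hs in
theorem twist_imgMap_congr {c c' : S' → ℂ} (hc : ∀ a, P.π a ∈ symMk x → c (P.ι a) = -c a)
    (hc' : ∀ a, P.π a ∈ symMk x → c' (P.ι a) = -c' a) {v v' : Fin g → ℂ}
    (hv : ∀ i, c (s i) * v i = c' (s i) * v' i) :
    P.twist hD c (imgMap x v) = P.twist hD c' (imgMap x v') := by
  refine tr_ext fun h hh => ?_
  rw [P.tr_twist_imgMap hD hs c v hh, P.tr_twist_imgMap hD hs c' v' hh]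
  refine Finset.sum_congr rfl fun i _ => ?_
  have hm : P.π (s i) ∈ symMk x := by rw [hs i]; exact mem_symMk.2 ⟨i, rfl⟩
  rw [hc _ hm, hc' _ hm]
  linear_combination (chartDeriv h (s i) / P.coverDeriv (s i) -
    chartDeriv h (P.ι (s i)) / P.coverDeriv (P.ι (s i))) * hv i

/-- The preimages of a tuple, given one preimage of each of its entries. -/
def liftTuple (s : Fin g → S') : Fin (2 * g) → S' := fun k =>
  if (finProdFinEquiv.symm k).1 = 0 then s (finProdFinEquiv.symm k).2
    else P.ι (s (finProdFinEquiv.symm k).2)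

include hs in
theorem isImageVector_twist (c : S' → ℂ) (v : Fin g → ℂ) :
    IsImageVector (P.twist hD c (imgMap x v)) (P.liftTuple s) fun k =>
      c (P.liftTuple s k) * v (finProdFinEquiv.symm k).2 / P.coverDeriv (P.liftTuple s k) := by
  refine isImageVector_of_tr (P.symLift_symMk x s hs).symm fun h hh => ?_
  rw [P.tr_twist_imgMap hD hs c v hh, ← finProdFinEquiv.sum_comp, Fintype.sum_prod_type,
    Fin.sum_univ_two, ← Finset.sum_add_distrib]
  refine Finset.sum_congr rfl fun i _ => ?_
  simp only [liftTuple, Equiv.symm_apply_apply, if_true, one_ne_zero, if_false]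
  ring

end SurfaceDoubleCover

end TwistImage

end

end HFK

namespace HFK

noncomputable section

universe u v

/-! ### Real spans of complex frames -/

section RealSpan

variable {V : Type*} [AddCommGroup V] [Module ℂ V] [Module ℝ V] [IsScalarTower ℝ ℂ V] {n : ℕ}

/-- The inclusion of the real vectors. -/
def ofRealVec (n : ℕ) : (Fin n → ℝ) →ₗ[ℝ] (Fin n → ℂ) where
  toFun r i := r i
  map_add' r s := by funext i; simp
  map_smul' c r := by funext i; simp

@[simp] theorem ofRealVec_apply (r : Fin n → ℝ) (i : Fin n) : ofRealVec n r i = r i := rfl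

/-- The real span of a complex frame. -/
def realSpan (e : (Fin n → ℂ) ≃ₗ[ℂ] V) : Submodule ℝ V :=
  LinearMap.range ((e.toLinearMap.restrictScalars ℝ).comp (ofRealVec n))

theorem mem_realSpan {e : (Fin n → ℂ) ≃ₗ[ℂ] V} {u : V} :
    u ∈ realSpan e ↔ ∃ r : Fin n → ℝ, e (ofRealVec n r) = u := Iff.rfl

theorem realSpan_spanning (e : (Fin n → ℂ) ≃ₗ[ℂ] V) (u : V) :
    ∃ a ∈ realSpan e, ∃ b ∈ realSpan e, u = a + Complex.I • b := by
  obtain ⟨v, rfl⟩ := e.surjective u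
  refine ⟨_, ⟨fun i => (v i).re, rfl⟩, _, ⟨fun i => (v i).im, rfl⟩, ?_⟩
  change e v = e _ + Complex.I • e _
  rw [← map_smul, ← map_add]
  congr 1
  funext i
  simp [mul_comm Complex.I, Complex.re_add_im]

variable {θ : V →ₗ[ℝ] V →ₗ[ℝ] ℝ} (hθ : ∀ u, θ u u = 0)
  (ht : ∀ u, u ≠ 0 → 0 < θ u (Complex.I • u)) (e : (Fin n → ℂ) ≃ₗ[ℂ] V)

include hθ ht in
theorem isLagrangian_realSpan (hi : ∀ u ∈ realSpan e, ∀ v ∈ realSpan e, θ u v = 0) :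
    IsLagrangian θ (realSpan e) :=
  isLagrangian_of_isotropic (J := fun u => Complex.I • u) hθ (smul_zero _) ht hi
    (realSpan_spanning e)

-- Tameness makes the isotropic real span Lagrangian, hence maximal among isotropic subspaces. Thus
-- `W` is determined by exhibiting enough vectors in it, without an upper bound on the spanning set
-- that defines it.
include hθ ht in
theorem eq_realSpan_of_isotropic {W : Submodule ℝ V} (hW : ∀ r, e (ofRealVec n r) ∈ W)
    (hi : ∀ u ∈ W, ∀ v ∈ W, θ u v = 0) : W = realSpan e := by
  have hle : realSpan e ≤ W := by
    rintro _ ⟨r, rfl⟩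
    exact hW r
  refine le_antisymm (fun u hu => ?_) hle
  exact (isLagrangian_realSpan hθ ht e (fun u hu v hv => hi u (hle hu) v (hle hv)) u).2
    fun v hv => hi u hu v (hle hv)

theorem finrank_realSpan (e : (Fin n → ℂ) ≃ₗ[ℂ] V) : Module.finrank ℝ (realSpan e) = n := by
  have hinj : Function.Injective ((e.toLinearMap.restrictScalars ℝ).comp (ofRealVec n)) := by
    intro r s h
    have h1 : ofRealVec n r = ofRealVec n s := e.injective h
    funext i
    exact Complex.ofReal_injective (congrFun h1 i)
  rw [realSpan, LinearMap.finrank_range_of_inj hinj]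
  simp

/-- Each has half of the real dimension of `V`, so trivial intersection suffices. -/
theorem isCompl_realSpan {e f : (Fin n → ℂ) ≃ₗ[ℂ] V} (h : Disjoint (realSpan e) (realSpan f)) :
    IsCompl (realSpan e) (realSpan f) := by
  have he := e.restrictScalars ℝ
  have : FiniteDimensional ℝ V := he.finiteDimensional
  refine (Submodule.isCompl_iff_disjoint _ _ ?_).2 h
  rw [finrank_realSpan, finrank_realSpan, ← he.finrank_eq, Module.finrank_pi_fintype]
  simp [mul_two]

end RealSpan

/-! ### Velocity frames along the tori -/

section Tori

variable {S : Type u} [TopologicalSpace S] [ChartedSpace ℂ S] {g : ℕ} (𝓗 : HeegaardDiagram S g)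
  (c : Fin 2)

theorem mem_tangentLine {γ : ℝ → S} {x : S} {v : ℂ} :
    v ∈ tangentLine γ x ↔ ∃ t c : ℝ, γ t = x ∧ v = c * velocity γ t := by
  have h : ∀ (t c : ℝ), c • velocity γ t = c * velocity γ t := fun t c => Complex.real_smul
  simp only [← h]
  exact Iff.rfl

/-- The points of the ordered torus. -/
def pt (t : Fin g → ℝ) : Fin g → S := fun i => 𝓗.curve c i (t i)

/-- The velocities of the coordinate curves of the ordered torus. -/
def vel (t : Fin g → ℝ) : Fin g → ℂ := fun i => velocity (𝓗.curve c i) (t i)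

variable {𝓗 c}

theorem vel_ne_zero (t : Fin g → ℝ) (i : Fin g) : vel 𝓗 c t i ≠ 0 :=
  velocity_ne_zero (𝓗.isClosedCurve c i) (t i)

theorem pt_mem (t : Fin g → ℝ) : symMk (pt 𝓗 c t) ∈ puncturedSym S g 𝓗.w 𝓗.z := by
  constructor
  · intro h
    obtain ⟨i, hi⟩ := mem_symMk.1 h
    exact (𝓗.avoids c i _).1 hi
  · intro h
    obtain ⟨i, hi⟩ := mem_symMk.1 h
    exact (𝓗.avoids c i _).2 hi

variable (𝓗 c) in
/-- The points of the torus. -/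
abbrev base (t : Fin g → ℝ) : Base 𝓗 := ⟨symMk (pt 𝓗 c t), pt_mem t⟩

theorem index_eq {i j : Fin g} {s t : ℝ} (h : 𝓗.curve c i s = 𝓗.curve c j t) : i = j := by
  by_contra hij
  exact (Set.disjoint_left.1 (𝓗.disjoint c i j hij)) ⟨s, rfl⟩ ⟨t, h.symm⟩

theorem pt_injective (t : Fin g → ℝ) : Function.Injective (pt 𝓗 c t) := fun _ _ h => index_eq h

/-- The curves of one family are disjoint, so an unordered point of the torus has only one ordering
with the i-th entry on the i-th curve. -/
theorem pt_eq {s t : Fin g → ℝ} (h : symMk (pt 𝓗 c s) = symMk (pt 𝓗 c t)) :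
    pt 𝓗 c s = pt 𝓗 c t := by
  funext i
  have h1 : pt 𝓗 c s i ∈ symMk (pt 𝓗 c t) := h ▸ mem_symMk.2 ⟨i, rfl⟩
  obtain ⟨j, hj⟩ := mem_symMk.1 h1
  obtain rfl : j = i := index_eq hj
  exact hj.symm

theorem vel_eq {s t : Fin g → ℝ} (h : pt 𝓗 c s = pt 𝓗 c t) : vel 𝓗 c s = vel 𝓗 c t := by
  funext i
  obtain ⟨n, hn⟩ := ((𝓗.isClosedCurve c i).embedded (s i) (t i)).1 (congrFun h i)
  simp only [vel, hn]
  exact velocity_add_int (𝓗.isClosedCurve c i) _ _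

theorem mem_orderedTorus {x : Fin g → S} :
    x ∈ orderedTorus (𝓗.curve c) ↔ ∃ t, pt 𝓗 c t = x := by
  constructor
  · intro h
    choose t ht using h
    exact ⟨t, funext ht⟩
  · rintro ⟨t, rfl⟩ i
    exact ⟨t i, rfl⟩

theorem mem_torus {D : Sym S g} : D ∈ torus (𝓗.curve c) ↔ ∃ t, symMk (pt 𝓗 c t) = D := by
  constructor
  · rintro ⟨x, hx, rfl⟩
    obtain ⟨t, rfl⟩ := mem_orderedTorus.1 hx
    exact ⟨t, rfl⟩
  · rintro ⟨t, rfl⟩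
    exact ⟨_, mem_orderedTorus.2 ⟨t, rfl⟩, rfl⟩

variable (𝓗 c) [IsManifold 𝓘(ℂ) ω S] [T2Space S] [Nonempty S]

/-- The complex frame of the tangent space given by the coordinate curves of the torus. -/
def frame (t : Fin g → ℝ) : (Fin g → ℂ) ≃ₗ[ℂ] SymTangent (symMk (pt 𝓗 c t)) :=
  (LinearEquiv.piCongrRight fun i => LinearEquiv.smulOfNeZero ℂ ℂ (vel 𝓗 c t i)
    (vel_ne_zero t i)).trans (LinearEquiv.ofBijective _ (imgMap_bijective (pt_injective t)))

variable {𝓗 c}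

theorem frame_apply (t : Fin g → ℝ) (v : Fin g → ℂ) :
    frame 𝓗 c t v = imgMap (pt 𝓗 c t) (fun i => vel 𝓗 c t i * v i) := rfl

/-- The spanning set allows all ordered points and all curve parameters over the given tuple. The
ordering is unique and the parameters are unique up to integers, which do not change the velocities.
-/
theorem tangentTorus_eq (t : Fin g → ℝ) :
    tangentTorus (𝓗.curve c) (symMk (pt 𝓗 c t)) = realSpan (frame 𝓗 c t) := by
  refine le_antisymm (Submodule.span_le.2 ?_) ?_
  · rintro ξ ⟨x, hx, v, hv, hξ⟩
    obtain ⟨s, rfl⟩ := mem_orderedTorus.1 hx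
    have hst := pt_eq hξ.1
    have hv' : ∀ i, ∃ r : ℝ, v i = r * vel 𝓗 c t i := by
      intro i
      obtain ⟨t', r, h1, h2⟩ := mem_tangentLine.1 (hv i)
      refine ⟨r, h2.trans ?_⟩
      have h3 : pt 𝓗 c (Function.update t i t') = pt 𝓗 c t := by
        funext j
        by_cases hj : j = i
        · subst hj
          rw [← hst]
          simpa [pt] using h1
        · simp [pt, hj]
      have h4 := congrFun (vel_eq h3) i
      simp only [vel, Function.update_self] at h4
      simp only [vel]
      rw [← h4]
    choose r hr using hv'
    rw [hst] at hξ
    refine mem_realSpan.2 ⟨r, ?_⟩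
    rw [frame_apply, hξ.eq_imgMap]
    congr 1
    funext i
    rw [hr i, mul_comm]
    rfl
  · rintro _ ⟨r, rfl⟩
    refine Submodule.subset_span ⟨pt 𝓗 c t, mem_orderedTorus.2 ⟨t, rfl⟩,
      fun i => vel 𝓗 c t i * r i, fun i => mem_tangentLine.2 ⟨t i, r i, rfl, ?_⟩,
      isImageVector_imgMap _ _⟩
    rw [mul_comm]
    rfl

/-- Paired with the trace of `h`, a frame vector gives a sum of derivatives of `h` along the curves,
which are continuous in the parameters. -/
theorem tendsto_frame {B : Type*} {l : Filter B} {τ : B → Fin g → ℝ} {t : Fin g → ℝ}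
    (hτ : Filter.Tendsto τ l (𝓝 t)) {q : B → Fin g → ℂ} {v : Fin g → ℂ}
    (hq : Filter.Tendsto q l (𝓝 v)) :
    Filter.Tendsto (fun b => (⟨_, frame 𝓗 c (τ b) (q b)⟩ : SymTangentBundle S g)) l
      (𝓝 ⟨_, frame 𝓗 c t v⟩) := by
  have hp : Filter.Tendsto (fun b => pt 𝓗 c (τ b)) l (𝓝 (pt 𝓗 c t)) :=
    tendsto_pi_nhds.2 fun i => ((𝓗.isClosedCurve c i).smooth.continuous.tendsto (t i)).comp
      (tendsto_pi_nhds.1 hτ i)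
  refine tendsto_of_tr ((continuous_symMk.tendsto _).comp hp) fun h hh => ?_
  have hi : ∀ i, ContMDiffAt 𝓘(ℂ) 𝓘(ℂ) ω h (𝓗.curve c i (t i)) := fun i =>
    hh _ (mem_symMk.2 ⟨i, rfl⟩)
  have hhol : ∀ᶠ b in l, HolNear h (symMk (pt 𝓗 c (τ b))) := by
    have h1 : ∀ᶠ b in l, ∀ i, ContMDiffAt 𝓘(ℂ) 𝓘(ℂ) ω h (pt 𝓗 c (τ b) i) :=
      Filter.eventually_all.2 fun i => (tendsto_pi_nhds.1 hp i).eventually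
        ((contMDiffAt_iff_contMDiffAt_nhds (by simp)).1 (hi i))
    filter_upwards [h1] with b hb x hx
    obtain ⟨i, rfl⟩ := mem_symMk.1 hx
    exact hb i
  have key : ∀ (s : Fin g → ℝ) (w : Fin g → ℂ), HolNear h (symMk (pt 𝓗 c s)) →
      tr (frame 𝓗 c s w) h = ∑ i, deriv (fun r => h (𝓗.curve c i r)) (s i) * w i := by
    intro s w hs
    rw [frame_apply, tr_imgMap _ _ hs]
    refine Finset.sum_congr rfl fun i _ => ?_
    rw [(hasDerivAt_comp_curve (𝓗.isClosedCurve c i).smooth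
      (hs _ (mem_symMk.2 ⟨i, rfl⟩))).deriv, ← mul_assoc]
    rfl
  simp only [key t v hh]
  refine Filter.Tendsto.congr' (f₁ := fun b => ∑ i, deriv (fun r => h (𝓗.curve c i r)) (τ b i) * q b i)
    (hhol.mono fun b hb => (key _ _ hb).symm) ?_
  exact tendsto_finsetSum _ fun i _ => ((continuousAt_deriv_comp_curve
    (𝓗.isClosedCurve c i).smooth (hi i)).tendsto.comp (tendsto_pi_nhds.1 hτ i)).mul
      (tendsto_pi_nhds.1 hq i)

-- The velocities of an α curve and a β curve at a crossing are independent over ℝ.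
omit [IsManifold 𝓘(ℂ) ω S] [T2Space S] [Nonempty S] in
theorem eq_zero_of_transverse {t s : Fin g → ℝ} {σ : Equiv.Perm (Fin g)}
    (hσ : pt 𝓗 1 s = pt 𝓗 0 t ∘ σ) {a b : ℝ} {i : Fin g}
    (h : vel 𝓗 0 t (σ i) * a = vel 𝓗 1 s i * b) : a = 0 := by
  have h1 := 𝓗.transverse (σ i) i (t (σ i)) (s i) (congrFun hσ i).symm
  have h2 := LinearIndependent.pair_iff.1 h1 a (-b)
  refine (h2 ?_).1
  change a • vel 𝓗 0 t (σ i) + (-b) • vel 𝓗 1 s i = 0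
  rw [Complex.real_smul, Complex.real_smul]
  push_cast
  linear_combination h

theorem imgMap_comp_perm {n : ℕ} (x : Fin n → S) (v : Fin n → ℂ) (σ : Equiv.Perm (Fin n)) :
    IsImageVector (imgMap x v) (x ∘ σ) (v ∘ σ) := by
  refine isImageVector_of_tr (symMk_comp_perm x σ) fun h hh => ?_
  rw [tr_imgMap x v hh]
  exact (Equiv.sum_comp σ fun i => chartDeriv h (x i) * v i).symm

end Tori

end

end HFK

namespace HFK

noncomputable section

universe u v

variable {S : Type u} [TopologicalSpace S] [ChartedSpace ℂ S]
variable {S' : Type v} [TopologicalSpace S'] [ChartedSpace ℂ S']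
variable {g : ℕ} {𝓗 : HeegaardDiagram S g} {P : SurfaceDoubleCover S S' 𝓗.w 𝓗.z}

theorem IsImageVector.unique {X : Type u} [TopologicalSpace X] [ChartedSpace ℂ X] {n : ℕ}
    {D : Sym X n} {ξ η : SymTangent D} {x : Fin n → X} {v : Fin n → ℂ} (hξ : IsImageVector ξ x v)
    (hη : IsImageVector η x v) : ξ = η := by
  apply Subtype.ext
  ext f
  rw [hξ.2 f, hη.2 f]

/-! ### The lifted curves and tori -/

namespace Phase

variable (Φ : Phase P) (c : Fin 2)

theorem curve_add_int (i : Fin g) (t : ℝ) (n : ℤ) : Φ.curve c i (t + n) = Φ.curve c i t := by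
  have := (show Function.Periodic (Φ.curve c i) 1 from Φ.periodic_curve c i).int_mul n t
  rwa [mul_one] at this

theorem arg_add_int (i : Fin g) (t : ℝ) (n : ℤ) : Φ.arg c i (t + n) = Φ.arg c i t := by
  have := (show Function.Periodic (Φ.arg c i) 1 from Φ.periodic_arg c i).int_mul n t
  rwa [mul_one] at this

theorem curve_ne_w (i : Fin g) (t : ℝ) : Φ.curve c i t ≠ P.w' := fun h =>
  (𝓗.avoids c i t).1 (by rw [← Φ.map_curve, h, P.map_w])

theorem curve_ne_z (i : Fin g) (t : ℝ) : Φ.curve c i t ≠ P.z' := fun h =>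
  (𝓗.avoids c i t).2 (by rw [← Φ.map_curve, h, P.map_z])

theorem deck_curve_ne (i : Fin g) (t : ℝ) : P.ι (Φ.curve c i t) ≠ Φ.curve c i t := fun h =>
  ((P.fixed _).1 h).elim (Φ.curve_ne_w c i t) (Φ.curve_ne_z c i t)

/-- The curve is embedded and its lift has the same period, so the chosen lift contains just one
point over each point of the curve. -/
theorem curve_eq_of_map {i j : Fin g} {t s : ℝ}
    (h : P.π (Φ.curve c i s) = P.π (Φ.curve c j t)) : Φ.curve c i s = Φ.curve c j t := by
  rw [Φ.map_curve, Φ.map_curve] at h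
  obtain rfl := index_eq h
  obtain ⟨n, rfl⟩ := ((𝓗.isClosedCurve c i).embedded s t).1 h
  exact Φ.curve_add_int c i t n

theorem deck_curve_notMem (i j : Fin g) (t : ℝ) : P.ι (Φ.curve c i t) ∉ range (Φ.curve c j) := by
  rintro ⟨s, hs⟩
  refine Φ.deck_curve_ne c i t ?_
  rw [← hs]
  exact Φ.curve_eq_of_map c (by rw [hs, P.map_deck])

open scoped Classical in
/-- The sign which is `1` on the chosen lifts of the curves. -/
def sign (a : S') : ℝ := if ∃ i, a ∈ range (Φ.curve c i) then 1 else -1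

theorem sign_curve (i : Fin g) (t : ℝ) : Φ.sign c (Φ.curve c i t) = 1 := if_pos ⟨i, t, rfl⟩

theorem sign_deck_curve (i : Fin g) (t : ℝ) : Φ.sign c (P.ι (Φ.curve c i t)) = -1 :=
  if_neg fun ⟨j, hj⟩ => Φ.deck_curve_notMem c i j t hj

theorem sign_ne_zero (a : S') : (Φ.sign c a : ℂ) ≠ 0 := by
  unfold sign
  split_ifs <;> norm_num

theorem eq_or_eq_of_mem {t : Fin g → ℝ} {a : S'} (ha : P.π a ∈ symMk (pt 𝓗 c t)) :
    ∃ i, a = Φ.curve c i (t i) ∨ a = P.ι (Φ.curve c i (t i)) := by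
  obtain ⟨i, hi⟩ := mem_symMk.1 ha
  refine ⟨i, (P.fibre _ _).1 ?_⟩
  rw [Φ.map_curve]
  exact hi

theorem sign_deck {t : Fin g → ℝ} {a : S'} (ha : P.π a ∈ symMk (pt 𝓗 c t)) :
    (Φ.sign c (P.ι a) : ℂ) = -Φ.sign c a := by
  obtain ⟨i, rfl | rfl⟩ := Φ.eq_or_eq_of_mem c ha
  · rw [Φ.sign_deck_curve, Φ.sign_curve]; norm_num
  · rw [P.deck_deck, Φ.sign_deck_curve, Φ.sign_curve]; norm_num

/-- The lifts of the points of the ordered torus. -/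
def liftPt (t : Fin g → ℝ) : Fin g → S' := fun i => Φ.curve c i (t i)

theorem map_liftPt (t : Fin g → ℝ) (i : Fin g) : P.π (Φ.liftPt c t i) = pt 𝓗 c t i :=
  Φ.map_curve c i (t i)

theorem symLift_pt (t : Fin g → ℝ) :
    P.symLift g (symMk (pt 𝓗 c t)) = symMk (P.liftTuple (Φ.liftPt c t)) :=
  P.symLift_symMk _ _ (Φ.map_liftPt c t)

theorem isClosed_range_curve [T2Space S'] (i : Fin g) : IsClosed (range (Φ.curve c i)) :=
  (Function.Periodic.compact_of_continuous (show Function.Periodic (Φ.curve c i) 1 from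
    Φ.periodic_curve c i) one_ne_zero (Φ.continuous_curve c i)).isClosed

/-- The preimage of the curve is the disjoint union of two closed sets, the chosen lift and its deck
translate, and no connected subset meets both. -/
theorem component_ne [T2Space S'] (i : Fin g) (t : ℝ) :
    connectedComponentIn (P.π ⁻¹' range (𝓗.curve c i)) (Φ.curve c i t) ≠
      connectedComponentIn (P.π ⁻¹' range (𝓗.curve c i)) (P.ι (Φ.curve c i t)) := by
  intro h
  set F := P.π ⁻¹' range (𝓗.curve c i)
  have hm : Φ.curve c i t ∈ F := ⟨t, (Φ.map_curve c i t).symm⟩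
  have hm' : P.ι (Φ.curve c i t) ∈ F := by
    change P.π (P.ι _) ∈ range (𝓗.curve c i)
    rw [P.map_deck]
    exact hm
  have hcl := Φ.isClosed_range_curve c i
  have hsub : connectedComponentIn F (Φ.curve c i t) ⊆
      range (Φ.curve c i) ∪ P.ι ⁻¹' range (Φ.curve c i) := by
    refine (connectedComponentIn_subset _ _).trans ?_
    rintro a ⟨s, hs⟩
    rcases (P.fibre (Φ.curve c i s) a).1 (by rw [Φ.map_curve, hs]) with rfl | rfl
    · exact Or.inl ⟨s, rfl⟩
    · exact Or.inr ⟨s, by rw [P.deck_deck]⟩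
  obtain ⟨a, -, ⟨s, rfl⟩, ha⟩ := isPreconnected_closed_iff.1
    (isPreconnected_connectedComponentIn (F := F) (x := Φ.curve c i t)) _ _ hcl
    (hcl.preimage P.continuous_deck) hsub ⟨_, mem_connectedComponentIn hm, t, rfl⟩
    ⟨P.ι (Φ.curve c i t), by rw [h]; exact mem_connectedComponentIn hm', t, by rw [P.deck_deck]⟩
  exact Φ.deck_curve_notMem c i i s ha

theorem liftTuple_mem [T2Space S'] (t : Fin g → ℝ) :
    P.liftTuple (Φ.liftPt c t) ∈ orderedLiftTorus P (𝓗.curve c) := by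
  intro i
  have h0 : P.liftTuple (Φ.liftPt c t) (finProdFinEquiv (0, i)) = Φ.curve c i (t i) := by
    simp [SurfaceDoubleCover.liftTuple, liftPt]
  have h1 : P.liftTuple (Φ.liftPt c t) (finProdFinEquiv (1, i)) = P.ι (Φ.curve c i (t i)) := by
    simp [SurfaceDoubleCover.liftTuple, liftPt]
  refine ⟨fun d => ?_, ?_⟩
  · fin_cases d
    · change P.π (P.liftTuple (Φ.liftPt c t) (finProdFinEquiv (0, i))) ∈ _
      rw [h0, Φ.map_curve]
      exact ⟨_, rfl⟩
    · change P.π (P.liftTuple (Φ.liftPt c t) (finProdFinEquiv (1, i))) ∈ _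
      rw [h1, P.map_deck, Φ.map_curve]
      exact ⟨_, rfl⟩
  · rw [h0, h1]
    exact Φ.component_ne c i (t i)

include Φ in
theorem symLift_mem_liftTorus [T2Space S'] (t : Fin g → ℝ) :
    P.symLift g (symMk (pt 𝓗 c t)) ∈ liftTorus P (𝓗.curve c) :=
  ⟨_, Φ.liftTuple_mem c t, (Φ.symLift_pt c t).symm⟩

variable [IsManifold 𝓘(ℂ) ω S] [T2Space S] [Nonempty S] [IsManifold 𝓘(ℂ) ω S'] [T2Space S']
  [Nonempty S']

-- The components of the twist are divided by `coverDeriv`, so the differential of the covering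
-- takes them to real multiples of the velocities, as the lifted tangent lines require. The function
-- `l` must be real for this.
include Φ in
theorem twist_mem_tangentLiftTorus (t : Fin g → ℝ) (l : S' → ℝ) (r : Fin g → ℝ) :
    P.twist (pt_mem t) (fun a => l a) (frame 𝓗 c t (ofRealVec g r)) ∈
      tangentLiftTorus P (𝓗.curve c) (P.symLift g (symMk (pt 𝓗 c t))) := by
  refine Submodule.subset_span ⟨_, Φ.liftTuple_mem c t, _, fun k => ?_,
    P.isImageVector_twist (pt_mem t) (Φ.map_liftPt c t) _ _⟩
  have hπ : P.π (P.liftTuple (Φ.liftPt c t) k) = pt 𝓗 c t (finProdFinEquiv.symm k).2 := by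
    unfold SurfaceDoubleCover.liftTuple
    split_ifs
    · exact Φ.map_liftPt c t _
    · rw [P.map_deck]; exact Φ.map_liftPt c t _
  have hm : P.π (P.liftTuple (Φ.liftPt c t) k) ∈ symMk (pt 𝓗 c t) := by
    rw [hπ]; exact mem_symMk.2 ⟨_, rfl⟩
  have h0 := P.coverDeriv_ne_zero (P.ne_w (pt_mem t) hm) (P.ne_z (pt_mem t) hm)
  refine mem_tangentLine.2 ⟨t (finProdFinEquiv.symm k).2,
    l (P.liftTuple (Φ.liftPt c t) k) * r (finProdFinEquiv.symm k).2, hπ.symm, ?_⟩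
  refine (P.mfderiv_π _ _).trans ?_
  rw [mul_div_cancel₀ _ h0]
  change _ * (vel 𝓗 c t _ * _) = _
  push_cast
  simp only [ofRealVec_apply, vel]
  ring

end Phase

/-! ### The two symplectic forms and their Lagrangians -/

section Forms

variable [IsManifold 𝓘(ℂ) ω S] [T2Space S] [Nonempty S] [IsManifold 𝓘(ℂ) ω S'] [T2Space S']
  [Nonempty S'] (Ω : TamedForm P)

/-- The form of the tangential polarization. -/
def tForm (D : Base 𝓗) : SymTangent D.1 →ₗ[ℝ] SymTangent D.1 →ₗ[ℝ] ℝ :=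
  (tangentialPolarization P Ω).form D

/-- The form of the normal polarization. -/
def nForm (D : Base 𝓗) : normalFibre P D.1 →ₗ[ℝ] normalFibre P D.1 →ₗ[ℝ] ℝ :=
  (normalPolarization P Ω).form D

/-- The Lagrangians of the normal polarization. -/
def nF (c : Fin 2) (D : Base 𝓗) : Submodule ℝ (normalFibre P D.1) := (normalPolarization P Ω).F c D

theorem tForm_apply (D : Base 𝓗) (u v : SymTangent D.1) :
    tForm Ω D u v = Ω.form (P.symLift g D.1)
      (P.twist D.2 (fun _ => 1) u) (P.twist D.2 (fun _ => 1) v) := by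
  have h := P.symDifferential_symLift D.2
  exact congrArg₂ (fun a b => Ω.form (P.symLift g D.1) a b) (h u) (h v)

theorem tForm_self (D : Base 𝓗) (u : SymTangent D.1) : tForm Ω D u u = 0 := by
  rw [tForm_apply]
  exact Ω.alternating _ (P.symLift_mem D.2) _

/-- The differential of the embedding is the twist by 1. It is complex linear, and injective because
`untwist` is a left inverse, so tameness pulls back. -/
theorem tForm_pos (D : Base 𝓗) (u : SymTangent D.1) (hu : u ≠ 0) :
    0 < tForm Ω D u (Complex.I • u) := by
  rw [tForm_apply, map_smul]
  refine Ω.tame _ (P.symLift_mem D.2) _ fun h => hu ?_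
  rw [← P.untwist_twist D.2 (c := fun _ => 1) (c' := fun _ => 1) (fun _ _ => one_mul 1) u, h,
    map_zero]

omit [IsManifold 𝓘(ℂ) ω S] [T2Space S] [Nonempty S] [IsManifold 𝓘(ℂ) ω S'] [T2Space S']
  [Nonempty S'] in
theorem nForm_self (D : Base 𝓗) (u : normalFibre P D.1) : nForm Ω D u u = 0 :=
  Ω.alternating _ (P.symLift_mem D.2) _

omit [IsManifold 𝓘(ℂ) ω S] [T2Space S] [Nonempty S] [IsManifold 𝓘(ℂ) ω S'] [T2Space S']
  [Nonempty S'] in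
theorem nForm_pos (D : Base 𝓗) (u : normalFibre P D.1) (hu : u ≠ 0) :
    0 < nForm Ω D u (Complex.I • u) :=
  Ω.tame _ (P.symLift_mem D.2) _ fun h => hu (Subtype.ext h)

variable {Ω} (Φ : Phase P) (c : Fin 2)

/-- The complex frame of the normal space along the torus. -/
def normalFrame (t : Fin g → ℝ) : (Fin g → ℂ) ≃ₗ[ℂ] normalFibre P (symMk (pt 𝓗 c t)) :=
  (frame 𝓗 c t).trans (P.twistEquiv (pt_mem t) (c := fun a => Φ.sign c a)
    (fun a _ => Φ.sign_ne_zero c a) fun _ ha => Φ.sign_deck c ha)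

theorem normalFrame_coe (t : Fin g → ℝ) (v : Fin g → ℂ) :
    (normalFrame Φ c t v).1 = P.twist (pt_mem t) (fun a => Φ.sign c a) (frame 𝓗 c t v) := rfl

variable (Ω) 

include Φ in
theorem tForm_isotropic (t : Fin g → ℝ) :
    ∀ u ∈ realSpan (frame 𝓗 c t), ∀ v ∈ realSpan (frame 𝓗 c t),
      tForm Ω (base 𝓗 c t) u v = 0 := by
  rintro _ ⟨r, rfl⟩ _ ⟨s, rfl⟩
  refine (tForm_apply Ω (base 𝓗 c t) _ _).trans ?_
  have h := fun r => Φ.twist_mem_tangentLiftTorus c t (fun _ => 1) r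
  simp only [Complex.ofReal_one] at h
  exact (Ω.lagrangian c _ (Φ.symLift_mem_liftTorus c t) _).1 (h r) _ (h s)

include Φ in
theorem tForm_isLagrangian (t : Fin g → ℝ) :
    IsLagrangian (tForm Ω (base 𝓗 c t)) (realSpan (frame 𝓗 c t)) :=
  isLagrangian_realSpan (tForm_self Ω (base 𝓗 c t)) (tForm_pos Ω (base 𝓗 c t)) (frame 𝓗 c t)
    (tForm_isotropic Ω Φ c t)

omit [IsManifold 𝓘(ℂ) ω S] [T2Space S] [Nonempty S] [IsManifold 𝓘(ℂ) ω S']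
  [Nonempty S'] in
include Φ in
theorem nF_isotropic (t : Fin g → ℝ) :
    ∀ u ∈ nF Ω c (base 𝓗 c t), ∀ v ∈ nF Ω c (base 𝓗 c t), nForm Ω (base 𝓗 c t) u v = 0 :=
  fun _ hu _ hv => (Ω.lagrangian c _ (Φ.symLift_mem_liftTorus c t) _).1 hu _ hv

/-- The sign function is real and odd, so twisting real tangent vectors of the torus by it gives
normal vectors tangent to the lifted torus. Isotropy shows that there are no others. -/
theorem nF_eq (t : Fin g → ℝ) : nF Ω c (base 𝓗 c t) = realSpan (V := normalFibre P (symMk (pt 𝓗 c t))) (normalFrame Φ c t) :=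
  eq_realSpan_of_isotropic (nForm_self Ω (base 𝓗 c t)) (nForm_pos Ω (base 𝓗 c t)) _
    (fun r => Φ.twist_mem_tangentLiftTorus c t (Φ.sign c) r) (nF_isotropic Ω Φ c t)

include Φ in
theorem nForm_isLagrangian (t : Fin g → ℝ) :
    IsLagrangian (V := normalFibre P (base 𝓗 c t).1) (nForm Ω (base 𝓗 c t)) (nF Ω c (base 𝓗 c t)) := by
  have h := nF_isotropic Ω Φ c t
  rw [nF_eq Ω Φ c t] at h ⊢
  exact isLagrangian_realSpan (V := normalFibre P (base 𝓗 c t).1)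
    (nForm_self Ω (base 𝓗 c t)) (nForm_pos Ω (base 𝓗 c t)) _ h

/-- The tuple remains a variable, so that a common point of the tori, presented by its α parameters,
can also be described by the β frames. -/
theorem exists_frames {t : Fin g → ℝ} (D : Base 𝓗) (h : symMk (pt 𝓗 c t) = D.1) :
    ∃ (e : (Fin g → ℂ) ≃ₗ[ℂ] SymTangent D.1) (f : (Fin g → ℂ) ≃ₗ[ℂ] normalFibre P D.1),
      tangentTorus (𝓗.curve c) D.1 = realSpan e ∧
      nF Ω c D = realSpan (V := normalFibre P D.1) f ∧
      (∀ v, IsImageVector (e v) (pt 𝓗 c t) (fun i => vel 𝓗 c t i * v i)) ∧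
      ∀ v, (f v).1 = P.twist D.2 (fun a => Φ.sign c a) (e v) := by
  obtain ⟨D, hD⟩ := D
  subst h
  exact ⟨frame 𝓗 c t, normalFrame Φ c t, tangentTorus_eq t, nF_eq Ω Φ c t,
    fun v => isImageVector_imgMap _ _, fun v => rfl⟩

-- The two orderings of a common point differ by a permutation. The signs by which the normal frames
-- differ from the tangential ones are real, so both claims reduce to the independence of velocities
-- at the crossings.
include Φ in
theorem isCompl_F (D : Base 𝓗) (h0 : D ∈ tori 𝓗 0) (h1 : D ∈ tori 𝓗 1) :
    IsCompl (tangentTorus (𝓗.curve 0) D.1) (tangentTorus (𝓗.curve 1) D.1) ∧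
    IsCompl (nF Ω 0 D) (nF Ω 1 D) := by
  obtain ⟨t, ht⟩ := mem_torus.1 h0
  obtain ⟨s, hs⟩ := mem_torus.1 h1
  obtain ⟨D, hD⟩ := D
  simp only at ht hs
  subst ht
  obtain ⟨σ, hσ⟩ := symMk_eq_iff.1 hs.symm
  obtain ⟨e₁, f₁, het, hft, he, hf⟩ := exists_frames Ω Φ 1 ⟨_, hD⟩ hs
  have himg : ∀ q, e₁ q = imgMap (pt 𝓗 0 t) (fun i => vel 𝓗 1 s (σ.symm i) * q (σ.symm i)) := by
    intro q
    refine (he q).unique ?_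
    have := imgMap_comp_perm (pt 𝓗 0 t) (fun i => vel 𝓗 1 s (σ.symm i) * q (σ.symm i)) σ
    rw [← hσ] at this
    simpa [Function.comp_def] using this
  have hkey : ∀ (r q : Fin g → ℝ) (l : Fin g → ℝ), imgMap (pt 𝓗 0 t) (fun i => vel 𝓗 0 t i * r i) =
      imgMap (pt 𝓗 0 t) (fun i => l i * (vel 𝓗 1 s (σ.symm i) * q (σ.symm i))) → r = 0 := by
    intro r q l h
    have h2 := imgMap_injective (pt_injective t) h
    funext i
    refine eq_zero_of_transverse (i := σ.symm i) (b := l i * q (σ.symm i)) hσ ?_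
    have := congrFun h2 i
    rw [σ.apply_symm_apply]
    refine this.trans ?_
    push_cast
    ring
  refine ⟨?_, ?_⟩
  · rw [tangentTorus_eq t, het]
    refine isCompl_realSpan (Submodule.disjoint_def.2 ?_)
    rintro _ ⟨r, rfl⟩ ⟨q, hq⟩
    have hr : r = 0 := by
      refine hkey r q (fun _ => 1) ?_
      refine Eq.trans (hq.symm.trans (himg _)) ?_
      simp
    rw [hr, map_zero]
  · rw [show nF Ω 0 ⟨_, hD⟩ = _ from nF_eq Ω Φ 0 t, hft]
    refine isCompl_realSpan (V := normalFibre P (symMk (pt 𝓗 0 t))) (Submodule.disjoint_def.2 ?_)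
    rintro _ ⟨r, rfl⟩ ⟨q, hq⟩
    have hr : r = 0 := by
      refine hkey r q (fun i => Φ.sign 1 (Φ.liftPt 0 t i)) ?_
      have h1 : (f₁ (ofRealVec g q)).1 = (normalFrame Φ 0 t (ofRealVec g r)).1 :=
        congrArg Subtype.val hq
      -- The twist by the β signs is rewritten as a twist by the α signs. The α sign is 1 on the α
      -- lifts, so the i-th component acquires the value of the β sign there as a factor.
      rw [hf, himg, normalFrame_coe, P.twist_imgMap_congr hD (Φ.map_liftPt 0 t)
        (c' := fun a => Φ.sign 0 a)
        (v' := fun i => Φ.sign 1 (Φ.liftPt 0 t i) * (vel 𝓗 1 s (σ.symm i) * q (σ.symm i)))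
        (fun a ha => Φ.sign_deck 1 (hs ▸ ha)) (fun a ha => Φ.sign_deck 0 ha)
        (fun i => by simp [Phase.liftPt, Φ.sign_curve])] at h1
      exact ((P.twistEquiv hD (c := fun a => Φ.sign 0 a) (fun a _ => Φ.sign_ne_zero 0 a)
        fun _ ha => Φ.sign_deck 0 ha).injective (Subtype.ext h1)).symm
    rw [hr, map_zero]

end Forms

end

end HFK

/-! ### Twisting functions that vary with the tuple -/

namespace HFK

noncomputable section

universe u v

variable {S : Type u} [TopologicalSpace S] [ChartedSpace ℂ S]
variable {S' : Type v} [TopologicalSpace S'] [ChartedSpace ℂ S']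
variable {g : ℕ} {𝓗 : HeegaardDiagram S g} {P : SurfaceDoubleCover S S' 𝓗.w 𝓗.z}

/-- A function on the points over the unordered tuples which is locally constant in the point and
continuous in the tuple. -/
structure IsVarying (P : SurfaceDoubleCover S S' 𝓗.w 𝓗.z) (σ : Base 𝓗 → S' → ℂ) : Prop where
  locConst : ∀ (D₀ : Base 𝓗) (a : S'), P.π a ∈ D₀.1 →
    ∀ᶠ p : Base 𝓗 × S' in 𝓝 D₀ ×ˢ 𝓝 a, σ p.1 p.2 = σ p.1 a
  continuousAt : ∀ (D₀ : Base 𝓗) (a : S'), P.π a ∈ D₀.1 → ContinuousAt (fun D => σ D a) D₀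

theorem IsVarying.tendsto {σ : Base 𝓗 → S' → ℂ} (h : IsVarying P σ) (D₀ : Base 𝓗) (a : S')
    (ha : P.π a ∈ D₀.1) :
    Filter.Tendsto (fun p : Base 𝓗 × S' => σ p.1 p.2) (𝓝 D₀ ×ˢ 𝓝 a) (𝓝 (σ D₀ a)) :=
  ((h.continuousAt D₀ a ha).tendsto.comp Filter.tendsto_fst).congr'
    ((h.locConst D₀ a ha).mono fun _ hp => hp.symm)

theorem IsVarying.inv {σ : Base 𝓗 → S' → ℂ} (h : IsVarying P σ)
    (h0 : ∀ (D : Base 𝓗) (a : S'), P.π a ∈ D.1 → σ D a ≠ 0) :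
    IsVarying P fun D => (σ D)⁻¹ where
  locConst D₀ a ha := (h.locConst D₀ a ha).mono fun p hp => by simp only [Pi.inv_apply, hp]
  continuousAt D₀ a ha := (h.continuousAt D₀ a ha).inv₀ (h0 D₀ a ha)

theorem IsVarying.const (r : ℂ) : IsVarying P fun _ _ => r where
  locConst _ _ _ := Filter.Eventually.of_forall fun _ => rfl
  continuousAt _ _ _ := continuousAt_const

/-- The tuple of preimages depends continuously on the tuple, so points over nearby tuples are near
points over `D₀`. -/
theorem eventually_forall_over {D₀ : Base 𝓗} {p : S' → Prop}
    (h : ∀ a, P.π a ∈ D₀.1 → ∀ᶠ b in 𝓝 a, p b) :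
    ∀ᶠ D : Base 𝓗 in 𝓝 D₀, ∀ a, P.π a ∈ D.1 → p a := by
  have h1 : ∀ᶠ D' in 𝓝 (P.symLift g D₀.1), ∀ a ∈ D', p a :=
    eventually_forall_mem fun a ha => h a (P.mem_symLift.1 ha)
  have h2 : ContinuousAt (fun D : Base 𝓗 => P.symLift g D.1) D₀ :=
    (P.continuousAt_symLift D₀.2).comp continuous_subtype_val.continuousAt
  filter_upwards [h2.eventually h1] with D hD a ha using hD a (P.mem_symLift.2 ha)

section Twist

variable [IsManifold 𝓘(ℂ) ω S] [T2Space S] [Nonempty S] [IsManifold 𝓘(ℂ) ω S'] [T2Space S']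
  [Nonempty S']

-- Let χₐ be 1 near a and 0 near the other points over `D₀`. Then Σ σ(D, a)χₐ represents σ(D) for
-- all nearby D. Only the finitely many coefficients depend on D, which reduces the continuity of
-- the twist to theirs.
omit [IsManifold 𝓘(ℂ) ω S] [T2Space S] [Nonempty S] [IsManifold 𝓘(ℂ) ω S'] [Nonempty S'] in
theorem IsVarying.exists_locConst {σ : Base 𝓗 → S' → ℂ} (h : IsVarying P σ) (D₀ : Base 𝓗) :
    ∃ (A : Finset S') (χ : S' → S' → ℂ), (∀ a ∈ A, P.π a ∈ D₀.1) ∧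
      (∀ᶠ D : Base 𝓗 in 𝓝 D₀, ∀ a ∈ A, P.LocConst D.1 (χ a) (χ a)) ∧
      ∀ᶠ D : Base 𝓗 in 𝓝 D₀, P.LocConst D.1 (fun b => ∑ a ∈ A, σ D a * χ a b) (σ D) := by
  classical
  set A : Finset S' := Multiset.toFinset (P.symLift g D₀.1).1 with hA
  have hAm : ∀ a, a ∈ A ↔ P.π a ∈ D₀.1 := fun a => by
    rw [hA, Multiset.mem_toFinset]; exact P.mem_symLift
  choose χ hχ using fun a => P.exists_locConst D₀.1 (fun b => if b = a then (1 : ℂ) else 0)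
  have hχ' : ∀ a₀, P.π a₀ ∈ D₀.1 → ∀ᶠ b in 𝓝 a₀, ∀ a ∈ A, χ a b = if a₀ = a then 1 else 0 :=
    fun a₀ h0 => (Filter.eventually_all_finset A).2 fun a _ => hχ a a₀ h0
  refine ⟨A, χ, fun a ha => (hAm a).1 ha, ?_, ?_⟩
  · refine eventually_forall_over (p := fun b => ∀ a ∈ A, ∀ᶠ b' in 𝓝 b, χ a b' = χ a b) ?_ |>.mono
      fun D hD a ha b hb => hD b hb a ha
    intro a₀ h0
    filter_upwards [(hχ' a₀ h0).eventually_nhds] with b hb a ha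
    filter_upwards [hb] with b' hb'
    rw [hb' a ha, hb.self_of_nhds a ha]
  · have h1 : ∀ a ∈ A, ∃ N ∈ 𝓝 D₀, ∃ V ∈ 𝓝 a, ∀ D ∈ N, ∀ b ∈ V, σ D b = σ D a := by
      intro a ha
      obtain ⟨N, hN, V, hV, hNV⟩ := Filter.eventually_prod_iff.1 (h.locConst D₀ a ((hAm a).1 ha))
      exact ⟨{D | N D}, hN, {b | V b}, hV, fun D hD b hb => hNV hD hb⟩
    choose! N hN V hV hNV using h1
    have h2 : ∀ᶠ D : Base 𝓗 in 𝓝 D₀, ∀ a ∈ A, D ∈ N a :=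
      (Filter.eventually_all_finset A).2 fun a ha => hN a ha
    have h3 := eventually_forall_over (P := P) (D₀ := D₀) (p := fun b => ∃ a₀ ∈ A, b ∈ V a₀ ∧
      ∀ᶠ b' in 𝓝 b, ∀ a ∈ A, χ a b' = if a₀ = a then 1 else 0) (by
        intro a₀ h0
        filter_upwards [(hχ' a₀ h0).eventually_nhds, hV a₀ ((hAm a₀).2 h0)] with b hb hbV
        exact ⟨a₀, (hAm a₀).2 h0, hbV, hb⟩)
    filter_upwards [h2, h3] with D hD hD' b hb
    obtain ⟨a₀, ha₀, hbV, hev⟩ := hD' b hb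
    filter_upwards [hev] with b' hb'
    rw [hNV a₀ ha₀ D (hD a₀ ha₀) b hbV]
    calc ∑ a ∈ A, σ D a * χ a b' = ∑ a ∈ A, if a₀ = a then σ D a else 0 :=
          Finset.sum_congr rfl fun a ha => by rw [hb' a ha, mul_ite, mul_one, mul_zero]
      _ = σ D a₀ := by rw [Finset.sum_ite_eq, if_pos ha₀]

omit [IsManifold 𝓘(ℂ) ω S] [Nonempty S] [T2Space S] in
theorem eventually_holNear {X : Type*} [TopologicalSpace X] [ChartedSpace ℂ X]
    [IsManifold 𝓘(ℂ) ω X] {n : ℕ} {D : Sym X n} {h : X → ℂ} (hh : HolNear h D) :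
    ∀ᶠ D' in 𝓝 D, HolNear h D' :=
  eventually_forall_mem fun x hx => (contMDiffAt_iff_contMDiffAt_nhds (by simp)).1 (hh x hx)

theorem IsVarying.tendsto_twist {σ : Base 𝓗 → S' → ℂ} (h : IsVarying P σ) {B : Type*}
    {l : Filter B} {D : B → Base 𝓗} {D₀ : Base 𝓗} (hD : Filter.Tendsto D l (𝓝 D₀))
    {ξ : ∀ b, SymTangent (D b).1} {ξ₀ : SymTangent D₀.1}
    (hξ : Filter.Tendsto (fun b => (⟨_, ξ b⟩ : SymTangentBundle S g)) l (𝓝 ⟨_, ξ₀⟩)) :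
    Filter.Tendsto (fun b => (⟨_, P.twist (D b).2 (σ (D b)) (ξ b)⟩ : SymTangentBundle S' (2 * g))) l
      (𝓝 ⟨_, P.twist D₀.2 (σ D₀) ξ₀⟩) := by
  obtain ⟨A, χ, hA, hχ, hl⟩ := h.exists_locConst D₀
  have hval : Filter.Tendsto (fun b => (D b).1) l (𝓝 D₀.1) :=
    (continuous_subtype_val.tendsto D₀).comp hD
  have hlift : Filter.Tendsto (fun b => P.symLift g (D b).1) l (𝓝 (P.symLift g D₀.1)) :=
    (P.continuousAt_symLift D₀.2).tendsto.comp hval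
  refine tendsto_of_tr hlift fun k hk => ?_
  have key : ∀ (D : Base 𝓗) (η : SymTangent D.1), HolNear k (P.symLift g D.1) →
      (∀ a ∈ A, P.LocConst D.1 (χ a) (χ a)) →
      P.LocConst D.1 (fun b => ∑ a ∈ A, σ D a * χ a b) (σ D) →
      tr (P.twist D.2 (σ D) η) k = ∑ a ∈ A, σ D a * tr η (P.push (χ a) k) := by
    intro D η hk hχ hl
    rw [P.tr_twist D.2 η hk hl]
    have h1 : P.push (fun b => ∑ a ∈ A, σ D a * χ a b) k =
        fun x => ∑ a ∈ A, σ D a * P.push (χ a) k x := by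
      funext x
      simp only [SurfaceDoubleCover.push, Finset.sum_mul, ← Finset.sum_add_distrib]
      exact Finset.sum_congr rfl fun a _ => by ring
    have h2 := fun a ha => (hχ a ha).holNear_push D.2 hk
    rw [h1, tr_sum η fun a ha => (HolNear.const _).mul (h2 a ha)]
    exact Finset.sum_congr rfl fun a ha => tr_smul η _ (h2 a ha)
  simp only [key D₀ ξ₀ hk hχ.self_of_nhds hl.self_of_nhds]
  refine Filter.Tendsto.congr' (f₁ := fun b => ∑ a ∈ A, σ (D b) a * tr (ξ b) (P.push (χ a) k)) ?_ ?_
  · filter_upwards [hlift.eventually (eventually_holNear hk), hD.eventually hχ, hD.eventually hl]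
      with b h1 h2 h3
    exact (key (D b) (ξ b) h1 h2 h3).symm
  · exact tendsto_finsetSum _ fun a ha => ((h.continuousAt D₀ a (hA a ha)).tendsto.comp hD).mul
      (tendsto_tr hξ ((hχ.self_of_nhds a ha).holNear_push D₀.2 hk))

theorem IsVarying.tendsto_untwist {σ : Base 𝓗 → S' → ℂ} (h : IsVarying P σ) {B : Type*}
    {l : Filter B} {D : B → Base 𝓗} {D₀ : Base 𝓗} (hD : Filter.Tendsto D l (𝓝 D₀))
    {ξ : ∀ b, SymTangent (P.symLift g (D b).1)} {ξ₀ : SymTangent (P.symLift g D₀.1)}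
    (hξ : Filter.Tendsto (fun b => (⟨_, ξ b⟩ : SymTangentBundle S' (2 * g))) l (𝓝 ⟨_, ξ₀⟩)) :
    Filter.Tendsto (fun b => (⟨_, P.untwist (D b).2 (σ (D b)) (ξ b)⟩ : SymTangentBundle S g)) l
      (𝓝 ⟨_, P.untwist D₀.2 (σ D₀) ξ₀⟩) := by
  obtain ⟨A, χ, hA, hχ, hl⟩ := h.exists_locConst D₀
  have hval : Filter.Tendsto (fun b => (D b).1) l (𝓝 D₀.1) :=
    (continuous_subtype_val.tendsto D₀).comp hD
  refine tendsto_of_tr hval fun k hk => ?_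
  have hmul : ∀ (D : Base 𝓗), HolNear k D.1 → ∀ a, P.LocConst D.1 (χ a) (χ a) →
      HolNear (fun b => χ a b * k (P.π b)) (P.symLift g D.1) := by
    intro D hk a ha
    refine ha.holNear.mul fun b hb => ?_
    have hb' := P.mem_symLift.1 hb
    exact (hk _ hb').comp b (P.contMDiffAt_π (P.ne_w D.2 hb') (P.ne_z D.2 hb'))
  have key : ∀ (D : Base 𝓗) (η : SymTangent (P.symLift g D.1)), HolNear k D.1 →
      (∀ a ∈ A, P.LocConst D.1 (χ a) (χ a)) →
      P.LocConst D.1 (fun b => ∑ a ∈ A, σ D a * χ a b) (σ D) →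
      tr (P.untwist D.2 (σ D) η) k =
        2⁻¹ * ∑ a ∈ A, σ D a * tr η (fun b => χ a b * k (P.π b)) := by
    intro D η hk hχ hl
    rw [P.tr_untwist D.2 η hk hl]
    have h1 : (fun b => (∑ a ∈ A, σ D a * χ a b) * k (P.π b)) =
        fun b => ∑ a ∈ A, σ D a * (χ a b * k (P.π b)) := by
      funext x
      simp only [Finset.sum_mul, mul_assoc]
    have h2 := fun a ha => hmul D hk a (hχ a ha)
    rw [h1, tr_sum η fun a ha => (HolNear.const _).mul (h2 a ha)]
    exact congrArg _ (Finset.sum_congr rfl fun a ha => tr_smul η _ (h2 a ha))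
  simp only [key D₀ ξ₀ hk hχ.self_of_nhds hl.self_of_nhds]
  refine Filter.Tendsto.congr' (f₁ := fun b => 2⁻¹ * ∑ a ∈ A, σ (D b) a *
    tr (ξ b) (fun b => χ a b * k (P.π b))) ?_ ?_
  · filter_upwards [hval.eventually (eventually_holNear hk), hD.eventually hχ, hD.eventually hl]
      with b h1 h2 h3
    exact (key (D b) (ξ b) h1 h2 h3).symm
  · exact (tendsto_finsetSum _ fun a ha => ((h.continuousAt D₀ a (hA a ha)).tendsto.comp hD).mul
      (tendsto_tr hξ (hmul D₀ hk a (hχ.self_of_nhds a ha)))).const_mul _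

end Twist

/-! ### Existence of an odd varying function -/

section Existence

variable [CompactSpace S] [T2Space S] [T2Space S']

/-- A phase function extends to a varying function. -/
theorem exists_varying (Φ : Phase P) : ∃ σ : Base 𝓗 → S' → ℂ, IsVarying P σ ∧
    (∀ (D : Base 𝓗) a, P.π a ∈ D.1 → σ D (P.ι a) = -σ D a) ∧
    ∀ (D : Base 𝓗) a, P.π a ∈ D.1 → 0 < (σ D a * (starRingEnd ℂ) (Φ.s a)).re := by
  classical
  have : SecondCountableTopology S := ChartedSpace.secondCountable_of_sigmaCompact ℂ S
  have hopen : IsOpen (puncturedSym S g 𝓗.w 𝓗.z) := isOpen_puncturedSym _ _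
  have : LocallyCompactSpace (Base 𝓗) := hopen.locallyCompactSpace
  choose l hl using fun D : Base 𝓗 => P.exists_locConst D.1 Φ.s
  -- Near a tuple `K`, the locally constant function with the values of the phase over `K` has all
  -- the desired properties. These survive convex combinations, so a partition of unity on the base
  -- can glue the local choices.
  let good : Base 𝓗 → S' → Prop := fun K b => 0 < (l K b * (starRingEnd ℂ) (Φ.s b)).re ∧
    l K (P.ι b) = -l K b ∧ ∀ᶠ b' in 𝓝 b, l K b' = l K b
  have hgood : ∀ K : Base 𝓗, ∀ᶠ D : Base 𝓗 in 𝓝 K, ∀ a, P.π a ∈ D.1 → good K a := by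
    refine fun K => eventually_forall_over fun a ha => ?_
    have hw := P.ne_w K.2 ha
    have hz := P.ne_z K.2 ha
    have h1 : ∀ᶠ b in 𝓝 a, 0 < (Φ.s a * (starRingEnd ℂ) (Φ.s b)).re := by
      have hc : ContinuousAt (fun b => (Φ.s a * (starRingEnd ℂ) (Φ.s b)).re) a :=
        Complex.continuous_re.continuousAt.comp (continuousAt_const.mul
          (Complex.continuous_conj.continuousAt.comp (Φ.continuousAt a hw hz)))
      refine hc.eventually_const_lt ?_
      beta_reduce
      rw [Complex.mul_conj, Complex.normSq_eq_norm_sq, Φ.norm_eq a hw hz]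
      norm_num
    have h2 : ∀ᶠ b in 𝓝 a, l K (P.ι b) = Φ.s (P.ι a) :=
      P.continuous_deck.continuousAt.eventually (hl K (P.ι a) (by rwa [P.map_deck]))
    filter_upwards [h1, h2, (hl K a ha).eventually_nhds] with b e1 e2 e3
    have e4 := e3.self_of_nhds
    refine ⟨by rw [e4]; exact e1, by rw [e2, e4, Φ.odd a hw hz], ?_⟩
    filter_upwards [e3] with b' hb'
    rw [hb', e4]
  choose U hUg hUo hKU using fun K => eventually_nhds_iff.1 (hgood K)
  obtain ⟨ρ, hρ⟩ := PartitionOfUnity.exists_isSubordinate isClosed_univ U hUo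
    fun K _ => mem_iUnion.2 ⟨K, hKU K⟩
  have hfin : ∀ D₀ : Base 𝓗, ∃ I : Finset (Base 𝓗), (∀ K ∈ I, D₀ ∈ U K) ∧
      ∀ᶠ D in 𝓝 D₀, (∑ K ∈ I, ρ K D = 1) ∧
        ∀ b, ∑ᶠ K, (ρ K D : ℂ) * l K b = ∑ K ∈ I, (ρ K D : ℂ) * l K b := by
    intro D₀
    obtain ⟨I, N, hN, hNU, hNI⟩ := ρ.exists_finset_nhds_support_subset hρ hUo D₀
    refine ⟨I, fun K hK => mem_iInter₂.1 (hNU (mem_of_mem_nhds hN)) K hK, ?_⟩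
    filter_upwards [hN] with D hD
    constructor
    · rw [← ρ.sum_eq_one (mem_univ D)]
      exact (finsum_eq_sum_of_support_subset _ (hNI D hD)).symm
    · intro b
      refine finsum_eq_sum_of_support_subset _ (subset_trans ?_ (hNI D hD))
      intro K hK h0
      exact hK (by simp only [h0, Complex.ofReal_zero, zero_mul])
  refine ⟨fun D b => ∑ᶠ K, (ρ K D : ℂ) * l K b, ⟨?_, ?_⟩, ?_, ?_⟩
  · intro D₀ a ha
    obtain ⟨I, hI, hev⟩ := hfin D₀
    have h1 : ∀ᶠ b in 𝓝 a, ∀ K ∈ I, l K b = l K a :=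
      (Filter.eventually_all_finset I).2 fun K hK => (hUg K D₀ (hI K hK) a ha).2.2
    filter_upwards [hev.prod_mk h1] with p hp
    rw [hp.1.2, hp.1.2]
    exact Finset.sum_congr rfl fun K hK => by rw [hp.2 K hK]
  · intro D₀ a ha
    obtain ⟨I, hI, hev⟩ := hfin D₀
    have h1 : ContinuousAt (fun D => ∑ K ∈ I, (ρ K D : ℂ) * l K a) D₀ := by
      refine tendsto_finsetSum _ fun K _ => Filter.Tendsto.mul_const _ ?_
      exact (Complex.continuous_ofReal.comp (ρ K).continuous).continuousAt
    exact h1.congr (hev.mono fun D hD => (hD.2 a).symm)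
  · intro D a ha
    obtain ⟨I, hI, hev⟩ := hfin D
    simp only [hev.self_of_nhds.2, ← Finset.sum_neg_distrib]
    exact Finset.sum_congr rfl fun K hK => by rw [(hUg K D (hI K hK) a ha).2.1]; ring
  · intro D a ha
    obtain ⟨I, hI, hev⟩ := hfin D
    obtain ⟨h1, h2⟩ := hev.self_of_nhds
    beta_reduce
    rw [h2, Finset.sum_mul, Complex.re_sum]
    have h3 : ∀ K ∈ I, ((ρ K D : ℂ) * l K a * (starRingEnd ℂ) (Φ.s a)).re =
        ρ K D * (l K a * (starRingEnd ℂ) (Φ.s a)).re := fun K _ => by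
      rw [mul_assoc, Complex.re_ofReal_mul]
    rw [Finset.sum_congr rfl h3]
    obtain ⟨K, hK, hK0⟩ : ∃ K ∈ I, ρ K D ≠ 0 := by
      by_contra! h
      rw [Finset.sum_congr rfl h] at h1
      simp at h1
    refine Finset.sum_pos' (fun K hK => mul_nonneg (ρ.nonneg K D) (hUg K D (hI K hK) a ha).1.le)
      ⟨K, hK, mul_pos (lt_of_le_of_ne (ρ.nonneg K D) hK0.symm) (hUg K D (hI K hK) a ha).1⟩

end Existence

end

end HFK

namespace HFK

noncomputable section

universe u v

/-! ### Root maps on vector bundles -/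

section LinearAlgebra

variable {V : Type*} [AddCommGroup V] [Module ℝ V] {ι : Type*} [Fintype ι] [DecidableEq ι]

/-- Every form on the segment is positive on the pair (u, Ju). -/
theorem segNondeg_of_tame {θ η : V →ₗ[ℝ] V →ₗ[ℝ] ℝ} {J : V → V}
    (hθ : ∀ u, u ≠ 0 → 0 < θ u (J u)) (hη : ∀ u, u ≠ 0 → 0 < η u (J u)) : SegNondeg θ η := by
  intro t ht u hu
  by_contra h0
  have h1 := hθ u h0
  have h2 := hη u h0
  have h3 := hu (J u)
  rcases eq_or_lt_of_le ht.1 with rfl | ht0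
  · simp only [sub_zero, one_mul, zero_mul, add_zero] at h3
    linarith
  · have h4 := mul_nonneg (sub_nonneg.2 ht.2) h1.le
    have h5 := mul_pos ht0 h2
    linarith

theorem sqrtForm_isUnit {a b : Matrix ι ι ℝ} (h : SegInv a b) (ha : a.transpose = -a)
    (hb : b.transpose = -b) : IsUnit (sqrtForm a b).det := by
  have h1 := h 1 ⟨zero_le_one, le_rfl⟩
  rw [sub_self, zero_smul, zero_add, one_smul, ← h.sqrtForm_congr ha hb, Matrix.det_mul] at h1
  exact isUnit_of_mul_isUnit_right h1

theorem exists_rootEquiv (e : (ι → ℝ) ≃ₗ[ℝ] V) {θ η : V →ₗ[ℝ] V →ₗ[ℝ] ℝ} (h : SegNondeg θ η)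
    (hθ : ∀ u, θ u u = 0) (hη : ∀ u, η u u = 0) :
    ∃ R : V ≃ₗ[ℝ] V, R.toLinearMap = rootMap e θ η := by
  have : FiniteDimensional ℝ V := e.finiteDimensional
  have hinj : Function.Injective (rootMap e θ η) := by
    rw [injective_iff_map_eq_zero]
    intro u hu
    refine h 1 ⟨zero_le_one, le_rfl⟩ u fun v => ?_
    rw [← rootMap_form e h hθ hη u v, hu]
    simp
  exact ⟨LinearEquiv.ofInjectiveEndo _ hinj, rfl⟩

end LinearAlgebra

section Bundles

universe a b

variable {M : Type a} [TopologicalSpace M] {Fib : Type*} {E : M → Type b}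
  [∀ x, AddCommGroup (E x)] [∀ x, Module ℝ (E x)] [TopologicalSpace (Bundle.TotalSpace Fib E)]

omit [TopologicalSpace M] in
theorem FormContinuousOn.comp {K : Set M} {form : ∀ x, E x →ₗ[ℝ] E x →ₗ[ℝ] ℝ}
    (h : FormContinuousOn (Fib := Fib) E K form) {B : Type*} [TopologicalSpace B] {x : B → M}
    (hx : ∀ b, x b ∈ K) {p q : ∀ b, E (x b)}
    (hp : Continuous fun b => (⟨x b, p b⟩ : Bundle.TotalSpace Fib E))
    (hq : Continuous fun b => (⟨x b, q b⟩ : Bundle.TotalSpace Fib E)) :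
    Continuous fun b => form (x b) (p b) (q b) := by
  let _ : TopologicalSpace (Σ x : K, E x × E x) := TopologicalSpace.induced
      (fun q => ((⟨q.1, q.2.1⟩, ⟨q.1, q.2.2⟩) :
        Bundle.TotalSpace Fib E × Bundle.TotalSpace Fib E)) inferInstance
  have h1 : Continuous fun b => (⟨⟨x b, hx b⟩, p b, q b⟩ : Σ x : K, E x × E x) :=
    continuous_induced_rng.2 (hp.prodMk hq)
  exact Continuous.comp (g := fun r : Σ x : K, E x × E x => form r.1 r.2.1 r.2.2) h h1

-- The universal test family is the space of pairs of vectors over one point itself, with the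
-- topology induced from the two total spaces.
omit [TopologicalSpace M] in
theorem formContinuousOn_univ {form : ∀ x, E x →ₗ[ℝ] E x →ₗ[ℝ] ℝ}
    (h : ∀ (B : Type max a b) (_ : TopologicalSpace B) (x : B → M) (p q : ∀ b, E (x b)),
      Continuous (fun b => (⟨x b, p b⟩ : Bundle.TotalSpace Fib E)) →
      Continuous (fun b => (⟨x b, q b⟩ : Bundle.TotalSpace Fib E)) →
      Continuous fun b => form (x b) (p b) (q b)) :
    FormContinuousOn (Fib := Fib) E univ form := by
  let f : (Σ x : (univ : Set M), E x × E x) → Bundle.TotalSpace Fib E × Bundle.TotalSpace Fib E :=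
    fun q => (⟨q.1, q.2.1⟩, ⟨q.1, q.2.2⟩)
  let _ : TopologicalSpace (Σ x : (univ : Set M), E x × E x) :=
    TopologicalSpace.induced f inferInstance
  have hf : Continuous f := continuous_induced_dom
  exact h (Σ x : (univ : Set M), E x × E x) _ (fun r => r.1) (fun r => r.2.1) (fun r => r.2.2) (continuous_fst.comp hf)
    (continuous_snd.comp hf)

/-- Two continuous families of tame forms are related by a continuous family of linear maps. -/
theorem exists_root {n : ℕ}
    (htriv : ∀ x₀ : M, ∃ (U : Set M) (e : ∀ x, (Fin n → ℝ) ≃ₗ[ℝ] E x), IsOpen U ∧ x₀ ∈ U ∧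
      IsOpenEmbedding (fun q : U × (Fin n → ℝ) => (⟨q.1, e q.1 q.2⟩ : Bundle.TotalSpace Fib E)))
    {θ η : ∀ x, E x →ₗ[ℝ] E x →ₗ[ℝ] ℝ} (hθ : FormContinuousOn (Fib := Fib) E univ θ)
    (hη : FormContinuousOn (Fib := Fib) E univ η) (hθ' : ∀ x u, θ x u u = 0)
    (hη' : ∀ x u, η x u u = 0) (hs : ∀ x, SegNondeg (θ x) (η x)) :
    ∃ R : ∀ x, E x ≃ₗ[ℝ] E x,
      Continuous (fun y : Bundle.TotalSpace Fib E =>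
        (⟨y.proj, R y.proj y.snd⟩ : Bundle.TotalSpace Fib E)) ∧
      Continuous (fun y : Bundle.TotalSpace Fib E =>
        (⟨y.proj, (R y.proj).symm y.snd⟩ : Bundle.TotalSpace Fib E)) ∧
      (∀ x u v, θ x (R x u) (R x v) = η x u v) ∧
      ∀ x (e : (Fin n → ℝ) ≃ₗ[ℝ] E x) u, R x u = rootMap e (θ x) (η x) u := by
  choose U e hU hx he using htriv
  choose R hR using fun x => exists_rootEquiv (e x x) (hs x) (hθ' x) (hη' x)
  -- `R x` is built from a basis chosen at `x`. Basis independence lets it be computed in a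
  -- trivialization around any other point, where its matrix is visibly continuous.
  have hR' : ∀ x (f : (Fin n → ℝ) ≃ₗ[ℝ] E x) u, R x u = rootMap f (θ x) (η x) u := by
    intro x f u
    rw [rootMap_indep f (e x x) (hs x), ← hR x]
    rfl
  let S : ∀ x₀ : M, U x₀ → Matrix (Fin n) (Fin n) ℝ := fun x₀ x =>
    sqrtForm (formMatrix (e x₀ x).toLinearMap (θ x)) (formMatrix (e x₀ x).toLinearMap (η x))
  have hmat : ∀ x₀ (κ : ∀ x, E x →ₗ[ℝ] E x →ₗ[ℝ] ℝ), FormContinuousOn (Fib := Fib) E univ κ →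
      Continuous fun x : U x₀ => formMatrix (e x₀ x).toLinearMap (κ x) := by
    intro x₀ κ hκ
    refine continuous_matrix fun i j => ?_
    simp only [formMatrix_apply]
    have hsec : ∀ i : Fin n, Continuous fun x : U x₀ =>
        (⟨x, e x₀ x (Pi.single i 1)⟩ : Bundle.TotalSpace Fib E) := fun i =>
      (he x₀).continuous.comp (f := fun x : U x₀ => (x, (Pi.single i 1 : Fin n → ℝ)))
        (continuous_id.prodMk continuous_const)
    exact hκ.comp (fun _ => mem_univ _) (hsec i) (hsec j)
  have hseg : ∀ x₀ (x : U x₀), SegInv (formMatrix (e x₀ x).toLinearMap (θ x))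
    (formMatrix (e x₀ x).toLinearMap (η x)) := fun x₀ x => (hs x).segInv (e x₀ x)
  have hSunit : ∀ x₀ x, IsUnit (S x₀ x).det := fun x₀ x => sqrtForm_isUnit (hseg x₀ x)
    (formMatrix_transpose _ (hθ' x)) (formMatrix_transpose _ (hη' x))
  have hS : ∀ x₀, Continuous (S x₀) := fun x₀ => continuousOn_univ.1
    (continuousOn_sqrtForm (hmat x₀ θ hθ).continuousOn (hmat x₀ η hη).continuousOn
      fun x _ => hseg x₀ x)
  have hSinv : ∀ x₀, Continuous fun x => (S x₀ x)⁻¹ := by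
    intro x₀
    simp only [Matrix.inv_def, Ring.inverse_eq_inv']
    exact ((hS x₀).matrix_det.inv₀ fun x => (hSunit x₀ x).ne_zero).smul (hS x₀).matrix_adjugate
  have hact : ∀ x₀ (x : U x₀) w, R x (e x₀ x w) = e x₀ x (Matrix.mulVec (S x₀ x) w) := by
    intro x₀ x w
    rw [hR' x (e x₀ x), rootMap_apply]
  have hact' : ∀ x₀ (x : U x₀) w, (R x).symm (e x₀ x w) = e x₀ x (Matrix.mulVec (S x₀ x)⁻¹ w) := by
    intro x₀ x w
    rw [LinearEquiv.symm_apply_eq, hact, Matrix.mulVec_mulVec,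
      Matrix.mul_nonsing_inv _ (hSunit x₀ x), Matrix.one_mulVec]
  refine ⟨R, ?_, ?_, fun x u v => ?_, hR'⟩
  · rw [continuous_iff_continuousAt]
    rintro ⟨x₀, u⟩
    have hy : (⟨x₀, u⟩ : Bundle.TotalSpace Fib E) =
        (fun q : U x₀ × (Fin n → ℝ) => (⟨q.1, e x₀ q.1 q.2⟩ : Bundle.TotalSpace Fib E))
          (⟨x₀, hx x₀⟩, (e x₀ x₀).symm u) := by
      simp
    rw [hy, ← (he x₀).continuousAt_iff]
    refine Continuous.continuousAt ?_
    simp only [Function.comp_def, hact]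
    exact (he x₀).continuous.comp (continuous_fst.prodMk
      (((hS x₀).comp continuous_fst).matrix_mulVec continuous_snd))
  · rw [continuous_iff_continuousAt]
    rintro ⟨x₀, u⟩
    have hy : (⟨x₀, u⟩ : Bundle.TotalSpace Fib E) =
        (fun q : U x₀ × (Fin n → ℝ) => (⟨q.1, e x₀ q.1 q.2⟩ : Bundle.TotalSpace Fib E))
          (⟨x₀, hx x₀⟩, (e x₀ x₀).symm u) := by
      simp
    rw [hy, ← (he x₀).continuousAt_iff]
    refine Continuous.continuousAt ?_
    simp only [Function.comp_def, hact']
    exact (he x₀).continuous.comp (continuous_fst.prodMk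
      (((hSinv x₀).comp continuous_fst).matrix_mulVec continuous_snd))
  · rw [hR' x (e x x), hR' x (e x x)]
    exact rootMap_form _ (hs x) (hθ' x) (hη' x) u v

end Bundles

end

end HFK

namespace HFK

noncomputable section

universe u v

variable {S : Type u} [TopologicalSpace S] [ChartedSpace ℂ S]
variable {S' : Type v} [TopologicalSpace S'] [ChartedSpace ℂ S']
variable {g : ℕ} {𝓗 : HeegaardDiagram S g} {P : SurfaceDoubleCover S S' 𝓗.w 𝓗.z}
variable (Ω : TamedForm P)

/-! ### Topology and local triviality of the two bundles -/

section Totals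

variable {B : Type*} [TopologicalSpace B]

theorem continuous_tangentialTotal {D : B → Base 𝓗} {ξ : ∀ b, SymTangent (D b).1} :
    Continuous (fun b => (⟨D b, ξ b⟩ : (tangentialPolarization P Ω).Total)) ↔
      Continuous D ∧ Continuous (fun b => (⟨(D b).1, ξ b⟩ : SymTangentBundle S g)) :=
  continuous_induced_rng.trans continuous_prodMk

theorem continuous_normalTotal {D : B → Base 𝓗} {ξ : ∀ b, normalFibre P (D b).1} :
    Continuous (fun b => (⟨D b, ξ b⟩ : (normalPolarization P Ω).Total)) ↔
      Continuous D ∧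
        Continuous (fun b => (⟨P.symLift g (D b).1, (ξ b).1⟩ : SymTangentBundle S' (2 * g))) :=
  continuous_induced_rng.trans continuous_prodMk

theorem continuous_tangential_proj :
    Continuous fun q : (tangentialPolarization P Ω).Total => q.proj :=
  ((continuous_tangentialTotal Ω (D := fun q : (tangentialPolarization P Ω).Total => q.proj)
    (ξ := fun q => q.snd)).1 continuous_id).1

theorem continuous_normal_proj :
    Continuous fun q : (normalPolarization P Ω).Total => q.proj :=
  ((continuous_normalTotal Ω (D := fun q : (normalPolarization P Ω).Total => q.proj)
    (ξ := fun q => q.snd)).1 continuous_id).1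

theorem continuous_nForm {D : B → Base 𝓗} {p q : ∀ b, normalFibre P (D b).1}
    (hp : Continuous (fun b => (⟨D b, p b⟩ : (normalPolarization P Ω).Total)))
    (hq : Continuous (fun b => (⟨D b, q b⟩ : (normalPolarization P Ω).Total))) :
    Continuous fun b => nForm Ω (D b) (p b) (q b) :=
  Ω.continuous.comp (fun b => P.symLift_mem (D b).2) ((continuous_normalTotal Ω).1 hp).2
    ((continuous_normalTotal Ω).1 hq).2

end Totals

variable [IsManifold 𝓘(ℂ) ω S] [T2Space S] [Nonempty S] [IsManifold 𝓘(ℂ) ω S'] [T2Space S']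
  [Nonempty S']

theorem continuous_tForm {B : Type*} [TopologicalSpace B] {D : B → Base 𝓗}
    {p q : ∀ b, SymTangent (D b).1}
    (hp : Continuous (fun b => (⟨D b, p b⟩ : (tangentialPolarization P Ω).Total)))
    (hq : Continuous (fun b => (⟨D b, q b⟩ : (tangentialPolarization P Ω).Total))) :
    Continuous fun b => tForm Ω (D b) (p b) (q b) := by
  have hd : ∀ p : ∀ b, SymTangent (D b).1,
      Continuous (fun b => (⟨D b, p b⟩ : (tangentialPolarization P Ω).Total)) →
      Continuous fun b => (⟨P.symLift g (D b).1, P.twist (D b).2 (fun _ => 1) (p b)⟩ :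
        SymTangentBundle S' (2 * g)) := by
    intro p hp
    obtain ⟨h1, h2⟩ := (continuous_tangentialTotal Ω).1 hp
    rw [continuous_iff_continuousAt]
    exact fun b => (IsVarying.const 1).tendsto_twist (h1.tendsto b) (h2.tendsto b)
  simp only [tForm_apply]
  exact Ω.continuous.comp (fun b => P.symLift_mem (D b).2) (hd p hp) (hd q hq)

/-- A varying function which is odd and does not vanish. -/
structure IsOddVarying (P : SurfaceDoubleCover S S' 𝓗.w 𝓗.z) (σ : Base 𝓗 → S' → ℂ) : Prop
    extends IsVarying P σ where
  odd : ∀ (D : Base 𝓗) a, P.π a ∈ D.1 → σ D (P.ι a) = -σ D a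
  ne_zero : ∀ (D : Base 𝓗) a, P.π a ∈ D.1 → σ D a ≠ 0

namespace IsOddVarying

variable {σ : Base 𝓗 → S' → ℂ} (h : IsOddVarying P σ)

/-- The isomorphism of the tangent bundle with the normal bundle. -/
def equiv (D : Base 𝓗) : SymTangent D.1 ≃ₗ[ℂ] normalFibre P D.1 :=
  P.twistEquiv D.2 (h.ne_zero D) (h.odd D)

variable {B : Type*} [TopologicalSpace B]

theorem continuous_equiv {D : B → Base 𝓗} {ξ : ∀ b, SymTangent (D b).1}
    (hξ : Continuous (fun b => (⟨D b, ξ b⟩ : (tangentialPolarization P Ω).Total))) :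
    Continuous (fun b => (⟨D b, h.equiv (D b) (ξ b)⟩ : (normalPolarization P Ω).Total)) := by
  obtain ⟨h1, h2⟩ := (continuous_tangentialTotal Ω).1 hξ
  refine (continuous_normalTotal Ω).2 ⟨h1, continuous_iff_continuousAt.2 fun b => ?_⟩
  exact h.toIsVarying.tendsto_twist (h1.tendsto b) (h2.tendsto b)

theorem continuous_equiv_symm {D : B → Base 𝓗} {η : ∀ b, normalFibre P (D b).1}
    (hη : Continuous (fun b => (⟨D b, η b⟩ : (normalPolarization P Ω).Total))) :
    Continuous (fun b =>
      (⟨D b, (h.equiv (D b)).symm (η b)⟩ : (tangentialPolarization P Ω).Total)) := by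
  obtain ⟨h1, h2⟩ := (continuous_normalTotal Ω).1 hη
  refine (continuous_tangentialTotal Ω).2 ⟨h1, continuous_iff_continuousAt.2 fun b => ?_⟩
  exact (h.toIsVarying.inv h.ne_zero).tendsto_untwist (h1.tendsto b) (h2.tendsto b)

/-- The homeomorphism of the tangent bundle with the normal bundle. -/
def homeo : (tangentialPolarization P Ω).Total ≃ₜ (normalPolarization P Ω).Total where
  toFun q := ⟨q.proj, h.equiv q.proj q.snd⟩
  invFun q := ⟨q.proj, (h.equiv q.proj).symm q.snd⟩
  left_inv q := congrArg (Bundle.TotalSpace.mk q.proj) ((h.equiv q.proj).symm_apply_apply q.snd)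
  right_inv q := congrArg (Bundle.TotalSpace.mk q.proj) ((h.equiv q.proj).apply_symm_apply q.snd)
  continuous_toFun := h.continuous_equiv Ω
    (D := fun q : (tangentialPolarization P Ω).Total => q.proj) (ξ := fun q => q.snd) continuous_id
  continuous_invFun := h.continuous_equiv_symm Ω
    (D := fun q : (normalPolarization P Ω).Total => q.proj) (η := fun q => q.snd) continuous_id

end IsOddVarying

theorem isOpenEmbedding_of_leftInverse {X Y : Type*} [TopologicalSpace X] [TopologicalSpace Y]
    {f : X → Y} {k : Y → X} (hf : Continuous f) (hk : Function.LeftInverse k f)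
    (ho : IsOpen (range f)) (hc : ContinuousOn k (range f)) : IsOpenEmbedding f := by
  refine IsOpenEmbedding.of_continuous_injective_isOpenMap hf hk.injective fun V hV => ?_
  have : f '' V = range f ∩ k ⁻¹' V := by
    ext y
    constructor
    · rintro ⟨x, hx, rfl⟩
      exact ⟨⟨x, rfl⟩, by rwa [mem_preimage, hk x]⟩
    · rintro ⟨⟨x, rfl⟩, hx⟩
      rw [mem_preimage, hk x] at hx
      exact ⟨x, hx, rfl⟩
  rw [this]
  exact hc.isOpen_inter_preimage ho hV

/-- Real coordinates of complex vectors. -/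
def realCoord (g : ℕ) : (Fin (2 * g) → ℝ) ≃ₗ[ℝ] (Fin g → ℂ) :=
  LinearEquiv.ofFinrankEq _ _ (by
    rw [Module.finrank_pi_fintype, Module.finrank_pi_fintype]
    simp [mul_comm])

-- The derivatives of the power sums of one coordinate trivialize the bundle over all tuples in its
-- domain.
omit [IsManifold 𝓘(ℂ) ω S'] [T2Space S'] [Nonempty S'] in
theorem tangential_locally_trivial (x₀ : Base 𝓗) :
    ∃ (U : Set (Base 𝓗)) (e : ∀ x : Base 𝓗, (Fin (2 * g) → ℝ) ≃ₗ[ℝ] SymTangent x.1),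
      IsOpen U ∧ x₀ ∈ U ∧ IsOpenEmbedding (fun q : U × (Fin (2 * g) → ℝ) =>
        (⟨q.1, e q.1 q.2⟩ : (tangentialPolarization P Ω).Total)) := by
  classical
  obtain ⟨c, hc, hx₀⟩ := exists_isHolChart_sym x₀.1
  set U : Set (Base 𝓗) := {D | ∀ x ∈ D.1, x ∈ c.source} with hUdef
  have hU : IsOpen U := (isOpen_forall_mem c.open_source).preimage continuous_subtype_val
  -- The trivialization must be a family over the whole base; outside `U` an arbitrary isomorphism
  -- serves.
  have hex : ∀ D : Base 𝓗, Nonempty ((Fin g → ℂ) ≃ₗ[ℝ] SymTangent D.1) := fun D => by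
    obtain ⟨c, hc, hD⟩ := exists_isHolChart_sym D.1
    exact ⟨(tangentEquiv hc hD).symm.restrictScalars ℝ⟩
  let e' : ∀ D : Base 𝓗, (Fin g → ℂ) ≃ₗ[ℝ] SymTangent D.1 := fun D =>
    if h : D ∈ U then (tangentEquiv hc h).symm.restrictScalars ℝ else (hex D).some
  have he' : ∀ (D : Base 𝓗) (h : D ∈ U) v, powerDeriv c (e' D v) = v := by
    intro D h v
    simp only [e', dif_pos h]
    exact powerDeriv_tangentEquiv_symm hc h v
  have hes : ∀ (D : Base 𝓗) (h : D ∈ U) ξ, e' D (powerDeriv c ξ) = ξ := by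
    intro D h ξ
    simp only [e', dif_pos h]
    exact (tangentEquiv hc h).symm_apply_apply ξ
  have hρ : Continuous (realCoord g) :=
    LinearMap.continuous_of_finiteDimensional (realCoord g).toLinearMap
  have hρ' : Continuous (realCoord g).symm :=
    LinearMap.continuous_of_finiteDimensional (realCoord g).symm.toLinearMap
  refine ⟨U, fun D => (realCoord g).trans (e' D), hU, hx₀, ?_⟩
  have hrange : range (fun q : U × (Fin (2 * g) → ℝ) =>
      (⟨q.1, e' q.1 (realCoord g q.2)⟩ : (tangentialPolarization P Ω).Total)) =
      {y | y.proj ∈ U} := by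
    ext y
    constructor
    · rintro ⟨q, rfl⟩
      exact q.1.2
    · intro hy
      refine ⟨(⟨y.proj, hy⟩, (realCoord g).symm (powerDeriv c y.snd)), ?_⟩
      have := hes y.proj hy y.snd
      simp only [LinearEquiv.apply_symm_apply]
      exact congrArg (Bundle.TotalSpace.mk y.proj) this
  refine isOpenEmbedding_of_leftInverse (k := fun y => if h : y.proj ∈ U then
    (⟨y.proj, h⟩, (realCoord g).symm (powerDeriv c y.snd)) else (⟨x₀, hx₀⟩, 0)) ?_ ?_ ?_ ?_
  · refine (continuous_tangentialTotal Ω (D := fun q : U × (Fin (2 * g) → ℝ) => q.1.1)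
      (ξ := fun q => e' q.1 (realCoord g q.2))).2
      ⟨continuous_subtype_val.comp continuous_fst, continuous_iff_continuousAt.2 fun q => ?_⟩
    refine tendsto_bundle hc (q₀ := ⟨q.1.1.1, e' q.1 (realCoord g q.2)⟩) q.1.2 ?_ ?_
    · exact (continuous_subtype_val.comp (continuous_subtype_val.comp continuous_fst)).tendsto q
    · have h1 : ∀ q : U × (Fin (2 * g) → ℝ),
          powerDeriv c (e' q.1 (realCoord g q.2)) = realCoord g q.2 := fun q => he' _ q.1.2 _
      simp only [h1]
      exact (hρ.comp continuous_snd).tendsto q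
  · intro q
    have hq : (⟨q.1, e' q.1 (realCoord g q.2)⟩ : (tangentialPolarization P Ω).Total).proj ∈ U :=
      q.1.2
    refine (dif_pos hq).trans (Prod.ext rfl ?_)
    change (realCoord g).symm (powerDeriv c (e' q.1 (realCoord g q.2))) = q.2
    rw [he' _ q.1.2, LinearEquiv.symm_apply_apply]
  · refine (congrArg IsOpen hrange).mpr ?_
    exact hU.preimage (continuous_tangential_proj Ω)
  · refine (congrArg (ContinuousOn _) hrange).mpr ?_
    rw [continuousOn_iff_continuous_domRestrict]
    have hpow : Continuous fun y : {y : (tangentialPolarization P Ω).Total | y.proj ∈ U} =>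
        powerDeriv c y.1.snd := by
      refine continuous_pi fun k => continuous_iff_continuousAt.2 fun y => ?_
      refine tendsto_ev (q := fun y : {y : (tangentialPolarization P Ω).Total | y.proj ∈ U} =>
        (⟨y.1.proj.1, y.1.snd⟩ : SymTangentBundle S g))
        (q₀ := ⟨y.1.proj.1, y.1.snd⟩) ?_ ?_
      · exact (((continuous_tangentialTotal Ω
          (D := fun q : (tangentialPolarization P Ω).Total => q.proj)
          (ξ := fun q => q.snd)).1 continuous_id).2.comp continuous_subtype_val).tendsto y
      · exact eventually_holAt_trace hc (HolNear.comp_chart hc y.2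
          (H := fun z => z ^ (k.val + 1)) fun _ _ => analyticAt_id.pow _) y.2
    refine Continuous.congr (f := fun y : {y : (tangentialPolarization P Ω).Total | y.proj ∈ U} =>
      ((⟨y.1.proj, y.2⟩, (realCoord g).symm (powerDeriv c y.1.snd)) : U × (Fin (2 * g) → ℝ))) ?_
      fun y => by
        have hy : y.1.proj ∈ U := y.2
        simp only [Set.domRestrict_apply, hy, dif_pos]
    exact (((continuous_tangential_proj Ω).comp continuous_subtype_val).subtype_mk _).prodMk
      (hρ'.comp hpow)

theorem normal_locally_trivial {σ : Base 𝓗 → S' → ℂ} (h : IsOddVarying P σ) (x₀ : Base 𝓗) :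
    ∃ (U : Set (Base 𝓗)) (e : ∀ x : Base 𝓗, (Fin (2 * g) → ℝ) ≃ₗ[ℝ] normalFibre P x.1),
      IsOpen U ∧ x₀ ∈ U ∧ IsOpenEmbedding (fun q : U × (Fin (2 * g) → ℝ) =>
        (⟨q.1, e q.1 q.2⟩ : (normalPolarization P Ω).Total)) := by
  obtain ⟨U, e, hU, hx, he⟩ := tangential_locally_trivial Ω x₀
  exact ⟨U, fun x => (e x).trans ((h.equiv x).restrictScalars ℝ), hU, hx,
    (h.homeo Ω).isOpenEmbedding.comp he⟩

end

end HFK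

namespace HFK

noncomputable section

universe u v

/-! ### The path of Lagrangian subspaces in coordinates -/

section LinearAlgebra

variable {ι : Type*} [Fintype ι] [DecidableEq ι]
variable {V : Type*} [AddCommGroup V] [Module ℝ V] {V' : Type*} [AddCommGroup V'] [Module ℝ V']

/-- The pulled-back forms have the same matrices in the basis `e` as the original ones in its image.
With basis independence this is naturality of the root map. -/
theorem map_rootMap (f : V' ≃ₗ[ℝ] V) (e : (ι → ℝ) ≃ₗ[ℝ] V') (θ η : V →ₗ[ℝ] V →ₗ[ℝ] ℝ) (u : V') :
    f (rootMap e (θ.compl₁₂ f.toLinearMap f.toLinearMap) (η.compl₁₂ f.toLinearMap f.toLinearMap) u) =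
      rootMap (e.trans f) θ η (f u) := by
  obtain ⟨x, rfl⟩ := e.surjective u
  rw [rootMap_apply]
  exact (rootMap_apply (e.trans f) θ η x).symm

theorem SegNondeg.rootMap_self {θ : V →ₗ[ℝ] V →ₗ[ℝ] ℝ} (h : SegNondeg θ θ) (e : (ι → ℝ) ≃ₗ[ℝ] V)
    (u : V) : rootMap e θ θ u = u := by
  obtain ⟨x, rfl⟩ := e.surjective u
  rw [rootMap_apply, sqrtForm_self (h.segInv e).isUnit, Matrix.one_mulVec]

end LinearAlgebra

section LagrangianPath

variable {g : ℕ}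

/-- The diagonal map with entries `exp (l i)`. -/
def expDiag (l : Fin g → ℂ) : (Fin g → ℂ) ≃ₗ[ℂ] (Fin g → ℂ) :=
  LinearEquiv.piCongrRight fun i => LinearEquiv.smulOfNeZero ℂ ℂ (Complex.exp (l i))
    (Complex.exp_ne_zero _)

theorem expDiag_apply (l v : Fin g → ℂ) (i : Fin g) : expDiag l v i = Complex.exp (l i) * v i := rfl

theorem expDiag_zero : expDiag (0 : Fin g → ℂ) = LinearEquiv.refl ℂ _ := by
  ext v i
  simp [expDiag_apply]

/-- The pull-back of a form by a diagonal map. -/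
def pullForm (l : Fin g → ℂ) (θ : (Fin g → ℂ) →ₗ[ℝ] (Fin g → ℂ) →ₗ[ℝ] ℝ) :
    (Fin g → ℂ) →ₗ[ℝ] (Fin g → ℂ) →ₗ[ℝ] ℝ :=
  θ.compl₁₂ ((expDiag l).restrictScalars ℝ).toLinearMap ((expDiag l).restrictScalars ℝ).toLinearMap

theorem pullForm_apply (l : Fin g → ℂ) (θ : (Fin g → ℂ) →ₗ[ℝ] (Fin g → ℂ) →ₗ[ℝ] ℝ)
    (u v : Fin g → ℂ) : pullForm l θ u v = θ (expDiag l u) (expDiag l v) := rfl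

/-- A form that vanishes on the diagonal and is positive on complex lines. -/
structure IsTame (θ : (Fin g → ℂ) →ₗ[ℝ] (Fin g → ℂ) →ₗ[ℝ] ℝ) : Prop where
  self : ∀ u, θ u u = 0
  pos : ∀ u, u ≠ 0 → 0 < θ u (Complex.I • u)

theorem IsTame.pull {θ : (Fin g → ℂ) →ₗ[ℝ] (Fin g → ℂ) →ₗ[ℝ] ℝ} (h : IsTame θ)
    (l : Fin g → ℂ) : IsTame (pullForm l θ) where
  self u := h.self _
  pos u hu := by
    rw [pullForm_apply, map_smul]
    exact h.pos _ fun h0 => hu ((expDiag l).map_eq_zero_iff.1 h0)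

theorem IsTame.combo {θ η : (Fin g → ℂ) →ₗ[ℝ] (Fin g → ℂ) →ₗ[ℝ] ℝ} (h : IsTame θ)
    (h' : IsTame η) {r : ℝ} (hr : r ∈ Icc (0 : ℝ) 1) : IsTame (r • θ + (1 - r) • η) where
  self u := by simp [h.self, h'.self]
  pos u hu := by
    have h1 := h.pos u hu
    have h2 := h'.pos u hu
    simp only [LinearMap.add_apply, LinearMap.smul_apply, smul_eq_mul]
    rcases eq_or_lt_of_le hr.1 with rfl | hr0
    · simpa using h2
    · exact add_pos_of_pos_of_nonneg (mul_pos hr0 h1) (mul_nonneg (sub_nonneg.2 hr.2) h2.le)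

theorem IsTame.segNondeg {θ η : (Fin g → ℂ) →ₗ[ℝ] (Fin g → ℂ) →ₗ[ℝ] ℝ} (h : IsTame θ)
    (h' : IsTame η) : SegNondeg θ η := segNondeg_of_tame h.pos h'.pos

/-- The forms interpolating between `θ` and the pull-back of `η`. -/
def pathForm (θ η : (Fin g → ℂ) →ₗ[ℝ] (Fin g → ℂ) →ₗ[ℝ] ℝ) (l : Fin g → ℂ) (r : ℝ) :
    (Fin g → ℂ) →ₗ[ℝ] (Fin g → ℂ) →ₗ[ℝ] ℝ := r • θ + (1 - r) • pullForm (-l) η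

/-- A path of linear maps which take the real vectors to Lagrangian subspaces for `θ`. -/
def pathMap (θ η : (Fin g → ℂ) →ₗ[ℝ] (Fin g → ℂ) →ₗ[ℝ] ℝ) (l : Fin g → ℂ) (r : ℝ) :
    (Fin g → ℂ) →ₗ[ℝ] (Fin g → ℂ) :=
  ((expDiag (-(1 - r) • l)).restrictScalars ℝ).toLinearMap.comp
    (rootMap (realCoord g) (pullForm (-(1 - r) • l) θ) (pathForm θ η l r))

variable {θ η : (Fin g → ℂ) →ₗ[ℝ] (Fin g → ℂ) →ₗ[ℝ] ℝ} (hθ : IsTame θ) (hη : IsTame η)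
  (l : Fin g → ℂ)

-- The root map pulls the diagonal pull-back of θ back to the interpolated form, and the diagonal
-- factor accounts for the difference between θ and its pull-back. So the composite pulls θ back to
-- `pathForm`.
include hθ hη in
theorem exists_pathEquiv {r : ℝ} (hr : r ∈ Icc (0 : ℝ) 1) :
    ∃ Φ : (Fin g → ℂ) ≃ₗ[ℝ] (Fin g → ℂ), Φ.toLinearMap = pathMap θ η l r ∧
      ∀ u v, θ (Φ u) (Φ v) = pathForm θ η l r u v := by
  have h1 := hθ.pull (-(1 - r) • l)
  have h2 : IsTame (pathForm θ η l r) := hθ.combo (hη.pull (-l)) hr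
  obtain ⟨R, hR⟩ := exists_rootEquiv (realCoord g) (h1.segNondeg h2) h1.self h2.self
  refine ⟨R.trans ((expDiag (-(1 - r) • l)).restrictScalars ℝ), ?_, fun u v => ?_⟩
  · rw [pathMap, ← hR]
    rfl
  · rw [← rootMap_form (realCoord g) (h1.segNondeg h2) h1.self h2.self u v, ← hR]
    rfl

theorem isLagrangian_real {κ : (Fin g → ℂ) →ₗ[ℝ] (Fin g → ℂ) →ₗ[ℝ] ℝ} (hκ : IsTame κ)
    (h : ∀ r s : Fin g → ℝ, κ (ofRealVec g r) (ofRealVec g s) = 0) :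
    IsLagrangian κ (LinearMap.range (ofRealVec g)) :=
  isLagrangian_realSpan hκ.self hκ.pos (LinearEquiv.refl ℂ _) (by
    rintro _ ⟨r, rfl⟩ _ ⟨s, rfl⟩
    exact h r s)

-- Real vectors are isotropic at both ends of the interpolation, hence for every interpolated form,
-- and tameness makes them Lagrangian. The path map carries this to θ.
include hθ hη in
theorem isLagrangian_pathMap {r : ℝ} (hr : r ∈ Icc (0 : ℝ) 1)
    (h : ∀ r s : Fin g → ℝ, θ (ofRealVec g r) (ofRealVec g s) = 0)
    (h' : ∀ r s : Fin g → ℝ, η (expDiag (-l) (ofRealVec g r)) (expDiag (-l) (ofRealVec g s)) = 0) :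
    IsLagrangian θ ((LinearMap.range (ofRealVec g)).map (pathMap θ η l r)) := by
  obtain ⟨Φ, hΦ, hform⟩ := exists_pathEquiv hθ hη l hr
  rw [← hΦ]
  refine IsLagrangian.map (isLagrangian_real (hθ.combo (hη.pull (-l)) hr) fun x y => ?_) Φ hform
  simp [h, h', pullForm_apply]

include hθ in
theorem pathMap_one (u : Fin g → ℂ) : pathMap θ η l 1 u = u := by
  have h1 : pullForm (-(1 - 1 : ℝ) • l) θ = θ := by
    simp only [sub_self, neg_zero, zero_smul, pullForm, expDiag_zero]
    rfl
  have h2 : pathForm θ η l 1 = θ := by simp [pathForm]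
  rw [pathMap, h1, h2, LinearMap.comp_apply, (hθ.segNondeg hθ).rootMap_self]
  simp [expDiag_zero]

-- At r = 0 both forms are pull-backs by exp(-l), and naturality moves this diagonal map past the
-- root map.
include hθ hη in
theorem pathMap_zero (u : Fin g → ℂ) :
    pathMap θ η l 0 u = rootMap (realCoord g) θ η (expDiag (-l) u) := by
  have h2 : pathForm θ η l 0 = pullForm (-l) η := by simp [pathForm]
  have h3 : (-(1 - 0) : ℝ) • l = -l := by simp
  rw [pathMap, h2, h3, LinearMap.comp_apply]
  refine (map_rootMap ((expDiag (-l)).restrictScalars ℝ) (realCoord g) θ η u).trans ?_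
  rw [rootMap_indep _ (realCoord g) (hθ.segNondeg hη)]
  rfl

theorem continuousOn_pathMap {X : Type*} [TopologicalSpace X]
    {θ η : X → (Fin g → ℂ) →ₗ[ℝ] (Fin g → ℂ) →ₗ[ℝ] ℝ} {l : X → Fin g → ℂ} {r : X → ℝ} {K : Set X}
    (hθ : ∀ x, IsTame (θ x)) (hη : ∀ x, IsTame (η x)) (hl : Continuous l) (hr : Continuous r)
    (hK : ∀ x ∈ K, r x ∈ Icc (0 : ℝ) 1)
    (hθc : ∀ p q : X → Fin g → ℂ, Continuous p → Continuous q →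
      Continuous fun x => θ x (p x) (q x))
    (hηc : ∀ p q : X → Fin g → ℂ, Continuous p → Continuous q →
      Continuous fun x => η x (p x) (q x)) (u : Fin g → ℂ) :
    ContinuousOn (fun x => pathMap (θ x) (η x) (l x) (r x) u) K := by
  have hexp : ∀ (m : X → Fin g → ℂ) (p : X → Fin g → ℂ), ContinuousOn m K → ContinuousOn p K →
      ContinuousOn (fun x => expDiag (m x) (p x)) K := fun m p hm hp =>
    continuousOn_pi.2 fun i => (continuousOn_pi.1 hm i).cexp.mul (continuousOn_pi.1 hp i)
  have hexp' : ∀ (m : X → Fin g → ℂ) (p : Fin g → ℂ), Continuous m →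
      Continuous (fun x => expDiag (m x) p) := fun m p hm =>
    continuous_pi fun i => (((continuous_apply i).comp hm).cexp.mul continuous_const)
  have hm : Continuous fun x => -(1 - r x) • l x := (continuous_const.sub hr).neg.smul hl
  have hA : Continuous fun x => formMatrix (realCoord g).toLinearMap
      (pullForm (-(1 - r x) • l x) (θ x)) := by
    refine continuous_matrix fun i j => ?_
    simp only [formMatrix_apply, pullForm_apply]
    exact hθc _ _ (hexp' _ _ hm) (hexp' _ _ hm)
  have hB : Continuous fun x => formMatrix (realCoord g).toLinearMap
      (pathForm (θ x) (η x) (l x) (r x)) := by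
    refine continuous_matrix fun i j => ?_
    simp only [formMatrix_apply, pathForm, LinearMap.add_apply, LinearMap.smul_apply,
      pullForm_apply, smul_eq_mul]
    exact (hr.mul (hθc _ _ continuous_const continuous_const)).add ((continuous_const.sub hr).mul
      (hηc _ _ (hexp' _ _ hl.neg) (hexp' _ _ hl.neg)))
  have hS := continuousOn_sqrtForm hA.continuousOn hB.continuousOn fun x hx =>
    (((hθ x).pull (-(1 - r x) • l x)).segNondeg
      (show IsTame (pathForm (θ x) (η x) (l x) (r x)) from
        (hθ x).combo ((hη x).pull (-(l x))) (hK x hx))).segInv (realCoord g)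
  refine hexp _ _ hm.continuousOn ?_
  have h1 : ∀ x, rootMap (realCoord g) (pullForm (-(1 - r x) • l x) (θ x))
      (pathForm (θ x) (η x) (l x) (r x)) u = realCoord g (Matrix.mulVec (sqrtForm
        (formMatrix (realCoord g).toLinearMap (pullForm (-(1 - r x) • l x) (θ x)))
        (formMatrix (realCoord g).toLinearMap (pathForm (θ x) (η x) (l x) (r x))))
        ((realCoord g).symm u)) := by
    intro x
    rw [← rootMap_apply, LinearEquiv.apply_symm_apply]
  refine ContinuousOn.congr ?_ fun x _ => h1 x
  refine (LinearMap.continuous_of_finiteDimensional (realCoord g).toLinearMap).comp_continuousOn ?_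
  rw [continuousOn_iff_continuous_domRestrict] at hS ⊢
  exact Continuous.matrix_mulVec hS continuous_const

end LagrangianPath

/-! ### Sections and continuity along the tori -/

section Tori

variable {S : Type u} [TopologicalSpace S] [ChartedSpace ℂ S] {g : ℕ} {𝓗 : HeegaardDiagram S g}
  (c : Fin 2)

theorem mem_tori {D : Base 𝓗} : D ∈ tori 𝓗 c ↔ ∃ t, base 𝓗 c t = D :=
  mem_torus.trans ⟨fun ⟨t, ht⟩ => ⟨t, Subtype.ext ht⟩, fun ⟨t, ht⟩ => ⟨t, congrArg Subtype.val ht⟩⟩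

theorem continuous_base : Continuous (base 𝓗 c) :=
  (continuous_symMk.comp (continuous_pi fun i =>
    (𝓗.isClosedCurve c i).smooth.continuous.comp (continuous_apply i))).subtype_mk _

theorem base_fract (t : Fin g → ℝ) : base 𝓗 c (fun i => Int.fract (t i)) = base 𝓗 c t := by
  refine Subtype.ext (congrArg symMk (funext fun i => ?_))
  refine ((𝓗.isClosedCurve c i).embedded _ _).2 ⟨-⌊t i⌋, ?_⟩
  push_cast
  rw [← sub_eq_add_neg, Int.self_sub_floor]

/-- Continuity along the torus can be checked in the coordinates of the torus. -/
theorem continuousOn_tori [T2Space S] {Z : Type*} [TopologicalSpace Z] {h : ℝ × Base 𝓗 → Z}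
    (hh : ContinuousOn (fun x : ℝ × (Fin g → ℝ) => h (x.1, base 𝓗 c x.2))
      (Icc (0 : ℝ) 1 ×ˢ univ)) : ContinuousOn h (Icc (0 : ℝ) 1 ×ˢ tori 𝓗 c) := by
  let I := ↥(Icc (0 : ℝ) 1)
  -- The compact cube of parameters in [0, 1] already covers the torus, so this map is a quotient
  -- map and detects continuity.
  let f : I × (Fin g → I) → ↥(Icc (0 : ℝ) 1 ×ˢ tori 𝓗 c) := fun x =>
    ⟨(x.1, base 𝓗 c fun i => x.2 i), x.1.2, (mem_tori c).2 ⟨_, rfl⟩⟩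
  have hval : Continuous fun x : I × (Fin g → I) => fun i => (x.2 i : ℝ) :=
    continuous_pi fun i => continuous_subtype_val.comp ((continuous_apply i).comp continuous_snd)
  have hf : Continuous f := ((continuous_subtype_val.comp continuous_fst).prodMk
    ((continuous_base c).comp hval)).subtype_mk _
  have hsurj : Function.Surjective f := by
    rintro ⟨⟨r, D⟩, hr, hD⟩
    obtain ⟨t, rfl⟩ := (mem_tori c).1 hD
    refine ⟨(⟨r, hr⟩, fun i => ⟨Int.fract (t i), Int.fract_nonneg _, (Int.fract_lt_one _).le⟩), ?_⟩
    exact Subtype.ext (Prod.ext rfl (base_fract c t))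
  have hq : IsQuotientMap f := hf.isClosedMap.isQuotientMap hf hsurj
  rw [continuousOn_iff_continuous_domRestrict, hq.continuous_iff]
  rw [continuousOn_iff_continuous_domRestrict] at hh
  exact hh.comp (f := fun x : I × (Fin g → I) =>
    (⟨(x.1, fun i => x.2 i), x.1.2, mem_univ _⟩ : ↥(Icc (0 : ℝ) 1 ×ˢ (univ : Set (Fin g → ℝ)))))
    (((continuous_subtype_val.comp continuous_fst).prodMk hval).subtype_mk _)

variable [IsManifold 𝓘(ℂ) ω S] [T2Space S] [Nonempty S]

/-- The frames are compared in the total space because their fibres are not definitionally equal. -/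
theorem frame_congr {t t' : Fin g → ℝ} (h : pt 𝓗 c t = pt 𝓗 c t') (v : Fin g → ℂ) :
    (⟨_, frame 𝓗 c t v⟩ : SymTangentBundle S g) = ⟨_, frame 𝓗 c t' v⟩ := by
  rw [frame_apply, frame_apply, vel_eq h, h]

open scoped Classical in
/-- The section of the tangent bundle over the torus with given coordinates. -/
def torusSection (w : (Fin g → ℝ) → Fin g → ℂ) (D : Base 𝓗) : SymTangent D.1 :=
  if h : ∃ (ξ : SymTangent D.1) (t : Fin g → ℝ),
      (⟨D.1, ξ⟩ : SymTangentBundle S g) = ⟨_, frame 𝓗 c t (w t)⟩ then h.choose else 0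

variable {c}

theorem torusSection_base {w : (Fin g → ℝ) → Fin g → ℂ}
    (hw : ∀ t t', pt 𝓗 c t = pt 𝓗 c t' → w t = w t') (t : Fin g → ℝ) :
    torusSection c w (base 𝓗 c t) = frame 𝓗 c t (w t) := by
  have h : ∃ (ξ : SymTangent (base 𝓗 c t).1) (t' : Fin g → ℝ),
      (⟨(base 𝓗 c t).1, ξ⟩ : SymTangentBundle S g) = ⟨_, frame 𝓗 c t' (w t')⟩ := ⟨_, t, rfl⟩
  rw [torusSection, dif_pos h]
  obtain ⟨t', ht'⟩ := h.choose_spec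
  have hpt : pt 𝓗 c t' = pt 𝓗 c t := pt_eq (congrArg Bundle.TotalSpace.proj ht').symm
  rw [hw t' t hpt, frame_congr c hpt] at ht'
  exact eq_of_heq (Bundle.TotalSpace.mk.inj ht').2

end Tori

end

end HFK

namespace HFK

noncomputable section

universe u v

/-! ### Subbundles spanned by continuous frames -/

section Subbundles

theorem linearIndependent_single {n : ℕ} {V : Type*} [AddCommGroup V] [Module ℝ V]
    {f : (Fin n → ℝ) →ₗ[ℝ] V} (hf : Function.Injective f) :
    LinearIndependent ℝ (fun j => f (Pi.single j 1)) := by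
  have h := (Pi.basisFun ℝ (Fin n)).linearIndependent.map' f (LinearMap.ker_eq_bot.2 hf)
  simpa [Function.comp_def] using h

theorem span_range_single {n : ℕ} {V : Type*} [AddCommGroup V] [Module ℝ V]
    (f : (Fin n → ℝ) →ₗ[ℝ] V) :
    Submodule.span ℝ (range fun j => f (Pi.single j 1)) = LinearMap.range f := by
  rw [LinearMap.range_eq_map, ← (Pi.basisFun ℝ (Fin n)).span_eq, Submodule.map_span, ← range_comp]
  simp [Function.comp_def]

theorem isSubbundleOn_of_frame {M : Type*} {B : Type*} [TopologicalSpace B] {Fib : Type*}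
    {E : M → Type*} [∀ x, AddCommGroup (E x)] [∀ x, Module ℝ (E x)]
    [TopologicalSpace (Bundle.TotalSpace Fib E)] {r : B → M} {K : Set B}
    {G : ∀ b, Submodule ℝ (E (r b))} {m : ℕ} (s : Fin m → ∀ b, E (r b))
    (hs : ∀ i, ContinuousOn (fun b => (⟨r b, s i b⟩ : Bundle.TotalSpace Fib E)) K)
    (h : ∀ b ∈ K, ∃ f : (Fin m → ℝ) →ₗ[ℝ] E (r b), Function.Injective f ∧
      (∀ j, s j b = f (Pi.single j 1)) ∧ LinearMap.range f = G b) :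
    IsSubbundleOn (Fib := Fib) E r K G := by
  refine fun b₀ _ => ⟨univ, m, s, isOpen_univ, mem_univ _, fun i => (hs i).mono inter_subset_right,
    fun b hb => ?_⟩
  obtain ⟨f, hf, hsf, hG⟩ := h b hb.2
  simp only [hsf]
  exact ⟨linearIndependent_single hf, (span_range_single f).trans hG⟩

end Subbundles

variable {S : Type u} [TopologicalSpace S] [ChartedSpace ℂ S]
variable {S' : Type v} [TopologicalSpace S'] [ChartedSpace ℂ S']
variable {g : ℕ} {𝓗 : HeegaardDiagram S g} {P : SurfaceDoubleCover S S' 𝓗.w 𝓗.z}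

/-! ### A single-valued logarithm along the tori -/

section Logarithm

variable (Φ : Phase P) (σ : Base 𝓗 → S' → ℂ) (c : Fin 2)

/-- The logarithms of the values of a varying function at the lifts of the points of the torus. -/
def logLift (t : Fin g → ℝ) : Fin g → ℂ := fun i =>
  Complex.log (σ (base 𝓗 c t) (Φ.liftPt c t i) * (starRingEnd ℂ) (Φ.s (Φ.liftPt c t i))) +
    Φ.arg c i (t i) * Complex.I

theorem liftPt_congr {t t' : Fin g → ℝ} (h : pt 𝓗 c t = pt 𝓗 c t') :
    Φ.liftPt c t = Φ.liftPt c t' := by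
  funext i
  refine Φ.curve_eq_of_map c ?_
  rw [Φ.map_curve, Φ.map_curve]
  exact congrFun h i

/-- This is where the periodicity of the lifts and of their arguments is needed: a general odd phase
could have nonzero winding along a closed lift. -/
theorem logLift_congr {t t' : Fin g → ℝ} (h : pt 𝓗 c t = pt 𝓗 c t') :
    logLift Φ σ c t = logLift Φ σ c t' := by
  have hb : base 𝓗 c t = base 𝓗 c t' := Subtype.ext (congrArg symMk h)
  funext i
  obtain ⟨n, hn⟩ := ((𝓗.isClosedCurve c i).embedded (t i) (t' i)).1 (congrFun h i)
  simp only [logLift, liftPt_congr Φ c h, hb, hn, Φ.arg_add_int]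

theorem liftPt_mem (t : Fin g → ℝ) (i : Fin g) : P.π (Φ.liftPt c t i) ∈ (base 𝓗 c t).1 := by
  rw [Φ.map_liftPt]
  exact mem_symMk.2 ⟨i, rfl⟩

variable {σ} (hpos : ∀ (D : Base 𝓗) a, P.π a ∈ D.1 → 0 < (σ D a * (starRingEnd ℂ) (Φ.s a)).re)

include hpos in
theorem exp_logLift (t : Fin g → ℝ) (i : Fin g) :
    Complex.exp (logLift Φ σ c t i) = σ (base 𝓗 c t) (Φ.liftPt c t i) := by
  have h1 := hpos _ _ (liftPt_mem Φ c t i)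
  have h2 : σ (base 𝓗 c t) (Φ.liftPt c t i) * (starRingEnd ℂ) (Φ.s (Φ.liftPt c t i)) ≠ 0 := by
    intro h0
    rw [h0] at h1
    simp at h1
  have h3 : (starRingEnd ℂ) (Φ.s (Φ.liftPt c t i)) * Φ.s (Φ.liftPt c t i) = 1 := by
    rw [Complex.conj_mul', show ‖Φ.s (Φ.liftPt c t i)‖ = 1 from
      Φ.norm_eq _ (Φ.curve_ne_w c i (t i)) (Φ.curve_ne_z c i (t i))]
    simp
  rw [logLift, Complex.exp_add, Complex.exp_log h2, ← Φ.s_curve c i (t i), mul_assoc]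
  exact (congrArg _ h3).trans (mul_one _)

-- Positivity of the real part keeps σ times the conjugate of s in the right half plane, where the
-- principal logarithm is continuous; the winding of s is taken up by the continuous argument.
include hpos in
theorem continuous_logLift (h : IsVarying P σ) : Continuous (logLift Φ σ c) := by
  refine continuous_pi fun i => ?_
  have hc : Continuous fun t : Fin g → ℝ => Φ.liftPt c t i :=
    (Φ.continuous_curve c i).comp (continuous_apply i)
  have hσ : Continuous fun t : Fin g → ℝ => σ (base 𝓗 c t) (Φ.liftPt c t i) :=
    continuous_iff_continuousAt.2 fun t => (h.tendsto _ _ (liftPt_mem Φ c t i)).comp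
      (((continuous_base c).tendsto t).prodMk (hc.tendsto t))
  have hs : Continuous fun t : Fin g → ℝ => Φ.s (Φ.liftPt c t i) :=
    continuous_iff_continuousAt.2 fun t => ContinuousAt.comp (f := fun t => Φ.liftPt c t i)
      (Φ.continuousAt _ (Φ.curve_ne_w c i (t i)) (Φ.curve_ne_z c i (t i))) hc.continuousAt
  refine ((hσ.mul (Complex.continuous_conj.comp hs)).clog fun t =>
    Or.inl (hpos _ _ (liftPt_mem Φ c t i))).add ?_
  exact (Complex.continuous_ofReal.comp ((Φ.continuous_arg c i).comp (continuous_apply i))).mul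
    continuous_const

end Logarithm

variable [IsManifold 𝓘(ℂ) ω S] [T2Space S] [Nonempty S]

section FrameForms

variable (c : Fin 2) (θ : ∀ D : Base 𝓗, SymTangent D.1 →ₗ[ℝ] SymTangent D.1 →ₗ[ℝ] ℝ)

/-- The real linear frame along the torus. -/
abbrev realFrame (t : Fin g → ℝ) : (Fin g → ℂ) ≃ₗ[ℝ] SymTangent (base 𝓗 c t).1 :=
  (frame 𝓗 c t).restrictScalars ℝ

/-- The expression of a family of forms in the frame along the torus. -/
def frameForm (t : Fin g → ℝ) : (Fin g → ℂ) →ₗ[ℝ] (Fin g → ℂ) →ₗ[ℝ] ℝ :=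
  (θ (base 𝓗 c t)).compl₁₂ (realFrame c t).toLinearMap (realFrame c t).toLinearMap

theorem frameForm_congr {t t' : Fin g → ℝ} (h : pt 𝓗 c t = pt 𝓗 c t') :
    frameForm c θ t = frameForm c θ t' := by
  have key : ∀ (x y : Fin g → S) (hx : symMk x ∈ puncturedSym S g 𝓗.w 𝓗.z)
      (hy : symMk y ∈ puncturedSym S g 𝓗.w 𝓗.z), x = y → ∀ u v : Fin g → ℂ,
      θ ⟨symMk x, hx⟩ (imgMap x u) (imgMap x v) = θ ⟨symMk y, hy⟩ (imgMap y u) (imgMap y v) := by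
    rintro x _ hx hy rfl u v
    rfl
  refine LinearMap.ext fun u => LinearMap.ext fun v => ?_
  refine (key _ _ (pt_mem t) (pt_mem t') h (fun i => vel 𝓗 c t i * u i)
    (fun i => vel 𝓗 c t i * v i)).trans ?_
  rw [vel_eq h]
  rfl

theorem isTame_frameForm (h : ∀ D u, θ D u u = 0)
    (hp : ∀ D u, u ≠ 0 → 0 < θ D u (Complex.I • u)) (t : Fin g → ℝ) : IsTame (frameForm c θ t) where
  self u := h _ _
  pos u hu := by
    have := hp (base 𝓗 c t) (frame 𝓗 c t u) fun h0 => hu ((frame 𝓗 c t).map_eq_zero_iff.1 h0)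
    rw [← map_smul] at this
    exact this

theorem continuous_frame (Ω : TamedForm P) {B : Type*} [TopologicalSpace B] {τ : B → Fin g → ℝ}
    {q : B → Fin g → ℂ} (hτ : Continuous τ) (hq : Continuous q) :
    Continuous fun b =>
      (⟨base 𝓗 c (τ b), frame 𝓗 c (τ b) (q b)⟩ : (tangentialPolarization P Ω).Total) :=
  (continuous_tangentialTotal Ω (D := fun b => base 𝓗 c (τ b))
    (ξ := fun b => frame 𝓗 c (τ b) (q b))).2 ⟨(continuous_base c).comp hτ,
      continuous_iff_continuousAt.2 fun b => tendsto_frame (hτ.tendsto b) (hq.tendsto b)⟩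

theorem continuousOn_torusSection (Ω : TamedForm P) {w : ℝ → (Fin g → ℝ) → Fin g → ℂ}
    (hw : ∀ r t t', pt 𝓗 c t = pt 𝓗 c t' → w r t = w r t')
    (hc : ContinuousOn (fun x : ℝ × (Fin g → ℝ) => w x.1 x.2) (Icc (0 : ℝ) 1 ×ˢ univ)) :
    ContinuousOn (fun y : ℝ × Base 𝓗 =>
      (⟨y.2, torusSection c (w y.1) y.2⟩ : (tangentialPolarization P Ω).Total))
      (Icc (0 : ℝ) 1 ×ˢ tori 𝓗 c) := by
  refine continuousOn_tori c ?_
  simp only [torusSection_base (hw _)]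
  rw [continuousOn_iff_continuous_domRestrict] at hc ⊢
  exact continuous_frame c Ω (continuous_snd.comp continuous_subtype_val) hc

end FrameForms

variable [IsManifold 𝓘(ℂ) ω S'] [T2Space S'] [Nonempty S'] (Ω : TamedForm P)

/-! ### The homotopy of Lagrangian subbundles -/

section Transport

variable {σ : Base 𝓗 → S' → ℂ} (h : IsOddVarying P σ)

/-- The form of the normal polarization, transported to the tangent bundle. -/
def transportForm (D : Base 𝓗) : SymTangent D.1 →ₗ[ℝ] SymTangent D.1 →ₗ[ℝ] ℝ :=
  (nForm Ω D).compl₁₂ ((h.equiv D).restrictScalars ℝ).toLinearMap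
    ((h.equiv D).restrictScalars ℝ).toLinearMap

theorem transportForm_self (D : Base 𝓗) (u : SymTangent D.1) : transportForm Ω h D u u = 0 :=
  nForm_self Ω D _

theorem transportForm_pos (D : Base 𝓗) (u : SymTangent D.1) (hu : u ≠ 0) :
    0 < transportForm Ω h D u (Complex.I • u) := by
  have := nForm_pos Ω D (h.equiv D u) fun h0 => hu ((h.equiv D).map_eq_zero_iff.1 h0)
  rw [← map_smul] at this
  exact this

theorem continuous_transportForm {B : Type*} [TopologicalSpace B] {D : B → Base 𝓗}
    {p q : ∀ b, SymTangent (D b).1}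
    (hp : Continuous (fun b => (⟨D b, p b⟩ : (tangentialPolarization P Ω).Total)))
    (hq : Continuous (fun b => (⟨D b, q b⟩ : (tangentialPolarization P Ω).Total))) :
    Continuous fun b => transportForm Ω h (D b) (p b) (q b) :=
  continuous_nForm Ω (h.continuous_equiv Ω hp) (h.continuous_equiv Ω hq)

variable (Φ : Phase P) (c : Fin 2)
  (hpos : ∀ (D : Base 𝓗) a, P.π a ∈ D.1 → 0 < (σ D a * (starRingEnd ℂ) (Φ.s a)).re)

-- At the lifted points the sign is 1 while σ is exp(ℓ). So the twist by the sign is the twist by σ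
-- after multiplication by exp(-ℓ).
include hpos in
theorem normalFrame_eq (t : Fin g → ℝ) (v : Fin g → ℂ) : normalFrame Φ c t v =
    h.equiv (base 𝓗 c t) (frame 𝓗 c t (expDiag (-logLift Φ σ c t) v)) := by
  refine Subtype.ext ?_
  rw [normalFrame_coe, frame_apply]
  refine P.twist_imgMap_congr (pt_mem t) (Φ.map_liftPt c t) (fun a ha => Φ.sign_deck c ha)
    (h.odd (base 𝓗 c t)) fun i => ?_
  rw [← exp_logLift Φ c hpos, Phase.liftPt, Φ.sign_curve]
  change _ = Complex.exp _ * (vel 𝓗 c t i * (Complex.exp (-logLift Φ σ c t i) * v i))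
  rw [Complex.exp_neg]
  have := Complex.exp_ne_zero (logLift Φ σ c t i)
  field_simp
  simp

-- The twist by σ carries exp(-ℓ)ℝ^g, read in the velocity frame, to the normal Lagrangian. This is
-- the isotropy that the path needs at r = 0.
include hpos in
theorem frameForm_transportForm_eq_zero (t : Fin g → ℝ) (r s : Fin g → ℝ) :
    frameForm c (transportForm Ω h) t (expDiag (-logLift Φ σ c t) (ofRealVec g r))
      (expDiag (-logLift Φ σ c t) (ofRealVec g s)) = 0 := by
  have hm : ∀ r, normalFrame Φ c t (ofRealVec g r) ∈ nF Ω c (base 𝓗 c t) := fun r => by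
    rw [nF_eq Ω Φ c t]
    exact ⟨r, rfl⟩
  have h1 := nF_isotropic Ω Φ c t _ (hm r) _ (hm s)
  rw [normalFrame_eq h Φ c hpos, normalFrame_eq h Φ c hpos] at h1
  exact h1

/-- The path of linear maps along the torus which defines the homotopy of Lagrangians. -/
def torusPath (r : ℝ) (t : Fin g → ℝ) : (Fin g → ℂ) →ₗ[ℝ] (Fin g → ℂ) :=
  pathMap (frameForm c (tForm Ω) t) (frameForm c (transportForm Ω h) t) (logLift Φ σ c t) r

theorem torusPath_congr (r : ℝ) {t t' : Fin g → ℝ} (ht : pt 𝓗 c t = pt 𝓗 c t') :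
    torusPath Ω h Φ c r t = torusPath Ω h Φ c r t' := by
  rw [torusPath, torusPath, frameForm_congr c _ ht, frameForm_congr c _ ht, logLift_congr Φ σ c ht]

theorem isTame_tForm (t : Fin g → ℝ) : IsTame (frameForm c (tForm Ω) t) :=
  isTame_frameForm c _ (tForm_self Ω) (tForm_pos Ω) t

theorem isTame_transportForm (t : Fin g → ℝ) : IsTame (frameForm c (transportForm Ω h) t) :=
  isTame_frameForm c _ (transportForm_self Ω h) (transportForm_pos Ω h) t

omit [IsManifold 𝓘(ℂ) ω S'] [T2Space S'] [Nonempty S'] in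
theorem continuous_frameForm {θ : ∀ D : Base 𝓗, SymTangent D.1 →ₗ[ℝ] SymTangent D.1 →ₗ[ℝ] ℝ}
    (hθ : ∀ (D : ℝ × (Fin g → ℝ) → Base 𝓗) (p q : ∀ b, SymTangent (D b).1),
      Continuous (fun b => (⟨D b, p b⟩ : (tangentialPolarization P Ω).Total)) →
      Continuous (fun b => (⟨D b, q b⟩ : (tangentialPolarization P Ω).Total)) →
      Continuous fun b => θ (D b) (p b) (q b))
    (p q : ℝ × (Fin g → ℝ) → Fin g → ℂ) (hp : Continuous p) (hq : Continuous q) :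
    Continuous fun x : ℝ × (Fin g → ℝ) => frameForm c θ x.2 (p x) (q x) :=
  hθ (fun x => base 𝓗 c x.2) (fun x => frame 𝓗 c x.2 (p x)) (fun x => frame 𝓗 c x.2 (q x))
    (continuous_frame c Ω continuous_snd hp) (continuous_frame c Ω continuous_snd hq)

include hpos in
theorem continuousOn_torusPath (u : Fin g → ℂ) :
    ContinuousOn (fun x : ℝ × (Fin g → ℝ) => torusPath Ω h Φ c x.1 x.2 u)
      (Icc (0 : ℝ) 1 ×ˢ univ) := by
  have h1 := continuous_frameForm Ω c (θ := tForm Ω) fun D p q => continuous_tForm Ω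
  have h2 := continuous_frameForm Ω c (θ := transportForm Ω h) fun D p q =>
    continuous_transportForm Ω h
  exact continuousOn_pathMap (X := ℝ × (Fin g → ℝ)) (θ := fun x => frameForm c (tForm Ω) x.2)
    (η := fun x => frameForm c (transportForm Ω h) x.2) (l := fun x => logLift Φ σ c x.2)
    (r := fun x => x.1) (fun x => isTame_tForm Ω c x.2) (fun x => isTame_transportForm Ω h c x.2)
    ((continuous_logLift Φ c hpos h.toIsVarying).comp continuous_snd) continuous_fst
    (fun x hx => hx.1) h1 h2 u

/-- The homotopy of Lagrangians, in coordinates of the torus. -/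
def pathFrame (r : ℝ) (t : Fin g → ℝ) : (Fin g → ℝ) →ₗ[ℝ] SymTangent (base 𝓗 c t).1 :=
  (realFrame c t).toLinearMap ∘ₗ torusPath Ω h Φ c r t ∘ₗ ofRealVec g

/-- The sections which span the homotopy of Lagrangians. -/
def pathSection (j : Fin g) (r : ℝ) (D : Base 𝓗) : SymTangent D.1 :=
  torusSection c (fun t => torusPath Ω h Φ c r t (ofRealVec g (Pi.single j 1))) D

/-- The homotopy of Lagrangians. -/
def pathSpan (r : ℝ) (D : Base 𝓗) : Submodule ℝ (SymTangent D.1) :=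
  Submodule.span ℝ (range fun j => pathSection Ω h Φ c j r D)

theorem pathSection_base (j : Fin g) (r : ℝ) (t : Fin g → ℝ) :
    pathSection Ω h Φ c j r (base 𝓗 c t) = pathFrame Ω h Φ c r t (Pi.single j 1) :=
  torusSection_base (fun _ _ ht => by rw [torusPath_congr Ω h Φ c r ht]) t

theorem pathSpan_base (r : ℝ) (t : Fin g → ℝ) :
    pathSpan Ω h Φ c r (base 𝓗 c t) = LinearMap.range (pathFrame Ω h Φ c r t) := by
  rw [pathSpan]
  simp only [pathSection_base]
  exact span_range_single _

theorem ofRealVec_injective (n : ℕ) : Function.Injective (ofRealVec n) := fun _ _ h =>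
  funext fun i => Complex.ofReal_injective (congrFun h i)

theorem pathFrame_injective {r : ℝ} (hr : r ∈ Icc (0 : ℝ) 1) (t : Fin g → ℝ) :
    Function.Injective (pathFrame Ω h Φ c r t) := by
  obtain ⟨A, hA, -⟩ := exists_pathEquiv (isTame_tForm Ω c t) (isTame_transportForm Ω h c t)
    (logLift Φ σ c t) hr
  rw [pathFrame, torusPath, ← hA]
  exact ((realFrame c t).injective.comp A.injective).comp (ofRealVec_injective g)

include hpos in
theorem isLagrangian_pathSpan {r : ℝ} (hr : r ∈ Icc (0 : ℝ) 1) (t : Fin g → ℝ) :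
    IsLagrangian (tForm Ω (base 𝓗 c t)) (pathSpan Ω h Φ c r (base 𝓗 c t)) := by
  have h1 := isLagrangian_pathMap (isTame_tForm Ω c t) (isTame_transportForm Ω h c t)
    (logLift Φ σ c t) hr (fun p q => tForm_isotropic Ω Φ c t _ ⟨p, rfl⟩ _ ⟨q, rfl⟩)
    (frameForm_transportForm_eq_zero Ω h Φ c hpos t)
  have h2 := h1.map (θ := tForm Ω (base 𝓗 c t)) (realFrame c t) fun u v => rfl
  rw [pathSpan_base, pathFrame, LinearMap.range_comp, LinearMap.range_comp]
  exact h2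

theorem pathSpan_one (t : Fin g → ℝ) :
    pathSpan Ω h Φ c 1 (base 𝓗 c t) = tangentTorus (𝓗.curve c) (base 𝓗 c t).1 := by
  rw [pathSpan_base, tangentTorus_eq t]
  refine congrArg LinearMap.range (LinearMap.ext fun x => ?_)
  exact congrArg (frame 𝓗 c t) (pathMap_one (isTame_tForm Ω c t) _ _)

-- At r = 0 the path map is the root map after exp(-ℓ). The inverse twist of the normal Lagrangian
-- is exp(-ℓ)ℝ^g in the velocity frame, and `R` is the same root map computed in another basis.
include hpos in
theorem pathSpan_zero (t : Fin g → ℝ) (R : SymTangent (base 𝓗 c t).1 ≃ₗ[ℝ] SymTangent (base 𝓗 c t).1)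
    (hR : ∀ (e : (Fin (2 * g) → ℝ) ≃ₗ[ℝ] SymTangent (base 𝓗 c t).1) u,
      R u = rootMap e (tForm Ω (base 𝓗 c t)) (transportForm Ω h (base 𝓗 c t)) u) :
    pathSpan Ω h Φ c 0 (base 𝓗 c t) = (nF Ω c (base 𝓗 c t)).map
      (((h.equiv (base 𝓗 c t)).restrictScalars ℝ).symm.trans R).toLinearMap := by
  rw [pathSpan_base, nF_eq Ω Φ c t, realSpan, ← LinearMap.range_comp]
  refine congrArg LinearMap.range (LinearMap.ext fun x => ?_)
  change frame 𝓗 c t (torusPath Ω h Φ c 0 t (ofRealVec g x)) =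
    R ((h.equiv (base 𝓗 c t)).symm (normalFrame Φ c t (ofRealVec g x)))
  rw [normalFrame_eq h Φ c hpos, LinearEquiv.symm_apply_apply, torusPath,
    pathMap_zero (isTame_tForm Ω c t) (isTame_transportForm Ω h c t),
    hR ((realCoord g).trans (realFrame c t))]
  exact map_rootMap (realFrame c t) (realCoord g) _ _ _

include hpos in
theorem isSubbundleOn_pathSpan :
    IsSubbundleOn (Fib := Fin (2 * g) → ℝ) (tangentialPolarization P Ω).E
      (fun y : ℝ × Base 𝓗 => y.2) (Icc (0 : ℝ) 1 ×ˢ tori 𝓗 c)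
      (fun y => pathSpan Ω h Φ c y.1 y.2) := by
  have h1 : ∀ j, ContinuousOn (fun y : ℝ × Base 𝓗 =>
      (⟨y.2, pathSection Ω h Φ c j y.1 y.2⟩ : (tangentialPolarization P Ω).Total))
      (Icc (0 : ℝ) 1 ×ˢ tori 𝓗 c) := fun j => continuousOn_torusSection c Ω
    (w := fun r t => torusPath Ω h Φ c r t (ofRealVec g (Pi.single j 1)))
    (fun r _ _ ht => by rw [torusPath_congr Ω h Φ c r ht]) (continuousOn_torusPath Ω h Φ c hpos _)
  have h2 : ∀ y ∈ Icc (0 : ℝ) 1 ×ˢ tori 𝓗 c, ∃ f : (Fin g → ℝ) →ₗ[ℝ] SymTangent y.2.1,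
      Function.Injective f ∧ (∀ j, pathSection Ω h Φ c j y.1 y.2 = f (Pi.single j 1)) ∧
        LinearMap.range f = pathSpan Ω h Φ c y.1 y.2 := by
    rintro ⟨r, D⟩ ⟨hr, hD⟩
    obtain ⟨t, rfl⟩ := (mem_tori c).1 hD
    exact ⟨pathFrame Ω h Φ c r t, pathFrame_injective Ω h Φ c hr t,
      fun j => pathSection_base Ω h Φ c j r t, (pathSpan_base Ω h Φ c r t).symm⟩
  exact isSubbundleOn_of_frame (M := Base 𝓗) (B := ℝ × Base 𝓗)
    (E := (tangentialPolarization P Ω).E) (r := fun y => y.2)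
    (G := fun y => pathSpan Ω h Φ c y.1 y.2)
    (fun j y => pathSection Ω h Φ c j y.1 y.2) h1 h2

end Transport

end

end HFK

/-! ### The polarizations and their isomorphism -/

namespace HFK

noncomputable section

universe u v

variable {S : Type u} [TopologicalSpace S] [ChartedSpace ℂ S]
variable {S' : Type v} [TopologicalSpace S'] [ChartedSpace ℂ S']
variable {g : ℕ} {𝓗 : HeegaardDiagram S g} {P : SurfaceDoubleCover S S' 𝓗.w 𝓗.z}
variable [IsManifold 𝓘(ℂ) ω S] [T2Space S] [Nonempty S] [IsManifold 𝓘(ℂ) ω S'] [T2Space S']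
  [Nonempty S'] (Ω : TamedForm P) {σ : Base 𝓗 → S' → ℂ} (h : IsOddVarying P σ) (Φ : Phase P)
  (hpos : ∀ (D : Base 𝓗) a, P.π a ∈ D.1 → 0 < (σ D a * (starRingEnd ℂ) (Φ.s a)).re)

-- The frame of the homotopy at r = 1 is a continuous frame of the tangent spaces of the torus.
include h Φ hpos in
theorem tangential_isSubbundleOn (c : Fin 2) :
    IsSubbundleOn (Fib := Fin (2 * g) → ℝ) (tangentialPolarization P Ω).E id (tori 𝓗 c)
      (fun D => tangentTorus (𝓗.curve c) D.1) := by
  have h1 : ∀ j, ContinuousOn (fun D : Base 𝓗 =>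
      (⟨D, pathSection Ω h Φ c j 1 D⟩ : (tangentialPolarization P Ω).Total)) (tori 𝓗 c) := by
    intro j
    have h2 := continuousOn_torusSection c Ω
      (w := fun r t => torusPath Ω h Φ c r t (ofRealVec g (Pi.single j 1)))
      (fun r _ _ ht => by rw [torusPath_congr Ω h Φ c r ht])
      (continuousOn_torusPath Ω h Φ c hpos _)
    exact h2.comp (f := fun D : Base 𝓗 => ((1 : ℝ), D))
      (continuous_const.prodMk continuous_id).continuousOn fun D hD => ⟨⟨zero_le_one, le_rfl⟩, hD⟩
  have h2 : ∀ D ∈ tori 𝓗 c, ∃ f : (Fin g → ℝ) →ₗ[ℝ] SymTangent D.1,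
      Function.Injective f ∧ (∀ j, pathSection Ω h Φ c j 1 D = f (Pi.single j 1)) ∧
        LinearMap.range f = tangentTorus (𝓗.curve c) D.1 := by
    intro D hD
    obtain ⟨t, rfl⟩ := (mem_tori c).1 hD
    exact ⟨pathFrame Ω h Φ c 1 t, pathFrame_injective Ω h Φ c ⟨zero_le_one, le_rfl⟩ t,
      fun j => pathSection_base Ω h Φ c j 1 t,
      (pathSpan_base Ω h Φ c 1 t).symm.trans (pathSpan_one Ω h Φ c t)⟩
  exact isSubbundleOn_of_frame (M := Base 𝓗) (B := Base 𝓗)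
    (E := (tangentialPolarization P Ω).E) (r := id)
    (G := fun D => tangentTorus (𝓗.curve c) D.1)
    (fun j D => pathSection Ω h Φ c j 1 D) h1 h2

-- The normal frame is the twist by σ of the sections exp(-ℓ)eⱼ, which descend from the parameters
-- to the torus because ℓ is single-valued.
include h Φ hpos in
theorem normal_isSubbundleOn (c : Fin 2) :
    IsSubbundleOn (Fib := Fin (2 * g) → ℝ) (normalPolarization P Ω).E id (tori 𝓗 c)
      (fun D => nF Ω c D) := by
  let w : Fin g → (Fin g → ℝ) → Fin g → ℂ := fun j t =>
    expDiag (-logLift Φ σ c t) (ofRealVec g (Pi.single j 1))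
  have hw : ∀ j t t', pt 𝓗 c t = pt 𝓗 c t' → w j t = w j t' := fun j t t' ht => by
    simp only [w, logLift_congr Φ σ c ht]
  have hwc : ∀ j, Continuous (w j) := fun j => continuous_pi fun i =>
    ((continuous_apply i).comp (continuous_logLift Φ c hpos h.toIsVarying).neg).cexp.mul
      continuous_const
  have h1 : ∀ j, ContinuousOn (fun D : Base 𝓗 =>
      (⟨D, h.equiv D (torusSection c (w j) D)⟩ : (normalPolarization P Ω).Total)) (tori 𝓗 c) := by
    intro j
    have h2 := (continuousOn_torusSection c Ω (w := fun _ => w j) (fun _ => hw j)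
      ((hwc j).comp continuous_snd).continuousOn).comp (f := fun D : Base 𝓗 => ((1 : ℝ), D))
      (continuous_const.prodMk continuous_id).continuousOn
      (s := tori 𝓗 c) fun D hD => ⟨⟨zero_le_one, le_rfl⟩, hD⟩
    rw [continuousOn_iff_continuous_domRestrict] at h2 ⊢
    exact h.continuous_equiv Ω (D := fun D : tori 𝓗 c => D.1)
      (ξ := fun D => torusSection c (w j) D.1) h2
  have h2 : ∀ D ∈ tori 𝓗 c, ∃ f : (Fin g → ℝ) →ₗ[ℝ] normalFibre P D.1,
      Function.Injective f ∧ (∀ j, h.equiv D (torusSection c (w j) D) = f (Pi.single j 1)) ∧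
        LinearMap.range f = nF Ω c D := by
    intro D hD
    obtain ⟨t, rfl⟩ := (mem_tori c).1 hD
    refine ⟨((normalFrame Φ c t).toLinearMap.restrictScalars ℝ).comp (ofRealVec g),
      (normalFrame Φ c t).injective.comp (ofRealVec_injective g), fun j => ?_,
      (nF_eq Ω Φ c t).symm⟩
    rw [torusSection_base (hw j)]
    exact (normalFrame_eq h Φ c hpos t _).symm
  exact isSubbundleOn_of_frame (M := Base 𝓗) (B := Base 𝓗)
    (E := (normalPolarization P Ω).E) (r := id) (G := fun D => nF Ω c D)
    (fun j D => h.equiv D (torusSection c (w j) D)) h1 h2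

include h Φ hpos in
theorem tangential_isPolarization : (tangentialPolarization P Ω).IsPolarization where
  locally_trivial := tangential_locally_trivial Ω
  continuous_proj := continuous_tangential_proj Ω
  continuous_form := formContinuousOn_univ (E := (tangentialPolarization P Ω).E)
    fun _ _ _ _ _ hp hq => continuous_tForm Ω hp hq
  alternating := tForm_self Ω
  nondegenerate D v hv := by
    by_contra h0
    exact (tForm_pos Ω D v h0).ne' (hv (Complex.I • (show SymTangent D.1 from v)))
  subbundle := tangential_isSubbundleOn Ω h Φ hpos
  lagrangian c D hD := by
    obtain ⟨t, rfl⟩ := (mem_tori c).1 hD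
    have h1 := tForm_isLagrangian Ω Φ c t
    rw [← tangentTorus_eq t] at h1
    exact h1
  transverse D hD := (isCompl_F Ω Φ D hD.1 hD.2).1

include h Φ hpos in
theorem normal_isPolarization : (normalPolarization P Ω).IsPolarization where
  locally_trivial := normal_locally_trivial Ω h
  continuous_proj := continuous_normal_proj Ω
  continuous_form := formContinuousOn_univ (E := (normalPolarization P Ω).E)
    fun _ _ _ _ _ hp hq => continuous_nForm Ω hp hq
  alternating := nForm_self Ω
  nondegenerate D v hv := by
    by_contra h0
    exact (nForm_pos Ω D v h0).ne' (hv (Complex.I • (show normalFibre P D.1 from v)))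
  subbundle := normal_isSubbundleOn Ω h Φ hpos
  lagrangian c D hD := by
    obtain ⟨t, rfl⟩ := (mem_tori c).1 hD
    exact nForm_isLagrangian Ω Φ c t
  transverse D hD := (isCompl_F Ω Φ D hD.1 hD.2).2

theorem exists_root_tangential : ∃ R : ∀ D : Base 𝓗, SymTangent D.1 ≃ₗ[ℝ] SymTangent D.1,
    Continuous (fun y : (tangentialPolarization P Ω).Total =>
      (⟨y.proj, R y.proj y.snd⟩ : (tangentialPolarization P Ω).Total)) ∧
    Continuous (fun y : (tangentialPolarization P Ω).Total =>
      (⟨y.proj, (R y.proj).symm y.snd⟩ : (tangentialPolarization P Ω).Total)) ∧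
    (∀ D u v, tForm Ω D (R D u) (R D v) = transportForm Ω h D u v) ∧
    ∀ D (e : (Fin (2 * g) → ℝ) ≃ₗ[ℝ] SymTangent D.1) u,
      R D u = rootMap e (tForm Ω D) (transportForm Ω h D) u :=
  exists_root (E := (tangentialPolarization P Ω).E) (n := 2 * g) (θ := tForm Ω)
    (η := transportForm Ω h) (tangential_locally_trivial Ω)
    (formContinuousOn_univ (E := (tangentialPolarization P Ω).E)
      fun _ _ _ _ _ hp hq => continuous_tForm Ω hp hq)
    (formContinuousOn_univ (E := (tangentialPolarization P Ω).E)
      fun _ _ _ _ _ hp hq => continuous_transportForm Ω h hp hq)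
    (tForm_self Ω) (transportForm_self Ω h)
    fun D => segNondeg_of_tame (V := SymTangent D.1) (tForm_pos Ω D) (transportForm_pos Ω h D)

theorem transportForm_symm (D : Base 𝓗) (u v : normalFibre P D.1) :
    transportForm Ω h D ((h.equiv D).symm u) ((h.equiv D).symm v) = nForm Ω D u v :=
  congrArg₂ (fun a b => nForm Ω D a b) ((h.equiv D).apply_symm_apply u)
    ((h.equiv D).apply_symm_apply v)

-- The isomorphism undoes the complex linear twist and then applies the root map, which corrects the
-- symplectic form. Its effect on the Lagrangians is the start of the path `pathSpan`.
include h Φ hpos in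
theorem normal_isomorphic_tangential :
    (normalPolarization P Ω).Isomorphic (tangentialPolarization P Ω) := by
  obtain ⟨R, hR, hR', hform, hroot⟩ := exists_root_tangential Ω h
  refine ⟨fun D => ((h.equiv D).restrictScalars ℝ).symm.trans (R D), ?_, ?_, ?_, fun c =>
    ⟨pathSpan Ω h Φ c, ?_, ?_, ?_, isSubbundleOn_pathSpan Ω h Φ c hpos⟩⟩
  · exact hR.comp (h.homeo Ω).continuous_symm
  · exact (h.homeo Ω).continuous.comp hR'
  · intro D u v
    refine (hform D ((h.equiv D).symm u) ((h.equiv D).symm v)).trans ?_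
    exact transportForm_symm Ω h D u v
  · intro D hD
    obtain ⟨t, rfl⟩ := (mem_tori c).1 hD
    exact pathSpan_zero Ω h Φ c hpos t (R (base 𝓗 c t)) (hroot (base 𝓗 c t))
  · intro D hD
    obtain ⟨t, rfl⟩ := (mem_tori c).1 hD
    exact pathSpan_one Ω h Φ c t
  · intro r hr D hD
    obtain ⟨t, rfl⟩ := (mem_tori c).1 hD
    exact isLagrangian_pathSpan Ω h Φ c hpos hr t

end

end HFK
/-- Let `𝓗 = (S, α, β, w, z)` be a Heegaard diagram of genus `g` of a knot `K` in a closed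
three-manifold `Y`, let `Y' → Y` be the double cover branched along `K` that is obtained from a
Seifert surface `Q` of `K`, and let `S' → S` be its restriction to the Heegaard surface. Then the
normal polarization of `Sym^g(S - {w, z}) ⊂ Sym^{2g}(S' - {w', z'})` with the tori of the `α` and
`β` curves is isomorphic to the tangential polarization. -/
theorem mainTheorem10
    {S : Type*} [TopologicalSpace S] [ChartedSpace ℂ S] [IsManifold 𝓘(ℂ) ω S]
    [CompactSpace S] [ConnectedSpace S] [T2Space S]
    {S' : Type*} [TopologicalSpace S'] [ChartedSpace ℂ S'] [IsManifold 𝓘(ℂ) ω S']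
    [CompactSpace S'] [ConnectedSpace S'] [T2Space S']
    {Y : Type*} [TopologicalSpace Y] [ChartedSpace (EuclideanSpace ℝ (Fin 3)) Y]
    [CompactSpace Y] [ConnectedSpace Y] [T2Space Y]
    {Y' : Type*} [TopologicalSpace Y'] [ChartedSpace (EuclideanSpace ℝ (Fin 3)) Y']
    [CompactSpace Y'] [ConnectedSpace Y'] [T2Space Y']
    {F : Type*} [TopologicalSpace F] [ChartedSpace (EuclideanHalfSpace 2) F] [CompactSpace F]
    {g : ℕ} (𝓗 : HFK.HeegaardDiagram S g) {K : Set Y} (split : HFK.HeegaardSplitting 𝓗 Y K)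
    (Q : HFK.SeifertSurface K F) (C : HFK.BranchedDoubleCover Q Y')
    (P : HFK.SurfaceDoubleCover S S' 𝓗.w 𝓗.z) (emb' : S' → Y') (hemb' : IsClosedEmbedding emb')
    (hrange : range emb' = C.p ⁻¹' range split.emb)
    (hproj : ∀ a, C.p (emb' a) = split.emb (P.π a)) (hdeck : ∀ a, C.τ (emb' a) = emb' (P.ι a))
    (Ω : HFK.TamedForm P) :
    (HFK.normalPolarization P Ω).IsPolarization ∧
      (HFK.tangentialPolarization P Ω).IsPolarization ∧
      (HFK.normalPolarization P Ω).Isomorphic (HFK.tangentialPolarization P Ω) := by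
  obtain ⟨Φ⟩ := HFK.exists_phase split C P hemb' hrange hproj hdeck
  obtain ⟨σ, hσ, hodd, hpos⟩ := HFK.exists_varying Φ
  have h : HFK.IsOddVarying P σ :=
    { toIsVarying := hσ
      odd := hodd
      ne_zero := fun D a ha h0 => by
        have := hpos D a ha
        rw [h0, zero_mul, Complex.zero_re] at this
        exact lt_irrefl _ this }
  exact ⟨HFK.normal_isPolarization Ω h Φ hpos, HFK.tangential_isPolarization Ω h Φ hpos,
    HFK.normal_isomorphic_tangential Ω h Φ hpos⟩
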